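/- Let $n\ge 3$ and $c\in\mathbb R$. Let $(M,g)$ be a smooth (Hausdorff, second countable) Riemannian manifold of dimension $n$, without boundary, with constant sectional curvature $c$, i.e. $\mathrm{Rm}_{ijkl}=c(g_{il}g_{jk}-g_{ik}g_{jl})$. Let $h$ be a smooth symmetric two-tensor on $M$ with $\mathrm{tr}_g h=0$ and $\mathrm{div}_g h=0$, and let $U\subset M$ be an open set with compact closure and smooth boundary, with outward unit normal $\hat n$. For a covariant $k$-tensor $F$ put $\|F\|_U^2=\int_U F_\alpha F^\alpha\,dv_g$. For two symmetric two-tensors put $(a\wedge b)_{ijkl}=a_{il}b_{jk}+a_{jk}b_{il}-a_{ik}b_{jl}-a_{jl}b_{ik}$; let $A_g=\frac1{n-2}\bigl(\mathrm{Ric}_g-\frac{R_g}{2(n-1)}g\bigr)$ be the Schouten tensor, $W_g=\mathrm{Rm}_g-A_g\wedge g$ the Weyl tensor (all indices down), $DW_g[h]=\frac{d}{dt}\big|_{t=0}W_{g+th}$ its linearization, and $\Delta h_{ij}=g^{kl}\nabla_l\nabla_k h_{ij}$. Then $$\|DW_g[h]\|_U^2=\frac{n-3}{n-2}\Bigl(\|\Delta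 h\|_U^2+c(n+2)\|\nabla h\|_U^2+2c^2n\|h\|_U^2\Bigr)+\mathrm{BT}_1+\mathrm{BT}_2+\mathrm{BT}_3,$$ where $\mathrm{BT}_1,\mathrm{BT}_2,\mathrm{BT}_3$ are boundary integrals of the types $$\mathrm{BT}_1=\int_{\partial U}\mathrm{contr}\bigl((g^{-1})^{\otimes 2}\otimes\nabla h\otimes h\otimes\hat n\bigr)\,dS_g,\quad \mathrm{BT}_2=\int_{\partial U}\mathrm{contr}\bigl((g^{-1})^{\otimes 3}\otimes\nabla^2 h\otimes\nabla h\otimes\hat n\bigr)\,dS_g,\quad \mathrm{BT}_3=\int_{\partial U}\mathrm{contr}\bigl((g^{-1})^{\otimes 3}\otimes\nabla^3 h\otimes h\otimes\hat n\bigr)\,dS_g,$$ and in each of them $\mathrm{contr}$ stands for a fixed linear combination of full tensor contractions, whose coefficients depend only on $n$ and $c$ (not on $M$, $g$, $h$ or $U$). -/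

import Mathlib

open MeasureTheory Set Manifold Bundle
open scoped ContDiff Topology

noncomputable section

namespace WeylVariation

/-! ### Tensor calculus in one coordinate system

A metric (or any symmetric two-tensor) is given by its matrix of components, a covariant tensor
of rank `k` by its components indexed by `Fin k → Fin n`. -/

/-- The coordinate space. -/
abbrev Coord (n : ℕ) : Type := EuclideanSpace ℝ (Fin n)

/-- Components of a field of bilinear forms. -/
abbrev MatField (n : ℕ) : Type := Coord n → Matrix (Fin n) (Fin n) ℝ

/-- Components of a covariant tensor field of rank `k`. -/
abbrev TensorField (n k : ℕ) : Type := Coord n → (Fin k → Fin n) → ℝ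

variable {n : ℕ}

/-- The partial derivative `∂ f / ∂ x_i`. -/
def pd (i : Fin n) (f : Coord n → ℝ) (x : Coord n) : ℝ :=
  fderiv ℝ f x (EuclideanSpace.single i 1)

/-- Christoffel symbols `Γ^k_{ij}` of the metric `G`. -/
def christoffel (G : MatField n) (k i j : Fin n) (x : Coord n) : ℝ :=
  (1 / 2) * ∑ l, (G x)⁻¹ k l *
    (pd i (fun y => G y j l) x + pd j (fun y => G y i l) x - pd l (fun y => G y i j) x)

/-- The covariant derivative `∇ T`; the index of differentiation is put last, so that
`(∇ T)_{α m} = T_{α ; m} = ∂_m T_α - ∑_s Γ^p_{m α_s} T_{α_1 … p … α_k}`. -/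
def covDeriv (G : MatField n) {k : ℕ} (T : TensorField n k) : TensorField n (k + 1) :=
  fun x I =>
    pd (I (Fin.last k)) (fun y => T y (fun s => I s.castSucc)) x
      - ∑ s : Fin k, ∑ p : Fin n, christoffel G p (I (Fin.last k)) (I s.castSucc) x *
          T x (Function.update (fun r : Fin k => I r.castSucc) s p)

/-- The components `Rm_{ijk}^l`, where `R(∂_i, ∂_j) ∂_k = Rm_{ijk}^l ∂_l` and
`R(X, Y) = [∇_X, ∇_Y] - ∇_{[X, Y]}`. -/
def riemannUp (G : MatField n) (i j k l : Fin n) (x : Coord n) : ℝ :=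
  pd i (christoffel G l j k) x - pd j (christoffel G l i k) x
    + ∑ p, (christoffel G p j k x * christoffel G l i p x
        - christoffel G p i k x * christoffel G l j p x)

/-- The Riemann tensor `Rm_{ijkl} = Rm_{ijk}^p g_{pl}`; with this sign the unit sphere has
`Rm_{ijkl} = g_{il} g_{jk} - g_{ik} g_{jl}`. -/
def riemann (G : MatField n) (i j k l : Fin n) (x : Coord n) : ℝ :=
  ∑ p, riemannUp G i j k p x * G x p l

/-- The Ricci tensor `Ric_{jk} = g^{il} Rm_{ijkl}`. -/
def ricci (G : MatField n) (j k : Fin n) (x : Coord n) : ℝ :=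
  ∑ i, ∑ l, (G x)⁻¹ i l * riemann G i j k l x

/-- The scalar curvature. -/
def scalarCurv (G : MatField n) (x : Coord n) : ℝ :=
  ∑ j, ∑ k, (G x)⁻¹ j k * ricci G j k x

/-- The Schouten tensor `A = (Ric - R g / (2 (n - 1))) / (n - 2)`. -/
def schouten (G : MatField n) : MatField n := fun x =>
  Matrix.of fun i j =>
    (1 / ((n : ℝ) - 2)) * (ricci G i j x - scalarCurv G x / (2 * ((n : ℝ) - 1)) * G x i j)

/-- The Kulkarni-Nomizu product
`(A ∧ B)_{ijkl} = A_{il} B_{jk} + A_{jk} B_{il} - A_{ik} B_{jl} - A_{jl} B_{ik}`. -/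
def kulkarniNomizu (A B : Matrix (Fin n) (Fin n) ℝ) (i j k l : Fin n) : ℝ :=
  A i l * B j k + A j k * B i l - A i k * B j l - A j l * B i k

/-- The Weyl tensor `W = Rm - A ∧ g`, with all indices down. -/
def weyl (G : MatField n) : TensorField n 4 := fun x I =>
  riemann G (I 0) (I 1) (I 2) (I 3) x
    - kulkarniNomizu (schouten G x) (G x) (I 0) (I 1) (I 2) (I 3)

/-- The linearization `DW_g[h] = d/dt W_{g + t h}` at `t = 0`. -/
def dWeyl (G H : MatField n) : TensorField n 4 := fun x I =>
  deriv (fun t : ℝ => weyl (fun y => G y + t • H y) x I) 0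

/-- A field of bilinear forms as a tensor of rank two. -/
def asTensor (H : MatField n) : TensorField n 2 := fun x I => H x (I 0) (I 1)

/-- `∇ h`, with components `h_{ij;k}`. -/
def nabla (G H : MatField n) : TensorField n 3 := covDeriv G (asTensor H)

/-- `∇² h`, with components `h_{ij;kl}` (first in direction `k`, then in direction `l`). -/
def nabla2 (G H : MatField n) : TensorField n 4 := covDeriv G (nabla G H)

/-- `∇³ h`. -/
def nabla3 (G H : MatField n) : TensorField n 5 := covDeriv G (nabla2 G H)

/-- The connection Laplacian `(Δ h)_{ij} = g^{kl} h_{ij;kl}`. -/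
def laplace (G H : MatField n) : TensorField n 2 := fun x I =>
  ∑ k, ∑ l, (G x)⁻¹ k l * nabla2 G H x ![I 0, I 1, k, l]

/-- The trace `g^{ij} h_{ij}`. -/
def trace (G H : MatField n) (x : Coord n) : ℝ :=
  ∑ i, ∑ j, (G x)⁻¹ i j * H x i j

/-- The divergence `(div h)_j = g^{ik} h_{ij;k}`. -/
def divergence (G H : MatField n) (j : Fin n) (x : Coord n) : ℝ :=
  ∑ i, ∑ k, (G x)⁻¹ i k * nabla G H x ![i, j, k]

/-- The pointwise square norm `|T|² = T_α T^α`. -/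
def normSq (G : MatField n) {k : ℕ} (T : TensorField n k) (x : Coord n) : ℝ :=
  ∑ I : Fin k → Fin n, ∑ J : Fin k → Fin n,
    (∏ s, (G x)⁻¹ (I s) (J s)) * T x I * T x J

/-- The tensor product `S ⊗ T`. -/
def tensorProd {a b : ℕ} (S : TensorField n a) (T : TensorField n b) : TensorField n (a + b) :=
  fun x I => S x (fun s => I (Fin.castAdd b s)) * T x (fun s => I (Fin.natAdd a s))

/-- A full contraction of `g⁻¹ ⊗ ⋯ ⊗ g⁻¹ ⊗ T ⊗ ν` (with `k` factors `g⁻¹`), where `T` has rank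
`2 k + 1` and `ν` is a vector. The permutation `σ` says how the slots of `T` are matched with the
`2 k` slots of the factors `g⁻¹` and the slot of `ν`. -/
def contraction (G : MatField n) (k : ℕ) (T : TensorField n (2 * k + 1)) (ν : Fin n → ℝ)
    (σ : Equiv.Perm (Fin (2 * k + 1))) (x : Coord n) : ℝ :=
  ∑ I : Fin (2 * k + 1) → Fin n,
    (∏ s : Fin k, (G x)⁻¹ (I ⟨2 * s, by omega⟩) (I ⟨2 * s + 1, by omega⟩))
      * ν (I (Fin.last (2 * k))) * T x (fun s => I (σ s))

/-! ### Manifolds -/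

variable {M : Type*} [TopologicalSpace M] [ChartedSpace (Coord n) M]

/-- Smooth Riemannian metrics on `M`. -/
abbrev Metric (n : ℕ) (M : Type*) [TopologicalSpace M] [ChartedSpace (Coord n) M]
    [IsManifold (𝓡 n) ∞ M] : Type _ :=
  ContMDiffRiemannianMetric (𝓡 n) ∞ (Coord n) (fun x : M => TangentSpace (𝓡 n) x)

/-- Smooth symmetric two-tensors on `M`. -/
structure SymTwoTensor (n : ℕ) (M : Type*) [TopologicalSpace M] [ChartedSpace (Coord n) M]
    [IsManifold (𝓡 n) ∞ M] where
  /-- The bilinear form on each tangent space. -/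
  form (x : M) : TangentSpace (𝓡 n) x →L[ℝ] TangentSpace (𝓡 n) x →L[ℝ] ℝ
  symm (x : M) (v w : TangentSpace (𝓡 n) x) : form x v w = form x w v
  contMDiff : ContMDiff (𝓡 n) ((𝓡 n).prod 𝓘(ℝ, Coord n →L[ℝ] Coord n →L[ℝ] ℝ)) ∞
    (fun x ↦ TotalSpace.mk' (Coord n →L[ℝ] Coord n →L[ℝ] ℝ)
      (E := fun x : M ↦ TangentSpace (𝓡 n) x →L[ℝ] TangentSpace (𝓡 n) x →L[ℝ] ℝ) x (form x))

/-- The coordinate vector `∂_i` of the chart `e`, at the point with coordinates `y`. -/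
def coordVec (e : OpenPartialHomeomorph M (Coord n)) (i : Fin n) (y : Coord n) :
    TangentSpace (𝓡 n) (e.symm y) :=
  mfderiv 𝓘(ℝ, Coord n) (𝓡 n) e.symm y (EuclideanSpace.single i (1 : ℝ) : Coord n)

/-- The components `B(∂_i, ∂_j)`, in the chart `e`, of a field of bilinear forms on `M`.
They are meaningful on `e.target`. -/
def components (B : (x : M) → TangentSpace (𝓡 n) x →L[ℝ] TangentSpace (𝓡 n) x →L[ℝ] ℝ)
    (e : OpenPartialHomeomorph M (Coord n)) : MatField n := fun y =>
  Matrix.of fun i j => B (e.symm y) (coordVec e i y) (coordVec e j y)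

/-- The Riemannian measure in the chart `e`: the measure `√(det g_{ij}) dx`, carried to `M`. -/
def chartVolume [IsManifold (𝓡 n) ∞ M] [MeasurableSpace M] (g : Metric n M)
    (e : OpenPartialHomeomorph M (Coord n)) : Measure M :=
  Measure.map e.symm ((volume.restrict e.target).withDensity
    fun y => ENNReal.ofReal (√(components g.inner e y).det))

/-- The Riemannian measure `dv_g`. The measures of the charts agree on overlaps, so on a second
countable manifold their supremum is the measure that restricts to each of them. -/
def riemannianVolume [IsManifold (𝓡 n) ∞ M] [MeasurableSpace M] (g : Metric n M) : Measure M :=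
  ⨆ e ∈ atlas (Coord n) M, chartVolume g e

/-- `g` has constant sectional curvature `c`: `Rm_{ijkl} = c (g_{il} g_{jk} - g_{ik} g_{jl})`. -/
def HasConstantCurvature [IsManifold (𝓡 n) ∞ M] (g : Metric n M) (c : ℝ) : Prop :=
  ∀ (x : M) (i j k l : Fin n),
    let e := chartAt (Coord n) x
    let G := components g.inner e
    riemann G i j k l (e x) =
      c * (G (e x) i l * G (e x) j k - G (e x) i k * G (e x) j l)

/-- `h` is transverse-traceless: `tr_g h = 0` and `div_g h = 0`. -/
def IsTransverseTraceless [IsManifold (𝓡 n) ∞ M] (g : Metric n M) (h : SymTwoTensor n M) : Prop :=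
  ∀ x : M,
    let e := chartAt (Coord n) x
    let G := components g.inner e
    let H := components h.form e
    trace G H (e x) = 0 ∧ ∀ j, divergence G H j (e x) = 0

/-- `‖F‖_U² = ∫_U F_α F^α dv_g` for a tensor `F` given in coordinates by a formula in `g` and `h`;
at each point the integrand is computed in the preferred chart. -/
def l2NormSq [IsManifold (𝓡 n) ∞ M] [MeasurableSpace M] (g : Metric n M) (h : SymTwoTensor n M)
    (U : Set M) {k : ℕ} (F : MatField n → MatField n → TensorField n k) : ℝ :=
  ∫ x in U,
    (let e := chartAt (Coord n) x
     let G := components g.inner e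
     let H := components h.form e
     normSq G (F G H) (e x)) ∂(riemannianVolume g)

/-! ### Domains with smooth boundary -/

variable [NeZero n]

/-- A smooth chart in which `U` is the half space `x_0 > 0`. -/
def IsBoundaryChart (U : Set M) (e : OpenPartialHomeomorph M (Coord n)) : Prop :=
  e ∈ IsManifold.maximalAtlas (𝓡 n) ∞ M ∧ ∀ q ∈ e.source, q ∈ U ↔ 0 < e q 0

/-- `U` is an open set with smooth boundary: around each boundary point there is a smooth chart in
which `U` is the half space `x_0 > 0`. -/
def IsSmoothDomain (n : ℕ) [NeZero n] {M : Type*} [TopologicalSpace M] [ChartedSpace (Coord n) M]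
    (U : Set M) : Prop :=
  IsOpen U ∧ ∀ p ∈ frontier U, ∃ e : OpenPartialHomeomorph M (Coord n),
    IsBoundaryChart U e ∧ p ∈ e.source

/-- Insert `x_0 = 0`: the inclusion of the boundary of the half space. -/
def hyperplaneIncl (z : {i : Fin n // i ≠ 0} → ℝ) : Coord n :=
  WithLp.toLp 2 fun i => if hi : i ≠ 0 then z ⟨i, hi⟩ else 0

/-- The surface measure in a boundary chart: the Riemannian measure
`√(det (g_{ab})_{a, b ≠ 0}) dz` of the metric induced on `x_0 = 0`, carried to `∂U`. -/
def chartSurface [IsManifold (𝓡 n) ∞ M] [MeasurableSpace M] (g : Metric n M)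
    (e : OpenPartialHomeomorph M (Coord n)) : Measure M :=
  Measure.map (fun z => e.symm (hyperplaneIncl z))
    ((volume.restrict {z : {i : Fin n // i ≠ 0} → ℝ | hyperplaneIncl z ∈ e.target}).withDensity
      fun z => ENNReal.ofReal
        (√((components g.inner e (hyperplaneIncl z)).submatrix
          (fun a : {i : Fin n // i ≠ 0} => (a : Fin n))
          (fun a : {i : Fin n // i ≠ 0} => (a : Fin n))).det))

/-- The surface measure `dS_g` on `∂U`, glued from the boundary charts as `dv_g` is from charts. -/
def surfaceMeasure [IsManifold (𝓡 n) ∞ M] [MeasurableSpace M] (g : Metric n M) (U : Set M) :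
    Measure M :=
  ⨆ (e : OpenPartialHomeomorph M (Coord n)) (_ : IsBoundaryChart U e), chartSurface g e

open Classical in
/-- Some boundary chart of `U` around `p`. -/
def boundaryChart (n : ℕ) [NeZero n] {M : Type*} [TopologicalSpace M] [ChartedSpace (Coord n) M]
    (U : Set M) (p : M) : OpenPartialHomeomorph M (Coord n) :=
  if hp : ∃ e : OpenPartialHomeomorph M (Coord n), IsBoundaryChart U e ∧ p ∈ e.source
  then hp.choose else chartAt (Coord n) p

/-- The components, in a boundary chart (where `U` is `x_0 > 0`), of the outward unit normal:
`n^i = - g^{i0} / √g^{00}`. -/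
def outwardNormal (G : MatField n) (x : Coord n) : Fin n → ℝ :=
  fun i => -(G x)⁻¹ i 0 / √((G x)⁻¹ 0 0)

/-- A boundary integral of the type
`∫_{∂U} contr (g⁻¹ ⊗ ⋯ ⊗ g⁻¹ ⊗ F ⊗ n) dS_g`: the linear combination, with coefficients `a`, of all
the full contractions. At each point the integrand is computed in a boundary chart. -/
def boundaryIntegral [IsManifold (𝓡 n) ∞ M] [MeasurableSpace M] (g : Metric n M)
    (h : SymTwoTensor n M) (U : Set M) (k : ℕ)
    (F : MatField n → MatField n → TensorField n (2 * k + 1))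
    (a : Equiv.Perm (Fin (2 * k + 1)) → ℝ) : ℝ :=
  ∫ p in frontier U,
    (let e := boundaryChart n U p
     let G := components g.inner e
     let H := components h.form e
     ∑ σ, a σ * contraction G k (F G H) (outwardNormal G (e p)) σ (e p)) ∂(surfaceMeasure g U)

/-- Boundary integrals of `g⁻¹ ⊗ g⁻¹ ⊗ ∇ h ⊗ h ⊗ n`. -/
def BT₁ [IsManifold (𝓡 n) ∞ M] [MeasurableSpace M] (g : Metric n M) (h : SymTwoTensor n M)
    (U : Set M) (a : Equiv.Perm (Fin 5) → ℝ) : ℝ :=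
  boundaryIntegral g h U 2 (fun G H => (tensorProd (nabla G H) (asTensor H) : TensorField n (3 + 2))) a

/-- Boundary integrals of `g⁻¹ ⊗ g⁻¹ ⊗ g⁻¹ ⊗ ∇² h ⊗ ∇ h ⊗ n`. -/
def BT₂ [IsManifold (𝓡 n) ∞ M] [MeasurableSpace M] (g : Metric n M) (h : SymTwoTensor n M)
    (U : Set M) (a : Equiv.Perm (Fin 7) → ℝ) : ℝ :=
  boundaryIntegral g h U 3 (fun G H => (tensorProd (nabla2 G H) (nabla G H) : TensorField n (4 + 3))) a

/-- Boundary integrals of `g⁻¹ ⊗ g⁻¹ ⊗ g⁻¹ ⊗ ∇³ h ⊗ h ⊗ n`. -/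
def BT₃ [IsManifold (𝓡 n) ∞ M] [MeasurableSpace M] (g : Metric n M) (h : SymTwoTensor n M)
    (U : Set M) (a : Equiv.Perm (Fin 7) → ℝ) : ℝ :=
  boundaryIntegral g h U 3 (fun G H => (tensorProd (nabla3 G H) (asTensor H) : TensorField n (5 + 2))) a

end WeylVariation

end

noncomputable section

namespace WeylVariation

variable {n : ℕ}

/-! ### Partial derivatives -/

/-! The formula is the integral over `U` of a pointwise identity. For transverse-traceless `h` on a
space form, `|DW[h]|²` equals the bracket on the right, times `(n-3)/(n-2)`, plus the divergences of
two explicit covector fields: `fluxOne`, built from `∇h ⊗ h`, and `fluxTwo`, built from `∇²h ⊗ ∇h`.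
The divergence theorem turns them into `BT₁` and `BT₂`; `BT₃` can be taken to be zero.

Why the pointwise identity holds. The Schouten tensor of a space form is `(c/2) g`, so the
zeroth-order part `(c/2) h ∧ g` of the linearized Riemann tensor cancels against `A ∧ h`. What
remains is `DW = R - B ∧ g`, where `R` (`linRiem`) is made of second derivatives of `h` and `B = (cn
h - Δh) / (2(n-2))` (`linSchouten`). The gauge conditions and the Ricci identity give `tr R = (n-2)
B` and `tr B = 0`, so `DW` is the trace-free part of `R` and `|DW|² = |R|² - |cn h - Δh|² / (n-2)`.
By its antisymmetries `|R|²` is a sum of four contractions of `∇²h ⊗ ∇²h`. Moving one derivative to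
the other factor costs a divergence. The derivatives are then commuted: commutators are algebraic
because the curvature is constant, and `div h = 0` removes the contracted terms. Modulo `div
fluxTwo` this gives `|R|² = |Δh|² - cn⟨Δh, h⟩ + 3c|∇h|² - 3c h_{jl;k} h_{jk;l}`. Two more Leibniz
steps, with flux `fluxOne`, replace `⟨Δh, h⟩` by `-|∇h|²` and `h_{jl;k} h_{jk;l}` by `-cn|h|²`; all
coefficients then contain the factor `(n-3)/(n-2)`.

How it is checked. All terms are natural under coordinate changes (`covDeriv_pull`, `weyl_pull`,
`dWeyl_pull`, `contraction_of_act`), so one may work at the centre of coordinates in which the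
metric is the identity to first order (`exists_normal`). There the relations between `h`, `∇h`,
`∇²h` and `∇³h` are those of `SpaceFormJet`, the linearization is computed in `hasDerivAt_weyl`, and
the identity is the finite-sum algebra of `sum_linWeyl_sq_eq`.

How it is integrated. Measures defined as suprema over charts restrict to the expected measure in
each chart (`iSup_restrict_eq`). With `√g div Y = ∂_m (√g Y^m)`, a partition of unity reduces the
divergence theorem on `U` (`integral_divergence`) to compactly supported fields on the whole space
and on the half space. -/

theorem pd_congr {f g : Coord n → ℝ} {x : Coord n} (h : f =ᶠ[𝓝 x] g) (i : Fin n) :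
    pd i f x = pd i g x := by
  unfold pd; rw [h.fderiv_eq]

theorem pd_congr_on {f g : Coord n → ℝ} {Ω : Set (Coord n)} (hΩ : IsOpen Ω)
    (h : ∀ y ∈ Ω, f y = g y) {x : Coord n} (hx : x ∈ Ω) (i : Fin n) :
    pd i f x = pd i g x :=
  pd_congr (Filter.eventually_of_mem (hΩ.mem_nhds hx) h) i

theorem pd_const (i : Fin n) (a : ℝ) (x : Coord n) : pd i (fun _ => a) x = 0 := by
  simp [pd]

theorem pd_add {f g : Coord n → ℝ} {x : Coord n} (hf : DifferentiableAt ℝ f x)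
    (hg : DifferentiableAt ℝ g x) (i : Fin n) :
    pd i (fun y => f y + g y) x = pd i f x + pd i g x := by
  simp only [pd]; rw [fderiv_fun_add hf hg]; rfl

theorem pd_sub {f g : Coord n → ℝ} {x : Coord n} (hf : DifferentiableAt ℝ f x)
    (hg : DifferentiableAt ℝ g x) (i : Fin n) :
    pd i (fun y => f y - g y) x = pd i f x - pd i g x := by
  simp only [pd]; rw [fderiv_fun_sub hf hg]; rfl

theorem pd_mul {f g : Coord n → ℝ} {x : Coord n} (hf : DifferentiableAt ℝ f x)
    (hg : DifferentiableAt ℝ g x) (i : Fin n) :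
    pd i (fun y => f y * g y) x = pd i f x * g x + f x * pd i g x := by
  simp only [pd]; rw [fderiv_fun_mul hf hg]; simp; ring

theorem pd_const_mul {f : Coord n → ℝ} {x : Coord n} (hf : DifferentiableAt ℝ f x)
    (a : ℝ) (i : Fin n) : pd i (fun y => a * f y) x = a * pd i f x := by
  rw [pd_mul (differentiableAt_const a) hf, pd_const]; ring

theorem pd_sum {ι : Type*} (s : Finset ι) {f : ι → Coord n → ℝ} {x : Coord n}
    (hf : ∀ a ∈ s, DifferentiableAt ℝ (f a) x) (i : Fin n) :
    pd i (fun y => ∑ a ∈ s, f a y) x = ∑ a ∈ s, pd i (f a) x := by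
  simp only [pd]; rw [fderiv_fun_sum hf]; simp

theorem pd_prod {ι : Type*} [DecidableEq ι] (s : Finset ι) {f : ι → Coord n → ℝ} {x : Coord n}
    (hf : ∀ a ∈ s, DifferentiableAt ℝ (f a) x) (i : Fin n) :
    pd i (fun y => ∏ a ∈ s, f a y) x = ∑ a ∈ s, (∏ b ∈ s.erase a, f b x) * pd i (f a) x := by
  simp only [pd]
  rw [(HasFDerivAt.finsetProd (fun a ha => (hf a ha).hasFDerivAt)).fderiv]
  simp

theorem coord_eq_sum (w : Coord n) : w = ∑ c, w c • EuclideanSpace.single c (1 : ℝ) := by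
  have := (EuclideanSpace.basisFun (Fin n) ℝ).sum_repr w
  simpa using this.symm

theorem fderiv_eq_sum_pd (f : Coord n → ℝ) (x w : Coord n) :
    fderiv ℝ f x w = ∑ c, w c * pd c f x := by
  conv_lhs => rw [coord_eq_sum w]
  simp [pd]

theorem differentiableAt_of_comp {φ : Coord n → Coord n} {x : Coord n}
    (hφ : ∀ a, DifferentiableAt ℝ (fun y => φ y a) x) : DifferentiableAt ℝ φ x :=
  differentiableAt_euclidean.2 hφ

theorem fderiv_apply_coord {φ : Coord n → Coord n} {x : Coord n} (hφ : DifferentiableAt ℝ φ x)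
    (v : Coord n) (a : Fin n) : (fderiv ℝ φ x v) a = fderiv ℝ (fun y => φ y a) x v := by
  have h := ((EuclideanSpace.proj (𝕜 := ℝ) a : Coord n →L[ℝ] ℝ).hasFDerivAt.comp x
    hφ.hasFDerivAt).fderiv
  have h' : fderiv ℝ (fun y => φ y a) x = (EuclideanSpace.proj a : Coord n →L[ℝ] ℝ) ∘L
    fderiv ℝ φ x := h
  rw [h']; simp

theorem pd_comp {f : Coord n → ℝ} {φ : Coord n → Coord n} {x : Coord n}
    (hf : DifferentiableAt ℝ f (φ x)) (hφ : ∀ a, DifferentiableAt ℝ (fun y => φ y a) x)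
    (i : Fin n) :
    pd i (fun y => f (φ y)) x = ∑ c, pd c f (φ x) * pd i (fun y => φ y c) x := by
  have hφ' := differentiableAt_of_comp hφ
  have : fderiv ℝ (fun y => f (φ y)) x = (fderiv ℝ f (φ x)).comp (fderiv ℝ φ x) :=
    fderiv_comp x hf hφ'
  simp only [pd]
  rw [this, ContinuousLinearMap.comp_apply, fderiv_eq_sum_pd]
  refine Finset.sum_congr rfl fun c _ => ?_
  rw [fderiv_apply_coord hφ', mul_comm]; rfl

theorem ContDiffOn.pd {f : Coord n → ℝ} {Ω : Set (Coord n)} (hf : ContDiffOn ℝ ∞ f Ω)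
    (hΩ : IsOpen Ω) (i : Fin n) : ContDiffOn ℝ ∞ (pd i f) Ω := by
  have := hf.fderiv_of_isOpen hΩ (m := ∞) (by simp)
  exact this.clm_apply contDiffOn_const

theorem ContDiffOn.diffAt {f : Coord n → ℝ} {Ω : Set (Coord n)} (hf : ContDiffOn ℝ ∞ f Ω)
    (hΩ : IsOpen Ω) {x : Coord n} (hx : x ∈ Ω) : DifferentiableAt ℝ f x :=
  (hf.contDiffAt (hΩ.mem_nhds hx)).differentiableAt (by simp)

theorem pd_comm {f : Coord n → ℝ} {Ω : Set (Coord n)} (hf : ContDiffOn ℝ ∞ f Ω)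
    (hΩ : IsOpen Ω) {x : Coord n} (hx : x ∈ Ω) (i j : Fin n) :
    pd i (pd j f) x = pd j (pd i f) x := by
  have hc := hf.contDiffAt (hΩ.mem_nhds hx)
  have hs : IsSymmSndFDerivAt ℝ f x := hc.isSymmSndFDerivAt (by simp; exact WithTop.coe_le_coe.2 (le_top : (2 : ℕ∞) ≤ ⊤))
  have hd : DifferentiableAt ℝ (fderiv ℝ f) x :=
    (hc.fderiv_right (m := 1) (by norm_cast)).differentiableAt (by simp)
  have key : ∀ a b : Fin n, WeylVariation.pd a (WeylVariation.pd b f) x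
      = fderiv ℝ (fderiv ℝ f) x (EuclideanSpace.single a 1) (EuclideanSpace.single b 1) := by
    intro a b
    have h : HasFDerivAt (fun y => fderiv ℝ f y (EuclideanSpace.single b 1)) _ x :=
      hd.hasFDerivAt.clm_apply (hasFDerivAt_const (EuclideanSpace.single b (1:ℝ)) x)
    have h2 : fderiv ℝ (fun y => fderiv ℝ f y (EuclideanSpace.single b 1)) x = _ := h.fderiv
    change fderiv ℝ (fun y => fderiv ℝ f y (EuclideanSpace.single b 1)) x _ = _
    rw [h2]; simp
  rw [key, key]; exact hs _ _

/-! ### Smooth matrix fields and their inverses -/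

/-- All the entries are smooth on `Ω`. -/
def SmoothMat (Ω : Set (Coord n)) (G : MatField n) : Prop :=
  ∀ i j, ContDiffOn ℝ ∞ (fun y => G y i j) Ω

/-- All the components are smooth on `Ω`. -/
def SmoothTensor (Ω : Set (Coord n)) {k : ℕ} (T : TensorField n k) : Prop :=
  ∀ I, ContDiffOn ℝ ∞ (fun y => T y I) Ω

theorem contDiffOn_det {ι : Type*} [Fintype ι] [DecidableEq ι] {E : Type*} [NormedAddCommGroup E]
    [NormedSpace ℝ E] {Ω : Set E} {A : E → Matrix ι ι ℝ}
    (hA : ∀ i j, ContDiffOn ℝ ∞ (fun y => A y i j) Ω) :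
    ContDiffOn ℝ ∞ (fun y => (A y).det) Ω := by
  simp only [Matrix.det_apply']
  exact ContDiffOn.sum fun σ _ => contDiffOn_const.mul (contDiffOn_prod fun i _ => hA _ _)

/-- Cramer's rule: an entry of the inverse is a cofactor divided by the determinant, and a cofactor
is itself the determinant of a matrix with one constant row. -/
theorem SmoothMat.inv {Ω : Set (Coord n)} {G : MatField n} (hG : SmoothMat Ω G)
    (hd : ∀ y ∈ Ω, (G y).det ≠ 0) : SmoothMat Ω (fun y => (G y)⁻¹) := by
  intro i j
  have h1 : ContDiffOn ℝ ∞ (fun y => (G y).adjugate i j) Ω := by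
    simp only [Matrix.adjugate_apply]
    refine contDiffOn_det fun a b => ?_
    by_cases h : a = j
    · subst h; simpa using contDiffOn_const
    · simpa [Matrix.updateRow_ne h] using hG a b
  have h2 := (contDiffOn_det hG).inv hd
  simp only [Matrix.inv_def, Matrix.smul_apply, Ring.inverse_eq_inv', smul_eq_mul]
  exact h2.mul h1

/-- `G` is a smooth symmetric nondegenerate matrix field on the open set `Ω`. -/
structure NondegOn (Ω : Set (Coord n)) (G : MatField n) : Prop where
  isOpen : IsOpen Ω
  smooth : SmoothMat Ω G
  symm : ∀ y ∈ Ω, ∀ i j, G y i j = G y j i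
  det : ∀ y ∈ Ω, (G y).det ≠ 0

namespace NondegOn

variable {Ω : Set (Coord n)} {G : MatField n}

theorem inv_smooth (hG : NondegOn Ω G) : SmoothMat Ω (fun y => (G y)⁻¹) := hG.smooth.inv hG.det

theorem mul_inv (hG : NondegOn Ω G) {x : Coord n} (hx : x ∈ Ω) : G x * (G x)⁻¹ = 1 :=
  Matrix.mul_nonsing_inv _ (isUnit_iff_ne_zero.2 (hG.det x hx))

theorem inv_mul (hG : NondegOn Ω G) {x : Coord n} (hx : x ∈ Ω) : (G x)⁻¹ * G x = 1 :=
  Matrix.nonsing_inv_mul _ (isUnit_iff_ne_zero.2 (hG.det x hx))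

theorem isSymm (hG : NondegOn Ω G) {x : Coord n} (hx : x ∈ Ω) : (G x).transpose = G x := by
  ext i j; exact hG.symm x hx j i

theorem inv_symm (hG : NondegOn Ω G) {x : Coord n} (hx : x ∈ Ω) (i j : Fin n) :
    (G x)⁻¹ i j = (G x)⁻¹ j i := by
  have := congrFun (congrFun (Matrix.transpose_nonsing_inv (G x)) j) i
  rw [hG.isSymm hx] at this; exact this

theorem diffAt (hG : NondegOn Ω G) {x : Coord n} (hx : x ∈ Ω) (i j : Fin n) :
    DifferentiableAt ℝ (fun y => G y i j) x := ContDiffOn.diffAt (hG.smooth i j) hG.isOpen hx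

theorem mono (hG : NondegOn Ω G) {Ω' : Set (Coord n)} (h : Ω' ⊆ Ω) (ho : IsOpen Ω') :
    NondegOn Ω' G where
  isOpen := ho
  smooth i j := (hG.smooth i j).mono h
  symm y hy := hG.symm y (h hy)
  det y hy := hG.det y (h hy)

theorem pd_symm (hG : NondegOn Ω G) {x : Coord n} (hx : x ∈ Ω) (c i j : Fin n) :
    pd c (fun y => G y i j) x = pd c (fun y => G y j i) x :=
  pd_congr_on hG.isOpen (fun y hy => hG.symm y hy i j) hx c

theorem christoffel_smooth (hG : NondegOn Ω G) (k i j : Fin n) :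
    ContDiffOn ℝ ∞ (christoffel G k i j) Ω := by
  unfold christoffel
  refine contDiffOn_const.mul (ContDiffOn.sum fun l _ => (hG.inv_smooth k l).mul ?_)
  exact ((ContDiffOn.pd (hG.smooth _ _) hG.isOpen _).add
    (ContDiffOn.pd (hG.smooth _ _) hG.isOpen _)).sub (ContDiffOn.pd (hG.smooth _ _) hG.isOpen _)

theorem christoffel_symm (hG : NondegOn Ω G) {x : Coord n} (hx : x ∈ Ω) (k i j : Fin n) :
    christoffel G k i j x = christoffel G k j i x := by
  unfold christoffel
  congr 1
  refine Finset.sum_congr rfl fun l _ => ?_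
  rw [hG.pd_symm hx l i j]; ring

/-- Multiplying by `G` cancels the `G⁻¹` of the definition. The lowered symbols are linear in the
first derivatives of the metric, which makes them the right objects for comparing coordinate
systems. -/
theorem christoffel_lower (hG : NondegOn Ω G) {x : Coord n} (hx : x ∈ Ω) (l i j : Fin n) :
    ∑ p, G x l p * christoffel G p i j x = (1 / 2) *
      (pd i (fun y => G y j l) x + pd j (fun y => G y i l) x - pd l (fun y => G y i j) x) := by
  set L : Fin n → ℝ := fun l =>
    pd i (fun y => G y j l) x + pd j (fun y => G y i l) x - pd l (fun y => G y i j) x with hL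
  have h1 : (fun p => christoffel G p i j x) = ((G x)⁻¹).mulVec ((1 / 2 : ℝ) • L) := by
    funext p
    simp only [christoffel, Matrix.mulVec, dotProduct, Finset.mul_sum, Pi.smul_apply, smul_eq_mul,
      hL]
    exact Finset.sum_congr rfl fun l _ => by ring
  have h2 : (G x).mulVec (fun p => christoffel G p i j x) = (1 / 2 : ℝ) • L := by
    rw [h1, Matrix.mulVec_mulVec, hG.mul_inv hx, Matrix.one_mulVec]
  exact congrFun h2 l

end NondegOn

theorem SmoothTensor.covDeriv {Ω : Set (Coord n)} {G : MatField n} (hG : NondegOn Ω G) {k : ℕ}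
    {T : TensorField n k} (hT : SmoothTensor Ω T) : SmoothTensor Ω (covDeriv G T) := by
  intro I
  refine ContDiffOn.sub (ContDiffOn.pd (hT _) hG.isOpen _) ?_
  exact ContDiffOn.sum fun s _ => ContDiffOn.sum fun p _ =>
    (hG.christoffel_smooth _ _ _).mul (hT _)

/-- Transformation laws hold only on open sets. Iterating them requires replacing a tensor by its
transform on a neighbourhood before differentiating again. -/
theorem covDeriv_congr {Ω : Set (Coord n)} (hΩ : IsOpen Ω) {G G' : MatField n} {k : ℕ}
    {T T' : TensorField n k} (hG : ∀ y ∈ Ω, G y = G' y) (hT : ∀ y ∈ Ω, T y = T' y) :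
    ∀ y ∈ Ω, covDeriv G T y = covDeriv G' T' y := by
  intro y hy
  funext I
  have h : ∀ p a b, christoffel G p a b y = christoffel G' p a b y := by
    intro p a b
    unfold christoffel
    rw [hG y hy]
    have : ∀ c i j, pd c (fun y => G y i j) y = pd c (fun y => G' y i j) y := fun c i j =>
      pd_congr_on hΩ (fun z hz => by rw [hG z hz]) hy c
    simp only [this]
  simp only [covDeriv, h, hT y hy]
  rw [pd_congr_on hΩ (fun z hz => by rw [hT z hz]) hy]

/-! ### Coordinate changes -/

/-- The Jacobian matrix of `φ`. -/
def jac (φ : Coord n → Coord n) (x : Coord n) : Matrix (Fin n) (Fin n) ℝ :=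
  Matrix.of fun a i => pd i (fun y => φ y a) x

/-- A smooth map between open sets with invertible Jacobian. -/
structure CoordChange (φ : Coord n → Coord n) (Ω Ω' : Set (Coord n)) : Prop where
  isOpen : IsOpen Ω
  isOpen' : IsOpen Ω'
  smooth : ∀ a, ContDiffOn ℝ ∞ (fun y => φ y a) Ω
  mapsTo : MapsTo φ Ω Ω'
  det : ∀ y ∈ Ω, (jac φ y).det ≠ 0

/-- The pullback of a field of bilinear forms. -/
def pullMat (φ : Coord n → Coord n) (G : MatField n) : MatField n := fun y =>
  (jac φ y).transpose * G (φ y) * jac φ y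

/-- The multilinear form with components `t`. -/
def ev {k : ℕ} (t : (Fin k → Fin n) → ℝ) (v : Fin k → Fin n → ℝ) : ℝ :=
  ∑ K : Fin k → Fin n, t K * ∏ s, v s (K s)

/-- The pullback of a covariant tensor field. -/
def pullTensor (φ : Coord n → Coord n) {k : ℕ} (T : TensorField n k) : TensorField n k :=
  fun y I => ev (T (φ y)) (fun s a => jac φ y a (I s))

theorem pullMat_apply (φ : Coord n → Coord n) (G : MatField n) (y : Coord n) (i j : Fin n) :
    pullMat φ G y i j = ∑ a, ∑ b, jac φ y a i * G (φ y) a b * jac φ y b j := by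
  simp only [pullMat, Matrix.mul_apply, Matrix.transpose_apply, Finset.sum_mul]
  rw [Finset.sum_comm]

namespace CoordChange

variable {φ : Coord n → Coord n} {Ω Ω' : Set (Coord n)}

theorem smooth' (hφ : CoordChange φ Ω Ω') : ContDiffOn ℝ ∞ φ Ω :=
  contDiffOn_euclidean.2 hφ.smooth

theorem smooth_comp (hφ : CoordChange φ Ω Ω') {f : Coord n → ℝ} (hf : ContDiffOn ℝ ∞ f Ω') :
    ContDiffOn ℝ ∞ (fun y => f (φ y)) Ω := hf.comp hφ.smooth' hφ.mapsTo

theorem smooth_jac (hφ : CoordChange φ Ω Ω') : SmoothMat Ω (jac φ) := fun a i =>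
  ContDiffOn.pd (hφ.smooth a) hφ.isOpen i

theorem smooth_pullMat (hφ : CoordChange φ Ω Ω') {G : MatField n} (hG : SmoothMat Ω' G) :
    SmoothMat Ω (pullMat φ G) := by
  intro i j
  simp only [pullMat_apply]
  exact ContDiffOn.sum fun a _ => ContDiffOn.sum fun b _ =>
    ((hφ.smooth_jac a i).mul (hφ.smooth_comp (hG a b))).mul (hφ.smooth_jac b j)

theorem nondegOn (hφ : CoordChange φ Ω Ω') {G : MatField n} (hG : NondegOn Ω' G) :
    NondegOn Ω (pullMat φ G) where
  isOpen := hφ.isOpen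
  smooth := hφ.smooth_pullMat hG.smooth
  symm y hy i j := by
    have h : (pullMat φ G y).transpose = pullMat φ G y := by
      simp only [pullMat, Matrix.transpose_mul, Matrix.transpose_transpose,
        hG.isSymm (hφ.mapsTo hy), Matrix.mul_assoc]
    exact congrFun (congrFun h j) i
  det y hy := by
    simp only [pullMat, Matrix.det_mul, Matrix.det_transpose]
    exact mul_ne_zero (mul_ne_zero (hφ.det y hy) (hG.det _ (hφ.mapsTo hy))) (hφ.det y hy)

theorem diffAt (hφ : CoordChange φ Ω Ω') {x : Coord n} (hx : x ∈ Ω) (a : Fin n) :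
    DifferentiableAt ℝ (fun y => φ y a) x := ContDiffOn.diffAt (hφ.smooth a) hφ.isOpen hx

theorem jac_diffAt (hφ : CoordChange φ Ω Ω') {x : Coord n} (hx : x ∈ Ω) (a i : Fin n) :
    DifferentiableAt ℝ (fun y => jac φ y a i) x :=
  ContDiffOn.diffAt (hφ.smooth_jac a i) hφ.isOpen hx

theorem pd_jac_symm (hφ : CoordChange φ Ω Ω') {x : Coord n} (hx : x ∈ Ω) (a i j : Fin n) :
    pd i (fun y => jac φ y a j) x = pd j (fun y => jac φ y a i) x :=
  pd_comm (hφ.smooth a) hφ.isOpen hx i j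

theorem pd_comp (hφ : CoordChange φ Ω Ω') {f : Coord n → ℝ} {x : Coord n} (hx : x ∈ Ω)
    (hf : ContDiffOn ℝ ∞ f Ω') (i : Fin n) :
    pd i (fun y => f (φ y)) x = ∑ c, pd c f (φ x) * jac φ x c i :=
  WeylVariation.pd_comp (ContDiffOn.diffAt hf hφ.isOpen' (hφ.mapsTo hx))
    (fun a => hφ.diffAt hx a) i

theorem pd_pullMat (hφ : CoordChange φ Ω Ω') {G : MatField n} (hG : SmoothMat Ω' G)
    {x : Coord n} (hx : x ∈ Ω) (i j l : Fin n) :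
    pd i (fun y => pullMat φ G y j l) x =
      ∑ a, ∑ b, (pd i (fun y => jac φ y a j) x * G (φ x) a b * jac φ x b l
        + jac φ x a j * (∑ c, pd c (fun y => G y a b) (φ x) * jac φ x c i) * jac φ x b l
        + jac φ x a j * G (φ x) a b * pd i (fun y => jac φ y b l) x) := by
  have hd : ∀ a b, DifferentiableAt ℝ (fun y => G (φ y) a b) x := fun a b =>
    ContDiffOn.diffAt (hφ.smooth_comp (hG a b)) hφ.isOpen hx
  have hJ := hφ.jac_diffAt hx
  simp only [pullMat_apply]
  rw [pd_sum _ (fun a _ => DifferentiableAt.fun_sum fun b _ =>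
    ((hJ a j).fun_mul (hd a b)).fun_mul (hJ b l))]
  refine Finset.sum_congr rfl fun a _ => ?_
  rw [pd_sum _ (fun b _ => ((hJ a j).fun_mul (hd a b)).fun_mul (hJ b l))]
  refine Finset.sum_congr rfl fun b _ => ?_
  rw [pd_mul ((hJ a j).fun_mul (hd a b)) (hJ b l), pd_mul (hJ a j) (hd a b),
    hφ.pd_comp hx (hG a b)]
  ring

end CoordChange

/-! ### Naturality of the covariant derivative -/

/-- The inhomogeneous transformation law, multiplied by the Jacobian so that no inverse map occurs;
`φ` need not be injective. The invertible matrix `Jᵀ G` is applied to both sides: the left one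
becomes the lowered symbol of the pulled back metric, and everything is expanded in first
derivatives of `G` and second derivatives of `φ`. -/
theorem CoordChange.christoffel_pull {φ : Coord n → Coord n} {Ω Ω' : Set (Coord n)}
    (hφ : CoordChange φ Ω Ω') {G : MatField n} (hG : NondegOn Ω' G) {x : Coord n} (hx : x ∈ Ω)
    (q i j : Fin n) :
    ∑ p, jac φ x q p * christoffel (pullMat φ G) p i j x =
      (∑ a, ∑ b, christoffel G q a b (φ x) * jac φ x a i * jac φ x b j)
        + pd i (fun y => jac φ y q j) x := by
  set J := jac φ x with hJ
  set R : Fin n → ℝ := fun q => (∑ a, ∑ b, christoffel G q a b (φ x) * J a i * J b j)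
        + pd i (fun y => jac φ y q j) x with hR
  set C : Fin n → ℝ := fun p => christoffel (pullMat φ G) p i j x with hC
  have hG' := hφ.nondegOn hG
  have hx' := hφ.mapsTo hx
  have key : (J.transpose * G (φ x)).mulVec (J.mulVec C) = (J.transpose * G (φ x)).mulVec R := by
    have h1 : (J.transpose * G (φ x)).mulVec (J.mulVec C) = (pullMat φ G x).mulVec C := by
      rw [Matrix.mulVec_mulVec, pullMat]
    rw [h1]
    funext l
    have h2 : (pullMat φ G x).mulVec C l = _ := hG'.christoffel_lower hx l i j
    rw [h2, hφ.pd_pullMat hG.smooth hx, hφ.pd_pullMat hG.smooth hx, hφ.pd_pullMat hG.smooth hx]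
    simp only [Finset.sum_add_distrib, Finset.mul_sum, Finset.sum_mul]
    have h3 : (J.transpose * G (φ x)).mulVec R l
        = ∑ a, ∑ b, J a l * J b i * (∑ c, J c j * (∑ q, G (φ x) a q * christoffel G q b c (φ x)))
          + ∑ a, ∑ q, J a l * G (φ x) a q * pd i (fun y => jac φ y q j) x := by
      simp only [← Matrix.mulVec_mulVec]
      simp only [Matrix.mulVec, dotProduct, Matrix.transpose_apply, hR, Finset.mul_sum, mul_add,
        Finset.sum_add_distrib]
      congr 1
      · refine Finset.sum_congr rfl fun a _ => ?_
        rw [Finset.sum_comm]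
        refine Finset.sum_congr rfl fun b _ => ?_
        rw [Finset.sum_comm]
        exact Finset.sum_congr rfl fun c _ => Finset.sum_congr rfl fun q _ => by ring
      · exact Finset.sum_congr rfl fun c _ => Finset.sum_congr rfl fun q _ => by ring
    rw [h3]
    simp only [hG.christoffel_lower hx']
    rw [← hJ]
    have e1 : ∀ u v w : Fin n, (∑ a, ∑ b, pd u (fun y => jac φ y a v) x * G (φ x) a b * J b w)
        = ∑ a, ∑ b, J a w * G (φ x) a b * pd u (fun y => jac φ y b v) x := by
      intro u v w
      rw [Finset.sum_comm]
      refine Finset.sum_congr rfl fun a _ => Finset.sum_congr rfl fun b _ => ?_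
      rw [hG.symm _ hx' b a]; ring
    -- Symmetry of the second derivatives of `φ`. Of the six terms containing them in the lowered
    -- symbol, four cancel and two add up to `Jᵀ G ∂J`.
    have e2 : ∀ u v w : Fin n, (∑ a, ∑ b, J a w * G (φ x) a b * pd u (fun y => jac φ y b v) x)
        = ∑ a, ∑ b, J a w * G (φ x) a b * pd v (fun y => jac φ y b u) x := by
      intro u v w
      refine Finset.sum_congr rfl fun a _ => Finset.sum_congr rfl fun b _ => ?_
      rw [hφ.pd_jac_symm hx]
    have d1 : (∑ a, ∑ b, ∑ c, J a j * (pd c (fun y => G y a b) (φ x) * J c i) * J b l)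
        = ∑ a, ∑ b, ∑ c, J a l * J b i * (J c j * pd b (fun y => G y c a) (φ x)) := by
      rw [Finset.sum_comm]
      refine Finset.sum_congr rfl fun a _ => ?_
      rw [Finset.sum_comm]
      exact Finset.sum_congr rfl fun b _ => Finset.sum_congr rfl fun c _ => by ring
    have d2 : (∑ a, ∑ b, ∑ c, J a i * (pd c (fun y => G y a b) (φ x) * J c j) * J b l)
        = ∑ a, ∑ b, ∑ c, J a l * J b i * (J c j * pd c (fun y => G y b a) (φ x)) := by
      rw [Finset.sum_comm]
      exact Finset.sum_congr rfl fun a _ => Finset.sum_congr rfl fun b _ =>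
        Finset.sum_congr rfl fun c _ => by ring
    have d3 : (∑ a, ∑ b, ∑ c, J a i * (pd c (fun y => G y a b) (φ x) * J c l) * J b j)
        = ∑ a, ∑ b, ∑ c, J a l * J b i * (J c j * pd a (fun y => G y b c) (φ x)) := by
      have : ∀ a, (∑ b, ∑ c, J a i * (pd c (fun y => G y a b) (φ x) * J c l) * J b j)
        = ∑ c, ∑ b, J a i * (pd c (fun y => G y a b) (φ x) * J c l) * J b j := fun a =>
          Finset.sum_comm
      simp only [this]
      rw [Finset.sum_comm]
      exact Finset.sum_congr rfl fun a _ => Finset.sum_congr rfl fun b _ =>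
        Finset.sum_congr rfl fun c _ => by ring
    have f : ∀ (A B C : Fin n → Fin n → Fin n → ℝ), (∑ a, ∑ b, J a l * J b i *
        ∑ c, (J c j * (1 / 2 * (A a b c + B a b c - C a b c)))) =
        1 / 2 * ((∑ a, ∑ b, ∑ c, J a l * J b i * (J c j * A a b c))
          + (∑ a, ∑ b, ∑ c, J a l * J b i * (J c j * B a b c))
          - ∑ a, ∑ b, ∑ c, J a l * J b i * (J c j * C a b c)) := by
      intro A B C
      simp only [Finset.mul_sum, ← Finset.sum_add_distrib, ← Finset.sum_sub_distrib]
      exact Finset.sum_congr rfl fun a _ => Finset.sum_congr rfl fun b _ =>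
        Finset.sum_congr rfl fun c _ => by ring
    rw [e1 i j l, e1 j i l, e1 l i j, d1, d2, d3, f, e2 j i l, e2 l i j, e2 j l i]
    ring
  have hu : IsUnit (J.transpose * G (φ x)).det := by
    rw [Matrix.det_mul, Matrix.det_transpose]
    exact isUnit_iff_ne_zero.2 (mul_ne_zero (hφ.det x hx) (hG.det _ hx'))
  have := Matrix.mulVec_injective_of_isUnit ((Matrix.isUnit_iff_isUnit_det _).2 hu) key
  exact congrFun this q

theorem ev_update_sum {k : ℕ} (t : (Fin k → Fin n) → ℝ) (v : Fin k → Fin n → ℝ) (s : Fin k)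
    {ι : Type*} (A : Finset ι) (w : ι → Fin n → ℝ) :
    ev t (Function.update v s (fun a => ∑ p ∈ A, w p a)) =
      ∑ p ∈ A, ev t (Function.update v s (w p)) := by
  simp only [ev]
  rw [Finset.sum_comm]
  refine Finset.sum_congr rfl fun K _ => ?_
  rw [← Finset.mul_sum]
  congr 1
  simp only [← Finset.mul_prod_erase Finset.univ _ (Finset.mem_univ s), Function.update_self]
  rw [Finset.sum_mul]
  refine Finset.sum_congr rfl fun p _ => ?_
  congr 1
  refine Finset.prod_congr rfl fun r hr => ?_
  rw [Function.update_of_ne (Finset.ne_of_mem_erase hr),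
    Function.update_of_ne (Finset.ne_of_mem_erase hr)]

theorem ev_update_add {k : ℕ} (t : (Fin k → Fin n) → ℝ) (v : Fin k → Fin n → ℝ) (s : Fin k)
    (w w' : Fin n → ℝ) :
    ev t (Function.update v s (fun a => w a + w' a)) =
      ev t (Function.update v s w) + ev t (Function.update v s w') := by
  simp only [ev, ← Finset.sum_add_distrib, ← mul_add]
  refine Finset.sum_congr rfl fun K _ => ?_
  congr 1
  simp only [← Finset.mul_prod_erase Finset.univ _ (Finset.mem_univ s), Function.update_self]
  have : ∀ u : Fin n → ℝ, (∏ r ∈ Finset.univ.erase s, Function.update v s u r (K r))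
      = ∏ r ∈ Finset.univ.erase s, v r (K r) := fun u => Finset.prod_congr rfl fun r hr => by
    rw [Function.update_of_ne (Finset.ne_of_mem_erase hr)]
  rw [this, this, this]; ring

theorem ev_update_smul {k : ℕ} (t : (Fin k → Fin n) → ℝ) (v : Fin k → Fin n → ℝ) (s : Fin k)
    (a : ℝ) (w : Fin n → ℝ) :
    ev t (Function.update v s (fun i => a * w i)) = a * ev t (Function.update v s w) := by
  simp only [ev, Finset.mul_sum]
  refine Finset.sum_congr rfl fun K _ => ?_
  simp only [← Finset.mul_prod_erase Finset.univ _ (Finset.mem_univ s), Function.update_self]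
  have : ∀ u : Fin n → ℝ, (∏ r ∈ Finset.univ.erase s, Function.update v s u r (K r))
      = ∏ r ∈ Finset.univ.erase s, v r (K r) := fun u => Finset.prod_congr rfl fun r hr => by
    rw [Function.update_of_ne (Finset.ne_of_mem_erase hr)]
  rw [this, this]; ring

/-- The involution exchanging the `s`-th index with the dummy index moves the matrix from the tensor
to the vector in slot `s`. -/
theorem sum_update_mul_prod {k : ℕ} (t : (Fin k → Fin n) → ℝ) (v : Fin k → Fin n → ℝ) (s : Fin k)
    (A : Fin n → Fin n → ℝ) :
    ∑ K : Fin k → Fin n, ∑ p, A p (K s) * t (Function.update K s p) * ∏ r, v r (K r) =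
      ev t (Function.update v s (fun p => ∑ b, A p b * v s b)) := by
  rw [ev_update_sum]
  simp only [ev]
  rw [← Finset.sum_product', ← Finset.sum_product_right']
  refine Finset.sum_nbij' (fun z => (Function.update z.1 s z.2, z.1 s))
    (fun z => (Function.update z.1 s z.2, z.1 s)) (by simp) (by simp) (by simp) (by simp) ?_
  rintro ⟨K, p⟩ -
  simp only [← Finset.mul_prod_erase Finset.univ _ (Finset.mem_univ s), Function.update_self]
  have : (∏ r ∈ Finset.univ.erase s, Function.update v s (fun p_1 => A p_1 (K s) * v s (K s)) r
      (Function.update K s p r)) = ∏ r ∈ Finset.univ.erase s, v r (K r) :=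
    Finset.prod_congr rfl fun r hr => by
      rw [Function.update_of_ne (Finset.ne_of_mem_erase hr),
        Function.update_of_ne (Finset.ne_of_mem_erase hr)]
  rw [this]; ring

theorem sum_fin_snoc {k : ℕ} (f : (Fin (k + 1) → Fin n) → ℝ) :
    ∑ K, f K = ∑ c, ∑ K : Fin k → Fin n, f (Fin.snoc K c) := by
  rw [← Finset.sum_product', Finset.univ_product_univ,
    ← (Fin.snocEquiv (fun _ : Fin (k + 1) => Fin n)).sum_comp]
  rfl

theorem pd_ev {k : ℕ} {T : TensorField n k} {V : Fin k → Fin n → Coord n → ℝ} {x : Coord n}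
    (hT : ∀ K, DifferentiableAt ℝ (fun y => T y K) x) (hV : ∀ s a, DifferentiableAt ℝ (V s a) x)
    (i : Fin n) :
    pd i (fun y => ev (T y) (fun s a => V s a y)) x =
      ev (fun K => pd i (fun y => T y K) x) (fun s a => V s a x)
      + ∑ s, ev (T x) (Function.update (fun s a => V s a x) s (fun a => pd i (V s a) x)) := by
  have hp : ∀ K : Fin k → Fin n, DifferentiableAt ℝ (fun y => ∏ s, V s (K s) y) x := fun K =>
    (HasFDerivAt.finsetProd fun s _ => (hV s (K s)).hasFDerivAt).differentiableAt
  simp only [ev]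
  rw [pd_sum _ (fun K _ => (hT K).fun_mul (hp K)), Finset.sum_comm, ← Finset.sum_add_distrib]
  refine Finset.sum_congr rfl fun K _ => ?_
  rw [pd_mul (hT K) (hp K), pd_prod _ (fun s _ => hV s _), ← Finset.mul_sum]
  congr 2
  refine Finset.sum_congr rfl fun s _ => ?_
  rw [← Finset.mul_prod_erase Finset.univ _ (Finset.mem_univ s), Function.update_self, mul_comm]
  congr 1
  refine Finset.prod_congr rfl fun r hr => ?_
  rw [Function.update_of_ne (Finset.ne_of_mem_erase hr)]

namespace CoordChange

variable {φ : Coord n → Coord n} {Ω Ω' : Set (Coord n)}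

theorem smooth_pullTensor (hφ : CoordChange φ Ω Ω') {k : ℕ} {T : TensorField n k}
    (hT : SmoothTensor Ω' T) : SmoothTensor Ω (pullTensor φ T) := fun I =>
  ContDiffOn.sum fun K _ => (hφ.smooth_comp (hT K)).mul
    (contDiffOn_prod fun s _ => hφ.smooth_jac (K s) (I s))

/-- Tensoriality of `∇`. The Leibniz rule applied to the Jacobian factors gives one term with `∂J`
per slot, and these are exactly the inhomogeneous terms of `christoffel_pull`. -/
theorem covDeriv_pull (hφ : CoordChange φ Ω Ω') {G : MatField n} (hG : NondegOn Ω' G) {k : ℕ}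
    {T : TensorField n k} (hT : SmoothTensor Ω' T) {x : Coord n} (hx : x ∈ Ω) :
    covDeriv (pullMat φ G) (pullTensor φ T) x = pullTensor φ (covDeriv G T) x := by
  funext I
  obtain ⟨I, m, rfl⟩ : ∃ (I' : Fin k → Fin n) (m : Fin n), I = Fin.snoc I' m :=
    ⟨Fin.init I, I (Fin.last k), (Fin.snoc_init_self I).symm⟩
  simp only [covDeriv, Fin.snoc_last, Fin.snoc_castSucc]
  have hx' := hφ.mapsTo hx
  have h1 : pd m (fun y => pullTensor φ T y I) x = _ :=
    pd_ev (T := fun y => T (φ y)) (V := fun s a y => jac φ y a (I s)) (i := m)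
      (fun K => ContDiffOn.diffAt (hφ.smooth_comp (hT K)) hφ.isOpen hx)
      (fun s a => hφ.jac_diffAt hx a (I s))
  rw [h1]
  have h2 : ∀ s : Fin k, ∑ p, christoffel (pullMat φ G) p m (I s) x *
      pullTensor φ T x (Function.update I s p) =
      ev (T (φ x)) (Function.update (fun s a => jac φ x a (I s)) s
        (fun q => ∑ a, ∑ b, christoffel G q a b (φ x) * jac φ x a m * jac φ x b (I s)))
      + ev (T (φ x)) (Function.update (fun s a => jac φ x a (I s)) s
        (fun q => pd m (fun y => jac φ y q (I s)) x)) := by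
    intro s
    rw [← ev_update_add]
    simp only [← hφ.christoffel_pull hG hx]
    rw [ev_update_sum]
    refine Finset.sum_congr rfl fun p _ => ?_
    have := ev_update_smul (T (φ x)) (fun s a => jac φ x a (I s)) s
      (christoffel (pullMat φ G) p m (I s) x) (fun a => jac φ x a p)
    simp only [mul_comm _ (christoffel (pullMat φ G) p m (I s) x)]
    rw [this]
    congr 1
    unfold pullTensor
    congr 1
    funext r
    by_cases h : r = s
    · subst h; simp
    · simp [Function.update_of_ne h]
  rw [Finset.sum_congr rfl fun s _ => h2 s, Finset.sum_add_distrib, add_sub_add_right_eq_sub]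
  -- The sum over the slot of differentiation is split off, leaving multilinear forms in the first
  -- `k` slots.
  have h3 : pullTensor φ (covDeriv G T) x (Fin.snoc I m) =
      ∑ c, jac φ x c m * (ev (fun K => pd c (fun y => T y K) (φ x)) (fun s a => jac φ x a (I s))
        - ∑ s, ev (T (φ x)) (Function.update (fun s a => jac φ x a (I s)) s
          (fun q => ∑ b, christoffel G q c b (φ x) * jac φ x b (I s)))) := by
    unfold pullTensor
    conv_lhs => unfold ev
    rw [sum_fin_snoc]
    refine Finset.sum_congr rfl fun c _ => ?_
    simp only [← sum_update_mul_prod]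
    simp only [ev, covDeriv, Fin.prod_univ_castSucc, Fin.snoc_last, Fin.snoc_castSucc]
    rw [Finset.sum_comm (s := Finset.univ (α := Fin k)), ← Finset.sum_sub_distrib, Finset.mul_sum]
    refine Finset.sum_congr rfl fun K _ => ?_
    simp only [← Finset.sum_mul]
    ring
  rw [h3]
  simp only [mul_sub, Finset.sum_sub_distrib]
  congr 1
  · simp only [hφ.pd_comp hx (hT _), ev, Finset.sum_mul, Finset.mul_sum]
    rw [Finset.sum_comm]
    exact Finset.sum_congr rfl fun c _ => Finset.sum_congr rfl fun K _ => by ring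
  · simp only [Finset.mul_sum]
    rw [Finset.sum_comm]
    refine Finset.sum_congr rfl fun s _ => ?_
    simp only [← ev_update_smul, ← ev_update_sum]
    congr 2
    funext q
    refine Finset.sum_congr rfl fun a _ => ?_
    rw [Finset.mul_sum]
    exact Finset.sum_congr rfl fun b _ => by ring

end CoordChange

/-! ### Low ranks -/

theorem sum_fin_one_fun (f : (Fin 1 → Fin n) → ℝ) : ∑ K, f K = ∑ a, f ![a] := by
  rw [sum_fin_snoc]
  refine Finset.sum_congr rfl fun a _ => ?_
  rw [Fintype.sum_unique]
  congr 1; funext s; fin_cases s; rfl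

theorem sum_fin_two_fun (f : (Fin 2 → Fin n) → ℝ) : ∑ K, f K = ∑ a, ∑ b, f ![a, b] := by
  rw [sum_fin_snoc, Finset.sum_comm, sum_fin_one_fun]
  refine Finset.sum_congr rfl fun a _ => Finset.sum_congr rfl fun b _ => ?_
  congr 1; funext s; fin_cases s <;> rfl

theorem sum_fin_three_fun (f : (Fin 3 → Fin n) → ℝ) :
    ∑ K, f K = ∑ a, ∑ b, ∑ c, f ![a, b, c] := by
  rw [sum_fin_snoc, Finset.sum_comm, sum_fin_two_fun]
  refine Finset.sum_congr rfl fun a _ => Finset.sum_congr rfl fun b _ =>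
    Finset.sum_congr rfl fun c _ => ?_
  congr 1; funext s; fin_cases s <;> rfl

theorem sum_fin_four_fun (f : (Fin 4 → Fin n) → ℝ) :
    ∑ K, f K = ∑ a, ∑ b, ∑ c, ∑ d, f ![a, b, c, d] := by
  rw [sum_fin_snoc, Finset.sum_comm, sum_fin_three_fun]
  refine Finset.sum_congr rfl fun a _ => Finset.sum_congr rfl fun b _ =>
    Finset.sum_congr rfl fun c _ => Finset.sum_congr rfl fun d _ => ?_
  congr 1; funext s; fin_cases s <;> rfl

theorem covDeriv_one (G : MatField n) (T : TensorField n 1) (x : Coord n) (i k : Fin n) :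
    covDeriv G T x ![i, k] = pd k (fun y => T y ![i]) x
      - ∑ p, christoffel G p k i x * T x ![p] := by
  have e : (fun s : Fin 1 => (![i, k] : Fin 2 → Fin n) s.castSucc) = ![i] := by
    funext s; fin_cases s; rfl
  have u : ∀ p, Function.update ![i] 0 p = (![p] : Fin 1 → Fin n) := by
    intro p; funext s; fin_cases s; rfl
  simp only [covDeriv, e, Fin.sum_univ_one, u]
  rfl

theorem covDeriv_two (G : MatField n) (T : TensorField n 2) (x : Coord n) (i j k : Fin n) :
    covDeriv G T x ![i, j, k] = pd k (fun y => T y ![i, j]) x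
      - ((∑ p, christoffel G p k i x * T x ![p, j])
        + ∑ p, christoffel G p k j x * T x ![i, p]) := by
  have e : (fun s : Fin 2 => (![i, j, k] : Fin 3 → Fin n) s.castSucc) = ![i, j] := by
    funext s; fin_cases s <;> rfl
  have u : ∀ p, Function.update ![i, j] 0 p = (![p, j] : Fin 2 → Fin n) := by
    intro p; funext s; fin_cases s <;> rfl
  have u' : ∀ p, Function.update ![i, j] 1 p = (![i, p] : Fin 2 → Fin n) := by
    intro p; funext s; fin_cases s <;> rfl
  simp only [covDeriv, e, Fin.sum_univ_two, u, u']
  rfl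

theorem covDeriv_three (G : MatField n) (T : TensorField n 3) (x : Coord n) (i j k l : Fin n) :
    covDeriv G T x ![i, j, k, l] = pd l (fun y => T y ![i, j, k]) x
      - ((∑ p, christoffel G p l i x * T x ![p, j, k])
        + (∑ p, christoffel G p l j x * T x ![i, p, k])
        + ∑ p, christoffel G p l k x * T x ![i, j, p]) := by
  have e : (fun s : Fin 3 => (![i, j, k, l] : Fin 4 → Fin n) s.castSucc) = ![i, j, k] := by
    funext s; fin_cases s <;> rfl
  have u : ∀ p, Function.update ![i, j, k] 0 p = (![p, j, k] : Fin 3 → Fin n) := by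
    intro p; funext s; fin_cases s <;> rfl
  have u' : ∀ p, Function.update ![i, j, k] 1 p = (![i, p, k] : Fin 3 → Fin n) := by
    intro p; funext s; fin_cases s <;> rfl
  have u'' : ∀ p, Function.update ![i, j, k] 2 p = (![i, j, p] : Fin 3 → Fin n) := by
    intro p; funext s; fin_cases s <;> rfl
  simp only [covDeriv, e, Fin.sum_univ_three, u, u', u'']
  rfl

theorem covDeriv_four (G : MatField n) (T : TensorField n 4) (x : Coord n) (i j k l m : Fin n) :
    covDeriv G T x ![i, j, k, l, m] = pd m (fun y => T y ![i, j, k, l]) x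
      - ((∑ p, christoffel G p m i x * T x ![p, j, k, l])
        + (∑ p, christoffel G p m j x * T x ![i, p, k, l])
        + (∑ p, christoffel G p m k x * T x ![i, j, p, l])
        + ∑ p, christoffel G p m l x * T x ![i, j, k, p]) := by
  have e : (fun s : Fin 4 => (![i, j, k, l, m] : Fin 5 → Fin n) s.castSucc) = ![i, j, k, l] := by
    funext s; fin_cases s <;> rfl
  have u : ∀ p, Function.update ![i, j, k, l] 0 p = (![p, j, k, l] : Fin 4 → Fin n) := by
    intro p; funext s; fin_cases s <;> rfl
  have u' : ∀ p, Function.update ![i, j, k, l] 1 p = (![i, p, k, l] : Fin 4 → Fin n) := by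
    intro p; funext s; fin_cases s <;> rfl
  have u'' : ∀ p, Function.update ![i, j, k, l] 2 p = (![i, j, p, l] : Fin 4 → Fin n) := by
    intro p; funext s; fin_cases s <;> rfl
  have u3 : ∀ p, Function.update ![i, j, k, l] 3 p = (![i, j, k, p] : Fin 4 → Fin n) := by
    intro p; funext s; fin_cases s <;> rfl
  simp only [covDeriv, e, Fin.sum_univ_four, u, u', u'', u3]
  rfl

/-! ### Naturality of the curvature -/

/-- This recovers the curvature from iterated covariant derivatives, so that its naturality follows
from that of `∇` without differentiating `christoffel_pull`. -/
theorem ricci_identity_covector {Ω : Set (Coord n)} {G : MatField n} (hG : NondegOn Ω G)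
    {T : TensorField n 1} (hT : SmoothTensor Ω T) {x : Coord n} (hx : x ∈ Ω) (j k l : Fin n) :
    covDeriv G (covDeriv G T) x ![j, k, l] - covDeriv G (covDeriv G T) x ![j, l, k] =
      -∑ p, riemannUp G l k j p x * T x ![p] := by
  have hΓ : ∀ a b c, DifferentiableAt ℝ (christoffel G a b c) x := fun a b c =>
    ContDiffOn.diffAt (hG.christoffel_smooth a b c) hG.isOpen hx
  have hTd : ∀ a, DifferentiableAt ℝ (fun y => T y ![a]) x := fun a =>
    ContDiffOn.diffAt (hT _) hG.isOpen hx
  have hTd' : ∀ a b, DifferentiableAt ℝ (pd b (fun y => T y ![a])) x := fun a b =>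
    ContDiffOn.diffAt (ContDiffOn.pd (hT _) hG.isOpen _) hG.isOpen hx
  have e : ∀ k l, pd l (fun y => covDeriv G T y ![j, k]) x =
      pd l (pd k (fun y => T y ![j])) x - ∑ p, (pd l (christoffel G p k j) x * T x ![p]
        + christoffel G p k j x * pd l (fun y => T y ![p]) x) := by
    intro k l
    simp only [covDeriv_one]
    rw [pd_sub (hTd' _ _) (DifferentiableAt.fun_sum fun p _ => (hΓ _ _ _).fun_mul (hTd _)),
      pd_sum _ fun p _ => (hΓ _ _ _).fun_mul (hTd _)]
    congr 1
    exact Finset.sum_congr rfl fun p _ => pd_mul (hΓ _ _ _) (hTd _) l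
  rw [covDeriv_two, covDeriv_two, e, e, pd_comm (hT _) hG.isOpen hx l k]
  simp only [covDeriv_one, hG.christoffel_symm hx _ k l]
  simp only [riemannUp, mul_sub, add_mul, sub_mul, Finset.sum_add_distrib, Finset.sum_sub_distrib,
    Finset.mul_sum, Finset.sum_mul]
  have c1 : ∀ k l, (∑ p, ∑ q, christoffel G p l j x * (christoffel G q k p x * T x ![q]))
      = ∑ p, ∑ q, christoffel G q l j x * christoffel G p k q x * T x ![p] := by
    intro k l
    rw [Finset.sum_comm]
    exact Finset.sum_congr rfl fun p _ => Finset.sum_congr rfl fun q _ => by ring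
  rw [c1 k l, c1 l k]
  ring

theorem ev_two (t : (Fin 2 → Fin n) → ℝ) (v : Fin 2 → Fin n → ℝ) :
    ev t v = ∑ a, ∑ b, t ![a, b] * (v 0 a * v 1 b) := by
  simp [ev, sum_fin_two_fun, Fin.prod_univ_two]

theorem ev_three (t : (Fin 3 → Fin n) → ℝ) (v : Fin 3 → Fin n → ℝ) :
    ev t v = ∑ a, ∑ b, ∑ c, t ![a, b, c] * (v 0 a * v 1 b * v 2 c) := by
  simp [ev, sum_fin_three_fun, Fin.prod_univ_three]

theorem ev_four (t : (Fin 4 → Fin n) → ℝ) (v : Fin 4 → Fin n → ℝ) :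
    ev t v = ∑ a, ∑ b, ∑ c, ∑ d, t ![a, b, c, d] * (v 0 a * v 1 b * v 2 c * v 3 d) := by
  simp [ev, sum_fin_four_fun, Fin.prod_univ_four]

theorem sum_comm_six {ι : Type*} [Fintype ι] (F : ι → ι → ι → ι → ι → ι → ℝ) :
    ∑ i, ∑ l, ∑ a, ∑ b, ∑ c, ∑ d, F i l a b c d = ∑ b, ∑ c, ∑ a, ∑ d, ∑ i, ∑ l, F i l a b c d := by
  simp only [← Fintype.sum_prod_type']
  exact Fintype.sum_equiv
    (M := ℝ) (⟨fun z => (z.2.2.2.1, z.2.2.2.2.1, z.2.2.1, z.2.2.2.2.2, z.1, z.2.1),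
      fun z => (z.2.2.2.2.1, z.2.2.2.2.2, z.2.2.1, z.1, z.2.1, z.2.2.2.1), fun _ => rfl, fun _ => rfl⟩ :
      ι × ι × ι × ι × ι × ι ≃ ι × ι × ι × ι × ι × ι) _ _ fun _ => rfl

namespace CoordChange

variable {φ : Coord n → Coord n} {Ω Ω' : Set (Coord n)} {G : MatField n}

/-- The Ricci identity is used for the constant covector `dx^q` and for its pullback, whose
components are the row `q` of the Jacobian. Two applications of `covDeriv_pull` identify the two
left-hand sides. -/
theorem riemannUp_pull (hφ : CoordChange φ Ω Ω') (hG : NondegOn Ω' G) {x : Coord n} (hx : x ∈ Ω)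
    (i j k q : Fin n) :
    ∑ p, jac φ x q p * riemannUp (pullMat φ G) i j k p x =
      ∑ a, ∑ b, ∑ c, riemannUp G a b c q (φ x) * (jac φ x a i * jac φ x b j * jac φ x c k) := by
  set T : TensorField n 1 := fun _ I => if I 0 = q then 1 else 0 with hTdef
  have hT : SmoothTensor Ω' T := fun I => contDiffOn_const
  have hG' := hφ.nondegOn hG
  have h1 := ricci_identity_covector hG' (hφ.smooth_pullTensor hT) hx k j i
  have h2 : ∀ y ∈ Ω, covDeriv (pullMat φ G) (pullTensor φ T) y = pullTensor φ (covDeriv G T) y :=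
    fun y hy => hφ.covDeriv_pull hG hT hy
  have h3 := covDeriv_congr hφ.isOpen (G := pullMat φ G) (fun _ _ => rfl) h2 x hx
  rw [h3, hφ.covDeriv_pull hG (hT.covDeriv hG) hx] at h1
  have h4 : ∀ p, pullTensor φ T x ![p] = jac φ x q p := by
    intro p
    simp [pullTensor, ev, sum_fin_one_fun, hTdef]
  simp only [h4] at h1
  have h5 : ∑ p, jac φ x q p * riemannUp (pullMat φ G) i j k p x =
      -(pullTensor φ (covDeriv G (covDeriv G T)) x ![k, j, i]
        - pullTensor φ (covDeriv G (covDeriv G T)) x ![k, i, j]) := by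
    rw [h1, neg_neg]
    exact Finset.sum_congr rfl fun p _ => mul_comm _ _
  rw [h5]
  have h6 : pullTensor φ (covDeriv G (covDeriv G T)) x ![k, i, j] =
      ∑ a, ∑ b, ∑ c, covDeriv G (covDeriv G T) (φ x) ![c, a, b] *
        (jac φ x a i * jac φ x b j * jac φ x c k) := by
    simp only [pullTensor, ev_three]
    rw [Finset.sum_comm]
    refine Finset.sum_congr rfl fun a _ => ?_
    rw [Finset.sum_comm]
    exact Finset.sum_congr rfl fun b _ => Finset.sum_congr rfl fun c _ => by
      simp; left; ring
  have h7 : pullTensor φ (covDeriv G (covDeriv G T)) x ![k, j, i] =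
      ∑ a, ∑ b, ∑ c, covDeriv G (covDeriv G T) (φ x) ![c, b, a] *
        (jac φ x a i * jac φ x b j * jac φ x c k) := by
    simp only [pullTensor, ev_three]
    have : ∀ c, (∑ b, ∑ a, covDeriv G (covDeriv G T) (φ x) ![c, b, a] *
      (jac φ x c (![k, j, i] 0) * jac φ x b (![k, j, i] 1) * jac φ x a (![k, j, i] 2))) =
      ∑ a, ∑ b, covDeriv G (covDeriv G T) (φ x) ![c, b, a] *
      (jac φ x c (![k, j, i] 0) * jac φ x b (![k, j, i] 1) * jac φ x a (![k, j, i] 2)) :=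
        fun c => Finset.sum_comm
    simp only [this]
    rw [Finset.sum_comm]
    refine Finset.sum_congr rfl fun a _ => ?_
    rw [Finset.sum_comm]
    exact Finset.sum_congr rfl fun b _ => Finset.sum_congr rfl fun c _ => by
      simp; left; ring
  rw [h6, h7, ← Finset.sum_sub_distrib, ← Finset.sum_neg_distrib]
  simp only [← Finset.sum_sub_distrib, ← Finset.sum_neg_distrib, ← sub_mul, ← neg_mul]
  refine Finset.sum_congr rfl fun a _ => Finset.sum_congr rfl fun b _ =>
    Finset.sum_congr rfl fun c _ => ?_
  congr 1
  rw [ricci_identity_covector hG hT (hφ.mapsTo hx), neg_neg]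
  simp [hTdef]

theorem riemann_pull (hφ : CoordChange φ Ω Ω') (hG : NondegOn Ω' G) {x : Coord n} (hx : x ∈ Ω)
    (i j k l : Fin n) :
    riemann (pullMat φ G) i j k l x = ∑ a, ∑ b, ∑ c, ∑ d, riemann G a b c d (φ x) *
      (jac φ x a i * jac φ x b j * jac φ x c k * jac φ x d l) := by
  have h1 : riemann (pullMat φ G) i j k l x = ∑ q, ∑ d,
      (∑ p, jac φ x q p * riemannUp (pullMat φ G) i j k p x) * (G (φ x) q d * jac φ x d l) := by
    simp only [riemann, pullMat_apply, Finset.mul_sum, Finset.sum_mul]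
    rw [Finset.sum_comm]
    refine Finset.sum_congr rfl fun q _ => ?_
    rw [Finset.sum_comm]
    exact Finset.sum_congr rfl fun d _ => Finset.sum_congr rfl fun p _ => by ring
  rw [h1]
  simp only [hφ.riemannUp_pull hG hx, riemann, Finset.sum_mul]
  have c1 : ∀ F : Fin n → Fin n → Fin n → Fin n → Fin n → ℝ,
      ∑ q, ∑ d, ∑ a, ∑ b, ∑ c, F q d a b c = ∑ a, ∑ b, ∑ c, ∑ d, ∑ q, F q d a b c := by
    intro F
    simp only [← Fintype.sum_prod_type']
    exact Fintype.sum_equiv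
      (M := ℝ) (⟨fun z => (z.2.2.1, z.2.2.2.1, z.2.2.2.2, z.2.1, z.1),
      fun z => (z.2.2.2.2, z.2.2.2.1, z.1, z.2.1, z.2.2.1), fun _ => rfl, fun _ => rfl⟩ :
      Fin n × Fin n × Fin n × Fin n × Fin n ≃ Fin n × Fin n × Fin n × Fin n × Fin n) _ _ fun _ => rfl
  rw [c1]
  exact Finset.sum_congr rfl fun a _ => Finset.sum_congr rfl fun b _ =>
    Finset.sum_congr rfl fun c _ => Finset.sum_congr rfl fun d _ =>
    Finset.sum_congr rfl fun q _ => by ring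

/-- In this form the inverse Jacobian does not appear: a contraction by the pulled back inverse
metric absorbs the Jacobian factors of two covariant slots. -/
theorem inv_pull (hφ : CoordChange φ Ω Ω') (G : MatField n) {x : Coord n} (hx : x ∈ Ω) :
    jac φ x * (pullMat φ G x)⁻¹ * (jac φ x).transpose = (G (φ x))⁻¹ := by
  have hJ : IsUnit (jac φ x).det := isUnit_iff_ne_zero.2 (hφ.det x hx)
  have hJ' : IsUnit (jac φ x).transpose.det := by rwa [Matrix.det_transpose]
  rw [pullMat, Matrix.mul_inv_rev, Matrix.mul_inv_rev, ← Matrix.mul_assoc, ← Matrix.mul_assoc,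
    Matrix.mul_nonsing_inv _ hJ, Matrix.one_mul, Matrix.mul_assoc, Matrix.nonsing_inv_mul _ hJ',
    Matrix.mul_one]

theorem inv_pull_apply (hφ : CoordChange φ Ω Ω') (G : MatField n) {x : Coord n} (hx : x ∈ Ω)
    (a b : Fin n) :
    ∑ i, ∑ j, (pullMat φ G x)⁻¹ i j * (jac φ x a i * jac φ x b j) = (G (φ x))⁻¹ a b := by
  rw [← hφ.inv_pull G hx]
  simp only [Matrix.mul_apply, Matrix.transpose_apply, Finset.sum_mul]
  rw [Finset.sum_comm]
  exact Finset.sum_congr rfl fun a _ => Finset.sum_congr rfl fun b _ => by ring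

theorem ricci_pull (hφ : CoordChange φ Ω Ω') (hG : NondegOn Ω' G) {x : Coord n} (hx : x ∈ Ω)
    (j k : Fin n) :
    ricci (pullMat φ G) j k x =
      ∑ b, ∑ c, ricci G b c (φ x) * (jac φ x b j * jac φ x c k) := by
  simp only [ricci, hφ.riemann_pull hG hx, Finset.mul_sum, Finset.sum_mul,
    ← hφ.inv_pull_apply G hx]
  rw [sum_comm_six]
  exact Finset.sum_congr rfl fun _ _ => Finset.sum_congr rfl fun _ _ =>
    Finset.sum_congr rfl fun _ _ => Finset.sum_congr rfl fun _ _ =>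
    Finset.sum_congr rfl fun _ _ => Finset.sum_congr rfl fun _ _ => by ring

theorem trace_two_pull (hφ : CoordChange φ Ω Ω') (G : MatField n) {x : Coord n} (hx : x ∈ Ω)
    (B : Fin n → Fin n → ℝ) :
    ∑ j, ∑ k, (pullMat φ G x)⁻¹ j k * (∑ b, ∑ c, B b c * (jac φ x b j * jac φ x c k)) =
      ∑ b, ∑ c, (G (φ x))⁻¹ b c * B b c := by
  simp only [Finset.mul_sum, ← hφ.inv_pull_apply G hx, Finset.sum_mul]
  have c1 : ∀ F : Fin n → Fin n → Fin n → Fin n → ℝ,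
      ∑ j, ∑ k, ∑ b, ∑ c, F j k b c = ∑ b, ∑ c, ∑ j, ∑ k, F j k b c := by
    intro F
    simp only [← Fintype.sum_prod_type']
    exact Fintype.sum_equiv
      (M := ℝ) (⟨fun z => (z.2.2.1, z.2.2.2, z.1, z.2.1),
      fun z => (z.2.2.1, z.2.2.2, z.1, z.2.1), fun _ => rfl, fun _ => rfl⟩ :
      Fin n × Fin n × Fin n × Fin n ≃ Fin n × Fin n × Fin n × Fin n) _ _ fun _ => rfl
  rw [c1]
  exact Finset.sum_congr rfl fun _ _ => Finset.sum_congr rfl fun _ _ =>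
    Finset.sum_congr rfl fun _ _ => Finset.sum_congr rfl fun _ _ => by ring

theorem scalarCurv_pull (hφ : CoordChange φ Ω Ω') (hG : NondegOn Ω' G) {x : Coord n}
    (hx : x ∈ Ω) : scalarCurv (pullMat φ G) x = scalarCurv G (φ x) := by
  simp only [scalarCurv, hφ.ricci_pull hG hx]
  exact hφ.trace_two_pull G hx _

theorem schouten_pull (hφ : CoordChange φ Ω Ω') (hG : NondegOn Ω' G) {x : Coord n}
    (hx : x ∈ Ω) : schouten (pullMat φ G) x = pullMat φ (schouten G) x := by
  ext i j
  rw [pullMat_apply]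
  simp only [schouten, Matrix.of_apply, hφ.ricci_pull hG hx, hφ.scalarCurv_pull hG hx,
    pullMat_apply, Finset.mul_sum, ← Finset.sum_sub_distrib]
  exact Finset.sum_congr rfl fun _ _ => Finset.sum_congr rfl fun _ _ => by ring

end CoordChange

theorem kulkarniNomizu_conj (A B J : Matrix (Fin n) (Fin n) ℝ) (i j k l : Fin n) :
    kulkarniNomizu (J.transpose * A * J) (J.transpose * B * J) i j k l =
      ∑ a, ∑ b, ∑ c, ∑ d, kulkarniNomizu A B a b c d * (J a i * J b j * J c k * J d l) := by
  have e : ∀ (A : Matrix (Fin n) (Fin n) ℝ) i j, (J.transpose * A * J) i j =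
      ∑ a, ∑ b, A a b * (J a i * J b j) := by
    intro A i j
    simp only [Matrix.mul_apply, Matrix.transpose_apply, Finset.sum_mul]
    rw [Finset.sum_comm]
    exact Finset.sum_congr rfl fun _ _ => Finset.sum_congr rfl fun _ _ => by ring
  have p : ∀ A B : Matrix (Fin n) (Fin n) ℝ, ∀ i j k l,
      (J.transpose * A * J) i l * (J.transpose * B * J) j k =
      ∑ a, ∑ b, ∑ c, ∑ d, A a d * B b c * (J a i * J b j * J c k * J d l) := by
    intro A B i j k l
    rw [e, e]
    simp only [Finset.sum_mul]
    simp only [Finset.mul_sum]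
    refine Finset.sum_congr rfl fun a _ => ?_
    rw [Finset.sum_comm]
    refine Finset.sum_congr rfl fun b _ => ?_
    rw [Finset.sum_comm]
    exact Finset.sum_congr rfl fun _ _ => Finset.sum_congr rfl fun _ _ => by ring
  have p' : ∀ A B : Matrix (Fin n) (Fin n) ℝ, (J.transpose * A * J) i k *
      (J.transpose * B * J) j l =
      ∑ a, ∑ b, ∑ c, ∑ d, A a c * B b d * (J a i * J b j * J c k * J d l) := by
    intro A B
    rw [p A B i j l k]
    refine Finset.sum_congr rfl fun a _ => Finset.sum_congr rfl fun b _ => ?_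
    rw [Finset.sum_comm]
    exact Finset.sum_congr rfl fun _ _ => Finset.sum_congr rfl fun _ _ => by ring
  simp only [kulkarniNomizu]
  rw [p A B i j k l, mul_comm ((J.transpose * A * J) j k), p B A i j k l, p' A B,
    mul_comm ((J.transpose * A * J) j l), p' B A]
  simp only [← Finset.sum_add_distrib, ← Finset.sum_sub_distrib]
  exact Finset.sum_congr rfl fun _ _ => Finset.sum_congr rfl fun _ _ =>
    Finset.sum_congr rfl fun _ _ => Finset.sum_congr rfl fun _ _ => by ring

namespace CoordChange

variable {φ : Coord n → Coord n} {Ω Ω' : Set (Coord n)} {G : MatField n}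

theorem weyl_pull (hφ : CoordChange φ Ω Ω') (hG : NondegOn Ω' G) {x : Coord n}
    (hx : x ∈ Ω) : weyl (pullMat φ G) x = pullTensor φ (weyl G) x := by
  funext I
  simp only [weyl, hφ.riemann_pull hG hx, hφ.schouten_pull hG hx, pullTensor, ev_four]
  simp only [pullMat, kulkarniNomizu_conj, ← Finset.sum_sub_distrib, ← sub_mul]
  rfl

end CoordChange

/-! ### Naturality of tensorial operations -/

theorem prod_sum_fun {k : ℕ} (a : Fin k → Fin n → ℝ) :
    ∏ s, ∑ i, a s i = ∑ I : Fin k → Fin n, ∏ s, a s (I s) := by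
  rw [Finset.prod_univ_sum, Fintype.piFinset_univ]

/-- The action of a matrix on the components of a covariant tensor. -/
def act (J : Matrix (Fin n) (Fin n) ℝ) {k : ℕ} (t : (Fin k → Fin n) → ℝ) :
    (Fin k → Fin n) → ℝ := fun I => ev t (fun s a => J a (I s))

theorem act_act (A B : Matrix (Fin n) (Fin n) ℝ) {k : ℕ} (t : (Fin k → Fin n) → ℝ) :
    act B (act A t) = act (A * B) t := by
  funext I
  simp only [act, ev, Finset.sum_mul, Matrix.mul_apply, prod_sum_fun, Finset.mul_sum]
  rw [Finset.sum_comm]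
  refine Finset.sum_congr rfl fun K _ => Finset.sum_congr rfl fun L _ => ?_
  rw [mul_assoc, ← Finset.prod_mul_distrib]

theorem act_one {k : ℕ} (t : (Fin k → Fin n) → ℝ) : act 1 t = t := by
  funext I
  simp only [act, ev]
  rw [Finset.sum_eq_single I]
  · simp
  · intro K _ hK
    obtain ⟨s, hs⟩ := Function.ne_iff.1 hK
    exact mul_eq_zero_of_right _ (Finset.prod_eq_zero (Finset.mem_univ s) (Matrix.one_apply_ne hs))
  · simp

theorem pullTensor_eq_act (φ : Coord n → Coord n) {k : ℕ} (T : TensorField n k) (x : Coord n) :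
    pullTensor φ T x = act (jac φ x) (T (φ x)) := rfl

theorem asTensor_pull (φ : Coord n → Coord n) (H : MatField n) :
    asTensor (pullMat φ H) = pullTensor φ (asTensor H) := by
  funext x I
  simp only [asTensor, pullMat_apply, pullTensor, ev_two]
  exact Finset.sum_congr rfl fun _ _ => Finset.sum_congr rfl fun _ _ => by
    simp; ring

theorem SmoothMat.asTensor {Ω : Set (Coord n)} {H : MatField n} (hH : SmoothMat Ω H) :
    SmoothTensor Ω (asTensor H) := fun I => hH _ _

/-- Each pair of slots contributes `J G'⁻¹ Jᵀ`, the inverse metric at the other point. Only values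
at the two points enter, so any tensor with a known transformation law is covered. -/
theorem normSq_of_act {k : ℕ} {G G' : MatField n} {T T' : TensorField n k} {x x' : Coord n}
    (J : Matrix (Fin n) (Fin n) ℝ)
    (hG : ∀ a b, ∑ i, ∑ j, (G' x')⁻¹ i j * (J a i * J b j) = (G x)⁻¹ a b)
    (hT : T' x' = act J (T x)) : normSq G' T' x' = normSq G T x := by
  simp only [normSq, hT, act, ev, ← hG, prod_sum_fun]
  simp only [Finset.mul_sum, Finset.sum_mul, Finset.prod_mul_distrib]
  rw [show (∑ I : Fin k → Fin n, ∑ J' : Fin k → Fin n, ∑ L : Fin k → Fin n, ∑ K : Fin k → Fin n,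
      ((∏ s, (G' x')⁻¹ (I s) (J' s)) * (T x K * ∏ s, J (K s) (I s))) *
        (T x L * ∏ s, J (L s) (J' s))) =
      ∑ L : Fin k → Fin n, ∑ K : Fin k → Fin n, ∑ I : Fin k → Fin n, ∑ J' : Fin k → Fin n,
      ((∏ s, (G' x')⁻¹ (I s) (J' s)) * (T x K * ∏ s, J (K s) (I s))) *
        (T x L * ∏ s, J (L s) (J' s)) from ?_]
  · rw [Finset.sum_comm]
    exact Finset.sum_congr rfl fun _ _ => Finset.sum_congr rfl fun _ _ =>
      Finset.sum_congr rfl fun _ _ => Finset.sum_congr rfl fun _ _ => by ring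
  · simp only [← Fintype.sum_prod_type']
    exact Fintype.sum_equiv (M := ℝ)
      (⟨fun z => (z.2.2.1, z.2.2.2, z.1, z.2.1), fun z => (z.2.2.1, z.2.2.2, z.1, z.2.1),
        fun _ => rfl, fun _ => rfl⟩ : (Fin k → Fin n) × (Fin k → Fin n) × (Fin k → Fin n) ×
          (Fin k → Fin n) ≃ (Fin k → Fin n) × (Fin k → Fin n) × (Fin k → Fin n) ×
          (Fin k → Fin n)) _ _ fun _ => rfl

theorem sum_fin_cons {k : ℕ} (f : (Fin (k + 1) → Fin n) → ℝ) :
    ∑ K, f K = ∑ c, ∑ K : Fin k → Fin n, f (Fin.cons c K) := by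
  rw [← Finset.sum_product', Finset.univ_product_univ,
    ← (Fin.consEquiv (fun _ : Fin (k + 1) => Fin n)).sum_comp]
  rfl

/-- Every index occurs in exactly one factor, so the sum over multi-indices factors; indices are
peeled off two at a time. -/
theorem sum_prod_pairs (k : ℕ) (p : Fin k → Fin n → Fin n → ℝ) (q : Fin n → ℝ) :
    ∑ I : Fin (2 * k + 1) → Fin n,
      (∏ s : Fin k, p s (I ⟨2 * s, by omega⟩) (I ⟨2 * s + 1, by omega⟩)) * q (I (Fin.last (2 * k)))
      = (∏ s, ∑ a, ∑ b, p s a b) * ∑ m, q m := by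
  induction k with
  | zero =>
    simp only [Finset.univ_eq_empty, Finset.prod_empty, one_mul]
    exact sum_fin_one_fun (fun I => q (I (Fin.last 0)))
  | succ k ih =>
    rw [Fin.prod_univ_succ, mul_assoc, ← ih (fun s => p s.succ), Finset.sum_mul]
    refine (sum_fin_cons (k := 2 * k + 2) _).trans (Finset.sum_congr rfl fun a _ => ?_)
    rw [Finset.sum_mul]
    refine (sum_fin_cons (k := 2 * k + 1) _).trans (Finset.sum_congr rfl fun b _ => ?_)
    rw [Finset.mul_sum]
    refine Finset.sum_congr rfl fun I _ => ?_
    rw [Fin.prod_univ_succ, mul_assoc]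
    rfl

theorem prod_pairs (k : ℕ) (f : Fin (2 * k + 1) → ℝ) :
    ∏ t, f t = (∏ s : Fin k, f ⟨2 * s, by omega⟩ * f ⟨2 * s + 1, by omega⟩)
      * f (Fin.last (2 * k)) := by
  induction k with
  | zero => simp
  | succ k ih =>
    refine (Fin.prod_univ_succ (n := 2 * k + 2) f).trans ?_
    rw [Fin.prod_univ_succ, Fin.prod_univ_succ (n := k), mul_assoc, mul_assoc]
    rw [ih (fun t => f t.succ.succ)]
    rfl

/-- Reindexing by `σ` attaches one Jacobian to each index position. Positions `2s` and `2s + 1` are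
absorbed by the `s`-th inverse metric and the last one by the vector. -/
theorem contraction_of_act {k : ℕ} {G G' : MatField n} {T T' : TensorField n (2 * k + 1)}
    {x x' : Coord n} (J : Matrix (Fin n) (Fin n) ℝ)
    (hG : ∀ a b, ∑ i, ∑ j, (G' x')⁻¹ i j * (J a i * J b j) = (G x)⁻¹ a b)
    (hT : T' x' = act J (T x)) (ν : Fin n → ℝ) (σ : Equiv.Perm (Fin (2 * k + 1))) :
    contraction G' k T' ν σ x' = contraction G k T (J.mulVec ν) σ x := by
  have h1 : ∀ I : Fin (2 * k + 1) → Fin n, T' x' (fun s => I (σ s)) =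
      ∑ L : Fin (2 * k + 1) → Fin n, T x (fun s => L (σ s)) * ∏ s, J (L s) (I s) := by
    intro I
    rw [hT, act, ev, ← (Equiv.arrowCongr σ.symm (Equiv.refl (Fin n))).sum_comp]
    refine Finset.sum_congr rfl fun L _ => ?_
    congr 1
    exact Equiv.prod_comp σ (fun s => J (L s) (I s))
  simp only [contraction, h1, Finset.mul_sum]
  rw [Finset.sum_comm]
  refine Finset.sum_congr rfl fun L _ => ?_
  have h2 := sum_prod_pairs k (fun s a b => (G' x')⁻¹ a b *
    (J (L ⟨2 * s, by omega⟩) a * J (L ⟨2 * s + 1, by omega⟩) b))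
    (fun m => J (L (Fin.last (2 * k))) m * ν m)
  simp only [hG] at h2
  rw [Matrix.mulVec, dotProduct, ← h2, Finset.sum_mul]
  refine Finset.sum_congr rfl fun I _ => ?_
  rw [prod_pairs k (fun s => J (L s) (I s))]
  simp only [Finset.prod_mul_distrib]
  ring

/-- Linearity in `ν`: a full contraction is the value of a covector on `ν`. This is how boundary
integrands become fluxes. -/
theorem contraction_eq_sum (G : MatField n) (k : ℕ) (T : TensorField n (2 * k + 1))
    (ν : Fin n → ℝ) (σ : Equiv.Perm (Fin (2 * k + 1))) (x : Coord n) :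
    contraction G k T ν σ x = ∑ m, ν m * contraction G k T (Pi.single m 1) σ x := by
  simp only [contraction, Finset.mul_sum]
  rw [Finset.sum_comm]
  refine Finset.sum_congr rfl fun I _ => ?_
  rw [Finset.sum_eq_single (I (Fin.last (2 * k)))]
  · simp; ring
  · intro b _ hb
    simp [Pi.single_eq_of_ne hb.symm]
  · simp

theorem tensorProd_act {a b : ℕ} {S S' : TensorField n a} {T T' : TensorField n b}
    {x x' : Coord n} {J : Matrix (Fin n) (Fin n) ℝ} (hS : S' x' = act J (S x))
    (hT : T' x' = act J (T x)) : tensorProd S' T' x' = act J (tensorProd S T x) := by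
  funext I
  simp only [tensorProd, hS, hT, act, ev, Finset.sum_mul, Finset.mul_sum]
  rw [← (Fin.appendEquiv a b).sum_comp, Fintype.sum_prod_type]
  rw [Finset.sum_comm]
  refine Finset.sum_congr rfl fun K _ => Finset.sum_congr rfl fun L _ => ?_
  simp only [Fin.appendEquiv, Equiv.coe_fn_mk, Fin.prod_univ_add, Fin.append_left,
    Fin.append_right]
  ring

namespace CoordChange

variable {φ : Coord n → Coord n} {Ω Ω' : Set (Coord n)} {G H : MatField n}

theorem nabla_pull (hφ : CoordChange φ Ω Ω') (hG : NondegOn Ω' G) (hH : SmoothMat Ω' H)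
    {x : Coord n} (hx : x ∈ Ω) :
    nabla (pullMat φ G) (pullMat φ H) x = pullTensor φ (nabla G H) x := by
  simp only [nabla, asTensor_pull]
  exact hφ.covDeriv_pull hG hH.asTensor hx

theorem nabla2_pull (hφ : CoordChange φ Ω Ω') (hG : NondegOn Ω' G) (hH : SmoothMat Ω' H)
    {x : Coord n} (hx : x ∈ Ω) :
    nabla2 (pullMat φ G) (pullMat φ H) x = pullTensor φ (nabla2 G H) x := by
  unfold nabla2
  rw [covDeriv_congr hφ.isOpen (G := pullMat φ G) (fun _ _ => rfl)
    (fun y hy => hφ.nabla_pull hG hH hy) x hx]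
  exact hφ.covDeriv_pull hG (hH.asTensor.covDeriv hG) hx

theorem trace_pull (hφ : CoordChange φ Ω Ω') (G H : MatField n) {x : Coord n} (hx : x ∈ Ω) :
    trace (pullMat φ G) (pullMat φ H) x = trace G H (φ x) := by
  simp only [trace]
  refine Eq.trans ?_ (hφ.trace_two_pull G hx (fun a b => H (φ x) a b))
  refine Finset.sum_congr rfl fun i _ => Finset.sum_congr rfl fun j _ => ?_
  rw [pullMat_apply φ H]
  congr 1
  exact Finset.sum_congr rfl fun _ _ => Finset.sum_congr rfl fun _ _ => by ring

theorem divergence_pull (hφ : CoordChange φ Ω Ω') (hG : NondegOn Ω' G) (hH : SmoothMat Ω' H)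
    {x : Coord n} (hx : x ∈ Ω) (j : Fin n) :
    divergence (pullMat φ G) (pullMat φ H) j x = ∑ b, divergence G H b (φ x) * jac φ x b j := by
  simp only [divergence, hφ.nabla_pull hG hH hx, pullTensor, ev_three]
  have h1 : ∀ i k, (∑ a, ∑ b, ∑ c, nabla G H (φ x) ![a, b, c] *
      (jac φ x a (![i, j, k] 0) * jac φ x b (![i, j, k] 1) * jac φ x c (![i, j, k] 2))) =
      ∑ a, ∑ c, (∑ b, nabla G H (φ x) ![a, b, c] * jac φ x b j) *
        (jac φ x a i * jac φ x c k) := by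
    intro i k
    refine Finset.sum_congr rfl fun a _ => ?_
    rw [Finset.sum_comm]
    refine Finset.sum_congr rfl fun c _ => ?_
    rw [Finset.sum_mul]
    exact Finset.sum_congr rfl fun b _ => by simp; ring
  simp only [h1]
  rw [hφ.trace_two_pull G hx (fun a c => ∑ b, nabla G H (φ x) ![a, b, c] * jac φ x b j)]
  simp only [Finset.mul_sum, Finset.sum_mul]
  simp only [← Fintype.sum_prod_type']
  exact Fintype.sum_equiv (M := ℝ)
      (⟨fun z => (z.2.2, z.1, z.2.1), fun z => (z.2.1, z.2.2, z.1),
        fun _ => rfl, fun _ => rfl⟩ : Fin n × Fin n × Fin n ≃ Fin n × Fin n × Fin n)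
        _ _ fun _ => by simp; ring

theorem laplace_pull (hφ : CoordChange φ Ω Ω') (hG : NondegOn Ω' G) (hH : SmoothMat Ω' H)
    {x : Coord n} (hx : x ∈ Ω) :
    laplace (pullMat φ G) (pullMat φ H) x = pullTensor φ (laplace G H) x := by
  funext I
  simp only [laplace, hφ.nabla2_pull hG hH hx, pullTensor, ev_four]
  have h1 : ∀ k l, (∑ a, ∑ b, ∑ c, ∑ d, nabla2 G H (φ x) ![a, b, c, d] *
      (jac φ x a (![I 0, I 1, k, l] 0) * jac φ x b (![I 0, I 1, k, l] 1) *
        jac φ x c (![I 0, I 1, k, l] 2) * jac φ x d (![I 0, I 1, k, l] 3))) =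
      ∑ c, ∑ d, (∑ a, ∑ b, nabla2 G H (φ x) ![a, b, c, d] * (jac φ x a (I 0) * jac φ x b (I 1)))
        * (jac φ x c k * jac φ x d l) := by
    intro k l
    simp only [Finset.sum_mul]
    simp only [← Fintype.sum_prod_type']
    exact Fintype.sum_equiv (M := ℝ)
      (⟨fun z => (z.2.2.1, z.2.2.2, z.1, z.2.1), fun z => (z.2.2.1, z.2.2.2, z.1, z.2.1),
        fun _ => rfl, fun _ => rfl⟩ : Fin n × Fin n × Fin n × Fin n ≃ Fin n × Fin n × Fin n × Fin n)
        _ _ fun _ => by simp; ring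
  simp only [h1]
  rw [hφ.trace_two_pull G hx (fun c d => ∑ a, ∑ b, nabla2 G H (φ x) ![a, b, c, d] *
    (jac φ x a (I 0) * jac φ x b (I 1))), ev_two]
  simp only [laplace]
  simp only [Finset.mul_sum, Finset.sum_mul]
  simp only [← Fintype.sum_prod_type']
  exact Fintype.sum_equiv (M := ℝ)
      (⟨fun z => (z.2.2.1, z.2.2.2, z.1, z.2.1), fun z => (z.2.2.1, z.2.2.2, z.1, z.2.1),
        fun _ => rfl, fun _ => rfl⟩ : Fin n × Fin n × Fin n × Fin n ≃ Fin n × Fin n × Fin n × Fin n)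
        _ _ fun _ => by simp; ring

theorem constCurv_pull (hφ : CoordChange φ Ω Ω') (hG : NondegOn Ω' G) {x : Coord n} (hx : x ∈ Ω)
    {c : ℝ} (h : ∀ i j k l, riemann G i j k l (φ x) =
      c * (G (φ x) i l * G (φ x) j k - G (φ x) i k * G (φ x) j l)) (i j k l : Fin n) :
    riemann (pullMat φ G) i j k l x = c * (pullMat φ G x i l * pullMat φ G x j k
      - pullMat φ G x i k * pullMat φ G x j l) := by
  have e : ∀ (A : Matrix (Fin n) (Fin n) ℝ) (i j k l : Fin n),
      c * (A i l * A j k - A i k * A j l) = c / 2 * kulkarniNomizu A A i j k l := by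
    intro A i j k l; unfold kulkarniNomizu; ring
  rw [hφ.riemann_pull hG hx, e]
  simp only [h, e]
  rw [pullMat, kulkarniNomizu_conj]
  simp only [Finset.mul_sum, mul_assoc]

theorem eventually_det_ne (A B : Matrix (Fin n) (Fin n) ℝ) (hA : A.det ≠ 0) :
    ∀ᶠ t in 𝓝 (0 : ℝ), (A + t • B).det ≠ 0 := by
  have hc : Continuous fun t : ℝ => (A + t • B).det := by fun_prop
  have : (A + (0 : ℝ) • B).det ≠ 0 := by simpa using hA
  exact hc.continuousAt.eventually_ne this

/-- Naturality of `W` is applied to each metric `G + t H` and differentiated at `t = 0`.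
Differentiability in `t` is assumed only in the pulled back coordinates; the law is therefore solved
for the other side with the inverse Jacobian, which exhibits it as a finite combination of
differentiable functions. -/
theorem dWeyl_pull (hφ : CoordChange φ Ω Ω') (hG : NondegOn Ω' G) (hH : SmoothMat Ω' H)
    (hHs : ∀ y ∈ Ω', ∀ i j, H y i j = H y j i) {x : Coord n} (hx : x ∈ Ω)
    (hd : ∀ I, DifferentiableAt ℝ
      (fun t : ℝ => weyl (fun y => pullMat φ G y + t • pullMat φ H y) x I) 0) :
    dWeyl (pullMat φ G) (pullMat φ H) x = pullTensor φ (dWeyl G H) x := by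
  have hpull : ∀ t : ℝ, pullMat φ (fun y => G y + t • H y) =
      fun y => pullMat φ G y + t • pullMat φ H y := by
    intro t; funext y
    simp [pullMat, Matrix.mul_add, Matrix.add_mul]
  have hJ : IsUnit (jac φ x).det := isUnit_iff_ne_zero.2 (hφ.det x hx)
  have key : ∀ᶠ t in 𝓝 (0 : ℝ), weyl (fun y => G y + t • H y) (φ x) =
      act (jac φ x)⁻¹ (weyl (fun y => pullMat φ G y + t • pullMat φ H y) x) := by
    filter_upwards [eventually_det_ne (G (φ x)) (H (φ x)) (hG.det _ (hφ.mapsTo hx))] with t ht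
    set Gt : MatField n := fun y => G y + t • H y with hGt
    have hs : SmoothMat Ω' Gt := fun i j => (hG.smooth i j).add (contDiffOn_const.mul (hH i j))
    -- For small `t` the matrix `G + t H` is nondegenerate at `φ x`, but only on a neighbourhood
    -- depending on `t`, to which the coordinate change is restricted.
    set Ωt : Set (Coord n) := Ω' ∩ {y | (Gt y).det ≠ 0} with hΩt
    have ho : IsOpen Ωt := by
      have := (contDiffOn_det hs).continuousOn.isOpen_inter_preimage hG.isOpen
        (isOpen_compl_singleton (x := (0 : ℝ)))
      exact this
    have hN : NondegOn Ωt Gt :=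
      { isOpen := ho
        smooth := fun i j => (hs i j).mono inter_subset_left
        symm := fun y hy i j => by
          simp only [hGt, Matrix.add_apply, Matrix.smul_apply]
          rw [hG.symm y hy.1 i j, hHs y hy.1 i j]
        det := fun y hy => hy.2 }
    have hφt : CoordChange φ (Ω ∩ φ ⁻¹' Ωt) Ωt :=
      { isOpen := hφ.smooth'.continuousOn.isOpen_inter_preimage hφ.isOpen ho
        isOpen' := ho
        smooth := fun a => (hφ.smooth a).mono inter_subset_left
        mapsTo := fun y hy => hy.2
        det := fun y hy => hφ.det y hy.1 }
    have hxt : x ∈ Ω ∩ φ ⁻¹' Ωt := ⟨hx, hφ.mapsTo hx, ht⟩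
    rw [← hpull t, hφt.weyl_pull hN hxt, pullTensor_eq_act, act_act,
      Matrix.mul_nonsing_inv _ hJ, act_one]
  have key2 : dWeyl G H (φ x) = act (jac φ x)⁻¹ (dWeyl (pullMat φ G) (pullMat φ H) x) := by
    funext K
    have h1 : (fun t : ℝ => weyl (fun y => G y + t • H y) (φ x) K) =ᶠ[𝓝 0] fun t =>
        act (jac φ x)⁻¹ (weyl (fun y => pullMat φ G y + t • pullMat φ H y) x) K :=
      key.mono fun t ht => congrFun ht K
    rw [dWeyl, h1.deriv_eq]
    simp only [act, ev]
    rw [deriv_fun_sum fun I _ => (hd I).mul_const _]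
    refine Finset.sum_congr rfl fun I _ => ?_
    rw [deriv_mul_const (hd I)]
    rfl
  rw [pullTensor_eq_act, key2, act_act, Matrix.nonsing_inv_mul _ hJ, act_one]

end CoordChange

/-! ### Normal coordinates -/

-- Positivity yields a factorization `A = Cᵀ C`, and `C⁻¹` is the required change of basis.
open scoped MatrixOrder Matrix.Norms.L2Operator in
theorem exists_orthonormalizing {A : Matrix (Fin n) (Fin n) ℝ} (hA : A.PosDef) :
    ∃ B : Matrix (Fin n) (Fin n) ℝ, B.det ≠ 0 ∧ B.transpose * A * B = 1 := by
  obtain ⟨C, hC⟩ := CStarAlgebra.nonneg_iff_eq_star_mul_self.mp hA.posSemidef.nonneg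
  have hC' : A = C.transpose * C := by
    rw [hC, Matrix.star_eq_conjTranspose, Matrix.conjTranspose_eq_transpose_of_trivial]
  have hd : C.det ≠ 0 := by
    intro h0
    have := hA.det_pos
    rw [hC', Matrix.det_mul, h0, mul_zero] at this
    exact lt_irrefl _ this
  have hu : IsUnit C.det := isUnit_iff_ne_zero.2 hd
  refine ⟨C⁻¹, ?_, ?_⟩
  · exact (Matrix.isUnit_nonsing_inv_det C hu).ne_zero
  · rw [hC', Matrix.mul_assoc, Matrix.mul_assoc, Matrix.mul_nonsing_inv _ hu, Matrix.mul_one,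
      ← Matrix.transpose_mul, Matrix.mul_nonsing_inv _ hu, Matrix.transpose_one]

/-- At `x` the metric is the identity matrix and has vanishing first derivatives. -/
structure NormalAt (G : MatField n) (x : Coord n) : Prop where
  eq_one : G x = 1
  christoffel : ∀ p i j, christoffel G p i j x = 0
  pd : ∀ i j l, pd i (fun y => G y j l) x = 0

/-- Adding the lowered symbols with index patterns `(l; i, j)` and `(j; i, l)` leaves `∂_i g_{jl}`.
-/
theorem normalAt_of {Ω : Set (Coord n)} {G : MatField n} (hG : NondegOn Ω G) {x : Coord n}
    (hx : x ∈ Ω) (h1 : G x = 1) (hΓ : ∀ p i j, christoffel G p i j x = 0) : NormalAt G x := by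
  refine ⟨h1, hΓ, fun i j l => ?_⟩
  have a1 := hG.christoffel_lower hx l i j
  have a2 := hG.christoffel_lower hx j i l
  simp only [hΓ, mul_zero, Finset.sum_const_zero] at a1 a2
  rw [hG.pd_symm hx i l j] at a2
  linarith

theorem pd_coord (i a : Fin n) (x : Coord n) :
    pd i (fun y => y a) x = if a = i then 1 else 0 := by
  have : fderiv ℝ (fun y : Coord n => y a) x = (EuclideanSpace.proj a : Coord n →L[ℝ] ℝ) :=
    (EuclideanSpace.proj a : Coord n →L[ℝ] ℝ).fderiv
  rw [pd, this]
  simp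

/-- The quadratic map `z ↦ x + A z - B(z, z) / 2`. -/
def quadMap (x : Coord n) (A : Matrix (Fin n) (Fin n) ℝ) (B : Fin n → Fin n → Fin n → ℝ)
    (z : Coord n) : Coord n :=
  WithLp.toLp 2 fun q => x q + (∑ i, A q i * z i) - (1 / 2) * ∑ i, ∑ j, B q i j * (z i * z j)

/-- Only first-order normal coordinates are needed, so a quadratic polynomial replaces the
exponential map. Its linear part orthonormalizes the metric, and its quadratic part cancels the
Christoffel symbols through the inhomogeneous term of `christoffel_pull`. No inverse function is
involved, since a `CoordChange` need not be injective. -/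
theorem exists_normal {Ω : Set (Coord n)} {G : MatField n} (hG : NondegOn Ω G) {x : Coord n}
    (hx : x ∈ Ω) (hpos : (G x).PosDef) :
    ∃ (φ : Coord n → Coord n) (Ω' : Set (Coord n)), CoordChange φ Ω' Ω ∧ 0 ∈ Ω' ∧ φ 0 = x ∧
      NormalAt (pullMat φ G) 0 := by
  obtain ⟨A, hA, hA1⟩ := exists_orthonormalizing hpos
  set B : Fin n → Fin n → Fin n → ℝ := fun q i j =>
    ∑ a, ∑ b, christoffel G q a b x * A a i * A b j with hB
  have hBs : ∀ q i j, B q i j = B q j i := by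
    intro q i j
    simp only [hB]
    rw [Finset.sum_comm]
    refine Finset.sum_congr rfl fun a _ => Finset.sum_congr rfl fun b _ => ?_
    rw [hG.christoffel_symm hx]; ring
  set φ := quadMap x A B with hφ
  have hφa : ∀ q, (fun z => φ z q) = fun z : Coord n =>
      x q + (∑ i, A q i * z i) - (1 / 2) * ∑ i, ∑ j, B q i j * (z i * z j) := fun q => rfl
  have hci : ∀ i, ContDiff ℝ ∞ (fun z : Coord n => z i) := fun i =>
    (EuclideanSpace.proj i : Coord n →L[ℝ] ℝ).contDiff
  have hdi : ∀ i (y : Coord n), DifferentiableAt ℝ (fun z : Coord n => z i) y := fun i y =>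
    ((hci i).differentiable (by simp)) y
  have hsm : ∀ q, ContDiff ℝ ∞ (fun z => φ z q) := by
    intro q
    rw [hφa]
    exact (contDiff_const.add (ContDiff.sum fun i _ => contDiff_const.mul (hci i))).sub
      (contDiff_const.mul (ContDiff.sum fun i _ => ContDiff.sum fun j _ =>
        contDiff_const.mul ((hci i).mul (hci j))))
  have hjac : ∀ z q j, jac φ z q j = A q j - ∑ i, B q i j * z i := by
    intro z q j
    simp only [jac, Matrix.of_apply]
    rw [hφa, pd_sub, pd_add (differentiableAt_const _), pd_const, pd_const_mul, pd_sum, pd_sum]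
    · have e1 : ∀ i, pd j (fun y : Coord n => A q i * y i) z = if i = j then A q i else 0 := by
        intro i; rw [pd_const_mul (hdi _ _), pd_coord]; simp
      have e2 : ∀ i, pd j (fun y : Coord n => ∑ l, B q i l * (y i * y l)) z =
          (∑ l, if i = j then B q i l * z l else 0) + B q i j * z i := by
        intro i
        rw [pd_sum _ fun l _ => (differentiableAt_const _).fun_mul ((hdi _ _).fun_mul (hdi _ _))]
        have : ∀ l, pd j (fun y : Coord n => B q i l * (y i * y l)) z =
            (if i = j then B q i l * z l else 0) + (if l = j then B q i l * z i else 0) := by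
          intro l
          rw [pd_const_mul ((hdi _ _).fun_mul (hdi _ _)), pd_mul (hdi _ _) (hdi _ _), pd_coord,
            pd_coord]
          split_ifs <;> ring
        simp [this, Finset.sum_add_distrib]
      simp only [e1, e2, Finset.sum_add_distrib]
      rw [Finset.sum_comm]
      simp only [Finset.sum_ite_eq', Finset.mem_univ, if_true]
      rw [Finset.sum_congr rfl fun l _ => by rw [hBs q j l]]
      ring
    all_goals first
      | exact fun i _ => DifferentiableAt.fun_sum fun l _ =>
          (differentiableAt_const _).fun_mul ((hdi _ _).fun_mul (hdi _ _))
      | exact DifferentiableAt.fun_sum fun i _ => DifferentiableAt.fun_sum fun l _ =>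
          (differentiableAt_const _).fun_mul ((hdi _ _).fun_mul (hdi _ _))
      | exact fun i _ => (differentiableAt_const _).fun_mul (hdi _ _)
      | exact DifferentiableAt.fun_sum fun i _ => (differentiableAt_const _).fun_mul (hdi _ _)
      | exact (differentiableAt_const _).fun_add
          (DifferentiableAt.fun_sum fun i _ => (differentiableAt_const _).fun_mul (hdi _ _))
      | exact (differentiableAt_const _).fun_mul (DifferentiableAt.fun_sum fun i _ =>
          DifferentiableAt.fun_sum fun l _ =>
          (differentiableAt_const _).fun_mul ((hdi _ _).fun_mul (hdi _ _)))
  have hφ0 : φ 0 = x := by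
    ext q; simp [hφ, quadMap]
  have hj0 : jac φ 0 = A := by
    ext q j; rw [hjac]; simp
  have hcont : Continuous φ := (contDiff_euclidean.2 hsm).continuous
  have hjc : ∀ q j, Continuous fun z => jac φ z q j := by
    intro q j
    simp only [hjac]
    exact continuous_const.sub (continuous_finsetSum _ fun i _ =>
      continuous_const.mul (hci i).continuous)
  have hdc : Continuous fun z => (jac φ z).det := by
    have : Continuous fun z => jac φ z := continuous_matrix fun q j => hjc q j
    exact this.matrix_det
  set Ω' : Set (Coord n) := φ ⁻¹' Ω ∩ {z | (jac φ z).det ≠ 0} with hΩ'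
  have hC : CoordChange φ Ω' Ω :=
    { isOpen := (hG.isOpen.preimage hcont).inter (isOpen_compl_singleton.preimage hdc)
      isOpen' := hG.isOpen
      smooth := fun q => (hsm q).contDiffOn
      mapsTo := fun z hz => hz.1
      det := fun z hz => hz.2 }
  have h0 : (0 : Coord n) ∈ Ω' := by
    refine ⟨?_, ?_⟩
    · simpa [hφ0] using hx
    · simpa [hj0] using hA
  refine ⟨φ, Ω', hC, h0, hφ0, ?_⟩
  refine normalAt_of (hC.nondegOn hG) h0 ?_ fun p i j => ?_
  · rw [pullMat, hj0, hφ0, hA1]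
  -- At the centre the transformation law reads `A Γ' = B - B`.
  · have key : ∀ q, ∑ p, A q p * christoffel (pullMat φ G) p i j 0 = 0 := by
      intro q
      have := hC.christoffel_pull hG h0 q i j
      rw [hj0, hφ0] at this
      rw [this]
      have e : pd i (fun y => jac φ y q j) 0 = - B q i j := by
        simp only [hjac]
        rw [pd_sub (differentiableAt_const _)
          (DifferentiableAt.fun_sum fun i _ => (differentiableAt_const _).fun_mul (hdi _ _)),
          pd_const, pd_sum _ fun i _ => (differentiableAt_const _).fun_mul (hdi _ _)]
        have : ∀ a, pd i (fun y : Coord n => B q a j * y a) 0 = if a = i then B q a j else 0 := by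
          intro a; rw [pd_const_mul (hdi _ _), pd_coord]; simp
        simp [this]
      rw [e]; simp [hB]
    have hz : A.mulVec (fun p => christoffel (pullMat φ G) p i j 0) = 0 := by
      funext q; exact key q
    exact congrFun (Matrix.eq_zero_of_mulVec_eq_zero hA hz) p

/-! ### Derivatives of the inverse metric -/

namespace NondegOn

variable {Ω : Set (Coord n)} {G : MatField n}

theorem inv_diffAt (hG : NondegOn Ω G) {x : Coord n} (hx : x ∈ Ω) (i j : Fin n) :
    DifferentiableAt ℝ (fun y => (G y)⁻¹ i j) x :=
  ContDiffOn.diffAt (hG.inv_smooth i j) hG.isOpen hx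

theorem pd_inv (hG : NondegOn Ω G) {x : Coord n} (hx : x ∈ Ω) (c i j : Fin n) :
    pd c (fun y => (G y)⁻¹ i j) x =
      -∑ a, ∑ b, (G x)⁻¹ i a * pd c (fun y => G y a b) x * (G x)⁻¹ b j := by
  set D : Matrix (Fin n) (Fin n) ℝ := Matrix.of fun i j => pd c (fun y => (G y)⁻¹ i j) x with hD
  set D' : Matrix (Fin n) (Fin n) ℝ := Matrix.of fun i j => pd c (fun y => G y i j) x with hD'
  have h1 : D * G x + (G x)⁻¹ * D' = 0 := by
    ext i j
    have e : ∀ y ∈ Ω, ∑ k, (G y)⁻¹ i k * G y k j = (1 : Matrix (Fin n) (Fin n) ℝ) i j := by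
      intro y hy
      rw [← hG.inv_mul hy, Matrix.mul_apply]
    have e2 := pd_congr_on hG.isOpen e hx c
    rw [pd_const, pd_sum _ fun k _ => (hG.inv_diffAt hx i k).fun_mul (hG.diffAt hx k j)] at e2
    rw [Finset.sum_congr rfl fun k _ => pd_mul (hG.inv_diffAt hx i k) (hG.diffAt hx k j) c,
      Finset.sum_add_distrib] at e2
    simpa [Matrix.mul_apply, hD, hD'] using e2
  have h2 : D = -((G x)⁻¹ * D' * (G x)⁻¹) := by
    have := congrArg (· * (G x)⁻¹) h1
    simp only [Matrix.add_mul, Matrix.mul_assoc, hG.mul_inv hx, Matrix.mul_one,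
      Matrix.zero_mul] at this
    rw [Matrix.mul_assoc]
    exact eq_neg_of_add_eq_zero_left this
  have h3 := congrFun (congrFun h2 i) j
  simp only [hD, Matrix.of_apply, Matrix.neg_apply, Matrix.mul_apply, Finset.sum_mul] at h3
  rw [h3, Finset.sum_comm]
  rfl

theorem pd_eq_christoffel (hG : NondegOn Ω G) {x : Coord n} (hx : x ∈ Ω) (c a b : Fin n) :
    pd c (fun y => G y a b) x = (∑ p, G x a p * christoffel G p c b x)
      + ∑ p, G x b p * christoffel G p c a x := by
  rw [hG.christoffel_lower hx, hG.christoffel_lower hx, hG.pd_symm hx c b a,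
    hG.pd_symm hx b c a, hG.pd_symm hx a c b]
  ring

/-- This is `∇ g⁻¹ = 0` in components. -/
theorem pd_inv' (hG : NondegOn Ω G) {x : Coord n} (hx : x ∈ Ω) (c i j : Fin n) :
    pd c (fun y => (G y)⁻¹ i j) x =
      -((∑ p, christoffel G i c p x * (G x)⁻¹ p j) + ∑ p, christoffel G j c p x * (G x)⁻¹ i p) := by
  set Γ : Matrix (Fin n) (Fin n) ℝ := Matrix.of fun p b => christoffel G p c b x with hΓ
  have h : (Matrix.of fun a b => pd c (fun y => G y a b) x) = G x * Γ + (G x * Γ).transpose := by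
    ext a b
    simp only [Matrix.of_apply, Matrix.add_apply, Matrix.mul_apply, Matrix.transpose_apply, hΓ]
    exact hG.pd_eq_christoffel hx c a b
  have h2 : (G x)⁻¹ * (Matrix.of fun a b => pd c (fun y => G y a b) x) * (G x)⁻¹ =
      Γ * (G x)⁻¹ + (G x)⁻¹ * Γ.transpose := by
    rw [h, Matrix.mul_add, Matrix.add_mul, ← Matrix.mul_assoc, hG.inv_mul hx, Matrix.one_mul,
      Matrix.transpose_mul, hG.isSymm hx, Matrix.mul_assoc, Matrix.mul_assoc, hG.mul_inv hx,
      Matrix.mul_one]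
  have h3 := congrFun (congrFun h2 i) j
  rw [hG.pd_inv hx]
  congr 1
  simp only [Matrix.mul_apply, Matrix.add_apply, Matrix.of_apply, Matrix.transpose_apply, hΓ,
    Finset.sum_mul] at h3
  rw [Finset.sum_comm, h3]
  congr 1
  exact Finset.sum_congr rfl fun p _ => mul_comm _ _

/-- Contraction commutes with `∇` because `∇ g⁻¹ = 0`. The family `F` shows only the two contracted
indices; other slots of a tensor are frozen, and their Christoffel terms are treated where the lemma
is used. -/
theorem trace_covDeriv (hG : NondegOn Ω G) {F : Fin n → Fin n → Coord n → ℝ}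
    (hF : ∀ i j, ContDiffOn ℝ ∞ (F i j) Ω) {x : Coord n} (hx : x ∈ Ω) (k : Fin n) :
    ∑ i, ∑ j, (G x)⁻¹ i j * (pd k (F i j) x - ((∑ p, christoffel G p k i x * F p j x)
      + ∑ p, christoffel G p k j x * F i p x)) =
      pd k (fun y => ∑ i, ∑ j, (G y)⁻¹ i j * F i j y) x := by
  have hFd : ∀ i j, DifferentiableAt ℝ (F i j) x := fun i j =>
    ContDiffOn.diffAt (hF i j) hG.isOpen hx
  rw [pd_sum _ fun i _ => DifferentiableAt.fun_sum fun j _ =>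
    (hG.inv_diffAt hx i j).fun_mul (hFd i j)]
  have e : ∀ i, pd k (fun y => ∑ j, (G y)⁻¹ i j * F i j y) x = ∑ j, ((G x)⁻¹ i j * pd k (F i j) x
    - ((∑ p, christoffel G i k p x * (G x)⁻¹ p j) + ∑ p, christoffel G j k p x * (G x)⁻¹ i p)
      * F i j x) := by
    intro i
    rw [pd_sum _ fun j _ => (hG.inv_diffAt hx i j).fun_mul (hFd i j)]
    refine Finset.sum_congr rfl fun j _ => ?_
    rw [pd_mul (hG.inv_diffAt hx i j) (hFd i j), hG.pd_inv' hx]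
    ring
  simp only [e, mul_sub, mul_add, add_mul, Finset.sum_sub_distrib, Finset.sum_add_distrib,
    Finset.mul_sum, Finset.sum_mul]
  congr 2
  · simp only [← Fintype.sum_prod_type']
    exact Fintype.sum_equiv (M := ℝ)
      (⟨fun z => (z.2.2, z.2.1, z.1), fun z => (z.2.2, z.2.1, z.1),
        fun _ => rfl, fun _ => rfl⟩ : Fin n × Fin n × Fin n ≃ Fin n × Fin n × Fin n)
        _ _ fun _ => by simp; ring
  · simp only [← Fintype.sum_prod_type']
    exact Fintype.sum_equiv (M := ℝ)
      (⟨fun z => (z.1, z.2.2, z.2.1), fun z => (z.1, z.2.2, z.2.1),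
        fun _ => rfl, fun _ => rfl⟩ : Fin n × Fin n × Fin n ≃ Fin n × Fin n × Fin n)
        _ _ fun _ => by simp; ring

theorem riemannUp_of_const (hG : NondegOn Ω G) {x : Coord n} (hx : x ∈ Ω) {c : ℝ}
    (h : ∀ i j k l, riemann G i j k l x = c * (G x i l * G x j k - G x i k * G x j l))
    (i j k p : Fin n) :
    riemannUp G i j k p x = c * ((1 : Matrix (Fin n) (Fin n) ℝ) i p * G x j k
      - G x i k * (1 : Matrix (Fin n) (Fin n) ℝ) j p) := by
  set r : Fin n → ℝ := fun p => riemannUp G i j k p x with hr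
  have h1 : Matrix.vecMul r (G x) = fun l => c * (G x i l * G x j k - G x i k * G x j l) := by
    funext l; exact h i j k l
  have h2 : r = Matrix.vecMul (fun l => c * (G x i l * G x j k - G x i k * G x j l)) (G x)⁻¹ := by
    rw [← h1, Matrix.vecMul_vecMul, hG.mul_inv hx, Matrix.vecMul_one]
  have h3 := congrFun h2 p
  change riemannUp G i j k p x = _ at h3
  rw [h3, ← hG.mul_inv hx]
  simp only [Matrix.vecMul, dotProduct, Matrix.mul_apply, Finset.sum_mul, Finset.mul_sum,
    ← Finset.sum_sub_distrib]
  exact Finset.sum_congr rfl fun l _ => by ring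

end NondegOn

theorem ricci_identity_two {Ω : Set (Coord n)} {G : MatField n} (hG : NondegOn Ω G)
    {T : TensorField n 2} (hT : SmoothTensor Ω T) {x : Coord n} (hx : x ∈ Ω) (i j k l : Fin n) :
    covDeriv G (covDeriv G T) x ![i, j, k, l] - covDeriv G (covDeriv G T) x ![i, j, l, k] =
      -((∑ p, riemannUp G l k i p x * T x ![p, j]) + ∑ p, riemannUp G l k j p x * T x ![i, p]) := by
  have hΓ : ∀ a b c, DifferentiableAt ℝ (christoffel G a b c) x := fun a b c =>
    ContDiffOn.diffAt (hG.christoffel_smooth a b c) hG.isOpen hx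
  have hTd : ∀ a b, DifferentiableAt ℝ (fun y => T y ![a, b]) x := fun a b =>
    ContDiffOn.diffAt (hT _) hG.isOpen hx
  have hTd' : ∀ a b c, DifferentiableAt ℝ (pd c (fun y => T y ![a, b])) x := fun a b c =>
    ContDiffOn.diffAt (ContDiffOn.pd (hT _) hG.isOpen _) hG.isOpen hx
  have e : ∀ k l, pd l (fun y => covDeriv G T y ![i, j, k]) x =
      pd l (pd k (fun y => T y ![i, j])) x - ((∑ p, (pd l (christoffel G p k i) x * T x ![p, j]
        + christoffel G p k i x * pd l (fun y => T y ![p, j]) x))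
        + ∑ p, (pd l (christoffel G p k j) x * T x ![i, p]
        + christoffel G p k j x * pd l (fun y => T y ![i, p]) x)) := by
    intro k l
    simp only [covDeriv_two]
    rw [pd_sub (hTd' _ _ _) ((DifferentiableAt.fun_sum fun p _ => (hΓ _ _ _).fun_mul (hTd _ _)).fun_add
        (DifferentiableAt.fun_sum fun p _ => (hΓ _ _ _).fun_mul (hTd _ _))),
      pd_add (DifferentiableAt.fun_sum fun p _ => (hΓ _ _ _).fun_mul (hTd _ _))
        (DifferentiableAt.fun_sum fun p _ => (hΓ _ _ _).fun_mul (hTd _ _)),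
      pd_sum _ fun p _ => (hΓ _ _ _).fun_mul (hTd _ _),
      pd_sum _ fun p _ => (hΓ _ _ _).fun_mul (hTd _ _)]
    congr 2
    · exact Finset.sum_congr rfl fun p _ => pd_mul (hΓ _ _ _) (hTd _ _) l
    · exact Finset.sum_congr rfl fun p _ => pd_mul (hΓ _ _ _) (hTd _ _) l
  rw [covDeriv_three, covDeriv_three, e, e, pd_comm (hT _) hG.isOpen hx l k]
  simp only [covDeriv_two, hG.christoffel_symm hx _ k l]
  simp only [riemannUp, mul_sub, mul_add, add_mul, sub_mul, Finset.sum_add_distrib,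
    Finset.sum_sub_distrib, Finset.mul_sum, Finset.sum_mul]
  have c1 : ∀ k l, (∑ p, ∑ q, christoffel G p l i x * (christoffel G q k p x * T x ![q, j]))
      = ∑ p, ∑ q, christoffel G q l i x * christoffel G p k q x * T x ![p, j] := by
    intro k l
    rw [Finset.sum_comm]
    exact Finset.sum_congr rfl fun p _ => Finset.sum_congr rfl fun q _ => by ring
  have c2 : ∀ k l, (∑ p, ∑ q, christoffel G p l j x * (christoffel G q k p x * T x ![i, q]))
      = ∑ p, ∑ q, christoffel G q l j x * christoffel G p k q x * T x ![i, p] := by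
    intro k l
    rw [Finset.sum_comm]
    exact Finset.sum_congr rfl fun p _ => Finset.sum_congr rfl fun q _ => by ring
  have c3 : ∀ k l, (∑ p, ∑ q, christoffel G p l j x * (christoffel G q k i x * T x ![q, p]))
      = ∑ p, ∑ q, christoffel G p k i x * (christoffel G q l j x * T x ![p, q]) := by
    intro k l
    rw [Finset.sum_comm]
    exact Finset.sum_congr rfl fun p _ => Finset.sum_congr rfl fun q _ => by ring
  rw [c1 k l, c1 l k, c2 k l, c2 l k, c3 k l, c3 l k]
  ring

/-- In rank three the identity is needed only at a normal point, where products of Christoffel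
symbols vanish and just their first derivatives survive. -/
theorem ricci_identity_three_normal {Ω : Set (Coord n)} {G : MatField n} (hG : NondegOn Ω G)
    {T : TensorField n 3} (hT : SmoothTensor Ω T) {x : Coord n} (hx : x ∈ Ω) (hN : NormalAt G x)
    (i j k l m : Fin n) :
    covDeriv G (covDeriv G T) x ![i, j, k, l, m] - covDeriv G (covDeriv G T) x ![i, j, k, m, l] =
      -((∑ p, riemannUp G m l i p x * T x ![p, j, k])
        + (∑ p, riemannUp G m l j p x * T x ![i, p, k])
        + ∑ p, riemannUp G m l k p x * T x ![i, j, p]) := by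
  have hΓ : ∀ a b c, DifferentiableAt ℝ (christoffel G a b c) x := fun a b c =>
    ContDiffOn.diffAt (hG.christoffel_smooth a b c) hG.isOpen hx
  have hTd : ∀ a b c, DifferentiableAt ℝ (fun y => T y ![a, b, c]) x := fun a b c =>
    ContDiffOn.diffAt (hT _) hG.isOpen hx
  have hTd' : ∀ a b c d, DifferentiableAt ℝ (pd d (fun y => T y ![a, b, c])) x := fun a b c d =>
    ContDiffOn.diffAt (ContDiffOn.pd (hT _) hG.isOpen _) hG.isOpen hx
  have hs : ∀ (a b : Fin n) (I : Fin n → Fin 3 → Fin n), DifferentiableAt ℝ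
      (fun y => ∑ p, christoffel G p a b y * T y (I p)) x := fun a b I =>
    DifferentiableAt.fun_sum fun p _ => (hΓ _ _ _).fun_mul
      (ContDiffOn.diffAt (hT _) hG.isOpen hx)
  have es : ∀ (a b d : Fin n) (I : Fin n → Fin 3 → Fin n),
      pd d (fun y => ∑ p, christoffel G p a b y * T y (I p)) x =
      ∑ p, pd d (christoffel G p a b) x * T x (I p) := by
    intro a b d I
    rw [pd_sum _ fun p _ => (hΓ _ _ _).fun_mul (ContDiffOn.diffAt (hT _) hG.isOpen hx)]
    refine Finset.sum_congr rfl fun p _ => ?_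
    rw [pd_mul (hΓ _ _ _) (ContDiffOn.diffAt (hT _) hG.isOpen hx), hN.christoffel]
    ring
  have e : ∀ l m, covDeriv G (covDeriv G T) x ![i, j, k, l, m] =
      pd m (pd l (fun y => T y ![i, j, k])) x - ((∑ p, pd m (christoffel G p l i) x * T x ![p, j, k])
        + (∑ p, pd m (christoffel G p l j) x * T x ![i, p, k])
        + (∑ p, pd m (christoffel G p l k) x * T x ![i, j, p])) := by
    intro l m
    rw [covDeriv_four]
    simp only [covDeriv_three, hN.christoffel, zero_mul, Finset.sum_const_zero, add_zero, sub_zero]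
    rw [pd_sub (hTd' _ _ _ _) (((hs _ _ _).fun_add (hs _ _ _)).fun_add (hs _ _ _)),
      pd_add ((hs _ _ _).fun_add (hs _ _ _)) (hs _ _ _), pd_add (hs _ _ _) (hs _ _ _), es, es, es]
  rw [e, e, pd_comm (hT _) hG.isOpen hx l m]
  simp only [riemannUp, hN.christoffel, mul_zero, sub_zero, Finset.sum_const_zero, add_zero,
    sub_mul, Finset.sum_sub_distrib]
  ring

/-! ### Transverse-traceless tensors on space forms, in coordinates -/

/-- In coordinates on `Ω`: `G` is a metric of constant curvature `c` and `H` is symmetric and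
transverse-traceless. -/
structure SpaceFormTT (Ω : Set (Coord n)) (c : ℝ) (G H : MatField n) : Prop where
  nondeg : NondegOn Ω G
  pos : ∀ y ∈ Ω, (G y).PosDef
  smooth : SmoothMat Ω H
  symm : ∀ y ∈ Ω, ∀ i j, H y i j = H y j i
  curv : ∀ y ∈ Ω, ∀ i j k l, riemann G i j k l y = c * (G y i l * G y j k - G y i k * G y j l)
  trace : ∀ y ∈ Ω, trace G H y = 0
  div : ∀ y ∈ Ω, ∀ j, divergence G H j y = 0

/-- All the conditions are tensorial, so the whole situation can be transported to normal
coordinates. -/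
theorem SpaceFormTT.pull {φ : Coord n → Coord n} {Ω Ω' : Set (Coord n)} {c : ℝ} {G H : MatField n}
    (hφ : CoordChange φ Ω Ω') (h : SpaceFormTT Ω' c G H) :
    SpaceFormTT Ω c (pullMat φ G) (pullMat φ H) where
  nondeg := hφ.nondegOn h.nondeg
  pos y hy := by
    have := (h.pos _ (hφ.mapsTo hy)).conjTranspose_mul_mul_same (B := jac φ y)
      (Matrix.mulVec_injective_of_isUnit ((Matrix.isUnit_iff_isUnit_det _).2
        (isUnit_iff_ne_zero.2 (hφ.det y hy))))
    rwa [Matrix.conjTranspose_eq_transpose_of_trivial] at this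
  smooth := hφ.smooth_pullMat h.smooth
  symm y hy i j := by
    rw [pullMat_apply, pullMat_apply, Finset.sum_comm]
    exact Finset.sum_congr rfl fun a _ => Finset.sum_congr rfl fun b _ => by
      rw [h.symm _ (hφ.mapsTo hy)]; ring
  curv y hy := hφ.constCurv_pull h.nondeg hy (h.curv _ (hφ.mapsTo hy))
  trace y hy := by rw [hφ.trace_pull G H hy, h.trace _ (hφ.mapsTo hy)]
  div y hy j := by
    rw [hφ.divergence_pull h.nondeg h.smooth hy]
    simp [h.div _ (hφ.mapsTo hy)]

/-- The algebraic relations, in an orthonormal frame, between the components of a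
transverse-traceless tensor on a space form and those of its first three covariant derivatives. -/
structure SpaceFormJet (c : ℝ) (h : Fin n → Fin n → ℝ) (a : Fin n → Fin n → Fin n → ℝ)
    (b : Fin n → Fin n → Fin n → Fin n → ℝ) (t : Fin n → Fin n → Fin n → Fin n → Fin n → ℝ) :
    Prop where
  h_symm : ∀ i j, h i j = h j i
  a_symm : ∀ i j k, a i j k = a j i k
  b_symm : ∀ i j k l, b i j k l = b j i k l
  h_trace : ∑ i, h i i = 0
  a_trace : ∀ k, ∑ i, a i i k = 0
  b_trace : ∀ k l, ∑ i, b i i k l = 0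
  a_div : ∀ j, ∑ i, a i j i = 0
  b_div : ∀ j k, ∑ i, b i j i k = 0
  t_div : ∀ j k l, ∑ i, t i j i k l = 0
  b_comm : ∀ i j k l, b i j k l - b i j l k =
    -(c * ((1 : Matrix (Fin n) (Fin n) ℝ) k i * h l j - (1 : Matrix (Fin n) (Fin n) ℝ) l i * h k j
      + (1 : Matrix (Fin n) (Fin n) ℝ) k j * h i l - (1 : Matrix (Fin n) (Fin n) ℝ) l j * h i k))
  t_comm : ∀ i j k l m, t i j k l m - t i j l k m =
    -(c * ((1 : Matrix (Fin n) (Fin n) ℝ) k i * a l j m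
      - (1 : Matrix (Fin n) (Fin n) ℝ) l i * a k j m
      + (1 : Matrix (Fin n) (Fin n) ℝ) k j * a i l m
      - (1 : Matrix (Fin n) (Fin n) ℝ) l j * a i k m))
  t_comm' : ∀ i j k l m, t i j k l m - t i j k m l =
    -(c * ((1 : Matrix (Fin n) (Fin n) ℝ) l i * a m j k
      - (1 : Matrix (Fin n) (Fin n) ℝ) m i * a l j k
      + (1 : Matrix (Fin n) (Fin n) ℝ) l j * a i m k
      - (1 : Matrix (Fin n) (Fin n) ℝ) m j * a i l k
      + (1 : Matrix (Fin n) (Fin n) ℝ) l k * a i j m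
      - (1 : Matrix (Fin n) (Fin n) ℝ) m k * a i j l))

/-! ### Symmetry, trace, divergence and commutation relations for `∇h` and `∇²h`. -/

namespace SpaceFormTT

variable {Ω : Set (Coord n)} {c : ℝ} {G H : MatField n}

theorem smooth_nabla (h : SpaceFormTT Ω c G H) : SmoothTensor Ω (nabla G H) :=
  h.smooth.asTensor.covDeriv h.nondeg

theorem smooth_nabla2 (h : SpaceFormTT Ω c G H) : SmoothTensor Ω (nabla2 G H) :=
  h.smooth_nabla.covDeriv h.nondeg

theorem nabla_symm (h : SpaceFormTT Ω c G H) {x : Coord n} (hx : x ∈ Ω) (i j k : Fin n) :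
    nabla G H x ![i, j, k] = nabla G H x ![j, i, k] := by
  have e : ∀ y ∈ Ω, ∀ a b, asTensor H y ![a, b] = asTensor H y ![b, a] := fun y hy a b =>
    h.symm y hy a b
  unfold nabla
  rw [covDeriv_two, covDeriv_two, pd_congr_on h.nondeg.isOpen (fun y hy => e y hy i j) hx,
    add_comm (∑ p, _)]
  simp only [e x hx i, e x hx _ j]

theorem nabla2_symm (h : SpaceFormTT Ω c G H) {x : Coord n} (hx : x ∈ Ω) (i j k l : Fin n) :
    nabla2 G H x ![i, j, k, l] = nabla2 G H x ![j, i, k, l] := by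
  unfold nabla2
  rw [covDeriv_three, covDeriv_three,
    pd_congr_on h.nondeg.isOpen (fun y hy => h.nabla_symm hy i j k) hx]
  simp only [h.nabla_symm hx i, h.nabla_symm hx _ j]
  ring

theorem nabla_trace (h : SpaceFormTT Ω c G H) {x : Coord n} (hx : x ∈ Ω) (k : Fin n) :
    ∑ i, ∑ j, (G x)⁻¹ i j * nabla G H x ![i, j, k] = 0 := by
  have := h.nondeg.trace_covDeriv (F := fun i j y => H y i j) h.smooth hx k
  simp only [nabla, covDeriv_two]
  refine this.trans ?_
  have e := pd_congr_on (f := fun y => ∑ i, ∑ j, (G y)⁻¹ i j * H y i j) (g := fun _ => 0)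
    h.nondeg.isOpen (fun y hy => h.trace y hy) hx k
  rw [e, pd_const]

theorem nabla2_trace (h : SpaceFormTT Ω c G H) {x : Coord n} (hx : x ∈ Ω) (k l : Fin n) :
    ∑ i, ∑ j, (G x)⁻¹ i j * nabla2 G H x ![i, j, k, l] = 0 := by
  have := h.nondeg.trace_covDeriv (F := fun i j y => nabla G H y ![i, j, k])
    (fun i j => h.smooth_nabla _) hx l
  rw [pd_congr_on h.nondeg.isOpen (fun y hy => h.nabla_trace hy k) hx, pd_const] at this
  simp only [nabla2, covDeriv_three, sub_add_eq_sub_sub, mul_sub, Finset.sum_sub_distrib] at this ⊢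
  rw [this, zero_sub, neg_eq_zero]
  simp only [Finset.mul_sum]
  -- What `trace_covDeriv` leaves over is the Christoffel term of the first derivative slot, a
  -- combination of traces of `∇h`.
  have e : ∀ p, ∑ i, ∑ j, (G x)⁻¹ i j * (christoffel G p l k x * nabla G H x ![i, j, p]) = 0 := by
    intro p
    have := h.nabla_trace hx p
    calc _ = christoffel G p l k x * ∑ i, ∑ j, (G x)⁻¹ i j * nabla G H x ![i, j, p] := by
          simp only [Finset.mul_sum]
          exact Finset.sum_congr rfl fun i _ => Finset.sum_congr rfl fun j _ => by ring
      _ = 0 := by rw [this, mul_zero]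
  calc _ = ∑ p, ∑ i, ∑ j, (G x)⁻¹ i j * (christoffel G p l k x * nabla G H x ![i, j, p]) := by
        simp only [← Fintype.sum_prod_type']
        exact Fintype.sum_equiv (M := ℝ)
          (⟨fun z => (z.2.2, z.1, z.2.1), fun z => (z.2.1, z.2.2, z.1),
            fun _ => rfl, fun _ => rfl⟩ : Fin n × Fin n × Fin n ≃ Fin n × Fin n × Fin n)
            _ _ fun _ => rfl
    _ = 0 := Finset.sum_eq_zero fun p _ => e p

theorem nabla2_div (h : SpaceFormTT Ω c G H) {x : Coord n} (hx : x ∈ Ω) (j l : Fin n) :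
    ∑ i, ∑ k, (G x)⁻¹ i k * nabla2 G H x ![i, j, k, l] = 0 := by
  have := h.nondeg.trace_covDeriv (F := fun i k y => nabla G H y ![i, j, k])
    (fun i j => h.smooth_nabla _) hx l
  have e1 := pd_congr_on (f := fun y => ∑ i, ∑ k, (G y)⁻¹ i k * nabla G H y ![i, j, k])
    (g := fun _ => 0) h.nondeg.isOpen (fun y hy => h.div y hy j) hx l
  rw [e1, pd_const] at this
  have e0 : ∀ i k, nabla2 G H x ![i, j, k, l] = pd l (fun y => nabla G H y ![i, j, k]) x
      - ((∑ p, christoffel G p l i x * nabla G H x ![p, j, k])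
        + ∑ p, christoffel G p l k x * nabla G H x ![i, j, p])
      - ∑ p, christoffel G p l j x * nabla G H x ![i, p, k] := by
    intro i k
    rw [nabla2, covDeriv_three]; ring
  simp only [e0, mul_sub _ _ (∑ p, christoffel G p l j x * _), Finset.sum_sub_distrib]
  rw [this, zero_sub, neg_eq_zero]
  simp only [Finset.mul_sum]
  -- Here the leftover is the Christoffel term of the free slot `j`, a combination of components of
  -- the divergence.
  have e : ∀ p, ∑ i, ∑ k, (G x)⁻¹ i k * (christoffel G p l j x * nabla G H x ![i, p, k]) = 0 := by
    intro p
    have := h.div x hx p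
    calc _ = christoffel G p l j x * ∑ i, ∑ k, (G x)⁻¹ i k * nabla G H x ![i, p, k] := by
          simp only [Finset.mul_sum]
          exact Finset.sum_congr rfl fun i _ => Finset.sum_congr rfl fun j _ => by ring
      _ = 0 := by
          have h0 : ∑ i, ∑ k, (G x)⁻¹ i k * nabla G H x ![i, p, k] = 0 := this
          rw [h0, mul_zero]
  calc _ = ∑ p, ∑ i, ∑ k, (G x)⁻¹ i k * (christoffel G p l j x * nabla G H x ![i, p, k]) := by
        simp only [← Fintype.sum_prod_type']
        exact Fintype.sum_equiv (M := ℝ)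
          (⟨fun z => (z.2.2, z.1, z.2.1), fun z => (z.2.1, z.2.2, z.1),
            fun _ => rfl, fun _ => rfl⟩ : Fin n × Fin n × Fin n ≃ Fin n × Fin n × Fin n)
            _ _ fun _ => rfl
    _ = 0 := Finset.sum_eq_zero fun p _ => e p

theorem nabla2_comm (h : SpaceFormTT Ω c G H) {x : Coord n} (hx : x ∈ Ω) (i j k l : Fin n) :
    nabla2 G H x ![i, j, k, l] - nabla2 G H x ![i, j, l, k] =
      -(c * (G x k i * H x l j - G x l i * H x k j + G x k j * H x i l - G x l j * H x i k)) := by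
  have := ricci_identity_two h.nondeg h.smooth.asTensor hx i j k l
  refine this.trans ?_
  simp only [h.nondeg.riemannUp_of_const hx (h.curv x hx), asTensor, Matrix.one_apply]
  simp [mul_sub, sub_mul, Finset.sum_sub_distrib]
  ring

end SpaceFormTT

theorem NormalAt.covDeriv {G : MatField n} {x : Coord n} (hN : NormalAt G x) {k : ℕ}
    (T : TensorField n k) (I : Fin k → Fin n) (m : Fin n) :
    covDeriv G T x (Fin.snoc I m) = WeylVariation.pd m (fun y => T y I) x := by
  simp [WeylVariation.covDeriv, hN.christoffel, Fin.snoc_last, Fin.snoc_castSucc]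

theorem NormalAt.pd_inv {Ω : Set (Coord n)} {G : MatField n} (hG : NondegOn Ω G) {x : Coord n}
    (hx : x ∈ Ω) (hN : NormalAt G x) (c i j : Fin n) :
    WeylVariation.pd c (fun y => (G y)⁻¹ i j) x = 0 := by
  simp [hG.pd_inv hx, hN.pd]

/-- At a normal point a covariant derivative is a coordinate derivative. The third-order divergence
relation and `t_comm` come from differentiating second-order relations valid on all of `Ω`;
`t_comm'` is a Ricci identity in its own right. -/
theorem SpaceFormTT.jet {Ω : Set (Coord n)} {c : ℝ} {G H : MatField n} (h : SpaceFormTT Ω c G H)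
    {x : Coord n} (hx : x ∈ Ω) (hN : NormalAt G x) :
    SpaceFormJet c (fun i j => H x i j) (fun i j k => nabla G H x ![i, j, k])
      (fun i j k l => nabla2 G H x ![i, j, k, l])
      (fun i j k l m => nabla3 G H x ![i, j, k, l, m]) := by
  have hinv : (G x)⁻¹ = 1 := by rw [hN.eq_one, inv_one]
  have htr : ∀ F : Fin n → Fin n → ℝ, ∑ i, ∑ j, (G x)⁻¹ i j * F i j = ∑ i, F i i := by
    intro F; simp [hinv, Matrix.one_apply]
  have hn2 : ∀ i j k l m, nabla3 G H x ![i, j, k, l, m] =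
      pd m (fun y => nabla2 G H y ![i, j, k, l]) x := by
    intro i j k l m
    unfold nabla3
    simp [covDeriv_four, hN.christoffel]
  have hn1 : ∀ i j k l, nabla2 G H x ![i, j, k, l] = pd l (fun y => nabla G H y ![i, j, k]) x := by
    intro i j k l
    unfold nabla2
    simp [covDeriv_three, hN.christoffel]
  have hn0 : ∀ i j k, nabla G H x ![i, j, k] = pd k (fun y => H y i j) x := by
    intro i j k
    unfold nabla
    simp [covDeriv_two, hN.christoffel, asTensor]
  have hd2 : ∀ I, DifferentiableAt ℝ (fun y => nabla2 G H y I) x := fun I =>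
    ContDiffOn.diffAt (h.smooth_nabla2 I) h.nondeg.isOpen hx
  have hdG := fun i j => h.nondeg.diffAt hx i j
  have hdH : ∀ i j, DifferentiableAt ℝ (fun y => H y i j) x := fun i j =>
    ContDiffOn.diffAt (h.smooth i j) h.nondeg.isOpen hx
  refine ⟨h.symm x hx, h.nabla_symm hx, h.nabla2_symm hx, ?_, fun k => ?_, fun k l => ?_,
    fun j => ?_, fun j k => ?_, fun j k l => ?_, fun i j k l => ?_, fun i j k l m => ?_,
    fun i j k l m => ?_⟩
  · exact (htr (fun i j => H x i j)).symm.trans (h.trace x hx)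
  · rw [← htr (fun i j => nabla G H x ![i, j, k])]; exact h.nabla_trace hx k
  · rw [← htr (fun i j => nabla2 G H x ![i, j, k, l])]; exact h.nabla2_trace hx k l
  · rw [← htr (fun i k => nabla G H x ![i, j, k])]; exact h.div x hx j
  · rw [← htr (fun i l => nabla2 G H x ![i, j, l, k])]; exact h.nabla2_div hx j k
  -- Since the inverse metric has zero derivative at `x`, differentiating the contracted relation
  -- differentiates only `∇²h`.
  · have := pd_congr_on h.nondeg.isOpen (fun y hy => h.nabla2_div hy j k) hx l
    rw [pd_const, pd_sum _ fun i _ => DifferentiableAt.fun_sum fun m _ =>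
      (h.nondeg.inv_diffAt hx i m).fun_mul (hd2 _)] at this
    rw [← this]
    refine Finset.sum_congr rfl fun i _ => ?_
    rw [pd_sum _ fun m _ => (h.nondeg.inv_diffAt hx i m).fun_mul (hd2 _)]
    rw [Finset.sum_congr rfl fun m _ => pd_mul (h.nondeg.inv_diffAt hx i m) (hd2 _) l]
    simp [hN.pd_inv h.nondeg hx, hinv, Matrix.one_apply, hn2]
  · have := h.nabla2_comm hx i j k l
    simp only [hN.eq_one] at this
    exact this
  -- In the commutator formula for `∇²h` only the factors `h` get differentiated, as `∂g = 0` at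
  -- `x`.
  · have := pd_congr_on h.nondeg.isOpen (fun y hy => h.nabla2_comm hy i j k l) hx m
    rw [pd_sub (hd2 _) (hd2 _), ← hn2, ← hn2] at this
    rw [this]
    have e : ∀ i j k l, pd m (fun y => G y i j * H y k l) x =
        (1 : Matrix (Fin n) (Fin n) ℝ) i j * nabla G H x ![k, l, m] := by
      intro i j k l
      rw [pd_mul (hdG _ _) (hdH _ _), hN.pd, hN.eq_one, hn0]; ring
    have hm : ∀ i j k l, DifferentiableAt ℝ (fun y => G y i j * H y k l) x := fun i j k l =>
      (hdG _ _).fun_mul (hdH _ _)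
    have e2 : (fun y => -(c * (G y k i * H y l j - G y l i * H y k j + G y k j * H y i l
        - G y l j * H y i k))) = fun y => (-c) * (G y k i * H y l j - G y l i * H y k j
          + G y k j * H y i l - G y l j * H y i k) := by funext y; ring
    rw [e2, pd_const_mul ((((hm _ _ _ _).fun_sub (hm _ _ _ _)).fun_add (hm _ _ _ _)).fun_sub
      (hm _ _ _ _)), pd_sub (((hm _ _ _ _).fun_sub (hm _ _ _ _)).fun_add (hm _ _ _ _))
      (hm _ _ _ _), pd_add ((hm _ _ _ _).fun_sub (hm _ _ _ _)) (hm _ _ _ _),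
      pd_sub (hm _ _ _ _) (hm _ _ _ _), e, e, e, e]
    ring
  -- The last two derivatives are commuted by the Ricci identity for the rank-three tensor `∇h`; its
  -- derivative slot is responsible for the two extra terms.
  · have := ricci_identity_three_normal h.nondeg h.smooth_nabla hx hN i j k l m
    refine this.trans ?_
    simp only [h.nondeg.riemannUp_of_const hx (h.curv x hx), hN.eq_one, Matrix.one_apply]
    simp [mul_sub, sub_mul, Finset.sum_sub_distrib]
    simp only [← mul_ite_zero]
    ring

/-! ### The pointwise identity in an orthonormal frame -/

namespace SpaceFormJet

variable {c : ℝ} {h : Fin n → Fin n → ℝ} {a : Fin n → Fin n → Fin n → ℝ}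
  {b : Fin n → Fin n → Fin n → Fin n → ℝ} {t : Fin n → Fin n → Fin n → Fin n → Fin n → ℝ}

/-- Commuting the derivatives brings the contracted one next to `h`, where the divergence vanishes.
The factor `n` is the trace of the identity in the curvature term. -/
theorem sum_b (J : SpaceFormJet c h a b t) (j k : Fin n) : ∑ i, b i j k i = c * n * h j k := by
  have e : ∑ i, (b i j k i - b i j i k) = _ := Finset.sum_congr rfl fun i _ => J.b_comm i j k i
  rw [Finset.sum_sub_distrib, J.b_div] at e
  simp only [Finset.sum_neg_distrib, ← Finset.mul_sum, Finset.sum_add_distrib,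
    Finset.sum_sub_distrib, J.h_trace] at e
  simp [Matrix.one_apply] at e
  rw [e, J.h_symm k j]; ring

theorem sum_b' (J : SpaceFormJet c h a b t) (i j : Fin n) : ∑ k, b i k j k = c * n * h i j := by
  rw [← J.sum_b]
  exact Finset.sum_congr rfl fun k _ => J.b_symm _ _ _ _

/-- The derivative in direction `k` is carried outwards past both derivatives of the Laplacian, by
one commutation of each kind, so that `Δ∇h` becomes `∇Δh` plus first-order terms. -/
theorem sum_t (J : SpaceFormJet c h a b t) (j l k : Fin n) :
    ∑ i, t j l k i i = (∑ i, t j l i i k) + 2 * c * (a k l j + a j k l)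
      + c * (n - 1) * a j l k := by
  have e1 : ∑ i, (t j l k i i - t j l i k i) = _ :=
    Finset.sum_congr rfl fun i _ => J.t_comm j l k i i
  have e2 : ∑ i, (t j l i k i - t j l i i k) = _ :=
    Finset.sum_congr rfl fun i _ => J.t_comm' j l i k i
  rw [Finset.sum_sub_distrib] at e1 e2
  simp only [Finset.sum_neg_distrib, ← Finset.mul_sum, Finset.sum_add_distrib,
    Finset.sum_sub_distrib] at e1 e2
  have d2 : ∑ i, a j i i = 0 := by
    rw [← J.a_div j]; exact Finset.sum_congr rfl fun i _ => J.a_symm _ _ _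
  simp [Matrix.one_apply, J.a_div, d2] at e1 e2
  linear_combination e1 + e2

/-- The outermost derivative is contracted with an index of `h`. Two commutations carry it to the
innermost position, where `div h = 0` removes the third-order term. -/
theorem sum_t' (J : SpaceFormJet c h a b t) (l k i : Fin n) :
    ∑ j, t j l k i j = c * n * a i l k + c * (n + 1) * a k l i := by
  have e1 : ∑ j, (t j l k i j - t j l k j i) = _ :=
    Finset.sum_congr rfl fun j _ => J.t_comm' j l k i j
  have e2 : ∑ j, (t j l k j i - t j l j k i) = _ :=
    Finset.sum_congr rfl fun j _ => J.t_comm j l k j i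
  rw [Finset.sum_sub_distrib] at e1 e2
  rw [J.t_div] at e2
  simp only [Finset.sum_neg_distrib, ← Finset.mul_sum, Finset.sum_add_distrib,
    Finset.sum_sub_distrib] at e1 e2
  simp [Matrix.one_apply, J.a_div, J.a_trace] at e1 e2
  linear_combination e1 + e2 + c * J.a_symm l i k + c * J.a_symm l k i

end SpaceFormJet

/-! ### Quadratic sums of tensors with the antisymmetries of a curvature tensor. -/

theorem sum_four_swap_left (F : Fin n → Fin n → Fin n → Fin n → ℝ) :
    ∑ i, ∑ j, ∑ k, ∑ l, F i j k l = ∑ i, ∑ j, ∑ k, ∑ l, F j i k l := Finset.sum_comm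

theorem sum_four_swap_right (F : Fin n → Fin n → Fin n → Fin n → ℝ) :
    ∑ i, ∑ j, ∑ k, ∑ l, F i j k l = ∑ i, ∑ j, ∑ k, ∑ l, F i j l k :=
  Finset.sum_congr rfl fun _ _ => Finset.sum_congr rfl fun _ _ => Finset.sum_comm

/-- Pairing a tensor with the symmetries of a curvature tensor with the four terms obtained by
antisymmetrization. -/
theorem sum_antisymm_pairing {F : Fin n → Fin n → Fin n → Fin n → ℝ}
    (h1 : ∀ i j k l, F j i k l = -F i j k l) (h2 : ∀ i j k l, F i j l k = -F i j k l)
    (e : Fin n → Fin n → Fin n → Fin n → ℝ) :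
    ∑ i, ∑ j, ∑ k, ∑ l, F i j k l * (e i j k l - e i j l k - e j i k l + e j i l k) =
      4 * ∑ i, ∑ j, ∑ k, ∑ l, F i j k l * e i j k l := by
  have s1 : ∑ i, ∑ j, ∑ k, ∑ l, F i j k l * e i j l k =
      -∑ i, ∑ j, ∑ k, ∑ l, F i j k l * e i j k l := by
    rw [sum_four_swap_right]
    have : ∀ i j k l, F i j l k * e i j k l = -(F i j k l * e i j k l) := by
      intro i j k l; rw [h2, neg_mul]
    simp only [this, Finset.sum_neg_distrib]
  have s2 : ∑ i, ∑ j, ∑ k, ∑ l, F i j k l * e j i k l =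
      -∑ i, ∑ j, ∑ k, ∑ l, F i j k l * e i j k l := by
    rw [sum_four_swap_left]
    have : ∀ i j k l, F j i k l * e i j k l = -(F i j k l * e i j k l) := by
      intro i j k l; rw [h1, neg_mul]
    simp only [this, Finset.sum_neg_distrib]
  have s3 : ∑ i, ∑ j, ∑ k, ∑ l, F i j k l * e j i l k =
      ∑ i, ∑ j, ∑ k, ∑ l, F i j k l * e i j k l := by
    rw [sum_four_swap_left, sum_four_swap_right]
    have : ∀ i j k l, F j i l k * e i j k l = F i j k l * e i j k l := by
      intro i j k l; rw [h1, h2, neg_neg]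
    simp only [this]
  simp only [mul_add, mul_sub, Finset.sum_add_distrib, Finset.sum_sub_distrib, s1, s2, s3]
  ring

/-- The second derivative part of the linearized Riemann tensor. -/
def linRiem (b : Fin n → Fin n → Fin n → Fin n → ℝ) (i j k l : Fin n) : ℝ :=
  (1 / 2) * (b j l k i - b j k l i - b i l k j + b i k l j)

theorem linRiem_antisymm_left (b : Fin n → Fin n → Fin n → Fin n → ℝ) (i j k l : Fin n) :
    linRiem b j i k l = -linRiem b i j k l := by unfold linRiem; ring

theorem linRiem_antisymm_right (b : Fin n → Fin n → Fin n → Fin n → ℝ) (i j k l : Fin n) :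
    linRiem b i j l k = -linRiem b i j k l := by unfold linRiem; ring

/-- `linRiem` is half the antisymmetrization of `b j l k i` in `(i, j)` and `(k, l)`. Pairing it
with itself therefore amounts to pairing it with a single term, and four products remain instead of
sixteen. -/
theorem sum_linRiem_sq (b : Fin n → Fin n → Fin n → Fin n → ℝ) :
    ∑ i, ∑ j, ∑ k, ∑ l, linRiem b i j k l ^ 2 =
      (∑ i, ∑ j, ∑ k, ∑ l, b j l k i * b j l k i) - (∑ i, ∑ j, ∑ k, ∑ l, b j l k i * b j k l i)
      - (∑ i, ∑ j, ∑ k, ∑ l, b j l k i * b i l k j)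
      + ∑ i, ∑ j, ∑ k, ∑ l, b j l k i * b i k l j := by
  have h := sum_antisymm_pairing (F := linRiem b) (fun i j k l => linRiem_antisymm_left b i j k l)
    (fun i j k l => linRiem_antisymm_right b i j k l) (fun i j k l => b j l k i)
  have e1 : ∑ i, ∑ j, ∑ k, ∑ l, linRiem b i j k l ^ 2 = (1 / 2) * ∑ i, ∑ j, ∑ k, ∑ l,
      linRiem b i j k l * (b j l k i - b j k l i - b i l k j + b i k l j) := by
    simp only [Finset.mul_sum]
    exact Finset.sum_congr rfl fun i _ => Finset.sum_congr rfl fun j _ =>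
      Finset.sum_congr rfl fun k _ => Finset.sum_congr rfl fun l _ => by
        simp only [linRiem]; ring
  rw [e1, h]
  simp only [← Finset.sum_add_distrib, ← Finset.sum_sub_distrib, Finset.mul_sum]
  exact Finset.sum_congr rfl fun i _ => Finset.sum_congr rfl fun j _ =>
      Finset.sum_congr rfl fun k _ => Finset.sum_congr rfl fun l _ => by
        simp only [linRiem]; ring

/-- `B ∧ 1` is the antisymmetrization of `B i l δ j k`, so pairing with it sees only the trace of
`F`. -/
theorem sum_mul_kulkarniNomizu_one {F : Fin n → Fin n → Fin n → Fin n → ℝ}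
    (h1 : ∀ i j k l, F j i k l = -F i j k l) (h2 : ∀ i j k l, F i j l k = -F i j k l)
    (B : Matrix (Fin n) (Fin n) ℝ) :
    ∑ i, ∑ j, ∑ k, ∑ l, F i j k l * kulkarniNomizu B 1 i j k l =
      4 * ∑ i, ∑ l, B i l * ∑ j, F i j j l := by
  have e : ∀ i j k l, kulkarniNomizu B 1 i j k l =
      B i l * (1 : Matrix (Fin n) (Fin n) ℝ) j k - B i k * (1 : Matrix (Fin n) (Fin n) ℝ) j l
      - B j l * (1 : Matrix (Fin n) (Fin n) ℝ) i k
      + B j k * (1 : Matrix (Fin n) (Fin n) ℝ) i l := by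
    intro i j k l; unfold kulkarniNomizu; ring
  simp only [e]
  rw [sum_antisymm_pairing h1 h2 (fun i j k l => B i l * (1 : Matrix (Fin n) (Fin n) ℝ) j k)]
  congr 1
  refine Finset.sum_congr rfl fun i _ => ?_
  simp only [Matrix.one_apply, mul_ite, mul_one, mul_zero, Finset.mul_sum]
  have : ∀ j, (∑ k, ∑ l, if j = k then F i j k l * B i l else 0) = ∑ l, F i j j l * B i l := by
    intro j
    rw [Finset.sum_comm]
    simp
  simp only [this]
  rw [Finset.sum_comm]
  exact Finset.sum_congr rfl fun l _ => Finset.sum_congr rfl fun j _ => mul_comm _ _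

/-! ### Trace and norm of the linearized curvature, and contracted third derivatives. -/

namespace SpaceFormJet

variable {c : ℝ} {h : Fin n → Fin n → ℝ} {a : Fin n → Fin n → Fin n → ℝ}
  {b : Fin n → Fin n → Fin n → Fin n → ℝ} {t : Fin n → Fin n → Fin n → Fin n → Fin n → ℝ}

/-- Of the four traced terms one is a divergence, one is a trace of `h`, one is `-Δh`, and the last
is given by `sum_b'`. -/
theorem linRiem_trace (J : SpaceFormJet c h a b t) (i l : Fin n) :
    ∑ j, linRiem b i j j l = (1 / 2) * (c * n * h i l - ∑ j, b i l j j) := by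
  simp only [linRiem, ← Finset.mul_sum, Finset.sum_add_distrib, Finset.sum_sub_distrib,
    J.b_div, J.b_trace, J.sum_b']
  ring

/-- The linearized Schouten tensor. -/
def linSchouten (c : ℝ) (h : Fin n → Fin n → ℝ) (b : Fin n → Fin n → Fin n → Fin n → ℝ) :
    Matrix (Fin n) (Fin n) ℝ :=
  Matrix.of fun i j => (1 / ((n : ℝ) - 2)) * ((1 / 2) * (c * n * h i j - ∑ k, b i j k k))

theorem linSchouten_trace (J : SpaceFormJet c h a b t) : ∑ i, linSchouten c h b i i = 0 := by
  simp only [linSchouten, Matrix.of_apply, ← Finset.mul_sum, Finset.sum_sub_distrib, J.h_trace]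
  rw [Finset.sum_comm]
  simp [J.b_trace]

/-- Pythagoras. `linRiem` and `B ∧ 1` have the same trace `(n-2) B`, so their difference is
trace-free and orthogonal to `B ∧ 1`. The part removed has square norm `4 (n-2) |B|²`. -/
theorem sum_linWeyl_sq (J : SpaceFormJet c h a b t) (hn : (n : ℝ) - 2 ≠ 0) :
    ∑ i, ∑ j, ∑ k, ∑ l, (linRiem b i j k l - kulkarniNomizu (linSchouten c h b) 1 i j k l) ^ 2 =
      (∑ i, ∑ j, ∑ k, ∑ l, linRiem b i j k l ^ 2)
      - 1 / ((n : ℝ) - 2) * ∑ i, ∑ l, (c * n * h i l - ∑ k, b i l k k) ^ 2 := by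
  set B := linSchouten c h b with hB
  have hK1 : ∀ i j k l, kulkarniNomizu B 1 j i k l = -kulkarniNomizu B 1 i j k l := by
    intro i j k l; unfold kulkarniNomizu; ring
  have hK2 : ∀ i j k l, kulkarniNomizu B 1 i j l k = -kulkarniNomizu B 1 i j k l := by
    intro i j k l; unfold kulkarniNomizu; ring
  have e1 := sum_mul_kulkarniNomizu_one (F := linRiem b)
    (fun i j k l => linRiem_antisymm_left b i j k l)
    (fun i j k l => linRiem_antisymm_right b i j k l) B
  have e2 := sum_mul_kulkarniNomizu_one hK1 hK2 B
  have t2 : ∀ i l, ∑ j, kulkarniNomizu B 1 i j j l = ((n : ℝ) - 2) * B i l := by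
    intro i l
    simp only [kulkarniNomizu, Finset.sum_sub_distrib, Finset.sum_add_distrib, ← Finset.mul_sum,
      ← Finset.sum_mul, hB, J.linSchouten_trace]
    simp [Matrix.one_apply]
    ring
  have t1 : ∀ i l, ∑ j, linRiem b i j j l = ((n : ℝ) - 2) * B i l := by
    intro i l
    rw [J.linRiem_trace, hB]
    simp only [linSchouten, Matrix.of_apply]
    field_simp
  simp only [t1] at e1
  simp only [t2] at e2
  have e3 : ∑ i, ∑ j, ∑ k, ∑ l, (linRiem b i j k l - kulkarniNomizu B 1 i j k l) ^ 2 =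
      (∑ i, ∑ j, ∑ k, ∑ l, linRiem b i j k l ^ 2)
      - 2 * (∑ i, ∑ j, ∑ k, ∑ l, linRiem b i j k l * kulkarniNomizu B 1 i j k l)
      + ∑ i, ∑ j, ∑ k, ∑ l, kulkarniNomizu B 1 i j k l * kulkarniNomizu B 1 i j k l := by
    simp only [← Finset.sum_add_distrib, ← Finset.sum_sub_distrib, Finset.mul_sum]
    exact Finset.sum_congr rfl fun i _ => Finset.sum_congr rfl fun j _ =>
      Finset.sum_congr rfl fun k _ => Finset.sum_congr rfl fun l _ => by ring
  have e4 : ∑ i, ∑ l, B i l * (((n : ℝ) - 2) * B i l) =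
      1 / ((n : ℝ) - 2) * (1 / 4) * ∑ i, ∑ l, (c * n * h i l - ∑ k, b i l k k) ^ 2 := by
    simp only [Finset.mul_sum]
    refine Finset.sum_congr rfl fun i _ => Finset.sum_congr rfl fun j _ => ?_
    simp only [hB, linSchouten, Matrix.of_apply]
    field_simp
    ring
  rw [e3, e1, e2, e4]
  ring

/-- The sum over four indices, performed in the order needed for a contraction. -/
theorem sum_four_rotate (F : Fin n → Fin n → Fin n → Fin n → ℝ) :
    ∑ i, ∑ j, ∑ k, ∑ l, F i j k l = ∑ j, ∑ k, ∑ l, ∑ i, F i j k l := by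
  simp only [← Fintype.sum_prod_type']
  exact Fintype.sum_equiv (M := ℝ)
    (⟨fun z => (z.2.1, z.2.2.1, z.2.2.2, z.1), fun z => (z.2.2.2, z.1, z.2.1, z.2.2.1),
      fun _ => rfl, fun _ => rfl⟩ : Fin n × Fin n × Fin n × Fin n ≃ Fin n × Fin n × Fin n × Fin n)
    _ _ fun _ => rfl

theorem sum_four_swap_mid (F : Fin n → Fin n → Fin n → Fin n → ℝ) :
    ∑ i, ∑ j, ∑ k, ∑ l, F i j k l = ∑ j, ∑ i, ∑ k, ∑ l, F i j k l := Finset.sum_comm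

theorem sum_three_last (F : Fin n → Fin n → Fin n → ℝ) :
    ∑ j, ∑ k, ∑ l, F j k l = ∑ j, ∑ l, ∑ k, F j k l :=
  Finset.sum_congr rfl fun _ _ => Finset.sum_comm

theorem sum_three_first (F : Fin n → Fin n → Fin n → ℝ) :
    ∑ j, ∑ k, ∑ l, F j k l = ∑ k, ∑ j, ∑ l, F j k l := Finset.sum_comm

/-- Integration by parts of the four quadratic expressions in the second derivatives. -/
theorem sum_t_mul_a (J : SpaceFormJet c h a b t) :
    ∑ i, ∑ j, ∑ k, ∑ l, t j l k i i * a j l k =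
      (∑ i, ∑ j, ∑ k, ∑ l, t j l i i k * a j l k)
      + 4 * c * (∑ j, ∑ k, ∑ l, a j l k * a j k l)
      + c * (n - 1) * ∑ j, ∑ k, ∑ l, a j l k * a j l k := by
  rw [sum_four_rotate, sum_four_rotate (fun i j k l => t j l i i k * a j l k)]
  simp only [← Finset.sum_mul, J.sum_t]
  have e : ∑ j, ∑ k, ∑ l, a k l j * a j l k = ∑ j, ∑ k, ∑ l, a j l k * a j k l := by
    rw [sum_three_last (fun j k l => a k l j * a j l k), sum_three_first]
    exact Finset.sum_congr rfl fun l _ => Finset.sum_congr rfl fun j _ =>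
      Finset.sum_congr rfl fun k _ => by rw [J.a_symm k l, J.a_symm j l]
  have e' : ∑ j, ∑ k, ∑ l, a j k l * a j l k = ∑ j, ∑ k, ∑ l, a j l k * a j k l := by
    simp only [mul_comm]
  simp only [add_mul, mul_add, Finset.sum_add_distrib, mul_assoc, ← Finset.mul_sum, e, e']
  ring

theorem sum_t_mul_a_swap (J : SpaceFormJet c h a b t) :
    ∑ i, ∑ j, ∑ k, ∑ l, t j l k i i * a j k l =
      (∑ i, ∑ j, ∑ k, ∑ l, t j l i i k * a j k l)
      + 2 * c * ((∑ j, ∑ k, ∑ l, a j l k * a j k l) + ∑ j, ∑ k, ∑ l, a j l k * a j l k)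
      + c * (n - 1) * ∑ j, ∑ k, ∑ l, a j l k * a j k l := by
  rw [sum_four_rotate, sum_four_rotate (fun i j k l => t j l i i k * a j k l)]
  simp only [← Finset.sum_mul, J.sum_t]
  have e : ∑ j, ∑ k, ∑ l, a k l j * a j k l = ∑ j, ∑ k, ∑ l, a j l k * a j k l := by
    rw [sum_three_first]
    exact Finset.sum_congr rfl fun k _ => Finset.sum_congr rfl fun j _ =>
      Finset.sum_congr rfl fun l _ => by rw [J.a_symm j k]
  have e' : ∑ j, ∑ k, ∑ l, a j k l * a j k l = ∑ j, ∑ k, ∑ l, a j l k * a j l k :=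
    sum_three_last _
  simp only [add_mul, mul_add, Finset.sum_add_distrib, mul_assoc, ← Finset.mul_sum, e, e']

/-- Here `sum_t'` applies, so no third derivative is left and no further Leibniz step is needed. -/
theorem sum_t_mul_a' (J : SpaceFormJet c h a b t) :
    ∑ i, ∑ j, ∑ k, ∑ l, t j l k i j * a i l k =
      c * n * (∑ j, ∑ k, ∑ l, a j l k * a j l k)
      + c * (n + 1) * ∑ j, ∑ k, ∑ l, a j l k * a j k l := by
  rw [sum_four_swap_mid, sum_four_rotate]
  simp only [← Finset.sum_mul, J.sum_t']
  have e : ∑ i, ∑ k, ∑ l, a k l i * a i l k = ∑ j, ∑ k, ∑ l, a j l k * a j k l := by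
    rw [sum_three_last (fun j k l => a k l j * a j l k), sum_three_first]
    exact Finset.sum_congr rfl fun l _ => Finset.sum_congr rfl fun j _ =>
      Finset.sum_congr rfl fun k _ => by rw [J.a_symm k l, J.a_symm j l]
  simp only [add_mul, Finset.sum_add_distrib, mul_assoc, ← Finset.mul_sum, e]

theorem sum_t_mul_a_swap' (J : SpaceFormJet c h a b t) :
    ∑ i, ∑ j, ∑ k, ∑ l, t j l k i j * a i k l =
      c * (2 * n + 1) * ∑ j, ∑ k, ∑ l, a j l k * a j k l := by
  rw [sum_four_swap_mid, sum_four_rotate]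
  simp only [← Finset.sum_mul, J.sum_t']
  have e : ∑ i, ∑ k, ∑ l, a k l i * a i k l = ∑ j, ∑ k, ∑ l, a j l k * a j k l := by
    rw [sum_three_first]
    exact Finset.sum_congr rfl fun k _ => Finset.sum_congr rfl fun j _ =>
      Finset.sum_congr rfl fun l _ => by rw [J.a_symm j k]
  simp only [add_mul, Finset.sum_add_distrib, mul_assoc, ← Finset.mul_sum, e]
  ring

end SpaceFormJet

/-! ### The linearized Weyl tensor in normal coordinates -/

theorem pd_christoffel_normal {Ω : Set (Coord n)} {G G' : MatField n} (hG : NondegOn Ω G)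
    {x : Coord n} (hx : x ∈ Ω) (i l j k : Fin n) (hG' : G' = G) :
    pd i (christoffel G l j k) x = (1 / 2) * ∑ m, (pd i (fun y => (G y)⁻¹ l m) x *
        (pd j (fun y => G' y k m) x + pd k (fun y => G' y j m) x - pd m (fun y => G' y j k) x)
      + (G x)⁻¹ l m * (pd i (pd j (fun y => G y k m)) x + pd i (pd k (fun y => G y j m)) x
        - pd i (pd m (fun y => G y j k)) x)) := by
  subst hG'
  have hp : ∀ a b d, DifferentiableAt ℝ (pd a (fun y => G' y b d)) x := fun a b d =>
    ContDiffOn.diffAt (ContDiffOn.pd (hG.smooth b d) hG.isOpen a) hG.isOpen hx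
  have hL : ∀ m, DifferentiableAt ℝ (fun y => pd j (fun y => G' y k m) y
      + pd k (fun y => G' y j m) y - pd m (fun y => G' y j k) y) x := fun m =>
    ((hp _ _ _).fun_add (hp _ _ _)).fun_sub (hp _ _ _)
  unfold christoffel
  rw [pd_const_mul (DifferentiableAt.fun_sum fun m _ => (hG.inv_diffAt hx l m).fun_mul (hL m)),
    pd_sum _ fun m _ => (hG.inv_diffAt hx l m).fun_mul (hL m)]
  congr 1
  refine Finset.sum_congr rfl fun m _ => ?_
  rw [pd_mul (hG.inv_diffAt hx l m) (hL m), pd_sub ((hp _ _ _).fun_add (hp _ _ _)) (hp _ _ _),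
    pd_add (hp _ _ _) (hp _ _ _)]

/-- The inverse satisfies `A(t) = 1 - t H A(t)`, so its mere continuity at `0` already yields the
derivative `-H A(0)`. -/
theorem hasDerivAt_inv_one_add (H : Matrix (Fin n) (Fin n) ℝ) (i j : Fin n) :
    HasDerivAt (fun t : ℝ => ((1 : Matrix (Fin n) (Fin n) ℝ) + t • H)⁻¹ i j) (-H i j) 0 := by
  set A : ℝ → Matrix (Fin n) (Fin n) ℝ := fun t => (1 + t • H)⁻¹ with hA
  have hev := CoordChange.eventually_det_ne (1 : Matrix (Fin n) (Fin n) ℝ) H (by simp)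
  have hcd : ∀ i j, ContinuousAt (fun t => A t i j) 0 := by
    intro i j
    have hd : Continuous fun t : ℝ => ((1 : Matrix (Fin n) (Fin n) ℝ) + t • H).det := by fun_prop
    have ha : Continuous fun t : ℝ => ((1 : Matrix (Fin n) (Fin n) ℝ) + t • H).adjugate i j := by
      have : Continuous fun t : ℝ => ((1 : Matrix (Fin n) (Fin n) ℝ) + t • H).adjugate :=
        Continuous.matrix_adjugate (by fun_prop)
      exact this.matrix_elem i j
    simp only [hA, Matrix.inv_def, Matrix.smul_apply, Ring.inverse_eq_inv', smul_eq_mul]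
    exact (hd.continuousAt.inv₀ (by simp)).mul ha.continuousAt
  have hA0 : A 0 = 1 := by simp [hA]
  have hr : ∀ᶠ t in 𝓝 (0 : ℝ), A t i j = (1 : Matrix (Fin n) (Fin n) ℝ) i j
      - t * ∑ k, H i k * A t k j := by
    filter_upwards [hev] with t ht
    have h1 : (1 + t • H) * A t = 1 := Matrix.mul_nonsing_inv _ (isUnit_iff_ne_zero.2 ht)
    rw [Matrix.add_mul, Matrix.one_mul, Matrix.smul_mul] at h1
    have h2 := congrFun (congrFun h1 i) j
    simp only [Matrix.add_apply, Matrix.smul_apply, smul_eq_mul] at h2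
    rw [Matrix.mul_apply] at h2
    linarith
  have hw : ContinuousAt (fun t => ∑ k, H i k * A t k j) 0 :=
    tendsto_finsetSum _ fun k _ => (hcd k j).const_mul _
  have hm : HasDerivAt (fun t => t * ∑ k, H i k * A t k j) (∑ k, H i k * A 0 k j) 0 := by
    rw [hasDerivAt_iff_tendsto_slope]
    refine Filter.Tendsto.congr' ?_ (hw.tendsto.mono_left nhdsWithin_le_nhds)
    filter_upwards [self_mem_nhdsWithin] with t ht
    have : t ≠ 0 := ht
    simp [slope, this]
  have h3 := (hasDerivAt_const (0 : ℝ) ((1 : Matrix (Fin n) (Fin n) ℝ) i j)).sub hm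
  refine (h3.congr_of_eventuallyEq hr).congr_deriv ?_
  simp [hA0, Matrix.one_apply]

theorem hasDerivAt_sq_mul {w : ℝ → ℝ} (hw : DifferentiableAt ℝ w 0) :
    HasDerivAt (fun t => t ^ 2 * w t) 0 0 := by
  have := (hasDerivAt_pow 2 (0 : ℝ)).fun_mul hw.hasDerivAt
  simpa using this

/-- The derivative of the metric plus a multiple of a perturbation. -/
theorem pd_add_smul {Ω : Set (Coord n)} (hΩ : IsOpen Ω) {G H : MatField n} (hG : SmoothMat Ω G)
    (hH : SmoothMat Ω H) {x : Coord n} (hx : x ∈ Ω) (t : ℝ) (c i j : Fin n) :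
    pd c (fun y => (G y + t • H y) i j) x =
      pd c (fun y => G y i j) x + t * pd c (fun y => H y i j) x := by
  have hdG := ContDiffOn.diffAt (hG i j) hΩ hx
  have hdH := ContDiffOn.diffAt (hH i j) hΩ hx
  simp only [Matrix.add_apply, Matrix.smul_apply, smul_eq_mul]
  rw [pd_add hdG (hdH.const_mul t), pd_const_mul hdH]

theorem pd_pd_add_smul {Ω : Set (Coord n)} (hΩ : IsOpen Ω) {G H : MatField n} (hG : SmoothMat Ω G)
    (hH : SmoothMat Ω H) {x : Coord n} (hx : x ∈ Ω) (t : ℝ) (c d i j : Fin n) :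
    pd c (pd d (fun y => (G y + t • H y) i j)) x =
      pd c (pd d (fun y => G y i j)) x + t * pd c (pd d (fun y => H y i j)) x := by
  have hdG := ContDiffOn.diffAt (ContDiffOn.pd (hG i j) hΩ d) hΩ hx
  have hdH := ContDiffOn.diffAt (ContDiffOn.pd (hH i j) hΩ d) hΩ hx
  rw [pd_congr_on hΩ (fun y hy => pd_add_smul hΩ hG hH hy t d i j) hx,
    pd_add hdG (hdH.const_mul t), pd_const_mul hdH]

/-- First derivative part `∂_j B_{km} + ∂_k B_{jm} - ∂_m B_{jk}` of the Christoffel symbols. -/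
def koszul (B : MatField n) (m j k : Fin n) (x : Coord n) : ℝ :=
  pd j (fun y => B y k m) x + pd k (fun y => B y j m) x - pd m (fun y => B y j k) x

/-- The derivative `∂_i` of `koszul`. -/
def dKoszul (B : MatField n) (i m j k : Fin n) (x : Coord n) : ℝ :=
  pd i (pd j (fun y => B y k m)) x + pd i (pd k (fun y => B y j m)) x
    - pd i (pd m (fun y => B y j k)) x

/-- At a normal point all first derivatives of `G + t H` are `O(t)`. Hence products of Christoffel
symbols, and derivatives of the inverse metric times first derivatives of the metric, are `O(t²)`.
To first order only second derivatives of the metric contribute, contracted with `(1 + t H)⁻¹`. -/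
theorem hasDerivAt_riemannUp {Ω : Set (Coord n)} {G H : MatField n} (hG : NondegOn Ω G)
    (hH : SmoothMat Ω H) (hHs : ∀ y ∈ Ω, ∀ i j, H y i j = H y j i) {x : Coord n} (hx : x ∈ Ω)
    (hN : NormalAt G x) (i j k l : Fin n) :
    HasDerivAt (fun t : ℝ => riemannUp (fun y => G y + t • H y) i j k l x)
      ((1 / 2) * (dKoszul H i l j k x - dKoszul H j l i k x)
        - ∑ m, H x l m * riemannUp G i j k m x) 0 := by
  set g : ℝ → Matrix (Fin n) (Fin n) ℝ := fun t => (1 + t • H x)⁻¹ with hg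
  have hgd : ∀ a b, HasDerivAt (fun t => g t a b) (-H x a b) 0 := hasDerivAt_inv_one_add (H x)
  have hg0 : g 0 = 1 := by simp [hg]
  set Γ : ℝ → Fin n → Fin n → Fin n → ℝ := fun t p a b =>
    (1 / 2) * ∑ m, g t p m * koszul H m a b x with hΓ
  -- All terms with a factor `t²`; only differentiability at `0` of the cofactor will matter.
  set w : ℝ → ℝ := fun t =>
    (-((1 / 2) * ∑ m, (∑ a, ∑ b, g t l a * pd i (fun y => H y a b) x * g t b m) * koszul H m j k x)
    + (1 / 2) * ∑ m, (∑ a, ∑ b, g t l a * pd j (fun y => H y a b) x * g t b m) * koszul H m i k x)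
    + ∑ p, (Γ t p j k * Γ t l i p - Γ t p i k * Γ t l j p) with hw
  set α : Fin n → ℝ := fun m => dKoszul G i m j k x - dKoszul G j m i k x with hα
  set β : Fin n → ℝ := fun m => dKoszul H i m j k x - dKoszul H j m i k x with hβ
  have formula : ∀ᶠ t in 𝓝 (0 : ℝ), riemannUp (fun y => G y + t • H y) i j k l x =
      (1 / 2) * (∑ m, g t l m * (α m + t * β m)) + t ^ 2 * w t := by
    filter_upwards [CoordChange.eventually_det_ne (G x) (H x) (hG.det _ hx)] with t ht
    set Gt : MatField n := fun y => G y + t • H y with hGt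
    have hs : SmoothMat Ω Gt := fun i j => (hG.smooth i j).add (contDiffOn_const.mul (hH i j))
    set Ωt : Set (Coord n) := Ω ∩ {y | (Gt y).det ≠ 0} with hΩt
    have ho : IsOpen Ωt := (contDiffOn_det hs).continuousOn.isOpen_inter_preimage hG.isOpen
        (isOpen_compl_singleton (x := (0 : ℝ)))
    have hNt : NondegOn Ωt Gt :=
      { isOpen := ho
        smooth := fun i j => (hs i j).mono inter_subset_left
        symm := fun y hy i j => by
          simp only [hGt, Matrix.add_apply, Matrix.smul_apply]
          rw [hG.symm y hy.1 i j, hHs y hy.1 i j]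
        det := fun y hy => hy.2 }
    have hxt : x ∈ Ωt := ⟨hx, ht⟩
    have hGx : (Gt x)⁻¹ = g t := by simp only [hGt, hg, hN.eq_one]
    have hp : ∀ c a b, pd c (fun y => Gt y a b) x = t * pd c (fun y => H y a b) x := by
      intro c a b
      rw [pd_add_smul hG.isOpen hG.smooth hH hx, hN.pd, zero_add]
    have hpp : ∀ c d a b, pd c (pd d (fun y => Gt y a b)) x =
        pd c (pd d (fun y => G y a b)) x + t * pd c (pd d (fun y => H y a b)) x :=
      fun c d a b => pd_pd_add_smul hG.isOpen hG.smooth hH hx t c d a b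
    have hc : ∀ p a b, christoffel Gt p a b x = t * Γ t p a b := by
      intro p a b
      simp only [christoffel, hGx, hp, hΓ, koszul, Finset.mul_sum]
      exact Finset.sum_congr rfl fun m _ => by ring
    have hdc : ∀ i j, pd i (christoffel Gt l j k) x =
        (1 / 2) * (∑ m, g t l m * (dKoszul G i m j k x + t * dKoszul H i m j k x))
        - t ^ 2 * ((1 / 2) * ∑ m, (∑ a, ∑ b, g t l a * pd i (fun y => H y a b) x * g t b m)
          * koszul H m j k x) := by
      intro i j
      rw [pd_christoffel_normal hNt hxt i l j k rfl]
      simp only [hNt.pd_inv hxt, hGx, hp, hpp]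
      rw [show ∀ A B C : ℝ, A = (1 / 2) * B - t ^ 2 * ((1 / 2) * C) ↔
        A = (1 / 2) * (B - t ^ 2 * C) from fun A B C => by constructor <;> intro h <;> rw [h] <;> ring]
      congr 1
      rw [Finset.mul_sum, ← Finset.sum_sub_distrib]
      refine Finset.sum_congr rfl fun m _ => ?_
      have : ∑ a, ∑ b, g t l a * (t * pd i (fun y => H y a b) x) * g t b m =
          t * ∑ a, ∑ b, g t l a * pd i (fun y => H y a b) x * g t b m := by
        simp only [Finset.mul_sum]
        exact Finset.sum_congr rfl fun a _ => Finset.sum_congr rfl fun b _ => by ring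
      rw [this]
      simp only [koszul, dKoszul]
      ring
    simp only [riemannUp, hdc, hc]
    have e1 : ∑ m, g t l m * (α m + t * β m) =
        (∑ m, g t l m * (dKoszul G i m j k x + t * dKoszul H i m j k x))
        - ∑ m, g t l m * (dKoszul G j m i k x + t * dKoszul H j m i k x) := by
      rw [← Finset.sum_sub_distrib]
      exact Finset.sum_congr rfl fun m _ => by simp only [hα, hβ]; ring
    have e2 : ∑ p, (t * Γ t p j k * (t * Γ t l i p) - t * Γ t p i k * (t * Γ t l j p)) =
        t ^ 2 * ∑ p, (Γ t p j k * Γ t l i p - Γ t p i k * Γ t l j p) := by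
      rw [Finset.mul_sum]
      exact Finset.sum_congr rfl fun m _ => by ring
    rw [e1, e2]
    simp only [hw]
    ring
  have hgD : ∀ a b, DifferentiableAt ℝ (fun t => g t a b) 0 := fun a b => (hgd a b).differentiableAt
  have hΓD : ∀ p a b, DifferentiableAt ℝ (fun t => Γ t p a b) 0 := fun p a b =>
    (DifferentiableAt.fun_sum fun m _ => (hgD p m).mul_const _).const_mul _
  have hquad : ∀ i l j k, DifferentiableAt ℝ (fun t => (1 / 2 : ℝ) * ∑ m,
      (∑ a, ∑ b, g t l a * pd i (fun y => H y a b) x * g t b m) * koszul H m j k x) 0 :=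
    fun i l j k => (DifferentiableAt.fun_sum fun m _ => (DifferentiableAt.fun_sum fun a _ =>
      DifferentiableAt.fun_sum fun b _ =>
        ((hgD l a).mul_const _).fun_mul (hgD b m)).mul_const _).const_mul _
  have hwD : DifferentiableAt ℝ w 0 :=
    ((hquad i l j k).fun_neg.fun_add (hquad j l i k)).fun_add
      (DifferentiableAt.fun_sum fun p _ => ((hΓD _ _ _).fun_mul (hΓD _ _ _)).fun_sub
        ((hΓD _ _ _).fun_mul (hΓD _ _ _)))
  have hlin : ∀ m, HasDerivAt (fun t => g t l m * (α m + t * β m))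
      (-H x l m * α m + (1 : Matrix (Fin n) (Fin n) ℝ) l m * β m) 0 := by
    intro m
    have h2 : HasDerivAt (fun t : ℝ => α m + t * β m) (β m) 0 := by
      simpa using ((hasDerivAt_id (0 : ℝ)).mul_const (β m)).const_add (α m)
    have := (hgd l m).fun_mul h2
    simpa [hg0] using this
  have hmain := ((HasDerivAt.fun_sum (u := Finset.univ) fun m _ => hlin m).const_mul (1 / 2 : ℝ)).add
    (hasDerivAt_sq_mul hwD)
  refine (hmain.congr_of_eventuallyEq formula).congr_deriv ?_
  -- The derivative of the inverse metric multiplies `α`, which is twice the curvature of `G`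
  -- itself.
  have hup : ∀ m, riemannUp G i j k m x = (1 / 2) * α m := by
    intro m
    have f0 : ∀ i j, pd i (christoffel G m j k) x = (1 / 2) * dKoszul G i m j k x := by
      intro i j
      rw [pd_christoffel_normal hG hx i m j k rfl]
      simp [hN.pd, hN.eq_one, Matrix.one_apply, dKoszul]
    simp only [riemannUp, f0, hN.christoffel, hα]
    simp
    ring
  simp only [hup, Finset.sum_add_distrib, add_zero]
  simp only [Matrix.one_apply, ite_mul, one_mul, zero_mul, Finset.sum_ite_eq, Finset.mem_univ,
    if_true, hβ, mul_add, Finset.mul_sum]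
  have e : ∑ m, 1 / 2 * (-H x l m * α m) = -∑ m, H x l m * (1 / 2 * α m) := by
    rw [← Finset.sum_neg_distrib]
    exact Finset.sum_congr rfl fun m _ => by ring
  rw [e]
  ring

/-- Lowering the index with `G + t H` adds `Rm_{ijk}^p h_{pl}`, which cancels the contribution of
the varying inverse metric in `hasDerivAt_riemannUp`. -/
theorem hasDerivAt_riemann {Ω : Set (Coord n)} {G H : MatField n} (hG : NondegOn Ω G)
    (hH : SmoothMat Ω H) (hHs : ∀ y ∈ Ω, ∀ i j, H y i j = H y j i) {x : Coord n} (hx : x ∈ Ω)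
    (hN : NormalAt G x) (i j k l : Fin n) :
    HasDerivAt (fun t : ℝ => riemann (fun y => G y + t • H y) i j k l x)
      ((1 / 2) * (dKoszul H i l j k x - dKoszul H j l i k x)) 0 := by
  have h1 : ∀ p, HasDerivAt (fun t : ℝ => (G x + t • H x) p l) (H x p l) 0 := by
    intro p
    simpa using ((hasDerivAt_id (0 : ℝ)).mul_const (H x p l)).const_add (G x p l)
  have h2 := HasDerivAt.fun_sum (u := Finset.univ) fun p _ =>
    (hasDerivAt_riemannUp hG hH hHs hx hN i j k p).fun_mul (h1 p)
  refine h2.congr_deriv ?_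
  simp only [zero_smul, add_zero, hN.eq_one, Finset.sum_add_distrib]
  simp only [Matrix.one_apply, mul_ite, mul_one, mul_zero, Finset.sum_ite_eq', Finset.mem_univ,
    if_true]
  have e : ∑ p, riemannUp G i j k p x * H x p l = ∑ m, H x l m * riemannUp G i j k m x :=
    Finset.sum_congr rfl fun p _ => by rw [hHs x hx p l, mul_comm]
  rw [e]
  ring

/-! ### First variation of Ricci, scalar, Schouten and Weyl curvature at a space form. -/

namespace SpaceFormTT

variable {Ω : Set (Coord n)} {c : ℝ} {G H : MatField n}

/-- Second coordinate derivatives of `h` differ from `∇²h` by `∂Γ` times `h`. After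
antisymmetrization in `i, j` the `∂Γ` terms form the curvature of `G`, and constancy of the
curvature turns them into `(c/2) h ∧ g`. -/
theorem dKoszul_eq (h : SpaceFormTT Ω c G H) {x : Coord n} (hx : x ∈ Ω) (hN : NormalAt G x)
    (i j k l : Fin n) :
    (1 / 2) * (dKoszul H i l j k x - dKoszul H j l i k x) =
      linRiem (fun i j k l => nabla2 G H x ![i, j, k, l]) i j k l
        + c / 2 * kulkarniNomizu (H x) 1 i j k l := by
  have hd : ∀ i j, DifferentiableAt ℝ (fun y => H y i j) x := fun i j =>
    ContDiffOn.diffAt (h.smooth i j) h.nondeg.isOpen hx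
  have hdd : ∀ k i j, DifferentiableAt ℝ (pd k (fun y => H y i j)) x := fun k i j =>
    ContDiffOn.diffAt (ContDiffOn.pd (h.smooth i j) h.nondeg.isOpen k) h.nondeg.isOpen hx
  have hΓ : ∀ a b c, DifferentiableAt ℝ (christoffel G a b c) x := fun a b c =>
    ContDiffOn.diffAt (h.nondeg.christoffel_smooth a b c) h.nondeg.isOpen hx
  have hs : ∀ (a b : Fin n) (I : Fin n → Fin n × Fin n), DifferentiableAt ℝ
      (fun y => ∑ p, christoffel G p a b y * H y (I p).1 (I p).2) x := fun a b I =>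
    DifferentiableAt.fun_sum fun p _ => (hΓ _ _ _).fun_mul (hd _ _)
  have es : ∀ (a b d : Fin n) (I : Fin n → Fin n × Fin n),
      pd d (fun y => ∑ p, christoffel G p a b y * H y (I p).1 (I p).2) x =
      ∑ p, pd d (christoffel G p a b) x * H x (I p).1 (I p).2 := by
    intro a b d I
    rw [pd_sum _ fun p _ => (hΓ _ _ _).fun_mul (hd _ _)]
    refine Finset.sum_congr rfl fun p _ => ?_
    rw [pd_mul (hΓ _ _ _) (hd _ _), hN.christoffel]
    ring
  have hn2 : ∀ u v p q, pd q (pd p (fun y => H y u v)) x = nabla2 G H x ![u, v, p, q]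
      + ((∑ r, pd q (christoffel G r p u) x * H x r v)
        + ∑ r, pd q (christoffel G r p v) x * H x u r) := by
    intro u v p q
    unfold nabla2 nabla
    simp only [covDeriv_three, hN.christoffel, zero_mul, Finset.sum_const_zero, add_zero, sub_zero]
    simp only [covDeriv_two, asTensor]
    have s1 := hs p u (fun r => (r, v))
    have s2 := hs p v (fun r => (u, r))
    have t1 := es p u q (fun r => (r, v))
    have t2 := es p v q (fun r => (u, r))
    simp only at s1 s2 t1 t2
    have := pd_sub (hdd p u v) (s1.fun_add s2) q
    rw [pd_add s1 s2, t1, t2] at this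
    simp only [Matrix.cons_val_zero, Matrix.cons_val_one]
    rw [this]
    ring
  have hR : ∀ i j k p, riemannUp G i j k p x = pd i (christoffel G p j k) x
      - pd j (christoffel G p i k) x := by
    intro i j k p
    simp [riemannUp, hN.christoffel]
  have hsw : ∀ q p u v, pd q (christoffel G p u v) x = pd q (christoffel G p v u) x :=
    fun q p u v => pd_congr_on h.nondeg.isOpen (fun y hy => h.nondeg.christoffel_symm hy p u v) hx q
  have e1 : (∑ r, pd i (christoffel G r k j) x * H x r l)
      - (∑ r, pd j (christoffel G r k i) x * H x r l) =
      c * ((1 : Matrix (Fin n) (Fin n) ℝ) j k * H x i l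
        - (1 : Matrix (Fin n) (Fin n) ℝ) i k * H x j l) := by
    rw [← Finset.sum_sub_distrib]
    have : ∀ r, pd i (christoffel G r k j) x * H x r l - pd j (christoffel G r k i) x * H x r l
        = riemannUp G i j k r x * H x r l := by
      intro r; rw [hR, hsw i r k j, hsw j r k i]; ring
    simp only [this, h.nondeg.riemannUp_of_const hx (h.curv x hx), hN.eq_one, Matrix.one_apply]
    simp [mul_sub, sub_mul, Finset.sum_sub_distrib]
  have e2 : (∑ r, pd i (christoffel G r l j) x * H x r k)
      - (∑ r, pd j (christoffel G r l i) x * H x r k) =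
      c * ((1 : Matrix (Fin n) (Fin n) ℝ) j l * H x i k
        - (1 : Matrix (Fin n) (Fin n) ℝ) i l * H x j k) := by
    rw [← Finset.sum_sub_distrib]
    have : ∀ r, pd i (christoffel G r l j) x * H x r k - pd j (christoffel G r l i) x * H x r k
        = riemannUp G i j l r x * H x r k := by
      intro r; rw [hR, hsw i r l j, hsw j r l i]; ring
    simp only [this, h.nondeg.riemannUp_of_const hx (h.curv x hx), hN.eq_one, Matrix.one_apply]
    simp [mul_sub, sub_mul, Finset.sum_sub_distrib]
  -- The terms with a Christoffel symbol in the lower indices `k, l` are symmetric and cancel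
  -- between the two differences.
  have e3 : ∀ q u, (∑ r, pd q (christoffel G r k l) x * H x u r) =
      ∑ r, pd q (christoffel G r l k) x * H x u r := by
    intro q u; simp only [hsw q _ k l]
  simp only [dKoszul]
  rw [pd_comm (h.smooth k l) h.nondeg.isOpen hx i j, hn2 j l k i, hn2 j k l i, hn2 i l k j,
    hn2 i k l j, e3, e3]
  simp only [linRiem, kulkarniNomizu]
  linear_combination (1 / 2) * e1 - (1 / 2) * e2

theorem ricci_eq (h : SpaceFormTT Ω c G H) {x : Coord n} (hx : x ∈ Ω) (hN : NormalAt G x)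
    (j k : Fin n) : ricci G j k x = c * (n - 1) * (1 : Matrix (Fin n) (Fin n) ℝ) j k := by
  have e : ∀ i l : Fin n, (G x)⁻¹ i l * riemann G i j k l x =
      if i = l then c * (1 : Matrix (Fin n) (Fin n) ℝ) j k - (if i = k then
        c * (1 : Matrix (Fin n) (Fin n) ℝ) j k else 0) else 0 := by
    intro i l
    rw [h.curv x hx, hN.eq_one, inv_one]
    by_cases hil : i = l
    · subst hil
      by_cases hik : i = k
      · subst hik; simp
      · simp [hik]
    · simp [hil]
  simp only [ricci, e, Finset.sum_ite_eq, Finset.mem_univ, if_true, Finset.sum_sub_distrib,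
    Finset.sum_const, Finset.card_univ, Fintype.card_fin, Finset.sum_ite_eq', nsmul_eq_mul]
  ring

theorem scalarCurv_eq (h : SpaceFormTT Ω c G H) {x : Coord n} (hx : x ∈ Ω) (hN : NormalAt G x) :
    scalarCurv G x = c * n * (n - 1) := by
  simp only [scalarCurv, h.ricci_eq hx hN, hN.eq_one, inv_one, Matrix.one_apply]
  simp
  ring

/-- Three contributions: the varying inverse metric gives `c h`, the trace of `linRiem` gives `(cn h
- Δh)/2`, and the trace of `(c/2) h ∧ g` gives `(c/2)(n-2) h`. -/
theorem hasDerivAt_ricci (h : SpaceFormTT Ω c G H) {x : Coord n} (hx : x ∈ Ω) (hN : NormalAt G x)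
    (j k : Fin n) :
    HasDerivAt (fun t : ℝ => ricci (fun y => G y + t • H y) j k x)
      (c * n * H x j k - (1 / 2) * ∑ i, nabla2 G H x ![j, k, i, i]) 0 := by
  have J := h.jet hx hN
  have hg : ∀ a b, HasDerivAt (fun t : ℝ => (G x + t • H x)⁻¹ a b) (-H x a b) 0 := by
    rw [hN.eq_one]; exact hasDerivAt_inv_one_add (H x)
  have h2 := HasDerivAt.fun_sum (u := Finset.univ) fun i _ =>
    HasDerivAt.fun_sum (u := Finset.univ) fun l _ =>
      (hg i l).fun_mul (hasDerivAt_riemann h.nondeg h.smooth h.symm hx hN i j k l)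
  refine h2.congr_deriv ?_
  simp only [zero_smul, add_zero, h.dKoszul_eq hx hN]
  have e0 : ∀ i l, -H x i l * riemann G i j k l x +
      (G x)⁻¹ i l * (linRiem (fun i j k l => nabla2 G H x ![i, j, k, l]) i j k l
        + c / 2 * kulkarniNomizu (H x) 1 i j k l) =
      -H x i l * riemann G i j k l x +
      if i = l then (linRiem (fun i j k l => nabla2 G H x ![i, j, k, l]) i j k l
        + c / 2 * kulkarniNomizu (H x) 1 i j k l) else 0 := by
    intro i l
    rw [hN.eq_one, inv_one, Matrix.one_apply]
    split_ifs <;> ring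
  simp only [e0, Finset.sum_add_distrib, Finset.sum_ite_eq, Finset.mem_univ, if_true]
  have t1 : ∑ i, linRiem (fun i j k l => nabla2 G H x ![i, j, k, l]) i j k i =
      (1 / 2) * (c * n * H x j k - ∑ i, nabla2 G H x ![j, k, i, i]) := by
    rw [← J.linRiem_trace]
    exact Finset.sum_congr rfl fun i _ => by
      rw [linRiem_antisymm_left, linRiem_antisymm_right, neg_neg]
  have t2 : ∑ i, c / 2 * kulkarniNomizu (H x) 1 i j k i = c / 2 * ((n - 2) * H x j k) := by
    rw [← Finset.mul_sum]
    congr 1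
    simp only [kulkarniNomizu, Finset.sum_add_distrib, Finset.sum_sub_distrib, ← Finset.sum_mul,
      J.h_trace]
    simp [Matrix.one_apply]
    ring
  have t3 : ∑ i, ∑ l, -H x i l * riemann G i j k l x = c * H x j k := by
    have e : ∀ i l : Fin n, -H x i l * riemann G i j k l x =
        (if i = l then -(c * (1 : Matrix (Fin n) (Fin n) ℝ) j k) * H x i i else 0) +
        (if i = k then (if j = l then c * H x j k else 0) else 0) := by
      intro i l
      rw [h.curv x hx, hN.eq_one, h.symm x hx j k]
      simp only [Matrix.one_apply]
      split_ifs <;> simp_all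
      all_goals ring
    simp only [e, Finset.sum_add_distrib, Finset.sum_ite_eq, Finset.sum_ite_eq', Finset.mem_univ,
      if_true, ← Finset.mul_sum, J.h_trace, mul_zero, zero_add, Finset.sum_ite_irrel,
      Finset.sum_const_zero]
  rw [t1, t2, t3]
  ring

/-- Every contribution is a multiple of `tr h` or of `tr Δh`, and both vanish. -/
theorem hasDerivAt_scalarCurv (h : SpaceFormTT Ω c G H) {x : Coord n} (hx : x ∈ Ω)
    (hN : NormalAt G x) :
    HasDerivAt (fun t : ℝ => scalarCurv (fun y => G y + t • H y) x) 0 0 := by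
  have J := h.jet hx hN
  have hg : ∀ a b, HasDerivAt (fun t : ℝ => (G x + t • H x)⁻¹ a b) (-H x a b) 0 := by
    rw [hN.eq_one]; exact hasDerivAt_inv_one_add (H x)
  have h2 := HasDerivAt.fun_sum (u := Finset.univ) fun i _ =>
    HasDerivAt.fun_sum (u := Finset.univ) fun l _ =>
      (hg i l).fun_mul (h.hasDerivAt_ricci hx hN i l)
  refine h2.congr_deriv ?_
  simp only [zero_smul, add_zero, h.ricci_eq hx hN, hN.eq_one, inv_one]
  have e0 : ∀ i l, -H x i l * (c * (n - 1) * (1 : Matrix (Fin n) (Fin n) ℝ) i l) +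
      (1 : Matrix (Fin n) (Fin n) ℝ) i l *
        (c * n * H x i l - (1 / 2) * ∑ m, nabla2 G H x ![i, l, m, m]) =
      if i = l then -H x i l * (c * (n - 1)) +
        (c * n * H x i l - (1 / 2) * ∑ m, nabla2 G H x ![i, l, m, m]) else 0 := by
    intro i l
    rw [Matrix.one_apply]
    split_ifs <;> ring
  simp only [e0, Finset.sum_ite_eq, Finset.mem_univ, if_true, Finset.sum_add_distrib,
    Finset.sum_sub_distrib, ← Finset.mul_sum, ← Finset.sum_mul, Finset.sum_neg_distrib]
  have t1 : ∑ i, H x i i = 0 := J.h_trace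
  have t2 : ∑ i, ∑ m, nabla2 G H x ![i, i, m, m] = 0 := by
    rw [Finset.sum_comm]
    exact Finset.sum_eq_zero fun m _ => J.b_trace m m
  rw [t1, t2]
  ring

theorem hasDerivAt_schouten (h : SpaceFormTT Ω c G H) {x : Coord n} (hx : x ∈ Ω)
    (hN : NormalAt G x) (hn : (n : ℝ) - 1 ≠ 0) (i j : Fin n) :
    HasDerivAt (fun t : ℝ => schouten (fun y => G y + t • H y) x i j)
      (SpaceFormJet.linSchouten c (fun i j => H x i j)
        (fun i j k l => nabla2 G H x ![i, j, k, l]) i j) 0 := by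
  have h1 : HasDerivAt (fun t : ℝ => (G x + t • H x) i j) (H x i j) 0 := by
    simpa using ((hasDerivAt_id (0 : ℝ)).mul_const (H x i j)).const_add (G x i j)
  have h2 := ((h.hasDerivAt_ricci hx hN i j).fun_sub
    (((h.hasDerivAt_scalarCurv hx hN).div_const (2 * ((n : ℝ) - 1))).fun_mul h1)).const_mul
      (1 / ((n : ℝ) - 2))
  refine h2.congr_deriv ?_
  simp only [zero_smul, add_zero, h.scalarCurv_eq hx hN, SpaceFormJet.linSchouten, Matrix.of_apply]
  congr 1
  field_simp
  ring

theorem schouten_eq (h : SpaceFormTT Ω c G H) {x : Coord n} (hx : x ∈ Ω)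
    (hN : NormalAt G x) (hn : (n : ℝ) - 1 ≠ 0) (hn' : (n : ℝ) - 2 ≠ 0) (i j : Fin n) :
    schouten G x i j = c / 2 * (1 : Matrix (Fin n) (Fin n) ℝ) i j := by
  simp only [schouten, Matrix.of_apply, h.ricci_eq hx hN, h.scalarCurv_eq hx hN, hN.eq_one]
  field_simp
  ring

/-- Since `A = (c/2) g`, varying the second factor of `A ∧ g` gives `(c/2) g ∧ h`, which cancels the
zeroth-order part of the linearized Riemann tensor. -/
theorem hasDerivAt_weyl (h : SpaceFormTT Ω c G H) {x : Coord n} (hx : x ∈ Ω)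
    (hN : NormalAt G x) (hn : (n : ℝ) - 1 ≠ 0) (hn' : (n : ℝ) - 2 ≠ 0) (I : Fin 4 → Fin n) :
    HasDerivAt (fun t : ℝ => weyl (fun y => G y + t • H y) x I)
      (linRiem (fun i j k l => nabla2 G H x ![i, j, k, l]) (I 0) (I 1) (I 2) (I 3)
        - kulkarniNomizu (SpaceFormJet.linSchouten c (fun i j => H x i j)
          (fun i j k l => nabla2 G H x ![i, j, k, l])) 1 (I 0) (I 1) (I 2) (I 3)) 0 := by
  have h1 : ∀ i j, HasDerivAt (fun t : ℝ => (G x + t • H x) i j) (H x i j) 0 := by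
    intro i j
    simpa using ((hasDerivAt_id (0 : ℝ)).mul_const (H x i j)).const_add (G x i j)
  have hS := h.hasDerivAt_schouten hx hN hn
  have hR := hasDerivAt_riemann h.nondeg h.smooth h.symm hx hN (I 0) (I 1) (I 2) (I 3)
  rw [h.dKoszul_eq hx hN] at hR
  have h2 := hR.fun_sub (((((hS (I 0) (I 3)).fun_mul (h1 (I 1) (I 2))).fun_add
    ((hS (I 1) (I 2)).fun_mul (h1 (I 0) (I 3)))).fun_sub
    ((hS (I 0) (I 2)).fun_mul (h1 (I 1) (I 3)))).fun_sub
    ((hS (I 1) (I 3)).fun_mul (h1 (I 0) (I 2))))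
  refine h2.congr_deriv ?_
  simp only [zero_smul, add_zero, h.schouten_eq hx hN hn hn', hN.eq_one, kulkarniNomizu]
  ring

end SpaceFormTT

/-! ### Fluxes and the pointwise identity -/

/-- The covector field whose value on `ν` is the linear combination, with coefficients `a`, of the
contractions of `g⁻¹ ⊗ ⋯ ⊗ g⁻¹ ⊗ T ⊗ ν`. -/
def flux (G : MatField n) (k : ℕ) (T : TensorField n (2 * k + 1))
    (a : Equiv.Perm (Fin (2 * k + 1)) → ℝ) : TensorField n 1 := fun x I =>
  ∑ σ, a σ * contraction G k T (Pi.single (I 0) 1) σ x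

/-- The divergence `g^{ij} Y_{i;j}`. -/
def covectorDiv (G : MatField n) (Y : TensorField n 1) (x : Coord n) : ℝ :=
  ∑ i, ∑ j, (G x)⁻¹ i j * covDeriv G Y x ![i, j]

theorem normSq_of_inv_eq_one {G : MatField n} {k : ℕ} (T : TensorField n k) {x : Coord n}
    (hG : (G x)⁻¹ = 1) : normSq G T x = ∑ I, T x I ^ 2 := by
  simp only [normSq, hG]
  refine Finset.sum_congr rfl fun I _ => ?_
  rw [Finset.sum_eq_single I]
  · simp [sq]
  · intro K _ hK
    obtain ⟨s, hs⟩ := Function.ne_iff.1 hK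
    have : ∏ s, (1 : Matrix (Fin n) (Fin n) ℝ) (I s) (K s) = 0 :=
      Finset.prod_eq_zero (Finset.mem_univ s) (Matrix.one_apply_ne hs.symm)
    rw [this]
    ring
  · simp

theorem sum_one_mul_cons {k : ℕ} (F : (Fin (k + 2) → Fin n) → ℝ) :
    ∑ I : Fin (k + 2) → Fin n, (1 : Matrix (Fin n) (Fin n) ℝ) (I 0) (I 1) * F I =
      ∑ p, ∑ I : Fin k → Fin n, F (Fin.cons p (Fin.cons p I)) := by
  refine (sum_fin_cons (k := k + 1) _).trans (Finset.sum_congr rfl fun p _ => ?_)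
  refine (sum_fin_cons (k := k) _).trans ?_
  rw [Finset.sum_eq_single p]
  · refine Finset.sum_congr rfl fun I _ => ?_
    rw [show (Fin.cons p (Fin.cons p I : Fin (k + 1) → Fin n) : Fin (k + 2) → Fin n) 1 = p from rfl,
      Fin.cons_zero, Matrix.one_apply_eq, one_mul]
  · intro q _ hq
    refine Finset.sum_eq_zero fun I _ => ?_
    rw [show (Fin.cons p (Fin.cons q I : Fin (k + 1) → Fin n) : Fin (k + 2) → Fin n) 1 = q from rfl,
      Fin.cons_zero, Matrix.one_apply_ne hq.symm, zero_mul]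
  · simp

theorem sum_single_mul (m : Fin n) (F : Fin n → ℝ) :
    ∑ b, (Pi.single m (1 : ℝ) : Fin n → ℝ) b * F b = F m := by
  rw [Finset.sum_eq_single m] <;> simp +contextual [Pi.single_eq_of_ne]

theorem contraction_two_of_inv_eq_one {G : MatField n} (T : TensorField n 5) {x : Coord n}
    (hG : (G x)⁻¹ = 1) (m : Fin n) (σ : Equiv.Perm (Fin 5)) :
    contraction G 2 T (Pi.single m 1) σ x =
      ∑ p, ∑ q, T x (fun s => (![p, p, q, q, m] : Fin 5 → Fin n) (σ s)) := by
  simp only [contraction, hG, Fin.prod_univ_two, mul_assoc]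
  refine (sum_one_mul_cons (k := 3) _).trans (Finset.sum_congr rfl fun p _ => ?_)
  refine (sum_one_mul_cons (k := 1) _).trans (Finset.sum_congr rfl fun q _ => ?_)
  exact (sum_fin_one_fun _).trans (sum_single_mul m fun b => T x (fun s => (![p, p, q, q, b] : Fin 5 → Fin n) (σ s)))

theorem contraction_three_of_inv_eq_one {G : MatField n} (T : TensorField n 7) {x : Coord n}
    (hG : (G x)⁻¹ = 1) (m : Fin n) (σ : Equiv.Perm (Fin 7)) :
    contraction G 3 T (Pi.single m 1) σ x =
      ∑ p, ∑ q, ∑ r, T x (fun s => (![p, p, q, q, r, r, m] : Fin 7 → Fin n) (σ s)) := by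
  simp only [contraction, hG, Fin.prod_univ_three, mul_assoc]
  refine (sum_one_mul_cons (k := 5) _).trans (Finset.sum_congr rfl fun p _ => ?_)
  refine (sum_one_mul_cons (k := 3) _).trans (Finset.sum_congr rfl fun q _ => ?_)
  refine (sum_one_mul_cons (k := 1) _).trans (Finset.sum_congr rfl fun r _ => ?_)
  exact (sum_fin_one_fun _).trans (sum_single_mul m fun b => T x (fun s => (![p, p, q, q, r, r, b] : Fin 7 → Fin n) (σ s)))

theorem SmoothTensor.tensorProd {Ω : Set (Coord n)} {a b : ℕ} {S : TensorField n a}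
    {T : TensorField n b} (hS : SmoothTensor Ω S) (hT : SmoothTensor Ω T) :
    SmoothTensor Ω (tensorProd S T) := fun _ => (hS _).mul (hT _)

theorem SmoothTensor.contraction {Ω : Set (Coord n)} {G : MatField n} (hG : NondegOn Ω G) {k : ℕ}
    {T : TensorField n (2 * k + 1)} (hT : SmoothTensor Ω T) (ν : Fin n → ℝ)
    (σ : Equiv.Perm (Fin (2 * k + 1))) : ContDiffOn ℝ ∞ (contraction G k T ν σ) Ω :=
  ContDiffOn.sum fun _ _ => ((contDiffOn_prod fun _ _ => hG.inv_smooth _ _).mul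
    contDiffOn_const).mul (hT _)

theorem SmoothTensor.flux {Ω : Set (Coord n)} {G : MatField n} (hG : NondegOn Ω G) {k : ℕ}
    {T : TensorField n (2 * k + 1)} (hT : SmoothTensor Ω T)
    (a : Equiv.Perm (Fin (2 * k + 1)) → ℝ) : SmoothTensor Ω (flux G k T a) := fun _ =>
  ContDiffOn.sum fun _ _ => contDiffOn_const.mul (hT.contraction hG _ _)

namespace NormalAt

theorem covectorDiv_eq {G : MatField n} {x : Coord n} (hN : NormalAt G x) (Y : TensorField n 1) :
    covectorDiv G Y x = ∑ m, WeylVariation.pd m (fun y => Y y ![m]) x := by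
  simp [covectorDiv, hN.eq_one, covDeriv_one, hN.christoffel, Matrix.one_apply]

/-- The inverse metrics have zero first derivatives at a normal point, so only the tensor is
differentiated. -/
theorem pd_contraction {Ω : Set (Coord n)} {G : MatField n} (hG : NondegOn Ω G) {x : Coord n}
    (hx : x ∈ Ω) (hN : NormalAt G x) {k : ℕ} {T : TensorField n (2 * k + 1)}
    (hT : SmoothTensor Ω T) (ν : Fin n → ℝ) (σ : Equiv.Perm (Fin (2 * k + 1))) (m : Fin n) :
    WeylVariation.pd m (contraction G k T ν σ) x =
      contraction G k (fun y I => WeylVariation.pd m (fun z => T z I) y) ν σ x := by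
  have hTd : ∀ I, DifferentiableAt ℝ (fun y => T y I) x := fun I =>
    ContDiffOn.diffAt (hT I) hG.isOpen hx
  have hid : ∀ i j, DifferentiableAt ℝ (fun y => (G y)⁻¹ i j) x := fun i j => hG.inv_diffAt hx i j
  have hP : ∀ I : Fin (2 * k + 1) → Fin n, DifferentiableAt ℝ (fun y =>
      ∏ s : Fin k, (G y)⁻¹ (I ⟨2 * s, by omega⟩) (I ⟨2 * s + 1, by omega⟩)) x := fun I =>
    (HasFDerivAt.finsetProd fun s _ => (hid _ _).hasFDerivAt).differentiableAt
  have hP0 : ∀ I : Fin (2 * k + 1) → Fin n, WeylVariation.pd m (fun y =>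
      ∏ s : Fin k, (G y)⁻¹ (I ⟨2 * s, by omega⟩) (I ⟨2 * s + 1, by omega⟩)) x = 0 := fun I => by
    rw [pd_prod _ fun s _ => hid _ _]
    simp [hN.pd_inv hG hx]
  unfold contraction
  rw [pd_sum _ fun I _ => ((hP I).mul_const _).fun_mul (hTd _)]
  refine Finset.sum_congr rfl fun I _ => ?_
  rw [pd_mul ((hP I).mul_const _) (hTd _), pd_mul (hP I) (differentiableAt_const _), hP0, pd_const]
  ring

theorem pd_tensorProd {G : MatField n} {x : Coord n} (hN : NormalAt G x) {a b : ℕ}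
    {S : TensorField n a} {T : TensorField n b} (hS : ∀ I, DifferentiableAt ℝ (fun y => S y I) x)
    (hT : ∀ I, DifferentiableAt ℝ (fun y => T y I) x) (I : Fin (a + b) → Fin n) (m : Fin n) :
    WeylVariation.pd m (fun y => tensorProd S T y I) x =
      WeylVariation.covDeriv G S x (Fin.snoc (fun s => I (Fin.castAdd b s)) m) *
          T x (fun s => I (Fin.natAdd a s))
        + S x (fun s => I (Fin.castAdd b s)) *
          WeylVariation.covDeriv G T x (Fin.snoc (fun s => I (Fin.natAdd a s)) m) := by
  rw [hN.covDeriv, hN.covDeriv]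
  exact pd_mul (hS _) (hT _) m

theorem covectorDiv_flux {Ω : Set (Coord n)} {G : MatField n} (hG : NondegOn Ω G) {x : Coord n}
    (hx : x ∈ Ω) (hN : NormalAt G x) {k : ℕ} {T : TensorField n (2 * k + 1)}
    (hT : SmoothTensor Ω T) (a : Equiv.Perm (Fin (2 * k + 1)) → ℝ) :
    covectorDiv G (flux G k T a) x = ∑ σ, a σ * ∑ m,
      contraction G k (fun y I => WeylVariation.pd m (fun z => T z I) y) (Pi.single m 1) σ x := by
  rw [hN.covectorDiv_eq]
  simp only [flux, Finset.mul_sum]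
  rw [Finset.sum_comm]
  refine Finset.sum_congr rfl fun m _ => ?_
  have hd : ∀ σ, DifferentiableAt ℝ (contraction G k T (Pi.single m 1) σ) x := fun σ =>
    ContDiffOn.diffAt (hT.contraction hG _ σ) hG.isOpen hx
  refine (pd_sum _ (fun σ _ => (hd σ).const_mul (a σ)) m).trans (Finset.sum_congr rfl fun σ _ => ?_)
  rw [pd_const_mul (hd σ), hN.pd_contraction hG hx hT]

end NormalAt

/-! The ways to match the slots of `∇² h ⊗ ∇ h`, and of `∇ h ⊗ h`, with those of the metrics. -/

/-- The first list sends each slot of the tensor to an index position; positions `0,1`, then `2,3`,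
then `4,5` are contracted by inverse metrics, and `6` belongs to the vector. Writing `m` for the
latter, `pairing0` to `pairing5` stand for `h_{pq;rm} h_{pq;r}`, `(Δh)_{pq} h_{pq;m}`, `h_{pq;rm}
h_{pr;q}`, `(Δh)_{pq} h_{pm;q}`, `h_{mp;qr} h_{rp;q}` and `h_{mp;qr} h_{rq;p}`. -/
def pairing0 : Equiv.Perm (Fin 7) :=
  ⟨![0, 2, 4, 6, 1, 3, 5], ![0, 4, 1, 5, 2, 6, 3], by decide, by decide⟩

def pairing1 : Equiv.Perm (Fin 7) :=
  ⟨![0, 2, 4, 5, 1, 3, 6], ![0, 4, 1, 5, 2, 3, 6], by decide, by decide⟩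

def pairing2 : Equiv.Perm (Fin 7) :=
  ⟨![0, 2, 4, 6, 1, 5, 3], ![0, 4, 1, 6, 2, 5, 3], by decide, by decide⟩

def pairing3 : Equiv.Perm (Fin 7) :=
  ⟨![0, 2, 4, 5, 1, 6, 3], ![0, 4, 1, 6, 2, 3, 5], by decide, by decide⟩

def pairing4 : Equiv.Perm (Fin 7) :=
  ⟨![6, 0, 2, 4, 5, 1, 3], ![1, 5, 2, 6, 3, 4, 0], by decide, by decide⟩

def pairing5 : Equiv.Perm (Fin 7) :=
  ⟨![6, 0, 2, 4, 5, 3, 1], ![1, 6, 2, 5, 3, 4, 0], by decide, by decide⟩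

/-- Now position `4` belongs to the vector: this is `h_{pm;q} h_{pq}`, and `pairing7` is `h_{pq;m}
h_{pq}`. -/
def pairing6 : Equiv.Perm (Fin 5) :=
  ⟨![0, 4, 2, 1, 3], ![0, 3, 2, 4, 1], by decide, by decide⟩

def pairing7 : Equiv.Perm (Fin 5) :=
  ⟨![0, 2, 4, 1, 3], ![0, 3, 1, 4, 2], by decide, by decide⟩

open Classical in
/-- The coefficients of the contractions of `∇² h ⊗ ∇ h`. -/
def coeffTwo : Equiv.Perm (Fin 7) → ℝ := fun σ =>
  -- Pairings 0, 2, 4, 5 carry the signs of the four products in `sum_linRiem_sq`. Pairings 1 and 3,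
  -- with signs opposite to 0 and 2, move a derivative back from the resulting `∇Δh`.
  (if σ = pairing0 then 1 else 0) - (if σ = pairing1 then 1 else 0) - (if σ = pairing2 then 1 else 0)
    + (if σ = pairing3 then 1 else 0) - (if σ = pairing4 then 1 else 0) + (if σ = pairing5 then 1 else 0)

open Classical in
/-- The coefficients of the contractions of `∇ h ⊗ h`. -/
def coeffOne (n : ℕ) (c : ℝ) : Equiv.Perm (Fin 5) → ℝ := fun σ =>
  -- These are the coefficients of `h_{jl;k} h_{jk;l}` and of `⟨Δh, h⟩` left over by `fluxTwo`:
  -- `-cn` comes from `|R|²`, and `2cn/(n-2)` from the cross term of `-|cn h - Δh|²/(n-2)`.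
  -3 * c * (if σ = pairing6 then 1 else 0)
    + (-(c * n) + 2 * c * n / ((n : ℝ) - 2)) * (if σ = pairing7 then 1 else 0)

theorem sum_coeffTwo_mul (F : Equiv.Perm (Fin 7) → ℝ) : ∑ σ, coeffTwo σ * F σ =
    F pairing0 - F pairing1 - F pairing2 + F pairing3 - F pairing4 + F pairing5 := by
  classical
  simp only [coeffTwo, add_mul, sub_mul, Finset.sum_add_distrib, Finset.sum_sub_distrib,
    ite_mul, one_mul, zero_mul, Finset.sum_ite_eq', Finset.mem_univ, if_true]

theorem sum_coeffOne_mul (c : ℝ) (F : Equiv.Perm (Fin 5) → ℝ) : ∑ σ, coeffOne n c σ * F σ =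
    -3 * c * F pairing6 + (-(c * n) + 2 * c * n / ((n : ℝ) - 2)) * F pairing7 := by
  classical
  simp only [coeffOne, add_mul, Finset.sum_add_distrib, mul_assoc, ← Finset.mul_sum,
    ite_mul, one_mul, zero_mul, Finset.sum_ite_eq', Finset.mem_univ, if_true]

namespace SpaceFormTT

variable {Ω : Set (Coord n)} {c : ℝ} {G H : MatField n}

theorem smooth_nabla2_nabla (h : SpaceFormTT Ω c G H) :
    SmoothTensor Ω (tensorProd (nabla2 G H) (nabla G H)) :=
  h.smooth_nabla2.tensorProd h.smooth_nabla

theorem smooth_nabla_asTensor (h : SpaceFormTT Ω c G H) :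
    SmoothTensor Ω (tensorProd (nabla G H) (asTensor H)) :=
  h.smooth_nabla.tensorProd h.smooth.asTensor

theorem contraction_two_normal (h : SpaceFormTT Ω c G H) {x : Coord n} (hx : x ∈ Ω)
    (hN : NormalAt G x) (σ : Equiv.Perm (Fin 7)) (m : Fin n) :
    contraction G 3 (fun y I => pd m (fun z =>
      (tensorProd (nabla2 G H) (nabla G H) : TensorField n (4 + 3)) z I) y) (Pi.single m 1) σ x =
      ∑ p, ∑ q, ∑ r, (let v : Fin 7 → Fin n := ![p, p, q, q, r, r, m]
        nabla3 G H x ![v (σ 0), v (σ 1), v (σ 2), v (σ 3), m] * nabla G H x ![v (σ 4), v (σ 5), v (σ 6)] +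
        nabla2 G H x ![v (σ 0), v (σ 1), v (σ 2), v (σ 3)] * nabla2 G H x ![v (σ 4), v (σ 5), v (σ 6), m]) := by
  rw [contraction_three_of_inv_eq_one _ (by rw [hN.eq_one, inv_one])]
  refine Finset.sum_congr rfl fun p _ => Finset.sum_congr rfl fun q _ =>
    Finset.sum_congr rfl fun r _ => (hN.pd_tensorProd
      (fun I => ContDiffOn.diffAt (h.smooth_nabla2 I) h.nondeg.isOpen hx)
      (fun I => ContDiffOn.diffAt (h.smooth_nabla I) h.nondeg.isOpen hx) _ m).trans ?_
  congr 3 <;> (funext s; fin_cases s <;> rfl)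

theorem contraction_one_normal (h : SpaceFormTT Ω c G H) {x : Coord n} (hx : x ∈ Ω)
    (hN : NormalAt G x) (σ : Equiv.Perm (Fin 5)) (m : Fin n) :
    contraction G 2 (fun y I => pd m (fun z =>
      (tensorProd (nabla G H) (asTensor H) : TensorField n (3 + 2)) z I) y) (Pi.single m 1) σ x =
      ∑ p, ∑ q, (let v : Fin 5 → Fin n := ![p, p, q, q, m]
        nabla2 G H x ![v (σ 0), v (σ 1), v (σ 2), m] * asTensor H x ![v (σ 3), v (σ 4)] +
        nabla G H x ![v (σ 0), v (σ 1), v (σ 2)] * nabla G H x ![v (σ 3), v (σ 4), m]) := by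
  rw [contraction_two_of_inv_eq_one _ (by rw [hN.eq_one, inv_one])]
  refine Finset.sum_congr rfl fun p _ => Finset.sum_congr rfl fun q _ => (hN.pd_tensorProd
      (fun I => ContDiffOn.diffAt (h.smooth_nabla I) h.nondeg.isOpen hx)
      (fun I => ContDiffOn.diffAt (h.smooth.asTensor I) h.nondeg.isOpen hx) _ m).trans ?_
  congr 3 <;> (funext s; fin_cases s <;> rfl)

theorem covectorDiv_two (h : SpaceFormTT Ω c G H) {x : Coord n} (hx : x ∈ Ω)
    (hN : NormalAt G x) :
    covectorDiv G (flux G 3 (tensorProd (nabla2 G H) (nabla G H) : TensorField n (4 + 3))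
      coeffTwo) x =
      (∑ m, ∑ p, ∑ q, ∑ r, (nabla3 G H x ![p, q, r, m, m] * nabla G H x ![p, q, r]
        + nabla2 G H x ![p, q, r, m] * nabla2 G H x ![p, q, r, m]))
      - (∑ m, ∑ p, ∑ q, ∑ r, (nabla3 G H x ![p, q, r, r, m] * nabla G H x ![p, q, m]
        + nabla2 G H x ![p, q, r, r] * nabla2 G H x ![p, q, m, m]))
      - (∑ m, ∑ p, ∑ q, ∑ r, (nabla3 G H x ![p, q, r, m, m] * nabla G H x ![p, r, q]
        + nabla2 G H x ![p, q, r, m] * nabla2 G H x ![p, r, q, m]))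
      + (∑ m, ∑ p, ∑ q, ∑ r, (nabla3 G H x ![p, q, r, r, m] * nabla G H x ![p, m, q]
        + nabla2 G H x ![p, q, r, r] * nabla2 G H x ![p, m, q, m]))
      - (∑ m, ∑ p, ∑ q, ∑ r, (nabla3 G H x ![m, p, q, r, m] * nabla G H x ![r, p, q]
        + nabla2 G H x ![m, p, q, r] * nabla2 G H x ![r, p, q, m]))
      + (∑ m, ∑ p, ∑ q, ∑ r, (nabla3 G H x ![m, p, q, r, m] * nabla G H x ![r, q, p]
        + nabla2 G H x ![m, p, q, r] * nabla2 G H x ![r, q, p, m])) := by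
  rw [hN.covectorDiv_flux h.nondeg hx (k := 3) h.smooth_nabla2_nabla, sum_coeffTwo_mul]
  simp only [h.contraction_two_normal hx hN]
  rfl

theorem covectorDiv_one (h : SpaceFormTT Ω c G H) {x : Coord n} (hx : x ∈ Ω)
    (hN : NormalAt G x) :
    covectorDiv G (flux G 2 (tensorProd (nabla G H) (asTensor H) : TensorField n (3 + 2))
      (coeffOne n c)) x =
      -3 * c * (∑ m, ∑ p, ∑ q, (nabla2 G H x ![p, m, q, m] * H x p q
        + nabla G H x ![p, m, q] * nabla G H x ![p, q, m]))
      + (-(c * n) + 2 * c * n / ((n : ℝ) - 2)) * (∑ m, ∑ p, ∑ q,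
        (nabla2 G H x ![p, q, m, m] * H x p q + nabla G H x ![p, q, m] * nabla G H x ![p, q, m])) := by
  rw [hN.covectorDiv_flux h.nondeg hx (k := 2) h.smooth_nabla_asTensor, sum_coeffOne_mul]
  simp only [h.contraction_one_normal hx hN]
  rfl

end SpaceFormTT

/-! ### The pointwise identity -/

theorem sum_four_perm_jlk (F : Fin n → Fin n → Fin n → Fin n → ℝ) :
    ∑ m, ∑ p, ∑ q, ∑ r, F m p q r = ∑ i, ∑ j, ∑ k, ∑ l, F i j l k :=
  Finset.sum_congr rfl fun _ _ => Finset.sum_congr rfl fun _ _ => Finset.sum_comm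

theorem sum_four_perm_kjli (F : Fin n → Fin n → Fin n → Fin n → ℝ) :
    ∑ m, ∑ p, ∑ q, ∑ r, F m p q r = ∑ i, ∑ j, ∑ k, ∑ l, F k j l i := by
  simp only [← Fintype.sum_prod_type']
  exact Fintype.sum_equiv (M := ℝ)
    (⟨fun z => (z.2.2.2, z.2.1, z.1, z.2.2.1), fun z => (z.2.2.1, z.2.1, z.2.2.2, z.1),
      fun _ => rfl, fun _ => rfl⟩ : Fin n × Fin n × Fin n × Fin n ≃ Fin n × Fin n × Fin n × Fin n)
    _ _ fun _ => rfl

theorem sum_four_perm_jlki (F : Fin n → Fin n → Fin n → Fin n → ℝ) :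
    ∑ m, ∑ p, ∑ q, ∑ r, F m p q r = ∑ i, ∑ j, ∑ k, ∑ l, F j l k i := by
  simp only [← Fintype.sum_prod_type']
  exact Fintype.sum_equiv (M := ℝ)
    (⟨fun z => (z.2.2.2, z.1, z.2.2.1, z.2.1), fun z => (z.2.1, z.2.2.2, z.2.2.1, z.1),
      fun _ => rfl, fun _ => rfl⟩ : Fin n × Fin n × Fin n × Fin n ≃ Fin n × Fin n × Fin n × Fin n)
    _ _ fun _ => rfl

namespace SpaceFormJet

variable {c : ℝ} {h : Fin n → Fin n → ℝ} {a : Fin n → Fin n → Fin n → ℝ}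
  {b : Fin n → Fin n → Fin n → Fin n → ℝ} {t : Fin n → Fin n → Fin n → Fin n → Fin n → ℝ}

/-- The sum of squares of the linearized Weyl tensor, up to divergences. -/
theorem sum_linWeyl_sq_eq (J : SpaceFormJet c h a b t) (hn : (n : ℝ) - 2 ≠ 0) :
    ∑ i, ∑ j, ∑ k, ∑ l, (linRiem b i j k l - kulkarniNomizu (linSchouten c h b) 1 i j k l) ^ 2 =
      ((n : ℝ) - 3) / (n - 2) * ((∑ i, ∑ j, (∑ k, b i j k k) ^ 2)
        + c * (n + 2) * (∑ i, ∑ j, ∑ k, a i j k ^ 2) + 2 * c ^ 2 * n * ∑ i, ∑ j, h i j ^ 2)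
      + (-3 * c * (∑ m, ∑ p, ∑ q, (b p m q m * h p q + a p m q * a p q m))
        + (-(c * n) + 2 * c * n / ((n : ℝ) - 2)) *
          (∑ m, ∑ p, ∑ q, (b p q m m * h p q + a p q m * a p q m)))
      + ((∑ m, ∑ p, ∑ q, ∑ r, (t p q r m m * a p q r + b p q r m * b p q r m))
        - (∑ m, ∑ p, ∑ q, ∑ r, (t p q r r m * a p q m + b p q r r * b p q m m))
        - (∑ m, ∑ p, ∑ q, ∑ r, (t p q r m m * a p r q + b p q r m * b p r q m))
        + (∑ m, ∑ p, ∑ q, ∑ r, (t p q r r m * a p m q + b p q r r * b p m q m))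
        - (∑ m, ∑ p, ∑ q, ∑ r, (t m p q r m * a r p q + b m p q r * b r p q m))
        + (∑ m, ∑ p, ∑ q, ∑ r, (t m p q r m * a r q p + b m p q r * b r q p m))) := by
  rw [J.sum_linWeyl_sq hn, sum_linRiem_sq]
  simp only [Finset.sum_add_distrib]
  -- the terms with two second derivatives
  have b0 : ∑ m, ∑ p, ∑ q, ∑ r, b p q r m * b p q r m =
      ∑ i, ∑ j, ∑ k, ∑ l, b j l k i * b j l k i := sum_four_perm_jlk _
  have b1 : ∑ m, ∑ p, ∑ q, ∑ r, b p q r r * b p q m m = ∑ i, ∑ l, (∑ k, b i l k k) ^ 2 := by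
    rw [Finset.sum_comm]
    refine Finset.sum_congr rfl fun p _ => ?_
    rw [Finset.sum_comm]
    refine Finset.sum_congr rfl fun q _ => ?_
    simp only [← Finset.sum_mul, ← Finset.mul_sum, sq]
  have b2 : ∑ m, ∑ p, ∑ q, ∑ r, b p q r m * b p r q m =
      ∑ i, ∑ j, ∑ k, ∑ l, b j l k i * b j k l i := sum_four_perm_jlk _
  have b3 : ∑ m, ∑ p, ∑ q, ∑ r, b p q r r * b p m q m =
      c * n * ∑ p, ∑ q, (∑ r, b p q r r) * h p q := by
    rw [Finset.sum_comm, Finset.mul_sum]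
    refine Finset.sum_congr rfl fun p _ => ?_
    rw [Finset.sum_comm, Finset.mul_sum]
    refine Finset.sum_congr rfl fun q _ => ?_
    simp only [← Finset.sum_mul, ← Finset.mul_sum]
    rw [J.sum_b']
    ring
  have b4 : ∑ m, ∑ p, ∑ q, ∑ r, b m p q r * b r p q m =
      ∑ i, ∑ j, ∑ k, ∑ l, b j l k i * b i l k j := sum_four_perm_jlki _
  have b5 : ∑ m, ∑ p, ∑ q, ∑ r, b m p q r * b r q p m =
      ∑ i, ∑ j, ∑ k, ∑ l, b j l k i * b i k l j := sum_four_perm_jlki _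
  -- the terms with three derivatives on one factor
  have t0 : ∑ m, ∑ p, ∑ q, ∑ r, t p q r m m * a p q r =
      ∑ i, ∑ j, ∑ k, ∑ l, t j l k i i * a j l k := sum_four_perm_jlk _
  have t1 : ∑ m, ∑ p, ∑ q, ∑ r, t p q r r m * a p q m =
      ∑ i, ∑ j, ∑ k, ∑ l, t j l i i k * a j l k := sum_four_perm_kjli _
  have t2 : ∑ m, ∑ p, ∑ q, ∑ r, t p q r m m * a p r q =
      ∑ i, ∑ j, ∑ k, ∑ l, t j l k i i * a j k l := sum_four_perm_jlk _
  have t3 : ∑ m, ∑ p, ∑ q, ∑ r, t p q r r m * a p m q =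
      ∑ i, ∑ j, ∑ k, ∑ l, t j l i i k * a j k l := sum_four_perm_kjli _
  have t4 : ∑ m, ∑ p, ∑ q, ∑ r, t m p q r m * a r p q =
      ∑ i, ∑ j, ∑ k, ∑ l, t j l k i j * a i l k := sum_four_perm_jlki _
  have t5 : ∑ m, ∑ p, ∑ q, ∑ r, t m p q r m * a r q p =
      ∑ i, ∑ j, ∑ k, ∑ l, t j l k i j * a i k l := sum_four_perm_jlki _
  -- the terms of lower order
  have d6 : ∑ m, ∑ p, ∑ q, b p m q m * h p q = c * n * ∑ i, ∑ j, h i j ^ 2 := by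
    rw [Finset.sum_comm, Finset.mul_sum]
    refine Finset.sum_congr rfl fun p _ => ?_
    rw [Finset.sum_comm, Finset.mul_sum]
    refine Finset.sum_congr rfl fun q _ => ?_
    rw [← Finset.sum_mul, J.sum_b']
    ring
  have e6 : ∑ m, ∑ p, ∑ q, a p m q * a p q m = ∑ j, ∑ k, ∑ l, a j l k * a j k l := by
    rw [sum_three_first]
    exact Finset.sum_congr rfl fun _ _ => Finset.sum_congr rfl fun _ _ =>
      Finset.sum_congr rfl fun _ _ => mul_comm _ _
  have d7 : ∑ m, ∑ p, ∑ q, b p q m m * h p q = ∑ p, ∑ q, (∑ r, b p q r r) * h p q := by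
    rw [Finset.sum_comm]
    refine Finset.sum_congr rfl fun p _ => ?_
    rw [Finset.sum_comm]
    simp only [Finset.sum_mul]
  have e7 : ∑ m, ∑ p, ∑ q, a p q m * a p q m = ∑ j, ∑ k, ∑ l, a j l k * a j l k := sum_three_first _
  have eP : ∑ i, ∑ j, ∑ k, a i j k ^ 2 = ∑ j, ∑ k, ∑ l, a j l k * a j l k := by
    simp only [sq]
    exact sum_three_last _
  have eS : ∑ i, ∑ l, (c * n * h i l - ∑ k, b i l k k) ^ 2 = c ^ 2 * n ^ 2 * (∑ i, ∑ j, h i j ^ 2)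
      - 2 * c * n * (∑ p, ∑ q, (∑ r, b p q r r) * h p q) + ∑ i, ∑ l, (∑ k, b i l k k) ^ 2 := by
    simp only [Finset.mul_sum, ← Finset.sum_sub_distrib, ← Finset.sum_add_distrib]
    refine Finset.sum_congr rfl fun i _ => Finset.sum_congr rfl fun j _ => ?_
    ring
  -- The products of second derivatives in `sum_linRiem_sq` and the sums with `∇Δh` cancel. The
  -- remaining coefficients are `1 - 1/(n-2)` for `|Δh|²`, `3 + n - 2n/(n-2) = (n-3)(n+2)/(n-2)` for
  -- `c|∇h|²`, and `3n - n²/(n-2) = 2n(n-3)/(n-2)` for `c²|h|²`.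
  rw [b0, b1, b2, b3, b4, b5, t0, t1, t2, t3, t4, t5, d6, e6, d7, e7, eP, eS, J.sum_t_mul_a,
    J.sum_t_mul_a_swap, J.sum_t_mul_a', J.sum_t_mul_a_swap']
  field_simp
  ring

end SpaceFormJet

namespace SpaceFormTT

variable {Ω : Set (Coord n)} {c : ℝ} {G H : MatField n}

/-- The flux of `∇² h ⊗ ∇ h`. -/
def _root_.WeylVariation.fluxTwo (G H : MatField n) : TensorField n 1 :=
  flux G 3 (tensorProd (nabla2 G H) (nabla G H) : TensorField n (4 + 3)) coeffTwo

/-- The flux of `∇ h ⊗ h`. -/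
def _root_.WeylVariation.fluxOne (c : ℝ) (G H : MatField n) : TensorField n 1 :=
  flux G 2 (tensorProd (nabla G H) (asTensor H) : TensorField n (3 + 2)) (coeffOne n c)

theorem normSq_dWeyl_normal (h : SpaceFormTT Ω c G H) {x : Coord n} (hx : x ∈ Ω)
    (hN : NormalAt G x) (hn : (n : ℝ) - 1 ≠ 0) (hn' : (n : ℝ) - 2 ≠ 0) :
    normSq G (dWeyl G H) x = ((n : ℝ) - 3) / (n - 2) * (normSq G (laplace G H) x
        + c * (n + 2) * normSq G (nabla G H) x + 2 * c ^ 2 * n * normSq G (asTensor H) x)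
      + covectorDiv G (fluxOne c G H) x + covectorDiv G (fluxTwo G H) x := by
  have hinv : (G x)⁻¹ = 1 := by rw [hN.eq_one, inv_one]
  have J := h.jet hx hN
  have hW : ∀ I, dWeyl G H x I = _ := fun I => (h.hasDerivAt_weyl hx hN hn hn' I).deriv
  simp only [normSq_of_inv_eq_one _ hinv, hW, fluxOne, fluxTwo]
  rw [h.covectorDiv_one hx hN, h.covectorDiv_two hx hN, sum_fin_four_fun, sum_fin_three_fun,
    sum_fin_two_fun, sum_fin_two_fun]
  have hL : ∀ i j, laplace G H x ![i, j] = ∑ k, nabla2 G H x ![i, j, k, k] := by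
    intro i j
    simp [laplace, hinv, Matrix.one_apply]
  simp only [hL]
  exact J.sum_linWeyl_sq_eq hn'

end SpaceFormTT

/-! ### Naturality of the flux -/

theorem flux_of_act {k : ℕ} {G G' : MatField n} {T T' : TensorField n (2 * k + 1)}
    {x x' : Coord n} (J : Matrix (Fin n) (Fin n) ℝ)
    (hG : ∀ a b, ∑ i, ∑ j, (G' x')⁻¹ i j * (J a i * J b j) = (G x)⁻¹ a b)
    (hT : T' x' = act J (T x)) (a : Equiv.Perm (Fin (2 * k + 1)) → ℝ) :
    flux G' k T' a x' = act J (flux G k T a x) := by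
  funext I
  simp only [flux, act, ev, sum_fin_one_fun, contraction_of_act J hG hT]
  simp only [Fin.prod_univ_one, Matrix.cons_val_zero, Finset.sum_mul]
  rw [Finset.sum_comm]
  refine Finset.sum_congr rfl fun σ _ => ?_
  rw [contraction_eq_sum, Finset.mul_sum]
  refine Finset.sum_congr rfl fun m _ => ?_
  simp
  ring

theorem sum_coeff_mul_contraction (G : MatField n) (k : ℕ) (T : TensorField n (2 * k + 1))
    (a : Equiv.Perm (Fin (2 * k + 1)) → ℝ) (ν : Fin n → ℝ) (x : Coord n) :
    ∑ σ, a σ * contraction G k T ν σ x = ∑ m, flux G k T a x ![m] * ν m := by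
  simp only [flux, Finset.sum_mul]
  rw [Finset.sum_comm]
  refine Finset.sum_congr rfl fun σ _ => ?_
  rw [contraction_eq_sum, Finset.mul_sum]
  refine Finset.sum_congr rfl fun m _ => ?_
  simp
  ring

namespace CoordChange

variable {φ : Coord n → Coord n} {Ω Ω' : Set (Coord n)} {G H : MatField n}

theorem covectorDiv_pull (hφ : CoordChange φ Ω Ω') (hG : NondegOn Ω' G) {Y : TensorField n 1}
    (hY : SmoothTensor Ω' Y) {x : Coord n} (hx : x ∈ Ω) :
    covectorDiv (pullMat φ G) (pullTensor φ Y) x = covectorDiv G Y (φ x) := by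
  simp only [covectorDiv, hφ.covDeriv_pull hG hY hx, pullTensor, ev_two]
  exact hφ.trace_two_pull G hx (fun a b => covDeriv G Y (φ x) ![a, b])

theorem fluxTwo_pull (hφ : CoordChange φ Ω Ω') (hG : NondegOn Ω' G) (hH : SmoothMat Ω' H)
    {x : Coord n} (hx : x ∈ Ω) :
    fluxTwo (pullMat φ G) (pullMat φ H) x = pullTensor φ (fluxTwo G H) x := by
  have hT : (tensorProd (nabla2 (pullMat φ G) (pullMat φ H)) (nabla (pullMat φ G) (pullMat φ H)) :
      TensorField n (4 + 3)) x =
      act (jac φ x) ((tensorProd (nabla2 G H) (nabla G H) : TensorField n (4 + 3)) (φ x)) :=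
    tensorProd_act (hφ.nabla2_pull hG hH hx) (hφ.nabla_pull hG hH hx)
  exact flux_of_act (k := 3) (jac φ x) (hφ.inv_pull_apply G hx) hT coeffTwo

theorem fluxOne_pull (c : ℝ) (hφ : CoordChange φ Ω Ω') (hG : NondegOn Ω' G) (hH : SmoothMat Ω' H)
    {x : Coord n} (hx : x ∈ Ω) :
    fluxOne c (pullMat φ G) (pullMat φ H) x = pullTensor φ (fluxOne c G H) x := by
  have hT : (tensorProd (nabla (pullMat φ G) (pullMat φ H)) (asTensor (pullMat φ H)) :
      TensorField n (3 + 2)) x =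
      act (jac φ x) ((tensorProd (nabla G H) (asTensor H) : TensorField n (3 + 2)) (φ x)) :=
    tensorProd_act (hφ.nabla_pull hG hH hx) (congrFun (asTensor_pull φ H) x)
  exact flux_of_act (k := 2) (jac φ x) (hφ.inv_pull_apply G hx) hT (coeffOne n c)

end CoordChange

namespace SpaceFormTT

variable {Ω Ω' : Set (Coord n)} {c : ℝ} {G H : MatField n} {φ : Coord n → Coord n}

theorem smooth_fluxTwo (h : SpaceFormTT Ω c G H) : SmoothTensor Ω (fluxTwo G H) :=
  SmoothTensor.flux h.nondeg (k := 3) h.smooth_nabla2_nabla _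

theorem smooth_fluxOne (h : SpaceFormTT Ω c G H) : SmoothTensor Ω (fluxOne c G H) :=
  SmoothTensor.flux h.nondeg (k := 2) h.smooth_nabla_asTensor _

theorem normSq_dWeyl_pull (hφ : CoordChange φ Ω' Ω) (h : SpaceFormTT Ω c G H) {x : Coord n}
    (hx : x ∈ Ω') (hd : ∀ I, DifferentiableAt ℝ
      (fun t : ℝ => weyl (fun y => pullMat φ G y + t • pullMat φ H y) x I) 0) :
    normSq (pullMat φ G) (dWeyl (pullMat φ G) (pullMat φ H)) x = normSq G (dWeyl G H) (φ x) :=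
  normSq_of_act (jac φ x) (hφ.inv_pull_apply G hx) (hφ.dWeyl_pull h.nondeg h.smooth h.symm hx hd)

theorem normSq_laplace_pull (hφ : CoordChange φ Ω' Ω) (h : SpaceFormTT Ω c G H) {x : Coord n}
    (hx : x ∈ Ω') :
    normSq (pullMat φ G) (laplace (pullMat φ G) (pullMat φ H)) x = normSq G (laplace G H) (φ x) :=
  normSq_of_act (jac φ x) (hφ.inv_pull_apply G hx) (hφ.laplace_pull h.nondeg h.smooth hx)

theorem normSq_nabla_pull (hφ : CoordChange φ Ω' Ω) (h : SpaceFormTT Ω c G H) {x : Coord n}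
    (hx : x ∈ Ω') :
    normSq (pullMat φ G) (nabla (pullMat φ G) (pullMat φ H)) x = normSq G (nabla G H) (φ x) :=
  normSq_of_act (jac φ x) (hφ.inv_pull_apply G hx) (hφ.nabla_pull h.nondeg h.smooth hx)

theorem normSq_asTensor_pull (hφ : CoordChange φ Ω' Ω) {x : Coord n} (hx : x ∈ Ω') :
    normSq (pullMat φ G) (asTensor (pullMat φ H)) x = normSq G (asTensor H) (φ x) :=
  normSq_of_act (jac φ x) (hφ.inv_pull_apply G hx) (congrFun (asTensor_pull φ H) x)

theorem covectorDiv_fluxTwo_pull (hφ : CoordChange φ Ω' Ω) (h : SpaceFormTT Ω c G H) {x : Coord n}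
    (hx : x ∈ Ω') : covectorDiv (pullMat φ G) (fluxTwo (pullMat φ G) (pullMat φ H)) x =
      covectorDiv G (fluxTwo G H) (φ x) := by
  rw [← hφ.covectorDiv_pull h.nondeg h.smooth_fluxTwo hx]
  simp only [covectorDiv]
  rw [covDeriv_congr hφ.isOpen (G := pullMat φ G) (fun _ _ => rfl)
    (fun y hy => hφ.fluxTwo_pull h.nondeg h.smooth hy) x hx]

theorem covectorDiv_fluxOne_pull (hφ : CoordChange φ Ω' Ω) (h : SpaceFormTT Ω c G H) {x : Coord n}
    (hx : x ∈ Ω') : covectorDiv (pullMat φ G) (fluxOne c (pullMat φ G) (pullMat φ H)) x =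
      covectorDiv G (fluxOne c G H) (φ x) := by
  rw [← hφ.covectorDiv_pull h.nondeg h.smooth_fluxOne hx]
  simp only [covectorDiv]
  rw [covDeriv_congr hφ.isOpen (G := pullMat φ G) (fun _ _ => rfl)
    (fun y hy => hφ.fluxOne_pull c h.nondeg h.smooth hy) x hx]

/-- The pointwise identity behind the integral formula. -/
theorem normSq_dWeyl (h : SpaceFormTT Ω c G H) {x : Coord n} (hx : x ∈ Ω)
    (hn : (n : ℝ) - 1 ≠ 0) (hn' : (n : ℝ) - 2 ≠ 0) :
    normSq G (dWeyl G H) x = ((n : ℝ) - 3) / (n - 2) * (normSq G (laplace G H) x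
        + c * (n + 2) * normSq G (nabla G H) x + 2 * c ^ 2 * n * normSq G (asTensor H) x)
      + covectorDiv G (fluxOne c G H) x + covectorDiv G (fluxTwo G H) x := by
  -- Every term is a scalar independent of coordinates, so it can be evaluated at the centre of
  -- normal coordinates. The differentiability in `t` required by `dWeyl_pull` is provided there by
  -- `hasDerivAt_weyl`.
  obtain ⟨φ, Ω', hφ, h0, rfl, hN⟩ := exists_normal h.nondeg hx (h.pos x hx)
  rw [← normSq_dWeyl_pull hφ h h0 fun I =>
      ((h.pull hφ).hasDerivAt_weyl h0 hN hn hn' I).differentiableAt,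
    ← normSq_laplace_pull hφ h h0, ← normSq_nabla_pull hφ h h0, ← normSq_asTensor_pull hφ h0,
    ← covectorDiv_fluxTwo_pull hφ h h0, ← covectorDiv_fluxOne_pull hφ h h0]
  exact (h.pull hφ).normSq_dWeyl_normal h0 hN hn hn'

theorem normSq_contDiffOn {k : ℕ} (h : SpaceFormTT Ω c G H) {T : TensorField n k}
    (hT : SmoothTensor Ω T) : ContDiffOn ℝ ∞ (normSq G T) Ω :=
  ContDiffOn.sum fun _ _ => ContDiffOn.sum fun _ _ =>
    ((contDiffOn_prod fun _ _ => h.nondeg.inv_smooth _ _).mul (hT _)).mul (hT _)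

theorem smooth_laplace (h : SpaceFormTT Ω c G H) : SmoothTensor Ω (laplace G H) := fun _ =>
  ContDiffOn.sum fun _ _ => ContDiffOn.sum fun _ _ =>
    (h.nondeg.inv_smooth _ _).mul (h.smooth_nabla2 _)

end SpaceFormTT

theorem covectorDiv_contDiffOn {Ω : Set (Coord n)} {G : MatField n} (hG : NondegOn Ω G)
    {Y : TensorField n 1} (hY : SmoothTensor Ω Y) : ContDiffOn ℝ ∞ (covectorDiv G Y) Ω :=
  ContDiffOn.sum fun _ _ => ContDiffOn.sum fun _ _ =>
    (hG.inv_smooth _ _).mul (hY.covDeriv hG _)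

/-! ### Coordinates on the manifold -/

section Coordinates

variable {M : Type*} [TopologicalSpace M] [ChartedSpace (Coord n) M] [IsManifold (𝓡 n) ∞ M]

/-- Fields of bilinear forms on the tangent spaces. -/
abbrev FormField (n : ℕ) (M : Type*) [TopologicalSpace M] [ChartedSpace (Coord n) M] : Type _ :=
  (x : M) → TangentSpace (𝓡 n) x →L[ℝ] TangentSpace (𝓡 n) x →L[ℝ] ℝ

/-- Smoothness of a field of bilinear forms. -/
def SmoothForm (B : FormField n M) : Prop :=
  ContMDiff (𝓡 n) ((𝓡 n).prod 𝓘(ℝ, Coord n →L[ℝ] Coord n →L[ℝ] ℝ)) ∞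
    (fun x ↦ TotalSpace.mk' (Coord n →L[ℝ] Coord n →L[ℝ] ℝ)
      (E := fun x : M ↦ TangentSpace (𝓡 n) x →L[ℝ] TangentSpace (𝓡 n) x →L[ℝ] ℝ) x (B x))

variable {e e' : OpenPartialHomeomorph M (Coord n)}

/-- The coordinate frame is the derivative of the smooth map `e.symm` applied to constant vectors.
-/
theorem contMDiffAt_coordVec (he : e ∈ IsManifold.maximalAtlas (𝓡 n) ∞ M) (i : Fin n) {y : Coord n}
    (hy : y ∈ e.target) :
    ContMDiffAt 𝓘(ℝ, Coord n) ((𝓡 n).prod 𝓘(ℝ, Coord n)) ∞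
      (fun z => TotalSpace.mk' (Coord n) (E := fun x : M => TangentSpace (𝓡 n) x)
        (e.symm z) (coordVec e i z)) y := by
  have hs : ContMDiffAt 𝓘(ℝ, Coord n) (𝓡 n) ∞ e.symm y :=
    contMDiffAt_symm_of_mem_maximalAtlas he hy
  have hϕ := ContMDiffAt.mfderiv_const hs (m := ∞) (by simp)
  have hv : ContMDiffAt 𝓘(ℝ, Coord n) (𝓘(ℝ, Coord n).prod 𝓘(ℝ, Coord n)) ∞
      (fun z : Coord n => TotalSpace.mk' (Coord n)
        (E := fun x : Coord n => TangentSpace 𝓘(ℝ, Coord n) x) z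
        (EuclideanSpace.single i (1 : ℝ) : Coord n)) y :=
    contMDiffAt_vectorSpace_iff_contDiffAt.2 contDiffAt_const
  exact ContMDiffAt.clm_apply_of_inCoordinates hϕ hv hs

theorem SmoothForm.components {B : FormField n M} (hB : SmoothForm B)
    (he : e ∈ IsManifold.maximalAtlas (𝓡 n) ∞ M) : SmoothMat e.target (components B e) := by
  intro i j y hy
  have hs : ContMDiffAt 𝓘(ℝ, Coord n) (𝓡 n) ∞ e.symm y :=
    contMDiffAt_symm_of_mem_maximalAtlas he hy
  have : ContMDiffAt 𝓘(ℝ, Coord n) ((𝓡 n).prod 𝓘(ℝ)) ∞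
      (fun z => TotalSpace.mk' ℝ (E := Bundle.Trivial M ℝ) (e.symm z)
        (B (e.symm z) (coordVec e i z) (coordVec e j z))) y := by
    apply ContMDiffAt.clm_bundle_apply₂ (F₁ := Coord n) (F₂ := Coord n)
    · exact ContMDiffAt.comp y (hB (e.symm y)) hs
    · exact contMDiffAt_coordVec he i hy
    · exact contMDiffAt_coordVec he j hy
  simp only [contMDiffAt_totalSpace] at this
  exact (contMDiffAt_iff_contDiffAt.1 this.2).contDiffWithinAt

/-- The transition map between two charts. -/
def transition (e e' : OpenPartialHomeomorph M (Coord n)) : Coord n → Coord n :=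
  fun y => e' (e.symm y)

/-- The domain of the transition map. -/
def overlap (e e' : OpenPartialHomeomorph M (Coord n)) : Set (Coord n) :=
  e.target ∩ e.symm ⁻¹' e'.source

theorem isOpen_overlap (e e' : OpenPartialHomeomorph M (Coord n)) : IsOpen (overlap e e') :=
  e.symm.isOpen_inter_preimage e'.open_source

theorem mapsTo_transition (e e' : OpenPartialHomeomorph M (Coord n)) :
    MapsTo (transition e e') (overlap e e') (overlap e' e) := by
  rintro y ⟨hy, hy'⟩
  refine ⟨e'.map_source hy', ?_⟩
  simp only [transition, mem_preimage, e'.left_inv hy']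
  exact e.map_target hy

theorem transition_transition {y : Coord n} (hy : y ∈ overlap e e') :
    transition e' e (transition e e' y) = y := by
  simp only [transition, e'.left_inv hy.2, e.right_inv hy.1]

theorem symm_transition {y : Coord n} (hy : y ∈ overlap e e') :
    e'.symm (transition e e' y) = e.symm y := e'.left_inv hy.2

theorem contDiffOn_transition (he : e ∈ IsManifold.maximalAtlas (𝓡 n) ∞ M)
    (he' : e' ∈ IsManifold.maximalAtlas (𝓡 n) ∞ M) :
    ContDiffOn ℝ ∞ (transition e e') (overlap e e') := by
  rw [← contMDiffOn_iff_contDiffOn]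
  exact (contMDiffOn_of_mem_maximalAtlas he').comp
    ((contMDiffOn_symm_of_mem_maximalAtlas he).mono inter_subset_left) fun y hy => hy.2

theorem fderiv_transition_apply {φ : Coord n → Coord n} {Ω : Set (Coord n)} (hΩ : IsOpen Ω)
    (hφ : ContDiffOn ℝ ∞ φ Ω) {y : Coord n} (hy : y ∈ Ω) (a i : Fin n) :
    fderiv ℝ φ y (EuclideanSpace.single i 1) a = jac φ y a i := by
  have hd : DifferentiableAt ℝ φ y := ((hφ y hy).contDiffAt (hΩ.mem_nhds hy)).differentiableAt
    (by simp)
  have := ((EuclideanSpace.proj (𝕜 := ℝ) a : Coord n →L[ℝ] ℝ).hasFDerivAt.comp y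
    hd.hasFDerivAt).fderiv
  change _ = fderiv ℝ (fun z => φ z a) y _
  have h2 : (fun z => φ z a) = (EuclideanSpace.proj (𝕜 := ℝ) a : Coord n →L[ℝ] ℝ) ∘ φ := rfl
  rw [h2, this]
  rfl

theorem coordChange_transition (he : e ∈ IsManifold.maximalAtlas (𝓡 n) ∞ M)
    (he' : e' ∈ IsManifold.maximalAtlas (𝓡 n) ∞ M) :
    CoordChange (transition e e') (overlap e e') (overlap e' e) := by
  have h1 := contDiffOn_transition he he'
  have h2 := contDiffOn_transition he' he
  refine ⟨isOpen_overlap _ _, isOpen_overlap _ _, fun a => ?_, mapsTo_transition _ _, ?_⟩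
  · exact (EuclideanSpace.proj (𝕜 := ℝ) a : Coord n →L[ℝ] ℝ).contDiff.comp_contDiffOn h1
  · intro y hy
    have hd1 : HasFDerivAt (transition e e') (fderiv ℝ (transition e e') y) y :=
      (((h1 y hy).contDiffAt ((isOpen_overlap _ _).mem_nhds hy)).differentiableAt
        (by simp)).hasFDerivAt
    have hy' := mapsTo_transition e e' hy
    have hd2 : HasFDerivAt (transition e' e) (fderiv ℝ (transition e' e) (transition e e' y))
        (transition e e' y) :=
      (((h2 _ hy').contDiffAt ((isOpen_overlap _ _).mem_nhds hy')).differentiableAt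
        (by simp)).hasFDerivAt
    have hid : HasFDerivAt (fun z => z) ((fderiv ℝ (transition e' e) (transition e e' y)).comp
        (fderiv ℝ (transition e e') y)) y :=
      (hd2.comp y hd1).congr_of_eventuallyEq (Filter.eventually_of_mem
        ((isOpen_overlap e e').mem_nhds hy) fun z hz => (transition_transition hz).symm)
    have heq := hid.unique (hasFDerivAt_id y)
    -- The transition maps are mutually inverse, so by the chain rule their Jacobian matrices are
    -- too.
    have hmul : jac (transition e' e) (transition e e' y) * jac (transition e e') y = 1 := by
      ext a i
      have h3 := congrArg (fun L : Coord n →L[ℝ] Coord n => L (EuclideanSpace.single i 1) a) heq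
      simp only [ContinuousLinearMap.comp_apply, ContinuousLinearMap.id_apply] at h3
      have h4 : fderiv ℝ (transition e e') y (EuclideanSpace.single i 1) =
          ∑ b, jac (transition e e') y b i • EuclideanSpace.single b (1 : ℝ) := by
        ext b
        rw [fderiv_transition_apply (isOpen_overlap _ _) h1 hy]
        simp [Finset.sum_apply, Pi.single_apply]
      rw [h4, map_sum] at h3
      simp only [map_smul, WithLp.ofLp_sum, Finset.sum_apply, WithLp.ofLp_smul, Pi.smul_apply,
        smul_eq_mul, fderiv_transition_apply (isOpen_overlap _ _) h2 hy'] at h3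
      rw [Matrix.mul_apply, Matrix.one_apply]
      have h5 : (EuclideanSpace.single i (1 : ℝ) : Coord n) a = if a = i then 1 else 0 := by
        simp
      rw [← h5, ← h3]
      exact Finset.sum_congr rfl fun b _ => mul_comm _ _
    intro h0
    have := congrArg Matrix.det hmul
    rw [Matrix.det_mul, h0, mul_zero, Matrix.det_one] at this
    exact zero_ne_one this

theorem mfderiv_symm_transition (he : e ∈ IsManifold.maximalAtlas (𝓡 n) ∞ M)
    (he' : e' ∈ IsManifold.maximalAtlas (𝓡 n) ∞ M) {y : Coord n} (hy : y ∈ overlap e e') :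
    (mfderiv 𝓘(ℝ, Coord n) (𝓡 n) e.symm y : Coord n →L[ℝ] Coord n) =
      (mfderiv 𝓘(ℝ, Coord n) (𝓡 n) e'.symm (transition e e' y) : Coord n →L[ℝ] Coord n).comp
        (fderiv ℝ (transition e e') y) := by
  have hy' := mapsTo_transition e e' hy
  have h1 := contDiffOn_transition he he'
  have hd1 : MDifferentiableAt 𝓘(ℝ, Coord n) 𝓘(ℝ, Coord n) (transition e e') y :=
    (((h1 y hy).contDiffAt ((isOpen_overlap _ _).mem_nhds hy)).differentiableAt
        (by simp)).mdifferentiableAt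
  have hd2 : MDifferentiableAt 𝓘(ℝ, Coord n) (𝓡 n) e'.symm (transition e e' y) :=
    (contMDiffAt_symm_of_mem_maximalAtlas he' hy'.1).mdifferentiableAt (by simp)
  have h2 := mfderiv_comp y hd2 hd1
  rw [mfderiv_eq_fderiv] at h2
  have h3 : e'.symm ∘ transition e e' =ᶠ[𝓝 y] e.symm :=
    Filter.eventually_of_mem ((isOpen_overlap e e').mem_nhds hy) fun z hz => symm_transition hz
  rw [← h3.mfderiv_eq]
  exact h2

theorem components_transition (B : FormField n M) (he : e ∈ IsManifold.maximalAtlas (𝓡 n) ∞ M)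
    (he' : e' ∈ IsManifold.maximalAtlas (𝓡 n) ∞ M) {y : Coord n} (hy : y ∈ overlap e e') :
    components B e y = pullMat (transition e e') (components B e') y := by
  have h1 := contDiffOn_transition he he'
  have hv : ∀ i, (coordVec e i y : Coord n) = ∑ a, jac (transition e e') y a i •
      (coordVec e' a (transition e e' y) : Coord n) := by
    intro i
    have h4 : fderiv ℝ (transition e e') y (EuclideanSpace.single i 1) =
        ∑ b, jac (transition e e') y b i • EuclideanSpace.single b (1 : ℝ) := by
      ext b
      rw [fderiv_transition_apply (isOpen_overlap _ _) h1 hy]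
      simp [Finset.sum_apply, Pi.single_apply]
    set L : Coord n →L[ℝ] Coord n :=
      mfderiv 𝓘(ℝ, Coord n) (𝓡 n) e'.symm (transition e e' y) with hL
    have h5 : (coordVec e i y : Coord n) =
        L (fderiv ℝ (transition e e') y (EuclideanSpace.single i 1)) :=
      congrArg (fun L : Coord n →L[ℝ] Coord n => L (EuclideanSpace.single i 1))
        (mfderiv_symm_transition he he' hy)
    rw [h5, h4, map_sum]
    simp only [map_smul]
    rfl
  -- The base points seen in the two charts are equal but not definitionally so. All tangent spaces
  -- are the same model space, and the forms are compared after substituting the equality.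
  have hB : ∀ (p q : M) (_ : p = q) (v w : Coord n), (B p : Coord n →L[ℝ] Coord n →L[ℝ] ℝ) v w =
      (B q : Coord n →L[ℝ] Coord n →L[ℝ] ℝ) v w := by
    rintro p q rfl v w; rfl
  ext i j
  rw [pullMat_apply]
  have h6 : components B e y i j = (B (e'.symm (transition e e' y)) : Coord n →L[ℝ] Coord n →L[ℝ] ℝ)
      (coordVec e i y : Coord n) (coordVec e j y : Coord n) := hB _ _ (symm_transition hy).symm _ _
  rw [h6, hv i, hv j]
  simp only [map_sum, map_smul, sum_apply, smul_apply,
    smul_eq_mul, Finset.mul_sum]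
  rw [Finset.sum_comm]
  refine Finset.sum_congr rfl fun a _ => Finset.sum_congr rfl fun b _ => ?_
  simp only [components, Matrix.of_apply]
  ring

end Coordinates

/-! ### Locality -/

section Locality

variable {Ω : Set (Coord n)} {G G' H H' : MatField n}

/-- The components in two charts are related only over the overlap. Since coordinate expressions
depend only on germs, such relations may be used inside derivatives. -/
theorem christoffel_congr (hΩ : IsOpen Ω) (hG : ∀ y ∈ Ω, G y = G' y) (k i j : Fin n) :
    ∀ y ∈ Ω, christoffel G k i j y = christoffel G' k i j y := by
  intro y hy
  have h : ∀ a b c, pd c (fun z => G z a b) y = pd c (fun z => G' z a b) y := fun a b c =>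
    pd_congr_on hΩ (fun z hz => by rw [hG z hz]) hy c
  simp only [christoffel, hG y hy, h]

theorem riemann_congr (hΩ : IsOpen Ω) (hG : ∀ y ∈ Ω, G y = G' y) (i j k l : Fin n) :
    ∀ y ∈ Ω, riemann G i j k l y = riemann G' i j k l y := by
  intro y hy
  have h : ∀ a b c d, pd d (christoffel G a b c) y = pd d (christoffel G' a b c) y :=
    fun a b c d => pd_congr_on hΩ (christoffel_congr hΩ hG a b c) hy d
  simp only [riemann, riemannUp, h, christoffel_congr hΩ hG _ _ _ y hy, hG y hy]

theorem nabla_congr (hΩ : IsOpen Ω) (hG : ∀ y ∈ Ω, G y = G' y) (hH : ∀ y ∈ Ω, H y = H' y) :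
    ∀ y ∈ Ω, nabla G H y = nabla G' H' y :=
  covDeriv_congr hΩ hG fun y hy => by funext I; simp only [asTensor, hH y hy]

theorem nabla2_congr (hΩ : IsOpen Ω) (hG : ∀ y ∈ Ω, G y = G' y) (hH : ∀ y ∈ Ω, H y = H' y) :
    ∀ y ∈ Ω, nabla2 G H y = nabla2 G' H' y :=
  covDeriv_congr hΩ hG (nabla_congr hΩ hG hH)

theorem laplace_congr (hΩ : IsOpen Ω) (hG : ∀ y ∈ Ω, G y = G' y) (hH : ∀ y ∈ Ω, H y = H' y) :
    ∀ y ∈ Ω, laplace G H y = laplace G' H' y := by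
  intro y hy
  funext I
  simp only [laplace, hG y hy, nabla2_congr hΩ hG hH y hy]

theorem divergence_congr (hΩ : IsOpen Ω) (hG : ∀ y ∈ Ω, G y = G' y) (hH : ∀ y ∈ Ω, H y = H' y)
    (j : Fin n) : ∀ y ∈ Ω, divergence G H j y = divergence G' H' j y := by
  intro y hy
  simp only [divergence, hG y hy, nabla_congr hΩ hG hH y hy]

theorem fluxTwo_congr (hΩ : IsOpen Ω) (hG : ∀ y ∈ Ω, G y = G' y) (hH : ∀ y ∈ Ω, H y = H' y) :
    ∀ y ∈ Ω, fluxTwo G H y = fluxTwo G' H' y := by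
  intro y hy
  funext I
  simp only [fluxTwo, flux, contraction, tensorProd, hG y hy, nabla_congr hΩ hG hH y hy,
    nabla2_congr hΩ hG hH y hy]

theorem fluxOne_congr (c : ℝ) (hΩ : IsOpen Ω) (hG : ∀ y ∈ Ω, G y = G' y)
    (hH : ∀ y ∈ Ω, H y = H' y) : ∀ y ∈ Ω, fluxOne c G H y = fluxOne c G' H' y := by
  intro y hy
  funext I
  simp only [fluxOne, flux, contraction, tensorProd, asTensor, hG y hy, hH y hy,
    nabla_congr hΩ hG hH y hy]

theorem covectorDiv_congr {Y Y' : TensorField n 1} (hΩ : IsOpen Ω) (hG : ∀ y ∈ Ω, G y = G' y)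
    (hY : ∀ y ∈ Ω, Y y = Y' y) : ∀ y ∈ Ω, covectorDiv G Y y = covectorDiv G' Y' y := by
  intro y hy
  simp only [covectorDiv, hG y hy, covDeriv_congr hΩ hG hY y hy]

end Locality

/-! ### Space forms in charts -/

section SpaceFormCharts

variable {M : Type*} [TopologicalSpace M] [ChartedSpace (Coord n) M] [IsManifold (𝓡 n) ∞ M]
  {e e' : OpenPartialHomeomorph M (Coord n)}

theorem SymTwoTensor.smoothForm (h : SymTwoTensor n M) : SmoothForm h.form := h.contMDiff

theorem smoothForm_metric (g : Metric n M) : SmoothForm (n := n) (M := M) g.inner := g.contMDiff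

/-- The derivative of the inverse chart is injective, so the inner product stays positive after
being pulled back to coordinate space. -/
theorem posDef_components (g : Metric n M) (he : e ∈ IsManifold.maximalAtlas (𝓡 n) ∞ M)
    {y : Coord n} (hy : y ∈ e.target) : (components g.inner e y).PosDef := by
  have hmd : e.MDifferentiable (𝓡 n) 𝓘(ℝ, Coord n) :=
    ⟨(contMDiffOn_of_mem_maximalAtlas he).mdifferentiableOn (by simp),
      (contMDiffOn_symm_of_mem_maximalAtlas he).mdifferentiableOn (by simp)⟩
  set L : Coord n →L[ℝ] Coord n := mfderiv 𝓘(ℝ, Coord n) (𝓡 n) e.symm y with hL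
  have hinj : ∀ v : Coord n, L v = 0 → v = 0 := by
    intro v hv
    have h1 := hmd.comp_symm_deriv hy
    set L' : Coord n →L[ℝ] Coord n := mfderiv (𝓡 n) 𝓘(ℝ, Coord n) e (e.symm y) with hL'
    have h2 : L' (L v) = v := congrArg (fun A : Coord n →L[ℝ] Coord n => A v) h1
    rw [← h2, hv, map_zero]
  set B : Coord n →L[ℝ] Coord n →L[ℝ] ℝ := g.inner (e.symm y) with hB
  have hc : ∀ i j, components g.inner e y i j =
      B (L (EuclideanSpace.single i 1)) (L (EuclideanSpace.single j 1)) := fun _ _ => rfl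
  have hsum : ∀ x : Fin n → ℝ, x ⬝ᵥ (components g.inner e y).mulVec x =
      B (L (WithLp.toLp 2 x)) (L (WithLp.toLp 2 x)) := by
    intro x
    have hx : (WithLp.toLp 2 x : Coord n) = ∑ i, x i • EuclideanSpace.single i (1 : ℝ) := by
      ext a
      simp [Finset.sum_apply, Pi.single_apply]
    rw [hx]
    simp only [map_sum, map_smul, sum_apply, smul_apply, smul_eq_mul, dotProduct, Matrix.mulVec, hc,
      Finset.mul_sum]
    rw [Finset.sum_comm]
    exact Finset.sum_congr rfl fun i _ => Finset.sum_congr rfl fun j _ => by ring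
  refine Matrix.PosDef.of_dotProduct_mulVec_pos ?_ ?_
  · ext i j
    simp only [Matrix.conjTranspose_apply, star_trivial, hc]
    exact g.symm (e.symm y) _ _
  · intro x hx
    rw [star_trivial, hsum]
    refine g.pos (e.symm y) _ fun h0 => hx ?_
    have h3 := hinj _ h0
    funext i
    exact congrArg (fun v : Coord n => v i) h3

/-- The hypotheses concern, for each point, the preferred chart and only its value at that point.
Being tensorial, they pass point by point through transition maps to an arbitrary smooth chart, and
hence hold on its whole target, where they can be differentiated. -/
theorem spaceFormTT_components {g : Metric n M} {h : SymTwoTensor n M} {c : ℝ}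
    (hc : HasConstantCurvature g c) (hTT : IsTransverseTraceless g h)
    (he : e ∈ IsManifold.maximalAtlas (𝓡 n) ∞ M) :
    SpaceFormTT e.target c (components g.inner e) (components h.form e) := by
  have hG : ∀ {e : OpenPartialHomeomorph M (Coord n)},
      e ∈ IsManifold.maximalAtlas (𝓡 n) ∞ M → NondegOn e.target (components g.inner e) :=
    fun {e} he =>
    { isOpen := e.open_target
      smooth := (smoothForm_metric g).components he
      symm := fun y _ i j => g.symm (e.symm y) _ _
      det := fun y hy => (posDef_components g he hy).det_pos.ne' }
  have key : ∀ y ∈ e.target, ∃ (e' : OpenPartialHomeomorph M (Coord n)),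
      e' ∈ IsManifold.maximalAtlas (𝓡 n) ∞ M ∧ y ∈ overlap e e' ∧
      (∀ i j k l, riemann (components g.inner e') i j k l (transition e e' y) =
        c * (components g.inner e' (transition e e' y) i l *
            components g.inner e' (transition e e' y) j k -
          components g.inner e' (transition e e' y) i k *
            components g.inner e' (transition e e' y) j l)) ∧
      trace (components g.inner e') (components h.form e') (transition e e' y) = 0 ∧
      ∀ j, divergence (components g.inner e') (components h.form e') j (transition e e' y) = 0 := by
    intro y hy
    exact ⟨chartAt _ (e.symm y), IsManifold.chart_mem_maximalAtlas _, ⟨hy, mem_chart_source _ _⟩,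
      hc (e.symm y), hTT (e.symm y)⟩
  refine ⟨hG he, fun y hy => posDef_components g he hy, h.smoothForm.components he,
    fun y _ i j => h.symm (e.symm y) _ _, ?_, ?_, ?_⟩
  all_goals
    intro y hy
    obtain ⟨e', he', hy', h1, h2, h3⟩ := key y hy
    have hφ := coordChange_transition he he'
    have hG' := (hG he').mono inter_subset_left (isOpen_overlap e' e)
    have hH' : SmoothMat (overlap e' e) (components h.form e') := fun i j =>
      (h.smoothForm.components he' i j).mono inter_subset_left
    have hcG : ∀ z ∈ overlap e e', components g.inner e z = _ := fun z hz =>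
      components_transition (n := n) g.inner he he' hz
    have hcH : ∀ z ∈ overlap e e', components h.form e z = _ := fun z hz =>
      components_transition (n := n) h.form he he' hz
  · intro i j k l
    rw [riemann_congr (isOpen_overlap e e') hcG i j k l y hy', hcG y hy']
    exact hφ.constCurv_pull hG' hy' h1 i j k l
  · rw [← h2, ← hφ.trace_pull _ _ hy']
    simp only [trace, hcG y hy', hcH y hy']
  · intro j
    rw [divergence_congr (isOpen_overlap e e') hcG hcH j y hy', hφ.divergence_pull hG' hH' hy']
    simp [h3]

end SpaceFormCharts

/-! ### Scalars and covector fields given in all charts -/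

section Families

variable {M : Type*} [TopologicalSpace M] [ChartedSpace (Coord n) M] [IsManifold (𝓡 n) ∞ M]
  {e e' : OpenPartialHomeomorph M (Coord n)}

/-- A smooth function on `M`, given by its expressions in all smooth charts. -/
structure ScalarFamily (s : OpenPartialHomeomorph M (Coord n) → Coord n → ℝ) : Prop where
  smooth : ∀ e ∈ IsManifold.maximalAtlas (𝓡 n) ∞ M, ContDiffOn ℝ ∞ (s e) e.target
  compat : ∀ e ∈ IsManifold.maximalAtlas (𝓡 n) ∞ M, ∀ e' ∈ IsManifold.maximalAtlas (𝓡 n) ∞ M,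
    ∀ y ∈ overlap e e', s e y = s e' (transition e e' y)

/-- The function on `M` with the given chart expressions. -/
def chartEval (s : OpenPartialHomeomorph M (Coord n) → Coord n → ℝ) (x : M) : ℝ :=
  s (chartAt (Coord n) x) (chartAt (Coord n) x x)

theorem mem_overlap {x : M} (hx : x ∈ e.source) (hx' : x ∈ e'.source) : e x ∈ overlap e e' :=
  ⟨e.map_source hx, by rwa [mem_preimage, e.left_inv hx]⟩

theorem transition_apply {x : M} (hx : x ∈ e.source) : transition e e' (e x) = e' x := by
  rw [transition, e.left_inv hx]

/-- `chartEval` uses a chart that varies with the point. Compatibility allows it to be computed in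
one fixed chart, which gives continuity and chartwise integrals. -/
theorem ScalarFamily.chartEval_eq {s : OpenPartialHomeomorph M (Coord n) → Coord n → ℝ}
    (hs : ScalarFamily s) (he : e ∈ IsManifold.maximalAtlas (𝓡 n) ∞ M) {x : M}
    (hx : x ∈ e.source) : chartEval s x = s e (e x) := by
  rw [hs.compat e he _ (IsManifold.chart_mem_maximalAtlas x) (e x)
    (mem_overlap hx (mem_chart_source _ x)), transition_apply hx]
  rfl

theorem ScalarFamily.chartEval_symm {s : OpenPartialHomeomorph M (Coord n) → Coord n → ℝ}
    (hs : ScalarFamily s) (he : e ∈ IsManifold.maximalAtlas (𝓡 n) ∞ M) {y : Coord n}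
    (hy : y ∈ e.target) : chartEval s (e.symm y) = s e y := by
  rw [hs.chartEval_eq he (e.map_target hy), e.right_inv hy]

theorem ScalarFamily.continuous {s : OpenPartialHomeomorph M (Coord n) → Coord n → ℝ}
    (hs : ScalarFamily s) : Continuous (chartEval s) := by
  rw [continuous_iff_continuousAt]
  intro x
  set e := chartAt (Coord n) x with he
  have hmem : e ∈ IsManifold.maximalAtlas (𝓡 n) ∞ M := IsManifold.chart_mem_maximalAtlas x
  have hx : x ∈ e.source := mem_chart_source _ x
  have h1 : ContinuousAt (fun z => s e (e z)) x :=
    ContinuousAt.comp (g := s e) (((hs.smooth e hmem).continuousOn).continuousAt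
      (e.open_target.mem_nhds (e.map_source hx))) (e.continuousAt hx)
  exact h1.congr (Filter.eventually_of_mem (e.open_source.mem_nhds hx) fun z hz =>
    (hs.chartEval_eq hmem hz).symm)

/-- A smooth covector field on `M`, given by its components in all smooth charts. -/
structure CovectorFamily (Y : OpenPartialHomeomorph M (Coord n) → TensorField n 1) : Prop where
  smooth : ∀ e ∈ IsManifold.maximalAtlas (𝓡 n) ∞ M, SmoothTensor e.target (Y e)
  compat : ∀ e ∈ IsManifold.maximalAtlas (𝓡 n) ∞ M, ∀ e' ∈ IsManifold.maximalAtlas (𝓡 n) ∞ M,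
    ∀ y ∈ overlap e e', Y e y = pullTensor (transition e e') (Y e') y

theorem nondegOn_components (g : Metric n M) (he : e ∈ IsManifold.maximalAtlas (𝓡 n) ∞ M) :
    NondegOn e.target (components g.inner e) where
  isOpen := e.open_target
  smooth := (smoothForm_metric g).components he
  symm := fun y _ i j => g.symm (e.symm y) _ _
  det := fun y hy => (posDef_components g he hy).det_pos.ne'

theorem components_eqOn (B : FormField n M) (he : e ∈ IsManifold.maximalAtlas (𝓡 n) ∞ M)
    (he' : e' ∈ IsManifold.maximalAtlas (𝓡 n) ∞ M) : ∀ y ∈ overlap e e',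
      components B e y = pullMat (transition e e') (components B e') y := fun _ hy =>
  components_transition B he he' hy

theorem CovectorFamily.div {Y : OpenPartialHomeomorph M (Coord n) → TensorField n 1}
    (hY : CovectorFamily Y) (g : Metric n M) :
    ScalarFamily fun e => covectorDiv (components g.inner e) (Y e) where
  smooth e he := covectorDiv_contDiffOn (nondegOn_components g he) (hY.smooth e he)
  compat e he e' he' y hy := by
    have hφ := coordChange_transition he he'
    have hG := (nondegOn_components g he').mono inter_subset_left (isOpen_overlap e' e)
    have hYs : SmoothTensor (overlap e' e) (Y e') := fun I =>
      (hY.smooth e' he' I).mono inter_subset_left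
    rw [covectorDiv_congr (isOpen_overlap e e') (components_eqOn (n := n) g.inner he he')
      (hY.compat e he e' he') y hy]
    exact hφ.covectorDiv_pull hG hYs hy

theorem CovectorFamily.smul {Y : OpenPartialHomeomorph M (Coord n) → TensorField n 1}
    (hY : CovectorFamily Y) {ρ : M → ℝ} (hρ : ContMDiff (𝓡 n) 𝓘(ℝ) ∞ ρ) :
    CovectorFamily fun e y I => ρ (e.symm y) * Y e y I where
  smooth e he I := by
    refine ContDiffOn.mul ?_ (hY.smooth e he I)
    rw [← contMDiffOn_iff_contDiffOn]
    exact hρ.comp_contMDiffOn (contMDiffOn_symm_of_mem_maximalAtlas he)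
  compat e he e' he' y hy := by
    funext I
    rw [hY.compat e he e' he' y hy]
    simp only [pullTensor, ev, symm_transition hy, Finset.mul_sum, mul_assoc]

section Fluxes

variable {g : Metric n M} {h : SymTwoTensor n M} {c : ℝ}

theorem covectorFamily_fluxTwo (hc : HasConstantCurvature g c) (hTT : IsTransverseTraceless g h) :
    CovectorFamily fun e : OpenPartialHomeomorph M (Coord n) =>
      fluxTwo (components g.inner e) (components h.form e) where
  smooth e he := (spaceFormTT_components hc hTT he).smooth_fluxTwo
  compat e he e' he' y hy := by
    have hφ := coordChange_transition he he'
    have hG := (nondegOn_components g he').mono inter_subset_left (isOpen_overlap e' e)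
    rw [fluxTwo_congr (isOpen_overlap e e') (components_eqOn (n := n) g.inner he he')
      (components_eqOn (n := n) h.form he he') y hy]
    exact hφ.fluxTwo_pull hG (fun i j => (h.smoothForm.components he' i j).mono
      inter_subset_left) hy

theorem covectorFamily_fluxOne (hc : HasConstantCurvature g c) (hTT : IsTransverseTraceless g h) :
    CovectorFamily fun e : OpenPartialHomeomorph M (Coord n) =>
      fluxOne c (components g.inner e) (components h.form e) where
  smooth e he := (spaceFormTT_components hc hTT he).smooth_fluxOne
  compat e he e' he' y hy := by
    have hφ := coordChange_transition he he'
    have hG := (nondegOn_components g he').mono inter_subset_left (isOpen_overlap e' e)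
    rw [fluxOne_congr c (isOpen_overlap e e') (components_eqOn (n := n) g.inner he he')
      (components_eqOn (n := n) h.form he he') y hy]
    exact hφ.fluxOne_pull c hG (fun i j => (h.smoothForm.components he' i j).mono
      inter_subset_left) hy

theorem scalarFamily_laplace (hc : HasConstantCurvature g c) (hTT : IsTransverseTraceless g h) :
    ScalarFamily fun e : OpenPartialHomeomorph M (Coord n) => normSq (components g.inner e)
      (laplace (components g.inner e) (components h.form e)) where
  smooth e he := (spaceFormTT_components hc hTT he).normSq_contDiffOn
    (spaceFormTT_components hc hTT he).smooth_laplace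
  compat e he e' he' y hy := by
    have hφ := coordChange_transition he he'
    have hG := (nondegOn_components g he').mono inter_subset_left (isOpen_overlap e' e)
    have hc1 := components_eqOn (n := n) g.inner he he'
    refine normSq_of_act (jac (transition e e') y) ?_ ?_
    · rw [hc1 y hy]; exact hφ.inv_pull_apply _ hy
    · rw [laplace_congr (isOpen_overlap e e') hc1 (components_eqOn (n := n) h.form he he') y hy]
      exact hφ.laplace_pull hG (fun i j => (h.smoothForm.components he' i j).mono
        inter_subset_left) hy

theorem scalarFamily_nabla (hc : HasConstantCurvature g c) (hTT : IsTransverseTraceless g h) :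
    ScalarFamily fun e : OpenPartialHomeomorph M (Coord n) => normSq (components g.inner e)
      (nabla (components g.inner e) (components h.form e)) where
  smooth e he := (spaceFormTT_components hc hTT he).normSq_contDiffOn
    (spaceFormTT_components hc hTT he).smooth_nabla
  compat e he e' he' y hy := by
    have hφ := coordChange_transition he he'
    have hG := (nondegOn_components g he').mono inter_subset_left (isOpen_overlap e' e)
    have hc1 := components_eqOn (n := n) g.inner he he'
    refine normSq_of_act (jac (transition e e') y) ?_ ?_
    · rw [hc1 y hy]; exact hφ.inv_pull_apply _ hy
    · rw [nabla_congr (isOpen_overlap e e') hc1 (components_eqOn (n := n) h.form he he') y hy]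
      exact hφ.nabla_pull hG (fun i j => (h.smoothForm.components he' i j).mono
        inter_subset_left) hy

theorem scalarFamily_asTensor (hc : HasConstantCurvature g c) (hTT : IsTransverseTraceless g h) :
    ScalarFamily fun e : OpenPartialHomeomorph M (Coord n) => normSq (components g.inner e)
      (asTensor (components h.form e)) where
  smooth e he := (spaceFormTT_components hc hTT he).normSq_contDiffOn
    (spaceFormTT_components hc hTT he).smooth.asTensor
  compat e he e' he' y hy := by
    have hφ := coordChange_transition he he'
    have hc1 := components_eqOn (n := n) g.inner he he'
    refine normSq_of_act (jac (transition e e') y) ?_ ?_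
    · rw [hc1 y hy]; exact hφ.inv_pull_apply _ hy
    · have := congrFun (asTensor_pull (transition e e') (components h.form e')) y
      rw [pullTensor_eq_act] at this
      rw [← this]
      funext I
      simp only [asTensor, components_eqOn (n := n) h.form he he' y hy]

end Fluxes

end Families

/-! ### Measures given by parametrizations -/

section ParamMeasure

variable {X : Type*} [TopologicalSpace X] [MeasurableSpace X] [BorelSpace X]
  {E : Type*} [NormedAddCommGroup E] [NormedSpace ℝ E] [FiniteDimensional ℝ E] [MeasureSpace E]
  [BorelSpace E] [(volume : Measure E).IsAddHaarMeasure]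

/-- The image under `f` of the measure with density `w` on `T`. -/
def paramMeasure (f : E → X) (T : Set E) (w : E → ENNReal) : Measure X :=
  Measure.map f ((volume.restrict T).withDensity w)

variable {f f' : E → X} {T T' : Set E} {w w' : E → ENNReal}

theorem measurableSet_inter_preimage_of_continuousOn (hT : MeasurableSet T) (hf : ContinuousOn f T)
    {A : Set X} (hA : MeasurableSet A) : MeasurableSet (T ∩ f ⁻¹' A) := by
  have h1 : Measurable (T.domRestrict f) := (continuousOn_iff_continuous_domRestrict.1 hf).measurable
  have h2 : T ∩ f ⁻¹' A = Subtype.val '' (T.domRestrict f ⁻¹' A) := by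
    ext x; simp [domRestrict, and_comm]
  rw [h2]
  exact hT.subtype_image (h1 hA)

theorem aemeasurable_param (hT : IsOpen T) (hf : ContinuousOn f T) :
    AEMeasurable f ((volume.restrict T).withDensity w) :=
  (hf.aemeasurable hT.measurableSet).mono_ac (withDensity_absolutelyContinuous _ _)

theorem paramMeasure_apply (hT : IsOpen T) (hf : ContinuousOn f T) {A : Set X}
    (hA : MeasurableSet A) : paramMeasure f T w A = ∫⁻ y in T ∩ f ⁻¹' A, w y := by
  rw [paramMeasure, Measure.map_apply_of_aemeasurable (aemeasurable_param hT hf) hA,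
    withDensity_apply', Measure.restrict_restrict' hT.measurableSet, inter_comm]

theorem paramMeasure_restrict_self (hT : IsOpen T) (hf : ContinuousOn f T) {s : Set X}
    (hs : MeasurableSet s) (hfs : MapsTo f T s) :
    (paramMeasure f T w).restrict s = paramMeasure f T w := by
  ext A hA
  rw [Measure.restrict_apply hA, paramMeasure_apply hT hf (hA.inter hs), paramMeasure_apply hT hf hA]
  congr 2
  ext y
  simp only [mem_inter_iff, mem_preimage]
  exact ⟨fun h => ⟨h.1, h.2.1⟩, fun h => ⟨h.1, h.2, hfs h.1⟩⟩

/-- The change of variables formula for `ψ`: the two parametrizations cover the same part of `X`,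
and their densities differ by the Jacobian determinant. -/
theorem paramMeasure_restrict_comm (hT : IsOpen T) (hf : ContinuousOn f T) (hT' : IsOpen T')
    (hf' : ContinuousOn f' T') {s s' : Set X} (hs : MeasurableSet s) (hs' : MeasurableSet s')
    (hfs : MapsTo f T s) {ψ : E → E} {ψ' : E → E →L[ℝ] E}
    (hψ : ∀ y ∈ T ∩ f ⁻¹' s', ψ y ∈ T' ∧ f' (ψ y) = f y)
    (hinj : InjOn ψ (T ∩ f ⁻¹' s'))
    (hsurj : ∀ z ∈ T' ∩ f' ⁻¹' s, ∃ y ∈ T ∩ f ⁻¹' s', ψ y = z)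
    (hd : ∀ y ∈ T ∩ f ⁻¹' s', HasFDerivAt ψ (ψ' y) y)
    (hw : ∀ y ∈ T ∩ f ⁻¹' s', w y = ENNReal.ofReal |(ψ' y).det| * w' (ψ y)) :
    (paramMeasure f T w).restrict s' = (paramMeasure f' T' w').restrict s := by
  ext A hA
  rw [Measure.restrict_apply hA, Measure.restrict_apply hA, paramMeasure_apply hT hf (hA.inter hs'),
    paramMeasure_apply hT' hf' (hA.inter hs)]
  have hsub : T ∩ f ⁻¹' (A ∩ s') ⊆ T ∩ f ⁻¹' s' := fun y hy => ⟨hy.1, hy.2.2⟩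
  have himg : T' ∩ f' ⁻¹' (A ∩ s) = ψ '' (T ∩ f ⁻¹' (A ∩ s')) := by
    ext z
    constructor
    · rintro ⟨hz, hzA, hzs⟩
      obtain ⟨y, hy, rfl⟩ := hsurj z ⟨hz, hzs⟩
      refine ⟨y, ⟨hy.1, ?_, hy.2⟩, rfl⟩
      rw [← (hψ y hy).2]
      exact hzA
    · rintro ⟨y, hy, rfl⟩
      obtain ⟨h1, h2⟩ := hψ y (hsub hy)
      refine ⟨h1, ?_⟩
      rw [mem_preimage, h2]
      exact ⟨hy.2.1, hfs hy.1⟩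
  have hmeas := measurableSet_inter_preimage_of_continuousOn hT.measurableSet hf (hA.inter hs')
  rw [himg, lintegral_image_eq_lintegral_abs_det_fderiv_mul volume hmeas
    (fun y hy => (hd y (hsub hy)).hasFDerivWithinAt) (hinj.mono hsub)]
  exact setLIntegral_congr_fun hmeas fun y hy => hw y (hsub hy)

theorem integral_paramMeasure (hT : IsOpen T) (hf : ContinuousOn f T) {v : E → ℝ}
    (hv : ContinuousOn v T) (hv0 : ∀ y ∈ T, 0 ≤ v y) {F : X → ℝ}
    (hF : AEStronglyMeasurable F (paramMeasure f T fun y => ENNReal.ofReal (v y))) :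
    ∫ x, F x ∂(paramMeasure f T fun y => ENNReal.ofReal (v y)) = ∫ y in T, v y * F (f y) := by
  rw [paramMeasure, integral_map (aemeasurable_param hT hf) hF,
    integral_withDensity_eq_integral_toReal_smul₀
      (hv.aemeasurable hT.measurableSet).ennreal_ofReal (by simp)]
  refine setIntegral_congr_fun hT.measurableSet fun y hy => ?_
  simp only [smul_eq_mul, ENNReal.toReal_ofReal (hv0 y hy)]

/-- Measures that agree on overlaps are glued by their supremum. -/
theorem iSup_restrict_eq {ι : Type*} (μ : ι → Measure X) (s : ι → Set X)
    (hs : ∀ i, MeasurableSet (s i)) (h0 : ∀ i, (μ i).restrict (s i) = μ i)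
    (hc : ∀ i j, (μ i).restrict (s j) = (μ j).restrict (s i)) (i : ι) :
    (⨆ j, μ j).restrict (s i) = μ i := by
  refine le_antisymm ?_ ?_
  -- A measure dominating every `μ j`: inside `s i` compatibility bounds `μ j` by `μ i`, and outside
  -- the supremum is its own bound. No countability of the family is needed.
  · set ρ := μ i + (⨆ j, μ j).restrict (s i)ᶜ with hρ
    have hle : ⨆ j, μ j ≤ ρ := by
      refine iSup_le fun j => ?_
      rw [← Measure.restrict_add_restrict_compl (μ := μ j) (hs i), hρ, hc j i]
      exact add_le_add Measure.restrict_le_self (Measure.restrict_mono le_rfl (le_iSup μ j))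
    calc (⨆ j, μ j).restrict (s i) ≤ ρ.restrict (s i) := Measure.restrict_mono le_rfl hle
      _ = μ i := by
        rw [hρ, Measure.restrict_add, h0, Measure.restrict_restrict (hs i), inter_compl_self,
          Measure.restrict_empty, add_zero]
  · calc μ i = (μ i).restrict (s i) := (h0 i).symm
      _ ≤ (⨆ j, μ j).restrict (s i) := Measure.restrict_mono le_rfl (le_iSup μ i)

end ParamMeasure

/-! ### The Riemannian measure in a chart -/

theorem det_eq_det_of_apply_single (L : Coord n →L[ℝ] Coord n) :
    L.det = (Matrix.of fun a i : Fin n => L (EuclideanSpace.single i 1) a).det := by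
  rw [ContinuousLinearMap.det, ← LinearMap.det_toMatrix (EuclideanSpace.basisFun (Fin n) ℝ).toBasis]
  rfl

theorem sqrt_det_transpose_mul_mul {ι : Type*} [Fintype ι] [DecidableEq ι] (J A : Matrix ι ι ℝ) :
    √(J.transpose * A * J).det = |J.det| * √A.det := by
  rw [Matrix.det_mul, Matrix.det_mul, Matrix.det_transpose,
    show J.det * A.det * J.det = J.det ^ 2 * A.det by ring, Real.sqrt_mul (sq_nonneg _),
    Real.sqrt_sq_eq_abs]

section ChartMeasures

variable {M : Type*} [TopologicalSpace M] [ChartedSpace (Coord n) M] [IsManifold (𝓡 n) ∞ M]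
  {e e' : OpenPartialHomeomorph M (Coord n)}

theorem det_fderiv_transition (he : e ∈ IsManifold.maximalAtlas (𝓡 n) ∞ M)
    (he' : e' ∈ IsManifold.maximalAtlas (𝓡 n) ∞ M) {y : Coord n} (hy : y ∈ overlap e e') :
    (fderiv ℝ (transition e e') y).det = (jac (transition e e') y).det := by
  rw [det_eq_det_of_apply_single]
  congr 1
  ext a i
  exact fderiv_transition_apply (isOpen_overlap _ _) (contDiffOn_transition he he') hy a i

theorem hasFDerivAt_transition (he : e ∈ IsManifold.maximalAtlas (𝓡 n) ∞ M)
    (he' : e' ∈ IsManifold.maximalAtlas (𝓡 n) ∞ M) {y : Coord n} (hy : y ∈ overlap e e') :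
    HasFDerivAt (transition e e') (fderiv ℝ (transition e e') y) y :=
  (((contDiffOn_transition he he' y hy).contDiffAt
    ((isOpen_overlap _ _).mem_nhds hy)).differentiableAt (by simp)).hasFDerivAt

theorem injOn_transition (e e' : OpenPartialHomeomorph M (Coord n)) :
    InjOn (transition e e') (overlap e e') := fun y hy z hz h => by
  rw [← transition_transition hy, ← transition_transition hz, h]

variable [MeasurableSpace M] [BorelSpace M]

theorem chartVolume_eq (g : Metric n M) (e : OpenPartialHomeomorph M (Coord n)) :
    chartVolume g e = paramMeasure e.symm e.target
      fun y => ENNReal.ofReal (√(components g.inner e y).det) := rfl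

theorem chartVolume_restrict_self (g : Metric n M) (e : OpenPartialHomeomorph M (Coord n)) :
    (chartVolume g e).restrict e.source = chartVolume g e :=
  paramMeasure_restrict_self e.open_target e.continuousOn_symm e.open_source.measurableSet
    e.mapsTo_symm

theorem chartVolume_restrict_comm (g : Metric n M) (he : e ∈ IsManifold.maximalAtlas (𝓡 n) ∞ M)
    (he' : e' ∈ IsManifold.maximalAtlas (𝓡 n) ∞ M) :
    (chartVolume g e).restrict e'.source = (chartVolume g e').restrict e.source := by
  refine paramMeasure_restrict_comm (ψ := transition e e') (ψ' := fderiv ℝ (transition e e'))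
    e.open_target e.continuousOn_symm e'.open_target e'.continuousOn_symm
    e.open_source.measurableSet e'.open_source.measurableSet e.mapsTo_symm
    (fun y hy => ⟨(mapsTo_transition e e' hy).1, symm_transition hy⟩) (injOn_transition e e')
    (fun z hz => ⟨transition e' e z, mapsTo_transition e' e hz, transition_transition hz⟩)
    (fun y hy => hasFDerivAt_transition he he' hy) fun y hy => ?_
  rw [components_transition (n := n) g.inner he he' hy, pullMat, sqrt_det_transpose_mul_mul,
    ENNReal.ofReal_mul (abs_nonneg _), det_fderiv_transition he he' hy]

/-- The gluing lemma covers the charts of the atlas, over which the supremum is taken. A chart of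
the maximal atlas is compared with these on a countable cover; second countability enters here. -/
theorem riemannianVolume_restrict [SecondCountableTopology M] (g : Metric n M)
    (he : e ∈ IsManifold.maximalAtlas (𝓡 n) ∞ M) :
    (riemannianVolume g).restrict e.source = chartVolume g e := by
  have hatlas : ∀ e' ∈ atlas (Coord n) M, e' ∈ IsManifold.maximalAtlas (𝓡 n) ∞ M := fun e' h =>
    StructureGroupoid.subset_maximalAtlas _ h
  have h1 : ∀ e' ∈ atlas (Coord n) M,
      (riemannianVolume g).restrict e'.source = chartVolume g e' := by
    intro e' h'
    have := iSup_restrict_eq (fun e : atlas (Coord n) M => chartVolume g e.1) (fun e => e.1.source)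
      (fun e => e.1.open_source.measurableSet) (fun e => chartVolume_restrict_self g e.1)
      (fun e e' => chartVolume_restrict_comm g (hatlas _ e.2) (hatlas _ e'.2)) ⟨e', h'⟩
    rwa [iSup_subtype] at this
  obtain ⟨s, hs, hcover⟩ := TopologicalSpace.countable_cover_nhds
    (fun x : M => chart_source_mem_nhds (Coord n) x)
  have : Countable s := hs.to_subtype
  have h2 : ((riemannianVolume g).restrict e.source).restrict
      (⋃ x : s, (chartAt (Coord n) (x : M)).source) =
      (chartVolume g e).restrict (⋃ x : s, (chartAt (Coord n) (x : M)).source) := by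
    rw [Measure.restrict_iUnion_congr]
    intro x
    have hx := hatlas _ (chart_mem_atlas (Coord n) (x : M))
    rw [chartVolume_restrict_comm g he hx, ← h1 _ (chart_mem_atlas (Coord n) (x : M)),
      Measure.restrict_restrict (chartAt (Coord n) (x : M)).open_source.measurableSet,
      Measure.restrict_restrict e.open_source.measurableSet, inter_comm]
  rw [← biUnion_eq_iUnion s (fun x _ => (chartAt (Coord n) x).source), hcover,
    Measure.restrict_univ, Measure.restrict_univ] at h2
  exact h2

end ChartMeasures

/-! ### Changes of boundary charts -/

section BoundaryCharts

variable [NeZero n] {M : Type*} [TopologicalSpace M] [ChartedSpace (Coord n) M]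
  [IsManifold (𝓡 n) ∞ M] {e e' : OpenPartialHomeomorph M (Coord n)} {U : Set M}

theorem hyperplaneIncl_zero_apply (z : {i : Fin n // i ≠ 0} → ℝ) : hyperplaneIncl z 0 = 0 := by
  simp [hyperplaneIncl]

theorem hyperplaneIncl_apply (z : {i : Fin n // i ≠ 0} → ℝ) (a : {i : Fin n // i ≠ 0}) :
    hyperplaneIncl z a = z a := by
  simp [hyperplaneIncl, a.2]

/-- The projection to the boundary of the half space. -/
def hyperplaneProj : Coord n →L[ℝ] ({i : Fin n // i ≠ 0} → ℝ) :=
  ContinuousLinearMap.pi fun a => EuclideanSpace.proj (𝕜 := ℝ) (a : Fin n)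

/-- `hyperplaneIncl` as a linear map. -/
def hyperplaneInclL : ({i : Fin n // i ≠ 0} → ℝ) →L[ℝ] Coord n :=
  LinearMap.toContinuousLinearMap
    { toFun := hyperplaneIncl
      map_add' := fun x y => by ext i; by_cases hi : i = 0 <;> simp [hyperplaneIncl, hi]
      map_smul' := fun r x => by ext i; by_cases hi : i = 0 <;> simp [hyperplaneIncl, hi] }

theorem hyperplaneInclL_apply (z : {i : Fin n // i ≠ 0} → ℝ) :
    hyperplaneInclL z = hyperplaneIncl z := rfl

theorem hyperplaneProj_apply (y : Coord n) (a : {i : Fin n // i ≠ 0}) :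
    hyperplaneProj y a = y a := rfl

theorem hyperplaneProj_incl (z : {i : Fin n // i ≠ 0} → ℝ) :
    hyperplaneProj (hyperplaneIncl z) = z := by
  funext a
  rw [hyperplaneProj_apply, hyperplaneIncl_apply]

theorem hyperplaneIncl_proj {y : Coord n} (hy : y 0 = 0) :
    hyperplaneIncl (hyperplaneProj y) = y := by
  ext i
  by_cases hi : i = 0
  · subst hi; rw [hyperplaneIncl_zero_apply, hy]
  · exact hyperplaneIncl_apply (hyperplaneProj y) ⟨i, hi⟩

theorem hyperplaneInclL_single (a : {i : Fin n // i ≠ 0}) :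
    hyperplaneInclL (Pi.single a 1) = EuclideanSpace.single (a : Fin n) (1 : ℝ) := by
  ext i
  by_cases hi : i = 0
  · subst hi
    rw [hyperplaneInclL_apply, hyperplaneIncl_zero_apply]
    simp [a.2.symm]
  · rw [hyperplaneInclL_apply, hyperplaneIncl_apply (a := ⟨i, hi⟩)]
    simp [Pi.single_apply, Subtype.ext_iff]

theorem transition_pos_iff (he : IsBoundaryChart U e) (he' : IsBoundaryChart U e') {y : Coord n}
    (hy : y ∈ overlap e e') : 0 < y 0 ↔ 0 < transition e e' y 0 := by
  have h1 : e.symm y ∈ U ↔ 0 < transition e e' y 0 := he'.2 _ hy.2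
  rw [← h1, he.2 _ (e.map_target hy.1), e.right_inv hy.1]

/-- The image cannot lie on the inner side, by the equivalence of signs. If it lay strictly outside,
then by continuity so would the images of nearby inner points, which is excluded by the same
equivalence. -/
theorem transition_zero (he : IsBoundaryChart U e) (he' : IsBoundaryChart U e') {y : Coord n}
    (hy : y ∈ overlap e e') (h0 : y 0 = 0) : transition e e' y 0 = 0 := by
  refine le_antisymm (not_lt.1 fun h => ?_) (not_lt.1 fun h => ?_)
  · exact (((transition_pos_iff he he' hy).2 h).ne' h0)
  · have hc : ContinuousAt (fun t : ℝ => transition e e' (y + t • EuclideanSpace.single 0 1) 0) 0 := by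
      have h1 : ContinuousAt (fun z => transition e e' z 0) y :=
        ((((coordChange_transition he.1 he'.1).smooth 0).continuousOn).continuousAt
          ((isOpen_overlap e e').mem_nhds hy))
      have h2 : ContinuousAt (fun t : ℝ => y + t • (EuclideanSpace.single 0 1 : Coord n)) 0 := by
        fun_prop
      exact ContinuousAt.comp (g := fun z => transition e e' z 0) (by simpa using h1) h2
    have hc2 : ContinuousAt (fun t : ℝ => y + t • (EuclideanSpace.single 0 1 : Coord n)) 0 := by
      fun_prop
    have e1 : ∀ᶠ t in 𝓝 (0 : ℝ), transition e e' (y + t • EuclideanSpace.single 0 1) 0 < 0 :=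
      hc.eventually_lt continuousAt_const (by simpa using h)
    have e2 : ∀ᶠ t in 𝓝 (0 : ℝ), y + t • (EuclideanSpace.single 0 1 : Coord n) ∈ overlap e e' :=
      hc2.eventually_mem ((isOpen_overlap e e').mem_nhds (by simpa using hy))
    have e3 : ∀ᶠ t in 𝓝[>] (0 : ℝ), False := by
      filter_upwards [e1.filter_mono nhdsWithin_le_nhds, e2.filter_mono nhdsWithin_le_nhds,
        self_mem_nhdsWithin] with t h1 h2 h3
      have := (transition_pos_iff he he' h2).1 (by simpa [h0] using h3)
      exact lt_asymm h1 this
    obtain ⟨t, ht⟩ := e3.exists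
    exact ht

/-- Along the hyperplane the first component of the transition map vanishes identically, hence so do
its tangential derivatives. -/
theorem jac_transition_zero (he : IsBoundaryChart U e) (he' : IsBoundaryChart U e') {y : Coord n}
    (hy : y ∈ overlap e e') (h0 : y 0 = 0) {a : Fin n} (ha : a ≠ 0) :
    jac (transition e e') y 0 a = 0 := by
  have hφ := coordChange_transition he.1 he'.1
  have hd : HasFDerivAt (fun z => transition e e' z 0)
      (fderiv ℝ (fun z => transition e e' z 0) y) (y + (0 : ℝ) • EuclideanSpace.single a 1) := by
    rw [zero_smul, add_zero]
    exact (ContDiffOn.diffAt (hφ.smooth 0) hφ.isOpen hy).hasFDerivAt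
  have hl : HasDerivAt (fun t : ℝ => y + t • (EuclideanSpace.single a 1 : Coord n))
      (EuclideanSpace.single a 1) 0 := by
    simpa using ((hasDerivAt_id (0 : ℝ)).smul_const (EuclideanSpace.single a 1 : Coord n)).const_add y
  have hcomp := hd.comp_hasDerivAt 0 hl
  have hz : (fun z => transition e e' z 0) ∘ (fun t : ℝ => y + t • EuclideanSpace.single a 1)
      =ᶠ[𝓝 0] fun _ => 0 := by
    have hc2 : ContinuousAt (fun t : ℝ => y + t • (EuclideanSpace.single a 1 : Coord n)) 0 := by
      fun_prop
    filter_upwards [hc2.eventually_mem ((isOpen_overlap e e').mem_nhds (by simpa using hy))]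
      with t ht
    refine transition_zero he he' ht ?_
    simp [h0, ha.symm]
  exact hcomp.unique ((hasDerivAt_const 0 (0 : ℝ)).congr_of_eventuallyEq hz)

/-- The first component vanishes on the hyperplane and is positive on the inner side, so its inward
derivative is nonnegative. It is not zero, for then a whole row of the invertible Jacobian would
vanish. -/
theorem jac_transition_pos (he : IsBoundaryChart U e) (he' : IsBoundaryChart U e') {y : Coord n}
    (hy : y ∈ overlap e e') (h0 : y 0 = 0) : 0 < jac (transition e e') y 0 0 := by
  have hφ := coordChange_transition he.1 he'.1
  have hd : HasFDerivAt (fun z => transition e e' z 0)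
      (fderiv ℝ (fun z => transition e e' z 0) y) (y + (0 : ℝ) • EuclideanSpace.single 0 1) := by
    rw [zero_smul, add_zero]
    exact (ContDiffOn.diffAt (hφ.smooth 0) hφ.isOpen hy).hasFDerivAt
  have hl : HasDerivAt (fun t : ℝ => y + t • (EuclideanSpace.single 0 1 : Coord n))
      (EuclideanSpace.single 0 1) 0 := by
    simpa using ((hasDerivAt_id (0 : ℝ)).smul_const (EuclideanSpace.single 0 1 : Coord n)).const_add y
  have hcomp : HasDerivAt (fun t : ℝ => transition e e' (y + t • EuclideanSpace.single 0 1) 0)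
      (jac (transition e e') y 0 0) 0 :=
    HasFDerivAt.comp_hasDerivAt (l := fun z => transition e e' z 0)
      (f := fun t : ℝ => y + t • (EuclideanSpace.single 0 1 : Coord n)) 0 hd hl
  have hge : 0 ≤ jac (transition e e') y 0 0 := by
    have hlim := (hasDerivAt_iff_tendsto_slope_zero.1 hcomp).mono_left
      (nhdsWithin_mono (0 : ℝ) (s := Ioi 0) fun t (ht : 0 < t) => ht.ne')
    refine ge_of_tendsto hlim ?_
    have hc2 : ContinuousAt (fun t : ℝ => y + t • (EuclideanSpace.single 0 1 : Coord n)) 0 := by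
      fun_prop
    filter_upwards [(hc2.eventually_mem ((isOpen_overlap e e').mem_nhds
      (by simpa using hy))).filter_mono nhdsWithin_le_nhds, self_mem_nhdsWithin] with t h1 h2
    have h3 : 0 < transition e e' (y + t • EuclideanSpace.single 0 1) 0 :=
      (transition_pos_iff he he' h1).1 (by simpa [h0] using h2)
    have h4 := transition_zero he he' hy h0
    simp only [zero_add, zero_smul, add_zero, h4, sub_zero, smul_eq_mul]
    exact mul_nonneg (inv_nonneg.2 (le_of_lt h2)) h3.le
  refine lt_of_le_of_ne hge fun h => hφ.det y hy ?_
  refine Matrix.det_eq_zero_of_row_eq_zero 0 fun a => ?_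
  by_cases ha : a = 0
  · rw [ha, ← h]
  · exact jac_transition_zero he he' hy h0 ha

end BoundaryCharts

/-! ### The surface measure in a boundary chart -/

theorem det_eq_det_of_apply_pi_single {ι : Type*} [Fintype ι] [DecidableEq ι]
    (L : (ι → ℝ) →L[ℝ] (ι → ℝ)) :
    L.det = (Matrix.of fun a i : ι => L (Pi.single i 1) a).det := by
  rw [ContinuousLinearMap.det, ← LinearMap.det_toMatrix (Pi.basisFun ℝ ι)]
  rfl

section SurfaceMeasure

variable [NeZero n] {M : Type*} [TopologicalSpace M] [ChartedSpace (Coord n) M]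
  [IsManifold (𝓡 n) ∞ M] {e e' : OpenPartialHomeomorph M (Coord n)} {U : Set M}

/-- The parameters of the boundary points in a boundary chart. -/
def boundaryDomain (e : OpenPartialHomeomorph M (Coord n)) : Set ({i : Fin n // i ≠ 0} → ℝ) :=
  {z | hyperplaneIncl z ∈ e.target}

theorem continuous_hyperplaneIncl :
    Continuous (hyperplaneIncl : ({i : Fin n // i ≠ 0} → ℝ) → Coord n) :=
  hyperplaneInclL.continuous

theorem isOpen_boundaryDomain (e : OpenPartialHomeomorph M (Coord n)) :
    IsOpen (boundaryDomain e) := e.open_target.preimage continuous_hyperplaneIncl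

theorem continuousOn_symm_hyperplaneIncl (e : OpenPartialHomeomorph M (Coord n)) :
    ContinuousOn (fun z => e.symm (hyperplaneIncl z)) (boundaryDomain e) :=
  e.continuousOn_symm.comp continuous_hyperplaneIncl.continuousOn fun _ hz => hz

/-- The metric induced on the hyperplane `x_0 = 0`. -/
def boundaryMetric (G : MatField n) (y : Coord n) :
    Matrix {i : Fin n // i ≠ 0} {i : Fin n // i ≠ 0} ℝ :=
  (G y).submatrix (fun a => (a : Fin n)) (fun a => (a : Fin n))

/-- The first row of the Jacobian vanishes in tangential directions, so the index `0` drops out of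
the pullback formula and the tangential blocks transform among themselves. -/
theorem boundaryMetric_transition (g : Metric n M) (he : IsBoundaryChart U e)
    (he' : IsBoundaryChart U e') {y : Coord n} (hy : y ∈ overlap e e') (h0 : y 0 = 0) :
    boundaryMetric (components g.inner e) y =
      ((jac (transition e e') y).submatrix (fun a : {i : Fin n // i ≠ 0} => (a : Fin n))
        (fun a : {i : Fin n // i ≠ 0} => (a : Fin n))).transpose *
      boundaryMetric (components g.inner e') (transition e e' y) *
      (jac (transition e e') y).submatrix (fun a : {i : Fin n // i ≠ 0} => (a : Fin n))
        (fun a : {i : Fin n // i ≠ 0} => (a : Fin n)) := by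
  have hsub : ∀ (F : Fin n → ℝ), F 0 = 0 → ∑ a, F a = ∑ a : {i : Fin n // i ≠ 0}, F a := by
    intro F hF
    rw [← Finset.sum_erase Finset.univ hF]
    exact Finset.sum_subtype _ (by simp) F
  ext a b
  simp only [boundaryMetric, Matrix.submatrix_apply]
  rw [components_transition (n := n) g.inner he.1 he'.1 hy, pullMat_apply]
  simp only [Matrix.mul_apply, Matrix.transpose_apply, Matrix.submatrix_apply, Finset.sum_mul]
  rw [Finset.sum_comm, hsub]
  · refine Finset.sum_congr rfl fun d _ => ?_
    rw [hsub]
    rw [jac_transition_zero he he' hy h0 a.2]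
    ring
  · rw [jac_transition_zero he he' hy h0 b.2]
    simp

/-- The transition map between boundary points. -/
def boundaryTransition (e e' : OpenPartialHomeomorph M (Coord n))
    (z : {i : Fin n // i ≠ 0} → ℝ) : {i : Fin n // i ≠ 0} → ℝ :=
  hyperplaneProj (transition e e' (hyperplaneIncl z))

theorem hyperplaneIncl_boundaryTransition (he : IsBoundaryChart U e) (he' : IsBoundaryChart U e')
    {z : {i : Fin n // i ≠ 0} → ℝ} (hz : hyperplaneIncl z ∈ overlap e e') :
    hyperplaneIncl (boundaryTransition e e' z) = transition e e' (hyperplaneIncl z) :=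
  hyperplaneIncl_proj (transition_zero he he' hz (hyperplaneIncl_zero_apply z))

theorem boundaryTransition_transition (he : IsBoundaryChart U e) (he' : IsBoundaryChart U e')
    {z : {i : Fin n // i ≠ 0} → ℝ} (hz : hyperplaneIncl z ∈ overlap e e') :
    boundaryTransition e' e (boundaryTransition e e' z) = z := by
  rw [boundaryTransition, hyperplaneIncl_boundaryTransition he he' hz, transition_transition hz,
    hyperplaneProj_incl]

/-- The derivative of the transition map between boundary points. -/
def boundaryTransitionDeriv (e e' : OpenPartialHomeomorph M (Coord n))
    (z : {i : Fin n // i ≠ 0} → ℝ) : ({i : Fin n // i ≠ 0} → ℝ) →L[ℝ] ({i : Fin n // i ≠ 0} → ℝ) :=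
  hyperplaneProj.comp ((fderiv ℝ (transition e e') (hyperplaneIncl z)).comp hyperplaneInclL)

theorem hasFDerivAt_boundaryTransition (he : IsBoundaryChart U e) (he' : IsBoundaryChart U e')
    {z : {i : Fin n // i ≠ 0} → ℝ} (hz : hyperplaneIncl z ∈ overlap e e') :
    HasFDerivAt (boundaryTransition e e') (boundaryTransitionDeriv e e' z) z :=
  hyperplaneProj.hasFDerivAt.comp z
    ((hasFDerivAt_transition he.1 he'.1 hz).comp z hyperplaneInclL.hasFDerivAt)

theorem det_boundaryTransitionDeriv (he : IsBoundaryChart U e) (he' : IsBoundaryChart U e')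
    {z : {i : Fin n // i ≠ 0} → ℝ} (hz : hyperplaneIncl z ∈ overlap e e') :
    (boundaryTransitionDeriv e e' z).det =
      ((jac (transition e e') (hyperplaneIncl z)).submatrix
        (fun a : {i : Fin n // i ≠ 0} => (a : Fin n))
        (fun a : {i : Fin n // i ≠ 0} => (a : Fin n))).det := by
  rw [det_eq_det_of_apply_pi_single]
  congr 1
  ext a b
  simp only [boundaryTransitionDeriv, Matrix.of_apply, ContinuousLinearMap.comp_apply,
    hyperplaneInclL_single, hyperplaneProj_apply, Matrix.submatrix_apply]
  exact fderiv_transition_apply (isOpen_overlap _ _) (contDiffOn_transition he.1 he'.1) hz _ _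

/-- The boundary points in a boundary chart. -/
theorem mem_frontier_iff (hU : IsOpen U) (he : IsBoundaryChart U e) {p : M} (hp : p ∈ e.source) :
    p ∈ frontier U ↔ e p 0 = 0 := by
  rw [hU.frontier_eq]
  constructor
  · rintro ⟨hcl, hnot⟩
    refine le_antisymm (not_lt.1 fun h => hnot ((he.2 p hp).2 h)) (not_lt.1 fun h => ?_)
    have hc : ContinuousAt (fun q => e q 0) p :=
      ContinuousAt.comp (g := fun y : Coord n => y 0) (by fun_prop) (e.continuousAt hp)
    have h1 : ∀ᶠ q in 𝓝 p, e q 0 < 0 ∧ q ∈ e.source :=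
      (hc.eventually_lt continuousAt_const h).and (e.open_source.mem_nhds hp)
    obtain ⟨q, ⟨hq, hqs⟩, hqU⟩ := mem_closure_iff_nhds.1 hcl _ h1
    exact lt_asymm hq ((he.2 q hqs).1 hqU)
  · intro h
    refine ⟨?_, fun hpU => ((he.2 p hp).1 hpU).ne' h⟩
    have hc : ContinuousAt (fun t : ℝ => e p + t • (EuclideanSpace.single 0 1 : Coord n)) 0 := by
      fun_prop
    have hlim : Filter.Tendsto (fun t : ℝ => e.symm (e p + t • EuclideanSpace.single 0 1))
        (𝓝[>] 0) (𝓝 p) := by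
      have h1 : ContinuousAt e.symm (e p + (0 : ℝ) • (EuclideanSpace.single 0 1 : Coord n)) := by
        simpa using e.continuousAt_symm (e.map_source hp)
      have h2 := ContinuousAt.comp (g := e.symm) (x := (0 : ℝ)) h1 hc
      have h3 := h2.tendsto.mono_left (nhdsWithin_le_nhds (s := Ioi 0))
      simpa [e.left_inv hp, Function.comp_def] using h3
    refine mem_closure_of_tendsto hlim ?_
    filter_upwards [(hc.eventually_mem (e.open_target.mem_nhds
      (by simpa using e.map_source hp))).filter_mono nhdsWithin_le_nhds, self_mem_nhdsWithin]
      with t h1 h2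
    rw [he.2 _ (e.map_target h1), e.right_inv h1]
    simpa [h] using h2

variable [MeasurableSpace M] [BorelSpace M]

theorem chartSurface_eq (g : Metric n M) (e : OpenPartialHomeomorph M (Coord n)) :
    chartSurface g e = paramMeasure (fun z => e.symm (hyperplaneIncl z)) (boundaryDomain e)
      fun z => ENNReal.ofReal
        (√(boundaryMetric (components g.inner e) (hyperplaneIncl z)).det) := rfl

theorem chartSurface_restrict_self (g : Metric n M) (e : OpenPartialHomeomorph M (Coord n)) :
    (chartSurface g e).restrict e.source = chartSurface g e :=
  paramMeasure_restrict_self (isOpen_boundaryDomain e) (continuousOn_symm_hyperplaneIncl e)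
    e.open_source.measurableSet fun _ hz => e.map_target hz

theorem chartSurface_restrict_comm (g : Metric n M) (he : IsBoundaryChart U e)
    (he' : IsBoundaryChart U e') :
    (chartSurface g e).restrict e'.source = (chartSurface g e').restrict e.source := by
  refine paramMeasure_restrict_comm (ψ := boundaryTransition e e')
    (ψ' := boundaryTransitionDeriv e e')
    (isOpen_boundaryDomain e) (continuousOn_symm_hyperplaneIncl e) (isOpen_boundaryDomain e')
    (continuousOn_symm_hyperplaneIncl e')
    e.open_source.measurableSet e'.open_source.measurableSet (fun _ hz => e.map_target hz)
    (fun z hz => ?_) (fun z hz w hw h => ?_) (fun w hw => ⟨boundaryTransition e' e w, ?_, ?_⟩)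
    (fun z hz => hasFDerivAt_boundaryTransition he he' hz) fun z hz => ?_
  · have hz' : hyperplaneIncl z ∈ overlap e e' := hz
    have h1 := hyperplaneIncl_boundaryTransition he he' hz'
    refine ⟨?_, ?_⟩
    · rw [boundaryDomain, mem_ofPred_eq, h1]
      exact (mapsTo_transition e e' hz').1
    · simp only [h1, symm_transition hz']
  · rw [← boundaryTransition_transition he he' (z := z) hz, h,
      boundaryTransition_transition he he' (z := w) hw]
  · have hw' : hyperplaneIncl w ∈ overlap e' e := hw
    have h1 : hyperplaneIncl (boundaryTransition e' e w) ∈ overlap e e' := by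
      rw [hyperplaneIncl_boundaryTransition he' he hw']
      exact mapsTo_transition e' e hw'
    exact h1
  · exact boundaryTransition_transition he' he hw
  · have hz' : hyperplaneIncl z ∈ overlap e e' := hz
    change ENNReal.ofReal (√(boundaryMetric _ _).det) = _ * ENNReal.ofReal (√(boundaryMetric _ _).det)
    rw [boundaryMetric_transition g he he' hz' (hyperplaneIncl_zero_apply z),
      sqrt_det_transpose_mul_mul, ENNReal.ofReal_mul (abs_nonneg _),
      det_boundaryTransitionDeriv he he' hz', hyperplaneIncl_boundaryTransition he he' hz']

/-- The supremum already runs over all boundary charts, so the gluing lemma suffices without a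
countable cover. -/
theorem surfaceMeasure_restrict (g : Metric n M) (he : IsBoundaryChart U e) :
    (surfaceMeasure g U).restrict e.source = chartSurface g e := by
  have := iSup_restrict_eq
    (fun e : {e : OpenPartialHomeomorph M (Coord n) // IsBoundaryChart U e} => chartSurface g e.1)
    (fun e => e.1.source) (fun e => e.1.open_source.measurableSet)
    (fun e => chartSurface_restrict_self g e.1)
    (fun e e' => chartSurface_restrict_comm g e.2 e'.2) ⟨e, he⟩
  rwa [iSup_subtype] at this

end SurfaceMeasure

/-! ### The outward normal -/

section Normal

variable [NeZero n] {M : Type*} [TopologicalSpace M] [ChartedSpace (Coord n) M]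
  [IsManifold (𝓡 n) ∞ M] {e e' : OpenPartialHomeomorph M (Coord n)} {U : Set M}

/-- The normal is the normalized dual of `-dx_0`. At the boundary a transition map rescales `dx_0`
by the positive entry `(0, 0)` of its Jacobian, and this factor cancels in the normalization; its
sign is what keeps the normal outward. -/
theorem outwardNormal_transition (g : Metric n M) (he : IsBoundaryChart U e)
    (he' : IsBoundaryChart U e') {y : Coord n} (hy : y ∈ overlap e e') (h0 : y 0 = 0) (a : Fin n) :
    outwardNormal (components g.inner e') (transition e e' y) a =
      ∑ i, jac (transition e e') y a i * outwardNormal (components g.inner e) y i := by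
  have hφ := coordChange_transition he.1 he'.1
  have hpos := jac_transition_pos he he' hy h0
  have hinv : ∀ b, (components g.inner e' (transition e e' y))⁻¹ b 0 =
      (∑ i, jac (transition e e') y b i * (components g.inner e y)⁻¹ i 0)
        * jac (transition e e') y 0 0 := by
    intro b
    rw [← hφ.inv_pull_apply _ hy, ← components_transition (n := n) g.inner he.1 he'.1 hy,
      Finset.sum_mul]
    refine Finset.sum_congr rfl fun i _ => ?_
    rw [Finset.sum_eq_single 0]
    · ring
    · intro j _ hj
      rw [jac_transition_zero he he' hy h0 hj]
      ring
    · simp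
  have h00 : (components g.inner e' (transition e e' y))⁻¹ 0 0 =
      jac (transition e e') y 0 0 ^ 2 * (components g.inner e y)⁻¹ 0 0 := by
    rw [hinv, Finset.sum_eq_single 0]
    · ring
    · intro j _ hj
      rw [jac_transition_zero he he' hy h0 hj]
      ring
    · simp
  simp only [outwardNormal]
  rw [h00, hinv, Real.sqrt_mul (sq_nonneg _), Real.sqrt_sq hpos.le]
  rw [neg_div, mul_comm (jac (transition e e') y 0 0), mul_div_mul_right _ _ hpos.ne',
    Finset.sum_div, ← Finset.sum_neg_distrib]
  exact Finset.sum_congr rfl fun i _ => by ring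

/-- The value of a covector field on the outward normal, in a boundary chart. -/
def normalFlux (g : Metric n M) (Y : OpenPartialHomeomorph M (Coord n) → TensorField n 1)
    (e : OpenPartialHomeomorph M (Coord n)) (y : Coord n) : ℝ :=
  ∑ m, Y e y ![m] * outwardNormal (components g.inner e) y m

theorem CovectorFamily.normalFlux_transition
    {Y : OpenPartialHomeomorph M (Coord n) → TensorField n 1} (hY : CovectorFamily Y)
    (g : Metric n M) (he : IsBoundaryChart U e) (he' : IsBoundaryChart U e') {y : Coord n}
    (hy : y ∈ overlap e e') (h0 : y 0 = 0) :
    normalFlux g Y e y = normalFlux g Y e' (transition e e' y) := by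
  simp only [normalFlux, hY.compat e he.1 e' he'.1 y hy, outwardNormal_transition g he he' hy h0,
    pullTensor, ev, sum_fin_one_fun, Finset.mul_sum, Finset.sum_mul]
  rw [Finset.sum_comm]
  refine Finset.sum_congr rfl fun a _ => Finset.sum_congr rfl fun i _ => ?_
  simp
  ring

end Normal

/-! ### The divergence in terms of the volume density -/

section Density

variable {Ω : Set (Coord n)} {G : MatField n}

/-- Jacobi's formula: the Leibniz rule differentiates one column at a time, and each resulting
determinant is expanded by Cramer's rule. -/
theorem pd_det {ι : Type*} [Fintype ι] [DecidableEq ι] {A : Coord n → Matrix ι ι ℝ} {x : Coord n}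
    (hA : ∀ i j, DifferentiableAt ℝ (fun y => A y i j) x) (c : Fin n) :
    pd c (fun y => (A y).det) x = ∑ a, ∑ r, (A x).adjugate a r * pd c (fun y => A y r a) x := by
  have hp : ∀ σ : Equiv.Perm ι, DifferentiableAt ℝ (fun y => ∏ i, A y (σ i) i) x := fun σ =>
    (HasFDerivAt.finsetProd fun i _ => (hA (σ i) i).hasFDerivAt).differentiableAt
  have hcr : ∀ a, ∑ r, (A x).adjugate a r * pd c (fun y => A y r a) x =
      ((A x).updateCol a fun r => pd c (fun y => A y r a) x).det := by
    intro a
    rw [← Matrix.cramer_apply, Matrix.cramer_eq_adjugate_mulVec]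
    rfl
  simp only [hcr, Matrix.det_apply']
  rw [pd_sum _ fun σ _ => (hp σ).const_mul _, Finset.sum_comm]
  refine Finset.sum_congr rfl fun σ _ => ?_
  rw [pd_const_mul (hp σ), pd_prod _ fun i _ => hA _ _, Finset.mul_sum]
  refine Finset.sum_congr rfl fun a _ => ?_
  rw [← Finset.prod_erase_mul _ _ (Finset.mem_univ a), Matrix.updateCol_self]
  congr 2
  refine Finset.prod_congr rfl fun b hb => ?_
  rw [Matrix.updateCol_ne (Finset.ne_of_mem_erase hb)]

/-- Jacobi's formula with `∂g` written in Christoffel symbols; it amounts to `∂_c log √g =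
Γ^m_{mc}`. -/
theorem NondegOn.pd_det (hG : NondegOn Ω G) {x : Coord n} (hx : x ∈ Ω) (c : Fin n) :
    pd c (fun y => (G y).det) x = 2 * (G x).det * ∑ m, christoffel G m m c x := by
  have hadj : ∀ i j, (G x).adjugate i j = (G x).det * (G x)⁻¹ i j := by
    intro i j
    rw [Matrix.inv_def, Matrix.smul_apply, Ring.inverse_eq_inv', smul_eq_mul,
      mul_inv_cancel_left₀ (hG.det x hx)]
  have h1 : ∀ (i p : Fin n), ∑ j, (G x)⁻¹ i j * G x j p = if i = p then 1 else 0 := by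
    intro i p
    rw [← Matrix.mul_apply, hG.inv_mul hx, Matrix.one_apply]
  rw [WeylVariation.pd_det fun i j => ContDiffOn.diffAt (hG.smooth i j) hG.isOpen hx]
  simp only [hadj, hG.pd_eq_christoffel hx, mul_assoc, ← Finset.mul_sum]
  have h2 : ∑ a, ∑ r, (G x)⁻¹ a r * (∑ p, G x r p * christoffel G p c a x) =
      ∑ m, christoffel G m m c x := by
    refine Finset.sum_congr rfl fun a _ => ?_
    simp only [Finset.mul_sum, ← mul_assoc]
    rw [Finset.sum_comm]
    simp only [← Finset.sum_mul, h1, ite_mul, one_mul, zero_mul, Finset.sum_ite_eq,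
      Finset.mem_univ, if_true, hG.christoffel_symm hx _ c]
  have h3 : ∑ a, ∑ r, (G x)⁻¹ a r * (∑ p, G x a p * christoffel G p c r x) =
      ∑ m, christoffel G m m c x := by
    rw [← h2, Finset.sum_comm]
    exact Finset.sum_congr rfl fun a _ => Finset.sum_congr rfl fun r _ => by
      rw [hG.inv_symm hx]
  simp only [mul_add, Finset.sum_add_distrib, h2, h3]
  ring

/-- The volume density times the vector field dual to `Y`. -/
def densityFlux (G : MatField n) (Y : TensorField n 1) (m : Fin n) (y : Coord n) : ℝ :=
  √(G y).det * ∑ i, (G y)⁻¹ m i * Y y ![i]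

theorem contDiffOn_sqrt_det (hG : NondegOn Ω G) (hpos : ∀ y ∈ Ω, 0 < (G y).det) :
    ContDiffOn ℝ ∞ (fun y => √(G y).det) Ω :=
  (contDiffOn_det hG.smooth).sqrt fun y hy => (hpos y hy).ne'

theorem contDiffOn_densityFlux (hG : NondegOn Ω G) (hpos : ∀ y ∈ Ω, 0 < (G y).det)
    {Y : TensorField n 1} (hY : SmoothTensor Ω Y) (m : Fin n) :
    ContDiffOn ℝ ∞ (densityFlux G Y m) Ω :=
  (contDiffOn_sqrt_det hG hpos).mul
    (ContDiffOn.sum fun i _ => (hG.inv_smooth m i).mul (hY ![i]))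

/-- The formula `∂_m (√g Y^m) = √g div Y`. Differentiating the density gives a contracted
Christoffel symbol. It cancels one of the two terms of `∂g⁻¹`, and the other is the Christoffel term
of `∇Y`. -/
theorem sum_pd_densityFlux (hG : NondegOn Ω G) (hpos : ∀ y ∈ Ω, 0 < (G y).det)
    {Y : TensorField n 1} (hY : SmoothTensor Ω Y) {x : Coord n} (hx : x ∈ Ω) :
    ∑ m, pd m (densityFlux G Y m) x = √(G x).det * covectorDiv G Y x := by
  have hs : ∀ c, pd c (fun y => √(G y).det) x = √(G x).det * ∑ m, christoffel G m m c x := by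
    intro c
    have hd : DifferentiableAt ℝ (fun y => (G y).det) x :=
      ContDiffOn.diffAt (contDiffOn_det hG.smooth) hG.isOpen hx
    have h1 := (hd.hasFDerivAt.sqrt (hpos x hx).ne').fderiv
    have h2 := hG.pd_det hx c
    have h3 := Real.mul_self_sqrt (hpos x hx).le
    have h4 := Real.sqrt_pos.2 (hpos x hx)
    simp only [pd] at h2 ⊢
    rw [h1, smul_apply, h2, smul_eq_mul]
    field_simp
    rw [sq, h3]
  have hY' : ∀ i, DifferentiableAt ℝ (fun y => Y y ![i]) x := fun i =>
    ContDiffOn.diffAt (hY ![i]) hG.isOpen hx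
  have hterm : ∀ m i, DifferentiableAt ℝ (fun y => (G y)⁻¹ m i * Y y ![i]) x := fun m i =>
    (hG.inv_diffAt hx m i).fun_mul (hY' i)
  have hm : ∀ m, pd m (densityFlux G Y m) x =
      √(G x).det * ((∑ p, christoffel G p p m x) * ∑ i, (G x)⁻¹ m i * Y x ![i]
        + ∑ i, (-((∑ p, christoffel G m m p x * (G x)⁻¹ p i)
            + ∑ p, christoffel G i m p x * (G x)⁻¹ m p) * Y x ![i]
          + (G x)⁻¹ m i * pd m (fun y => Y y ![i]) x)) := by
    intro m
    unfold densityFlux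
    rw [pd_mul (ContDiffOn.diffAt (contDiffOn_sqrt_det hG hpos) hG.isOpen hx)
      (DifferentiableAt.fun_sum fun i _ => hterm m i), hs, pd_sum _ fun i _ => hterm m i]
    simp only [pd_mul (hG.inv_diffAt hx m _) (hY' _), hG.pd_inv' hx]
    ring
  have h1 : ∑ m, (∑ p, christoffel G p p m x) * ∑ i, (G x)⁻¹ m i * Y x ![i] =
      ∑ m, ∑ i, (∑ p, christoffel G m m p x * (G x)⁻¹ p i) * Y x ![i] := by
    simp only [Finset.sum_mul, Finset.mul_sum]
    rw [Finset.sum_congr rfl fun m _ => Finset.sum_comm, Finset.sum_comm]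
    refine Finset.sum_congr rfl fun a _ => ?_
    rw [Finset.sum_comm]
    exact Finset.sum_congr rfl fun b _ => Finset.sum_congr rfl fun d _ => by ring
  have h2 : ∑ m, ∑ i, (∑ p, christoffel G i m p x * (G x)⁻¹ m p) * Y x ![i] =
      ∑ i, ∑ j, (G x)⁻¹ i j * ∑ p, christoffel G p j i x * Y x ![p] := by
    simp only [Finset.sum_mul, Finset.mul_sum]
    rw [Finset.sum_congr rfl fun m _ => Finset.sum_comm, Finset.sum_comm]
    exact Finset.sum_congr rfl fun a _ => Finset.sum_congr rfl fun b _ =>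
      Finset.sum_congr rfl fun d _ => by rw [hG.inv_symm hx b a]; ring
  have h3 : ∑ m, ∑ i, (G x)⁻¹ m i * pd m (fun y => Y y ![i]) x =
      ∑ i, ∑ j, (G x)⁻¹ i j * pd j (fun y => Y y ![i]) x := by
    rw [Finset.sum_comm]
    exact Finset.sum_congr rfl fun a _ => Finset.sum_congr rfl fun r _ => by
      rw [hG.inv_symm hx]
  simp only [hm, ← Finset.mul_sum, Finset.sum_add_distrib, neg_mul, add_mul, Finset.sum_neg_distrib,
    neg_add, h1, h2, h3]
  congr 1
  simp only [covectorDiv, covDeriv_one, mul_sub, Finset.sum_sub_distrib]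
  ring

end Density

/-! ### The divergence theorem in a half space -/

theorem exists_bound_of_hasCompactSupport {ι E : Type*} [Finite ι] [NormedAddCommGroup E]
    {F : ι → E → ℝ} (hc : ∀ m, HasCompactSupport (F m)) :
    ∃ R : ℝ, 0 < R ∧ ∀ m, tsupport (F m) ⊆ Metric.ball 0 R := by
  have hK : IsCompact (⋃ m, tsupport (F m)) := isCompact_iUnion hc
  obtain ⟨R, hR⟩ := hK.isBounded.subset_ball 0
  refine ⟨max R 1, by positivity, fun m => (subset_iUnion _ m).trans (hR.trans ?_)⟩
  exact Metric.ball_subset_ball (le_max_left _ _)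

theorem pd_eq_zero_of_notMem_tsupport {f : Coord n → ℝ} {y : Coord n} (hy : y ∉ tsupport f)
    (i : Fin n) : pd i f y = 0 := by
  rw [pd, Function.notMem_support.1 fun h => hy (support_fderiv_subset ℝ h)]
  simp

theorem continuous_pd {f : Coord n → ℝ} (hf : ContDiff ℝ 1 f) (i : Fin n) :
    Continuous (pd i f) :=
  (hf.continuous_fderiv (by simp)).clm_apply continuous_const

/-- This matches two parametrizations of the hyperplane: by coordinates with index `i ≠ 0`, and by
`Fin N` with a zero inserted, as in the divergence theorem for boxes. -/
theorem hyperplaneIncl_piCongrLeft {N : ℕ} (x : Fin N → ℝ) :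
    hyperplaneIncl (MeasurableEquiv.piCongrLeft (fun _ => ℝ) (finSuccAboveEquiv (0 : Fin (N + 1))) x)
      = WithLp.toLp 2 ((0 : Fin (N + 1)).insertNth (0 : ℝ) x) := by
  ext i
  cases i using Fin.cases with
  | zero => simp [hyperplaneIncl_zero_apply]
  | succ j =>
    have h := hyperplaneIncl_apply (MeasurableEquiv.piCongrLeft (fun _ => ℝ)
      (finSuccAboveEquiv (0 : Fin (N + 1))) x) (finSuccAboveEquiv 0 j)
    have h2 := Equiv.piCongrLeft_apply_apply (fun _ => ℝ) (finSuccAboveEquiv (0 : Fin (N + 1))) x j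
    simp only [finSuccAboveEquiv_apply, Fin.zero_succAbove] at h h2
    rw [h]
    exact h2.trans (by simp)

/-- By compact support the half space can be replaced by a box with one face on the hyperplane and
the fields zero on all other faces. Only that face contributes to the divergence theorem for the
box. -/
theorem integral_halfSpace_sum_pd [NeZero n] {F : Fin n → Coord n → ℝ}
    (hF : ∀ m, ContDiff ℝ 1 (F m)) (hc : ∀ m, HasCompactSupport (F m)) :
    ∫ y in {y : Coord n | 0 < y 0}, ∑ m, pd m (F m) y = -∫ z, F 0 (hyperplaneIncl z) := by
  obtain ⟨N, rfl⟩ : ∃ N, n = N + 1 := Nat.exists_eq_succ_of_ne_zero (NeZero.ne n)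
  obtain ⟨R, hR, hsupp⟩ := exists_bound_of_hasCompactSupport hc
  have hnot : ∀ (w : Fin (N + 1) → ℝ) (i m : Fin (N + 1)), R ≤ |w i| →
      WithLp.toLp 2 w ∉ tsupport (F m) := by
    intro w i m hi hmem
    have h1 := mem_ball_zero_iff.1 (hsupp m hmem)
    have h2 := PiLp.norm_apply_le (WithLp.toLp 2 w : Coord (N + 1)) i
    rw [Real.norm_eq_abs] at h2
    exact absurd (hi.trans h2) (not_le.2 h1)
  have hzero : ∀ (w : Fin (N + 1) → ℝ) (i m : Fin (N + 1)), R ≤ |w i| →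
      F m (WithLp.toLp 2 w) = 0 := fun w i m hi => image_eq_zero_of_notMem_tsupport (hnot w i m hi)
  set a : Fin (N + 1) → ℝ := Fin.cons 0 fun _ => -R with ha
  set b : Fin (N + 1) → ℝ := fun _ => R with hb
  set D : (Fin (N + 1) → ℝ) → ℝ := fun w => ∑ m, pd m (F m) (WithLp.toLp 2 w) with hD
  have hab : a ≤ b := by
    intro i
    cases i using Fin.cases with
    | zero => simpa [ha, hb] using hR.le
    | succ j => simp only [ha, hb, Fin.cons_succ]; linarith
  have hDcont : Continuous D := continuous_finsetSum _ fun m _ =>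
    (continuous_pd (hF m) m).comp (PiLp.continuous_toLp 2 _)
  have h1 : ∫ y in {y : Coord (N + 1) | 0 < y 0}, ∑ m, pd m (F m) y =
      ∫ w in {w : Fin (N + 1) → ℝ | 0 < w 0}, D w :=
    ((PiLp.volume_preserving_toLp (Fin (N + 1))).setIntegral_preimage_emb
      (MeasurableEquiv.toLp 2 _).measurableEmbedding _ _).symm
  have h2 : ∫ w in {w : Fin (N + 1) → ℝ | 0 < w 0}, D w = ∫ w in Icc a b, D w := by
    -- The half-open box fits the strict inequality defining the half space and differs from the
    -- closed one by a null set.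
    rw [volume_pi, ← setIntegral_congr_set Measure.univ_pi_Ioc_ae_eq_Icc, ← volume_pi]
    refine setIntegral_eq_of_subset_of_forall_sdiff_eq_zero
      (measurableSet_lt measurable_const (measurable_pi_apply 0)) (fun w hw => ?_) fun w hw => ?_
    · simpa [ha] using (hw 0 (mem_univ _)).1
    · obtain ⟨hw0, hw1⟩ := hw
      obtain ⟨i, hi⟩ : ∃ i, w i ∉ Ioc (a i) (b i) := by simpa [Set.mem_pi] using hw1
      refine Finset.sum_eq_zero fun m _ => pd_eq_zero_of_notMem_tsupport (hnot w i m ?_) m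
      by_contra hlt
      have hlt := abs_lt.1 (not_le.1 hlt)
      refine hi ⟨?_, hlt.2.le⟩
      cases i using Fin.cases with
      | zero => exact hw0
      | succ j => exact hlt.1
  have hder : ∀ m (w : Fin (N + 1) → ℝ), HasFDerivAt (fun w => F m (WithLp.toLp 2 w))
      ((fderiv ℝ (F m) (WithLp.toLp 2 w)).comp
        ((PiLp.continuousLinearEquiv 2 ℝ fun _ : Fin (N + 1) => ℝ).symm :
          (Fin (N + 1) → ℝ) →L[ℝ] Coord (N + 1))) w := fun m w =>
    ((hF m).differentiable (by simp) _).hasFDerivAt.comp w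
      ((PiLp.continuousLinearEquiv 2 ℝ fun _ : Fin (N + 1) => ℝ).symm :
          (Fin (N + 1) → ℝ) →L[ℝ] Coord (N + 1)).hasFDerivAt
  have h3 := integral_divergence_of_hasFDerivAt_off_countable' a b hab
    (fun m w => F m (WithLp.toLp 2 w)) _ ∅ countable_empty
    (fun m => ((hF m).continuous.comp (PiLp.continuous_toLp 2 _)).continuousOn)
    (fun w _ m => hder m w) (hDcont.integrableOn_Icc)
  have h4 : ∀ (m : Fin (N + 1)) (t : ℝ) (x : Fin N → ℝ), R ≤ |t| →
      F m (WithLp.toLp 2 (m.insertNth t x)) = 0 := fun m t x ht =>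
    hzero _ m m (by simpa using ht)
  have h5 : ∫ x in Icc (a ∘ (0 : Fin (N + 1)).succAbove) (b ∘ (0 : Fin (N + 1)).succAbove),
      F 0 (WithLp.toLp 2 ((0 : Fin (N + 1)).insertNth (a 0) x)) =
        ∫ z, F 0 (hyperplaneIncl z) := by
    rw [setIntegral_eq_integral_of_forall_compl_eq_zero,
      ← (volume_measurePreserving_piCongrLeft (fun _ => ℝ)
        (finSuccAboveEquiv (0 : Fin (N + 1)))).integral_comp
          (MeasurableEquiv.measurableEmbedding _)]
    · simp only [hyperplaneIncl_piCongrLeft]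
      rfl
    · intro x hx
      obtain ⟨j, hj⟩ : ∃ j, R ≤ |x j| := by
        by_contra! hlt
        exact hx ⟨fun j => (abs_lt.1 (hlt j)).1.le, fun j => (abs_lt.1 (hlt j)).2.le⟩
      exact hzero _ j.succ 0 (by simpa using hj)
  rw [h1, h2]
  refine h3.trans ?_
  rw [Finset.sum_eq_single 0, h5]
  · simp only [hb, h4 0 R _ (le_abs_self R), integral_zero, zero_sub]
  · intro m _ hm
    obtain ⟨j, rfl⟩ := Fin.exists_succ_eq.2 hm
    have haj : R ≤ |a j.succ| := by simp [ha, le_abs_self]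
    simp only [hb, h4 _ R _ (le_abs_self R), h4 _ _ _ haj, integral_zero, sub_zero]
  · simp

/-! ### The flux through the boundary -/

/-- Cramer's rule: this minor is the cofactor of the entry `(0, 0)`. -/
theorem det_boundary_submatrix [NeZero n] {A : Matrix (Fin n) (Fin n) ℝ} (hA : A.det ≠ 0) :
    (A.submatrix (fun a : {i : Fin n // i ≠ 0} => (a : Fin n))
      (fun a : {i : Fin n // i ≠ 0} => (a : Fin n))).det = A.det * A⁻¹ 0 0 := by
  obtain ⟨N, rfl⟩ : ∃ N, n = N + 1 := Nat.exists_eq_succ_of_ne_zero (NeZero.ne n)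
  rw [Matrix.inv_def, Matrix.smul_apply, Ring.inverse_eq_inv', smul_eq_mul,
    mul_inv_cancel_left₀ hA]
  have h := Matrix.adjugate_fin_succ_eq_det_submatrix A 0 0
  have h2 := Matrix.det_submatrix_equiv_self (finSuccAboveEquiv (0 : Fin (N + 1)))
    (A.submatrix (fun a : {i : Fin (N + 1) // i ≠ 0} => (a : Fin (N + 1)))
      (fun a : {i : Fin (N + 1) // i ≠ 0} => (a : Fin (N + 1))))
  rw [← h2]
  refine Eq.trans ?_ h.symm
  simp only [Fin.val_zero, add_zero, pow_zero, one_mul]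
  rfl

/-- The area density is `√(det g · g^{00})` and the normal is `-g^{m0}/√g^{00}`. The roots of
`g^{00}` cancel, leaving exactly the boundary density in the divergence theorem for the half space.
-/
theorem sqrt_det_boundary_mul_flux [NeZero n] {G : MatField n} {y : Coord n}
    (hG : (G y).PosDef) (Y : TensorField n 1) :
    √(boundaryMetric G y).det * ∑ m, Y y ![m] * outwardNormal G y m = -densityFlux G Y 0 y := by
  have h00 : 0 < (G y)⁻¹ 0 0 := hG.inv.diag_pos
  have hs : ∀ i, (G y)⁻¹ i 0 = (G y)⁻¹ 0 i := fun i => by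
    simpa using hG.inv.isHermitian.apply 0 i
  rw [boundaryMetric, det_boundary_submatrix hG.det_pos.ne', Real.sqrt_mul hG.det_pos.le,
    densityFlux, mul_assoc, ← mul_neg]
  congr 1
  rw [Finset.mul_sum, ← Finset.sum_neg_distrib]
  refine Finset.sum_congr rfl fun m _ => ?_
  have := (Real.sqrt_pos.2 h00).ne'
  rw [outwardNormal, hs m]
  field_simp

/-! ### The divergence theorem in one chart -/

theorem integrable_paramMeasure {E : Type*} [NormedAddCommGroup E] [NormedSpace ℝ E]
    [FiniteDimensional ℝ E] [MeasureSpace E] [BorelSpace E]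
    [(volume : Measure E).IsAddHaarMeasure] {X : Type*} [TopologicalSpace X]
    [MeasurableSpace X] [BorelSpace X] {f : E → X} {T : Set E}
    (hT : IsOpen T) (hf : ContinuousOn f T) {v : E → ℝ}
    (hv : ContinuousOn v T) (hv0 : ∀ y ∈ T, 0 ≤ v y) {F : X → ℝ}
    (hF : AEStronglyMeasurable F (paramMeasure f T fun y => ENNReal.ofReal (v y)))
    (hint : IntegrableOn (fun y => v y * F (f y)) T) :
    Integrable F (paramMeasure f T fun y => ENNReal.ofReal (v y)) := by
  rw [paramMeasure, integrable_map_measure hF (aemeasurable_param hT hf),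
    integrable_withDensity_iff_integrable_smul₀'
      (hv.aemeasurable hT.measurableSet).ennreal_ofReal (by simp)]
  refine IntegrableOn.congr_fun hint (fun y hy => ?_) hT.measurableSet
  simp only [smul_eq_mul, ENNReal.toReal_ofReal (hv0 y hy), Function.comp_apply]

theorem integral_sum_pd {F : Fin n → Coord n → ℝ}
    (hF : ∀ m, ContDiff ℝ 1 (F m)) (hc : ∀ m, HasCompactSupport (F m)) :
    ∫ y, ∑ m, pd m (F m) y = 0 := by
  have hint : ∀ m, Integrable (pd m (F m)) := fun m =>
    (continuous_pd (hF m) m).integrable_of_hasCompactSupport ((hc m).fderiv_apply ℝ _)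
  rw [integral_finsetSum _ fun m _ => hint m]
  refine Finset.sum_eq_zero fun m _ => ?_
  -- Integration by parts against the constant function `1`.
  have h := integral_mul_fderiv_eq_neg_fderiv_mul_of_integrable (μ := (volume : Measure (Coord n)))
    (f := fun _ : Coord n => (1 : ℝ)) (g := F m) (v := EuclideanSpace.single m 1) (by simp)
    (by simp only [one_mul]; exact hint m)
    (by simpa using (hF m).continuous.integrable_of_hasCompactSupport (hc m))
    (fun x _ => differentiableAt_const _) (fun x _ => (hF m).differentiable (by simp) x)
  simpa [pd] using h

section LocalStokes

variable {M : Type*} [TopologicalSpace M] [ChartedSpace (Coord n) M] [IsManifold (𝓡 n) ∞ M]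
  {e : OpenPartialHomeomorph M (Coord n)} {Y : OpenPartialHomeomorph M (Coord n) → TensorField n 1}
  {ρ : M → ℝ} {g : Metric n M}

/-- The product of a function and a covector field. -/
def cutoff (ρ : M → ℝ) (Y : OpenPartialHomeomorph M (Coord n) → TensorField n 1) :
    OpenPartialHomeomorph M (Coord n) → TensorField n 1 :=
  fun e y I => ρ (e.symm y) * Y e y I

/-- The divergence of a covector field. -/
def divergenceFamily (g : Metric n M)
    (Y : OpenPartialHomeomorph M (Coord n) → TensorField n 1) :
    OpenPartialHomeomorph M (Coord n) → Coord n → ℝ :=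
  fun e => covectorDiv (components g.inner e) (Y e)

/-- The flux density of `ρ Y` in the chart `e`, extended by zero. -/
def chartFlux (g : Metric n M) (ρ : M → ℝ)
    (Y : OpenPartialHomeomorph M (Coord n) → TensorField n 1)
    (e : OpenPartialHomeomorph M (Coord n)) (m : Fin n) : Coord n → ℝ :=
  e.target.indicator (densityFlux (components g.inner e) (cutoff ρ Y e) m)

theorem chartFlux_eq_zero {m : Fin n} {y : Coord n} (hy : y ∉ e '' tsupport ρ) :
    chartFlux g ρ Y e m y = 0 := by
  by_cases hyt : y ∈ e.target
  · have h0 : ρ (e.symm y) = 0 :=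
      image_eq_zero_of_notMem_tsupport fun h => hy ⟨_, h, e.right_inv hyt⟩
    simp [chartFlux, densityFlux, cutoff, h0]
  · exact indicator_of_notMem hyt _

theorem isCompact_image_tsupport (hK : HasCompactSupport ρ) (hKe : tsupport ρ ⊆ e.source) :
    IsCompact (e '' tsupport ρ) :=
  IsCompact.image_of_continuousOn hK (e.continuousOn.mono hKe)

theorem tsupport_chartFlux_subset (hK : HasCompactSupport ρ) (hKe : tsupport ρ ⊆ e.source)
    (m : Fin n) : tsupport (chartFlux g ρ Y e m) ⊆ e '' tsupport ρ :=
  closure_minimal (fun _ hy => by_contra fun h => hy (chartFlux_eq_zero h))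
    (isCompact_image_tsupport hK hKe).isClosed

theorem hasCompactSupport_chartFlux (hK : HasCompactSupport ρ) (hKe : tsupport ρ ⊆ e.source)
    (m : Fin n) : HasCompactSupport (chartFlux g ρ Y e m) :=
  HasCompactSupport.intro (isCompact_image_tsupport hK hKe) fun _ h => chartFlux_eq_zero h

/-- Extension by zero preserves smoothness because the support of `ρ` has compact image inside the
target of the chart. -/
theorem contDiff_chartFlux (he : e ∈ IsManifold.maximalAtlas (𝓡 n) ∞ M) (hY : CovectorFamily Y)
    (hρ : ContMDiff (𝓡 n) 𝓘(ℝ) ∞ ρ) (hK : HasCompactSupport ρ) (hKe : tsupport ρ ⊆ e.source)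
    (m : Fin n) : ContDiff ℝ 1 (chartFlux g ρ Y e m) := by
  rw [contDiff_iff_contDiffAt]
  intro y
  by_cases hy : y ∈ e.target
  · have h := contDiffOn_densityFlux (nondegOn_components g he)
      (fun z hz => (posDef_components g he hz).det_pos) ((hY.smul hρ).smooth e he) m
    have h1 := (h.contDiffAt (e.open_target.mem_nhds hy)).of_le (m := 1) (by norm_cast)
    exact h1.congr_of_eventuallyEq (Filter.eventually_of_mem (e.open_target.mem_nhds hy)
      fun z hz => indicator_of_mem hz _)
  · have hnot : y ∉ e '' tsupport ρ := fun ⟨p, hp, h⟩ => hy (h ▸ e.map_source (hKe hp))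
    refine (contDiffAt_const (c := (0 : ℝ))).congr_of_eventuallyEq (Filter.eventually_of_mem
      ((isCompact_image_tsupport hK hKe).isClosed.isOpen_compl.mem_nhds hnot)
      fun z hz => chartFlux_eq_zero hz)

theorem sum_pd_chartFlux (he : e ∈ IsManifold.maximalAtlas (𝓡 n) ∞ M) (hY : CovectorFamily Y)
    (hρ : ContMDiff (𝓡 n) 𝓘(ℝ) ∞ ρ) (hK : HasCompactSupport ρ) (hKe : tsupport ρ ⊆ e.source)
    (y : Coord n) : ∑ m, pd m (chartFlux g ρ Y e m) y = e.target.indicator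
      (fun y => √(components g.inner e y).det * divergenceFamily g (cutoff ρ Y) e y) y := by
  by_cases hy : y ∈ e.target
  · rw [indicator_of_mem hy]
    refine Eq.trans ?_ (sum_pd_densityFlux (nondegOn_components g he)
      (fun z hz => (posDef_components g he hz).det_pos) ((hY.smul hρ).smooth e he) hy)
    exact Finset.sum_congr rfl fun m _ => pd_congr_on e.open_target
      (fun z hz => indicator_of_mem hz _) hy m
  · rw [indicator_of_notMem hy]
    refine Finset.sum_eq_zero fun m _ => pd_eq_zero_of_notMem_tsupport (fun h => hy ?_) m
    obtain ⟨p, hp, rfl⟩ := tsupport_chartFlux_subset hK hKe m h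
    exact e.map_source (hKe hp)

theorem covectorDiv_sum {ι : Type*} (s : Finset ι) {Ω : Set (Coord n)} {G : MatField n}
    {T : ι → TensorField n 1} (hΩ : IsOpen Ω) (hT : ∀ i ∈ s, SmoothTensor Ω (T i)) {x : Coord n}
    (hx : x ∈ Ω) : covectorDiv G (fun y I => ∑ i ∈ s, T i y I) x =
      ∑ i ∈ s, covectorDiv G (T i) x := by
  simp only [covectorDiv, covDeriv_one]
  simp only [pd_sum s fun i hi => ContDiffOn.diffAt (hT i hi _) hΩ hx]
  rw [Finset.sum_comm (s := s)]
  refine Finset.sum_congr rfl fun a _ => ?_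
  rw [Finset.sum_comm (s := s)]
  refine Finset.sum_congr rfl fun b _ => ?_
  rw [← Finset.mul_sum, Finset.sum_sub_distrib, Finset.sum_comm (s := s)]
  simp only [Finset.mul_sum]

theorem divergenceFamily_cutoff_congr {ρ' : M → ℝ} {V : Set M} (hV : IsOpen V)
    (h : EqOn ρ ρ' V) {x : M} (hx : x ∈ V) :
    chartEval (divergenceFamily g (cutoff ρ Y)) x =
      chartEval (divergenceFamily g (cutoff ρ' Y)) x := by
  have hxs := mem_chart_source (Coord n) x
  refine covectorDiv_congr (Ω := (chartAt (Coord n) x).target ∩ (chartAt (Coord n) x).symm ⁻¹' V)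
    ((chartAt (Coord n) x).isOpen_inter_preimage_symm hV) (fun _ _ => rfl) (fun y hy => ?_) _
    ⟨(chartAt (Coord n) x).map_source hxs, by rwa [mem_preimage, (chartAt (Coord n) x).left_inv hxs]⟩
  funext I
  simp only [cutoff, h hy.2]

theorem divergenceFamily_cutoff_eq_zero {x : M} (hx : x ∉ tsupport ρ) :
    chartEval (divergenceFamily g (cutoff ρ Y)) x = 0 := by
  rw [divergenceFamily_cutoff_congr (ρ' := fun _ => 0) (isClosed_tsupport ρ).isOpen_compl
    (fun z hz => image_eq_zero_of_notMem_tsupport hz) hx]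
  -- The divergence of the zero covector field, obtained as that of an empty sum.
  have h := covectorDiv_sum (ι := Fin n) ∅ (G := components g.inner (chartAt (Coord n) x))
    (T := fun _ _ _ => 0) isOpen_univ (by simp) (mem_univ (chartAt (Coord n) x x))
  simp only [Finset.sum_empty] at h
  have h0 : cutoff (fun _ => 0) Y (chartAt (Coord n) x) = fun _ _ => 0 := by
    funext y I
    exact zero_mul _
  rw [chartEval, divergenceFamily, h0]
  exact h

variable [MeasurableSpace M] [BorelSpace M] [SecondCountableTopology M] {U : Set M}

/-- In the chart the volume density turns the covariant divergence into the ordinary divergence of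
`chartFlux`. The interior and the boundary case both start from here. -/
theorem setIntegral_divergence_eq (g : Metric n M) (he : e ∈ IsManifold.maximalAtlas (𝓡 n) ∞ M)
    (hY : CovectorFamily Y)
    (hρ : ContMDiff (𝓡 n) 𝓘(ℝ) ∞ ρ) (hK : HasCompactSupport ρ) (hKe : tsupport ρ ⊆ e.source)
    (hU : IsOpen U) :
    ∫ x in U, chartEval (divergenceFamily g (cutoff ρ Y)) x ∂riemannianVolume g =
      ∫ y in e.target, (e.symm ⁻¹' U).indicator (fun y => ∑ m, pd m (chartFlux g ρ Y e m) y) y := by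
  have hS : ScalarFamily (divergenceFamily g (cutoff ρ Y)) := (hY.smul hρ).div g
  have h1 : ∫ x in U, chartEval (divergenceFamily g (cutoff ρ Y)) x ∂riemannianVolume g =
      ∫ x in e.source ∩ U, chartEval (divergenceFamily g (cutoff ρ Y)) x ∂riemannianVolume g :=
    setIntegral_eq_of_subset_of_forall_sdiff_eq_zero hU.measurableSet inter_subset_right
      fun x hx => divergenceFamily_cutoff_eq_zero fun h => hx.2 ⟨hKe h, hx.1⟩
  rw [h1, inter_comm, ← Measure.restrict_restrict hU.measurableSet, riemannianVolume_restrict g he,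
    ← integral_indicator hU.measurableSet, chartVolume_eq,
    integral_paramMeasure e.open_target e.continuousOn_symm
      (contDiffOn_sqrt_det (nondegOn_components g he)
        fun z hz => (posDef_components g he hz).det_pos).continuousOn
      (fun _ _ => Real.sqrt_nonneg _)
      (hS.continuous.measurable.indicator hU.measurableSet).aestronglyMeasurable]
  refine setIntegral_congr_fun e.open_target.measurableSet fun y hy => ?_
  by_cases hyU : e.symm y ∈ U
  · simp only [indicator_of_mem (s := U) hyU, indicator_of_mem (s := e.symm ⁻¹' U) hyU,
      hS.chartEval_symm he hy, sum_pd_chartFlux he hY hρ hK hKe, indicator_of_mem hy]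
  · simp only [indicator_of_notMem (s := U) hyU, indicator_of_notMem (s := e.symm ⁻¹' U) hyU,
      mul_zero]

theorem setIntegral_divergence_of_subset (g : Metric n M)
    (he : e ∈ IsManifold.maximalAtlas (𝓡 n) ∞ M) (hY : CovectorFamily Y)
    (hρ : ContMDiff (𝓡 n) 𝓘(ℝ) ∞ ρ) (hK : HasCompactSupport ρ) (hKe : tsupport ρ ⊆ e.source)
    (hU : IsOpen U) (hKU : tsupport ρ ⊆ U) :
    ∫ x in U, chartEval (divergenceFamily g (cutoff ρ Y)) x ∂riemannianVolume g = 0 := by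
  rw [setIntegral_divergence_eq g he hY hρ hK hKe hU,
    ← integral_sum_pd (contDiff_chartFlux (g := g) he hY hρ hK hKe)
      (hasCompactSupport_chartFlux hK hKe),
    ← setIntegral_eq_integral_of_forall_compl_eq_zero (s := e.target)
      (f := fun y => ∑ m, pd m (chartFlux g ρ Y e m) y) fun y hy => by
      rw [sum_pd_chartFlux he hY hρ hK hKe, indicator_of_notMem hy]]
  refine setIntegral_congr_fun e.open_target.measurableSet fun y hy => ?_
  by_cases hyU : e.symm y ∈ U
  · exact indicator_of_mem (s := e.symm ⁻¹' U) hyU _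
  · have h : ∀ m, y ∉ tsupport (chartFlux g ρ Y e m) := fun m hm => by
      obtain ⟨p, hp, rfl⟩ := tsupport_chartFlux_subset hK hKe m hm
      exact hyU (by rw [e.left_inv (hKe hp)]; exact hKU hp)
    rw [indicator_of_notMem (s := e.symm ⁻¹' U) hyU]
    exact (Finset.sum_eq_zero fun m _ => pd_eq_zero_of_notMem_tsupport (h m) m).symm

theorem setIntegral_divergence_of_boundaryChart [NeZero n] (g : Metric n M)
    (he : IsBoundaryChart U e) (hY : CovectorFamily Y)
    (hρ : ContMDiff (𝓡 n) 𝓘(ℝ) ∞ ρ) (hK : HasCompactSupport ρ) (hKe : tsupport ρ ⊆ e.source)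
    (hU : IsOpen U) :
    ∫ x in U, chartEval (divergenceFamily g (cutoff ρ Y)) x ∂riemannianVolume g =
      -∫ z, chartFlux g ρ Y e 0 (hyperplaneIncl z) := by
  have hmeas : MeasurableSet {y : Coord n | 0 < y 0} :=
    (isOpen_lt continuous_const (by fun_prop : Continuous fun y : Coord n => y 0)).measurableSet
  rw [setIntegral_divergence_eq g he.1 hY hρ hK hKe hU,
    ← integral_halfSpace_sum_pd (contDiff_chartFlux (g := g) he.1 hY hρ hK hKe)
      (hasCompactSupport_chartFlux hK hKe), ← integral_indicator e.open_target.measurableSet,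
      ← integral_indicator hmeas]
  congr 1
  funext y
  by_cases hy : y ∈ e.target
  · have hiff : y ∈ e.symm ⁻¹' U ↔ y ∈ {y : Coord n | 0 < y 0} := by
      rw [mem_preimage, he.2 _ (e.map_target hy), e.right_inv hy]
      rfl
    rw [indicator_of_mem hy]
    by_cases h : y ∈ e.symm ⁻¹' U
    · rw [indicator_of_mem h, indicator_of_mem (hiff.1 h)]
    · rw [indicator_of_notMem h, indicator_of_notMem fun h' => h (hiff.2 h')]
  · rw [indicator_of_notMem hy]
    by_cases h : y ∈ {y : Coord n | 0 < y 0}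
    · rw [indicator_of_mem h, sum_pd_chartFlux he.1 hY hρ hK hKe, indicator_of_notMem hy]
    · rw [indicator_of_notMem h]

end LocalStokes

/-! ### The divergence theorem on a smooth domain -/

section Stokes

variable {M : Type*} [TopologicalSpace M] [ChartedSpace (Coord n) M] [IsManifold (𝓡 n) ∞ M]
  {e : OpenPartialHomeomorph M (Coord n)} {Y : OpenPartialHomeomorph M (Coord n) → TensorField n 1}
  {ρ : M → ℝ} {U : Set M}

/-- In a chart the measure has a continuous density, so small compact neighbourhoods have finite
measure. This makes continuous functions integrable on the compact closure of `U`. -/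
theorem isFiniteMeasureOnCompacts_riemannianVolume [T2Space M] [SecondCountableTopology M]
    [MeasurableSpace M] [BorelSpace M] (g : Metric n M) :
    IsFiniteMeasureOnCompacts (riemannianVolume g) := by
  have : LocallyCompactSpace M := ChartedSpace.locallyCompactSpace (Coord n) M
  refine ⟨fun A hA => hA.measure_lt_top_of_nhdsWithin fun x _ => ?_⟩
  set e := chartAt (Coord n) x with he
  have hmem : e ∈ IsManifold.maximalAtlas (𝓡 n) ∞ M := IsManifold.chart_mem_maximalAtlas x
  obtain ⟨K, hK, hxK, hKe⟩ := exists_compact_subset e.open_source (mem_chart_source (Coord n) x)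
  refine ⟨K, mem_nhdsWithin_of_mem_nhds (mem_interior_iff_mem_nhds.1 hxK), ?_⟩
  have hK' : IsCompact (e '' K) := hK.image_of_continuousOn (e.continuousOn.mono hKe)
  have hKt : e '' K ⊆ e.target := by
    rintro _ ⟨p, hp, rfl⟩
    exact e.map_source (hKe hp)
  have hset : e.target ∩ e.symm ⁻¹' K = e '' K := by
    ext y
    constructor
    · rintro ⟨h1, h2⟩
      exact ⟨_, h2, e.right_inv h1⟩
    · rintro ⟨p, hp, rfl⟩
      exact ⟨e.map_source (hKe hp), by rwa [mem_preimage, e.left_inv (hKe hp)]⟩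
  have h1 : riemannianVolume g K = ∫⁻ y in e '' K, ENNReal.ofReal (√(components g.inner e y).det) := by
    rw [← hset, ← paramMeasure_apply e.open_target e.continuousOn_symm hK.measurableSet,
      ← chartVolume_eq, ← riemannianVolume_restrict g hmem,
      Measure.restrict_apply hK.measurableSet, inter_eq_left.2 hKe]
  rw [h1]
  exact (((contDiffOn_sqrt_det (nondegOn_components g hmem) fun z hz =>
    (posDef_components g hmem hz).det_pos).continuousOn.mono hKt).integrableOn_compact
      hK').lintegral_lt_top

variable [NeZero n]

theorem boundaryChart_spec (hU : IsSmoothDomain n U) {p : M} (hp : p ∈ frontier U) :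
    IsBoundaryChart U (boundaryChart n U p) ∧ p ∈ (boundaryChart n U p).source := by
  have h := hU.2 p hp
  rw [boundaryChart, dif_pos h]
  exact h.choose_spec

/-- The value of a covector field on the outward normal. -/
def boundaryFlux (g : Metric n M) (U : Set M)
    (Y : OpenPartialHomeomorph M (Coord n) → TensorField n 1) (p : M) : ℝ :=
  normalFlux g Y (boundaryChart n U p) (boundaryChart n U p p)

theorem CovectorFamily.boundaryFlux_eq (hY : CovectorFamily Y) (g : Metric n M)
    (hU : IsSmoothDomain n U) (he : IsBoundaryChart U e) {p : M} (hp : p ∈ frontier U)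
    (hpe : p ∈ e.source) : boundaryFlux g U Y p = normalFlux g Y e (e p) := by
  obtain ⟨h1, h2⟩ := boundaryChart_spec hU hp
  rw [boundaryFlux, hY.normalFlux_transition g h1 he (mem_overlap h2 hpe)
    ((mem_frontier_iff hU.1 h1 h2).1 hp), transition_apply h2]

theorem normalFlux_cutoff (g : Metric n M) {p : M} (hp : p ∈ e.source) :
    normalFlux g (cutoff ρ Y) e (e p) = ρ p * normalFlux g Y e (e p) := by
  simp only [normalFlux, cutoff, e.left_inv hp, Finset.mul_sum, mul_assoc]

theorem boundaryFlux_cutoff (g : Metric n M) (hU : IsSmoothDomain n U) {p : M}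
    (hp : p ∈ frontier U) : boundaryFlux g U (cutoff ρ Y) p = ρ p * boundaryFlux g U Y p :=
  normalFlux_cutoff g (boundaryChart_spec hU hp).2

theorem continuousOn_normalFlux (g : Metric n M) (hY : CovectorFamily Y)
    (he : e ∈ IsManifold.maximalAtlas (𝓡 n) ∞ M) : ContinuousOn (normalFlux g Y e) e.target := by
  have hG := nondegOn_components g he
  refine continuousOn_finsetSum _ fun m _ => (hY.smooth e he _).continuousOn.mul ?_
  refine ((hG.inv_smooth m 0).continuousOn.neg).div
    ((hG.inv_smooth 0 0).continuousOn.sqrt) fun y hy => ?_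
  exact (Real.sqrt_pos.2 (posDef_components g he hy).inv.diag_pos).ne'

variable [MeasurableSpace M] [BorelSpace M]

/-- The support of `ρ` lies in one boundary chart, so the surface integral is an integral over the
hyperplane, with integrand given by `sqrt_det_boundary_mul_flux`. Integrability is recorded for the
later summation over a partition of unity. -/
theorem integral_boundaryFlux_cutoff (g : Metric n M) (hU : IsSmoothDomain n U)
    (he : IsBoundaryChart U e) (hY : CovectorFamily Y) (hρ : ContMDiff (𝓡 n) 𝓘(ℝ) ∞ ρ)
    (hK : HasCompactSupport ρ) (hKe : tsupport ρ ⊆ e.source) :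
    IntegrableOn (boundaryFlux g U (cutoff ρ Y)) (frontier U) (surfaceMeasure g U) ∧
    ∫ p in frontier U, boundaryFlux g U (cutoff ρ Y) p ∂surfaceMeasure g U =
      -∫ z, chartFlux g ρ Y e 0 (hyperplaneIncl z) := by
  have hZ : CovectorFamily (cutoff ρ Y) := hY.smul hρ
  have hB : MeasurableSet (frontier U) := isClosed_frontier.measurableSet
  have hs := e.open_source.measurableSet
  -- `boundaryFlux` uses a chart chosen separately at each point, so its measurability is not
  -- evident. `Ψ` is the measurable expression in the fixed chart `e`, equal to it on the relevant
  -- part of the boundary.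
  set Ψ : M → ℝ := e.source.indicator fun p => normalFlux g (cutoff ρ Y) e (e p) with hΨ
  have hΨm : ∀ μ : Measure M, AEStronglyMeasurable Ψ μ := fun μ =>
    (aestronglyMeasurable_indicator_iff hs).2 (ContinuousOn.aestronglyMeasurable
      ((continuousOn_normalFlux g hZ he.1).comp e.continuousOn e.mapsTo) hs)
  have hoff : ∀ p ∈ frontier U \ (frontier U ∩ e.source), boundaryFlux g U (cutoff ρ Y) p = 0 := by
    intro p hp
    rw [boundaryFlux_cutoff g hU hp.1,
      image_eq_zero_of_notMem_tsupport fun h => hp.2 ⟨hp.1, hKe h⟩, zero_mul]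
  have hon : EqOn (boundaryFlux g U (cutoff ρ Y)) Ψ (frontier U ∩ e.source) := fun p hp => by
    rw [hZ.boundaryFlux_eq g hU he hp.1 hp.2, hΨ, indicator_of_mem hp.2]
  have hres : (surfaceMeasure g U).restrict (frontier U ∩ e.source) =
      (chartSurface g e).restrict (frontier U) := by
    rw [← Measure.restrict_restrict hB, surfaceMeasure_restrict g he]
  have hcont : ContinuousOn (fun z => √(boundaryMetric (components g.inner e)
      (hyperplaneIncl z)).det) (boundaryDomain e) := by
    have h : ContDiffOn ℝ ∞ (fun y => (boundaryMetric (components g.inner e) y).det) e.target :=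
      contDiffOn_det fun i j => (nondegOn_components g he.1).smooth _ _
    exact (h.continuousOn.sqrt).comp continuous_hyperplaneIncl.continuousOn fun _ hz => hz
  have hval : ∀ z ∈ boundaryDomain e, √(boundaryMetric (components g.inner e)
      (hyperplaneIncl z)).det * (frontier U).indicator Ψ (e.symm (hyperplaneIncl z)) =
        -chartFlux g ρ Y e 0 (hyperplaneIncl z) := by
    intro z hz
    have hmem := e.map_target hz
    have hfr : e.symm (hyperplaneIncl z) ∈ frontier U := by
      rw [mem_frontier_iff hU.1 he hmem, e.right_inv hz, hyperplaneIncl_zero_apply]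
    rw [indicator_of_mem hfr, hΨ, indicator_of_mem hmem, e.right_inv hz, normalFlux,
      sqrt_det_boundary_mul_flux (posDef_components g he.1 hz), chartFlux,
      indicator_of_mem (s := e.target) hz]
  have hF := contDiff_chartFlux (g := g) he.1 hY hρ hK hKe 0
  have hFc : HasCompactSupport fun z => chartFlux g ρ Y e 0 (hyperplaneIncl z) := by
    refine HasCompactSupport.intro ((isCompact_image_tsupport hK hKe).image
      (hyperplaneProj (n := n)).continuous) fun z hz => chartFlux_eq_zero fun h => hz ?_
    exact ⟨_, h, hyperplaneProj_incl z⟩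
  have hFi : Integrable fun z => chartFlux g ρ Y e 0 (hyperplaneIncl z) :=
    (hF.continuous.comp continuous_hyperplaneIncl).integrable_of_hasCompactSupport hFc
  constructor
  · refine IntegrableOn.of_forall_sdiff_eq_zero (s := frontier U ∩ e.source) ?_ hB hoff
    refine IntegrableOn.congr_fun (f := Ψ) ?_ (fun p hp => (hon hp).symm) (hB.inter hs)
    rw [IntegrableOn, hres, ← IntegrableOn, ← integrable_indicator_iff hB, chartSurface_eq]
    refine integrable_paramMeasure (isOpen_boundaryDomain e) (continuousOn_symm_hyperplaneIncl e)
      hcont (fun _ _ => Real.sqrt_nonneg _) ((hΨm _).indicator hB) ?_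
    exact hFi.neg.integrableOn.congr_fun (fun z hz => (hval z hz).symm)
      (isOpen_boundaryDomain e).measurableSet
  · rw [setIntegral_eq_of_subset_of_forall_sdiff_eq_zero hB inter_subset_left hoff,
      setIntegral_congr_fun (hB.inter hs) hon, hres, ← integral_indicator hB, chartSurface_eq,
      integral_paramMeasure (isOpen_boundaryDomain e) (continuousOn_symm_hyperplaneIncl e)
        hcont (fun _ _ => Real.sqrt_nonneg _) ((hΨm _).indicator hB),
      setIntegral_congr_fun (isOpen_boundaryDomain e).measurableSet hval, integral_neg,
      setIntegral_eq_integral_of_forall_compl_eq_zero]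
    intro z hz
    exact indicator_of_notMem (s := e.target) hz _

theorem integral_divergence_cutoff [SecondCountableTopology M] (g : Metric n M)
    (hU : IsSmoothDomain n U) (he : e ∈ IsManifold.maximalAtlas (𝓡 n) ∞ M)
    (hY : CovectorFamily Y) (hρ : ContMDiff (𝓡 n) 𝓘(ℝ) ∞ ρ)
    (hK : HasCompactSupport ρ) (hKe : tsupport ρ ⊆ e.source)
    (h : IsBoundaryChart U e ∨ tsupport ρ ⊆ U) :
    IntegrableOn (boundaryFlux g U (cutoff ρ Y)) (frontier U) (surfaceMeasure g U) ∧
    ∫ x in U, chartEval (divergenceFamily g (cutoff ρ Y)) x ∂riemannianVolume g =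
      ∫ p in frontier U, boundaryFlux g U (cutoff ρ Y) p ∂surfaceMeasure g U := by
  rcases h with h | h
  · obtain ⟨h1, h2⟩ := integral_boundaryFlux_cutoff g hU h hY hρ hK hKe
    exact ⟨h1, by rw [h2, setIntegral_divergence_of_boundaryChart g h hY hρ hK hKe hU.1]⟩
  · have hB : MeasurableSet (frontier U) := isClosed_frontier.measurableSet
    have h0 : EqOn (boundaryFlux g U (cutoff ρ Y)) (fun _ => 0) (frontier U) := fun p hp => by
      rw [boundaryFlux_cutoff g hU hp, image_eq_zero_of_notMem_tsupport fun hps =>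
        (hU.1.frontier_eq ▸ hp : p ∈ closure U \ U).2 (h hps), zero_mul]
    refine ⟨integrableOn_zero.congr_fun h0.symm hB, ?_⟩
    rw [setIntegral_divergence_of_subset g he hY hρ hK hKe hU.1 h, setIntegral_congr_fun hB h0,
      integral_zero]

/-- A smooth partition of unity on the compact closure splits `Y` into fields supported either
inside `U` or in one boundary chart. The local formulas are summed; on the frontier the cutoffs add
up to `1`. -/
theorem integral_divergence [T2Space M] [SecondCountableTopology M] (g : Metric n M)
    (hU : IsSmoothDomain n U) (hUc : IsCompact (closure U)) (hY : CovectorFamily Y) :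
    ∫ x in U, chartEval (divergenceFamily g Y) x ∂riemannianVolume g =
      ∫ p in frontier U, boundaryFlux g U Y p ∂surfaceMeasure g U := by
  have : LocallyCompactSpace M := ChartedSpace.locallyCompactSpace (Coord n) M
  have := isFiniteMeasureOnCompacts_riemannianVolume g
  have hB : MeasurableSet (frontier U) := isClosed_frontier.measurableSet
  have hex : ∀ p ∈ closure U, ∃ e ∈ IsManifold.maximalAtlas (𝓡 n) ∞ M, ∃ K : Set M, IsCompact K ∧
      p ∈ interior K ∧ K ⊆ e.source ∧ (IsBoundaryChart U e ∨ K ⊆ U) := by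
    intro p hp
    by_cases hpU : p ∈ U
    · obtain ⟨K, hK, hpK, hKe⟩ := exists_compact_subset
        ((chartAt (Coord n) p).open_source.inter hU.1) ⟨mem_chart_source _ p, hpU⟩
      exact ⟨_, IsManifold.chart_mem_maximalAtlas p, K, hK, hpK, hKe.trans inter_subset_left,
        Or.inr (hKe.trans inter_subset_right)⟩
    · obtain ⟨e, he, hpe⟩ := hU.2 p (by rw [hU.1.frontier_eq]; exact ⟨hp, hpU⟩)
      obtain ⟨K, hK, hpK, hKe⟩ := exists_compact_subset e.open_source hpe
      exact ⟨e, he.1, K, hK, hpK, hKe, Or.inl he⟩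
  choose! e he K hK hpK hKe hor using hex
  obtain ⟨t, ht, hcov⟩ := hUc.elim_nhds_subcover (fun p => interior (K p))
    fun p hp => isOpen_interior.mem_nhds (hpK p hp)
  obtain ⟨f, hf⟩ := SmoothPartitionOfUnity.exists_isSubordinate (𝓡 n) isClosed_closure
    (fun p : t => interior (K p)) (fun _ => isOpen_interior) (by
      simpa [iUnion_subtype] using hcov)
  have hsum : ∀ x ∈ closure U, ∑ i, f i x = 1 := fun x hx => by
    rw [← finsum_eq_sum_of_fintype]
    exact f.sum_eq_one hx
  have hsub : ∀ i : t, tsupport (f i) ⊆ K i := fun i => (hf i).trans interior_subset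
  have hcs : ∀ i : t, HasCompactSupport (f i) := fun i =>
    (hK i (ht i i.2)).of_isClosed_subset (isClosed_tsupport _) (hsub i)
  have hloc := fun i : t => integral_divergence_cutoff g hU (he i (ht i i.2)) hY (f i).contMDiff
    (hcs i) ((hsub i).trans (hKe i (ht i i.2)))
    ((hor i (ht i i.2)).imp_right fun h => (hsub i).trans h)
  have hdiv : EqOn (chartEval (divergenceFamily g Y))
      (fun x => ∑ i, chartEval (divergenceFamily g (cutoff (f i) Y)) x) U := by
    intro x hx
    have h1 : chartEval (divergenceFamily g (cutoff (fun x => ∑ i, f i x) Y)) x =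
        ∑ i, chartEval (divergenceFamily g (cutoff (f i) Y)) x := by
      have hmem : chartAt (Coord n) x ∈ IsManifold.maximalAtlas (𝓡 n) ∞ M :=
        IsManifold.chart_mem_maximalAtlas x
      have h2 : cutoff (fun x => ∑ i, f i x) Y (chartAt (Coord n) x) =
          fun y I => ∑ i, cutoff (f i) Y (chartAt (Coord n) x) y I := by
        funext y I
        exact Finset.sum_mul _ _ _
      rw [chartEval, divergenceFamily, h2]
      exact covectorDiv_sum _ (chartAt (Coord n) x).open_target
        (fun i _ => (hY.smul (f i).contMDiff).smooth _ hmem) (mem_chart_target _ x)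
    -- The cutoffs sum to `1` on the open set `U`, hence near each of its points, so their
    -- derivatives do not contribute.
    have h3 := divergenceFamily_cutoff_congr (g := g) (Y := Y) (ρ := fun x => ∑ i, f i x)
      (ρ' := fun _ => 1) hU.1 (fun x hx => hsum x (subset_closure hx)) hx
    have h4 : cutoff (fun _ : M => (1 : ℝ)) Y = Y := by
      funext e y I
      exact one_mul _
    rw [h4] at h3
    exact h3.symm.trans h1
  have hint : ∀ i, IntegrableOn (chartEval (divergenceFamily g (cutoff (f i) Y))) U
      (riemannianVolume g) := fun i =>
    ((((hY.smul (f i).contMDiff).div g).continuous.continuousOn).integrableOn_compact hUc).mono_set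
      subset_closure
  rw [setIntegral_congr_fun hU.1.measurableSet hdiv, integral_finsetSum _ fun i _ => hint i,
    Finset.sum_congr rfl fun i _ => (hloc i).2, ← integral_finsetSum _ fun i _ => (hloc i).1]
  refine setIntegral_congr_fun hB fun p hp => ?_
  simp only [boundaryFlux_cutoff g hU hp]
  rw [← Finset.sum_mul, hsum p (frontier_subset_closure hp), one_mul]

end Stokes

/-! ### Boundary terms and norms -/

section Terms

variable {M : Type*} [TopologicalSpace M] [ChartedSpace (Coord n) M] [IsManifold (𝓡 n) ∞ M]
  [MeasurableSpace M] {U : Set M} {g : Metric n M} {h : SymTwoTensor n M} {c : ℝ}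

theorem boundaryIntegral_eq [NeZero n] (k : ℕ)
    (F : MatField n → MatField n → TensorField n (2 * k + 1))
    (a : Equiv.Perm (Fin (2 * k + 1)) → ℝ) :
    boundaryIntegral g h U k F a = ∫ p in frontier U, boundaryFlux g U (fun e =>
      flux (components g.inner e) k (F (components g.inner e) (components h.form e)) a) p
        ∂surfaceMeasure g U := by
  simp only [boundaryIntegral, boundaryFlux, normalFlux, sum_coeff_mul_contraction]

theorem BT₃_zero [NeZero n] : BT₃ g h U 0 = 0 := by
  simp [BT₃, boundaryIntegral]

variable [T2Space M] [SecondCountableTopology M] [BorelSpace M]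

/-- The pointwise identity is integrated. Only the right-hand terms have to be integrable, and they
are continuous on the compact closure; nothing about the regularity of `DW[h]` in the point is used.
-/
theorem l2NormSq_dWeyl (hc : HasConstantCurvature g c) (hTT : IsTransverseTraceless g h)
    (hU : MeasurableSet U) (hUc : IsCompact (closure U)) (hn : (n : ℝ) - 1 ≠ 0)
    (hn' : (n : ℝ) - 2 ≠ 0) :
    l2NormSq g h U dWeyl = ((n : ℝ) - 3) / ((n : ℝ) - 2) *
      (l2NormSq g h U laplace + c * ((n : ℝ) + 2) * l2NormSq g h U nabla
        + 2 * c ^ 2 * (n : ℝ) * l2NormSq g h U (fun _ H => asTensor H))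
      + (∫ x in U, chartEval (divergenceFamily g fun e => fluxOne c (components g.inner e)
          (components h.form e)) x ∂riemannianVolume g)
      + ∫ x in U, chartEval (divergenceFamily g fun e => fluxTwo (components g.inner e)
          (components h.form e)) x ∂riemannianVolume g := by
  have := isFiniteMeasureOnCompacts_riemannianVolume g
  have hint : ∀ {s : OpenPartialHomeomorph M (Coord n) → Coord n → ℝ}, ScalarFamily s →
      Integrable (chartEval s) ((riemannianVolume g).restrict U) := fun hs =>
    (hs.continuous.continuousOn.integrableOn_compact hUc).mono_set subset_closure
  have h1 := hint (scalarFamily_laplace hc hTT)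
  have h2 := hint (scalarFamily_nabla hc hTT)
  have h3 := hint (scalarFamily_asTensor hc hTT)
  have h4 := hint ((covectorFamily_fluxOne hc hTT).div g)
  have h5 := hint ((covectorFamily_fluxTwo hc hTT).div g)
  have hpt : ∀ x : M, normSq (components g.inner (chartAt (Coord n) x))
      (dWeyl (components g.inner (chartAt (Coord n) x)) (components h.form (chartAt (Coord n) x)))
      (chartAt (Coord n) x x) = _ := fun x =>
    (spaceFormTT_components hc hTT (IsManifold.chart_mem_maximalAtlas x)).normSq_dWeyl
      (mem_chart_target _ x) hn hn'
  simp only [l2NormSq, hpt]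
  have key := integral_add (((h1.add (h2.const_mul (c * (n + 2)))).add
    (h3.const_mul (2 * c ^ 2 * n))).const_mul (((n : ℝ) - 3) / (n - 2)) |>.add h4) h5
  refine key.trans ?_
  congr 1
  refine (integral_add (((h1.add (h2.const_mul (c * (n + 2)))).add
    (h3.const_mul (2 * c ^ 2 * n))).const_mul (((n : ℝ) - 3) / (n - 2))) h4).trans ?_
  congr 1
  refine (integral_const_mul _ _).trans ?_
  congr 1
  refine (integral_add (h1.add (h2.const_mul (c * (n + 2)))) (h3.const_mul (2 * c ^ 2 * n))).trans ?_
  refine congrArg₂ (· + ·) ?_ (integral_const_mul _ _)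
  refine (integral_add h1 (h2.const_mul (c * (n + 2)))).trans ?_
  exact congrArg₂ (· + ·) rfl (integral_const_mul _ _)

end Terms

end WeylVariation

end

theorem proposition3 (n : ℕ) [NeZero n] (hn : 3 ≤ n) (c : ℝ) :
    ∃ (a₁ : Equiv.Perm (Fin 5) → ℝ) (a₂ a₃ : Equiv.Perm (Fin 7) → ℝ),
      ∀ (M : Type*) [TopologicalSpace M] [T2Space M] [SecondCountableTopology M]
        [ChartedSpace (WeylVariation.Coord n) M] [IsManifold (𝓡 n) ∞ M]
        [MeasurableSpace M] [BorelSpace M]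
        (g : WeylVariation.Metric n M) (h : WeylVariation.SymTwoTensor n M) (U : Set M),
        WeylVariation.HasConstantCurvature g c →
        WeylVariation.IsTransverseTraceless g h →
        WeylVariation.IsSmoothDomain n U →
        IsCompact (closure U) →
        WeylVariation.l2NormSq g h U WeylVariation.dWeyl =
          ((n : ℝ) - 3) / ((n : ℝ) - 2) *
            (WeylVariation.l2NormSq g h U WeylVariation.laplace
              + c * ((n : ℝ) + 2) * WeylVariation.l2NormSq g h U WeylVariation.nabla
              + 2 * c ^ 2 * (n : ℝ) *
                WeylVariation.l2NormSq g h U (fun _ H => WeylVariation.asTensor H))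
            + WeylVariation.BT₁ g h U a₁ + WeylVariation.BT₂ g h U a₂
            + WeylVariation.BT₃ g h U a₃ := by
  have hn3 : (3 : ℝ) ≤ n := by exact_mod_cast hn
  -- All boundary contributions already have the first two types, so the coefficients of the third
  -- are zero.
  refine ⟨WeylVariation.coeffOne n c, WeylVariation.coeffTwo, 0, ?_⟩
  intro M _ _ _ _ _ _ _ g h U hc hTT hU hUc
  rw [WeylVariation.l2NormSq_dWeyl hc hTT hU.1.measurableSet hUc (by linarith) (by linarith),
    WeylVariation.integral_divergence g hU hUc (WeylVariation.covectorFamily_fluxOne hc hTT),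
    WeylVariation.integral_divergence g hU hUc (WeylVariation.covectorFamily_fluxTwo hc hTT),
    WeylVariation.BT₃_zero, add_zero, WeylVariation.BT₁, WeylVariation.BT₂,
    WeylVariation.boundaryIntegral_eq, WeylVariation.boundaryIntegral_eq]
  rfl
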